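/- Let $M$ be a smooth Riemannian manifold without boundary, $d=\dim M$, with distance $\operatorname{dist}$, let $X$ be a $C^1$ vector field on $M$, and let $\sigma$ be a hyperbolic singularity of $X$ (that is, $X(\sigma)=0$ and no eigenvalue of $DX(\sigma)$ lies on the imaginary axis). For a $C^1$ vector field $Y$ with complete flow $\varphi=(\varphi_t)$ and a hyperbolic singularity $\sigma_Y$ of $Y$, let $E^s\oplus E^u=T_{\sigma_Y}M$ be the hyperbolic splitting. Call an inner product on $T_{\sigma_Y}M$ *adapted* if $E^s\perp E^u$ and, for some $\rho>0$, $\langle DY(\sigma_Y)v,v\rangle\le-\rho|v|^2$ on $E^s$ and $\langle DY(\sigma_Y)v,v\rangle\ge\rho|v|^2$ on $E^u$. Given one, put $$D_n=\exp_{\sigma_Y}\{v=v^s+v^u:\ |v^s|=|v^u|\in[e^{-(n+1)},e^{-n})\},\qquad C_n=\varphi_{[0,1)}(D_n),$$ $$\mathscr C_{\sigma_Y}=\{C_n:n>n_0\}\cup\{M\setminus\textstyle\bigcup_{n>n_0}C_n\},$$ and, for $x\in M$, let $t^{\pm}_x=\inf\{\tau>0:\varphi_{\pm\tau}(x)\in\partial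 B_r(\sigma_Y)\}$. For a regular point $x$ and $\beta>0$ let $N_x(\beta|Y(x)|)=\exp_x\{v\in T_xM: v\perp Y(x),\ |v|<\beta|Y(x)|\}$ (these lengths being those of the Riemannian metric). **Theorem B.** There are constants $0<L_0<L_1$, $0<K_0<K_1$, $c_0,\beta_0,r_0>0$ depending only on $X$ and $\sigma$ such that for every $0<r<r_0$ there are $n_0\in\mathbb N$, $N_0>0$, numbers $c_1=c_1(\beta)>0$ and $H_2=H_2(L,\beta)>0$, and a $C^1$ neighborhood $\mathcal U$ of $X$, such that the following holds for every $Y\in\mathcal U$ (in particular for $Y=X$, $\sigma_Y=\sigma$). The vector field $Y$ has exactly one singularity $\sigma_Y$ in $B_r(\sigma)$, this singularity is hyperbolic, and there is an adapted inner product on $T_{\sigma_Y}M$ for which, if $Y$ generates a complete flow $\varphi$: * for all $n>n_0$ and $x\in D_n$: $x\in B_r(\sigma_Y)$, $|Y(x)|\in[L_0e^{-n-1},L_1e^{-n}]$ and $t^{\pm}_x/n\in[K_0,K_1]$; the sets $C_n$, $n>n_0$, are measurable and pairwise disjoint; * for every $L\ge N_0$ and $0<\beta<\beta_0$ there is a countable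 measurable partition $\mathscr A$ of $M$ that refines $\mathscr C_{\sigma_Y}$ and has the following properties, where $L'=L^{K_1}e$ and $L''=(L')^{d}$: 1. for every $n>n_0$, $\mathscr B_n=\{A\in\mathscr A:A\subset C_n\}$ is a finite partition of $C_n$; 2. $\operatorname{diam}(A)\le c_0\,\beta\,(L')^{-n}$ for every $n>n_0$ and $A\in\mathscr B_n$; 3. $\#\mathscr B_n\le c_1(L'')^n$ for every $n>n_0$; 4. if $n>n_0$, $A\in\mathscr B_n$ and $x,y\in A$, then $y$ is in the $\beta$-scaled tubular neighborhood of $x$, in forward and in backward time, until $x$ leaves $B_r(\sigma_Y)$: let $I$ be the interval of those $t\in\mathbb R$ such that $\operatorname{dist}(\varphi_s(x),\sigma_Y)\le r$ for all $s$ between $0$ and $t$; there is a continuous strictly increasing $h:I\to\mathbb R$ such that $\varphi_{h(t)}(y)\in N_{\varphi_t(x)}(\beta|Y(\varphi_t(x))|)$ for all $t\in I$, and $h(s)=0$ for some $s\in I$ with $|s|\le1$; 5. $H_\mu(\mathscr A)=-\sum_{A\in\mathscr A}\mu(A)\log\mu(A)<H_2$ for every probability measure $\mu$ that is invariant under $\varphi$.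 -/

import Mathlib

open Set Filter Topology MeasureTheory Bundle Manifold
open scoped ContDiff ENNReal

noncomputable section

namespace SingFlow

/-- The model space of a `d`-dimensional manifold without boundary. -/
abbrev Model (d : ℕ) : Type := EuclideanSpace ℝ (Fin d)

/-! ### Vector fields, flows and the `C¹` topology -/

section VectorFields

variable {d : ℕ} {M : Type*} [TopologicalSpace M] [ChartedSpace (Model d) M]
  [IsManifold (𝓡 d) ∞ M]

/-- `X` is a `C¹` vector field on `M`. -/
def IsC1VectorField (X : ∀ x : M, TangentSpace (𝓡 d) x) : Prop :=
  ContMDiff (𝓡 d) (𝓡 d).tangent 1 (fun x => (⟨x, X x⟩ : TangentBundle (𝓡 d) M))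

/-- The coordinate expression of the vector field `X` in the chart around `p`. -/
def coordField (X : ∀ x : M, TangentSpace (𝓡 d) x) (p : M) : Model d → Model d :=
  fun u => tangentCoordChange (𝓡 d) ((extChartAt (𝓡 d) p).symm u) p
    ((extChartAt (𝓡 d) p).symm u) (X ((extChartAt (𝓡 d) p).symm u))

/-- `𝒰` is a neighbourhood of `X` for the `C¹` topology: it contains every `C¹` vector field
whose coordinate expressions are uniformly `ε`-close to those of `X`, together with their first
derivatives, on finitely many compact subsets of coordinate charts. -/
def IsC1Neighborhood (X : ∀ x : M, TangentSpace (𝓡 d) x)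
    (𝒰 : Set (∀ x : M, TangentSpace (𝓡 d) x)) : Prop :=
  ∃ F : Set (M × Set (Model d)), F.Finite ∧
    (∀ q ∈ F, IsCompact q.2 ∧ q.2 ⊆ (extChartAt (𝓡 d) q.1).target) ∧
    ∃ ε : ℝ, 0 < ε ∧ ∀ Y : (∀ x : M, TangentSpace (𝓡 d) x), IsC1VectorField Y →
      (∀ q ∈ F, ∀ u ∈ q.2, ‖coordField Y q.1 u - coordField X q.1 u‖ < ε ∧
        ‖fderiv ℝ (coordField Y q.1) u - fderiv ℝ (coordField X q.1) u‖ < ε) →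
      Y ∈ 𝒰

/-- `φ` is the (complete) flow generated by `X`. -/
structure IsFlowOf (X : ∀ x : M, TangentSpace (𝓡 d) x) (φ : ℝ → M → M) : Prop where
  zero : ∀ x, φ 0 x = x
  add : ∀ s t x, φ (s + t) x = φ s (φ t x)
  integral : ∀ x, IsMIntegralCurve (fun t => φ t x) X

/-- The tangent vector at `x` whose coordinates in the chart around `p` are `a`. -/
def chartVector (p x : M) (a : Model d) : TangentSpace (𝓡 d) x :=
  tangentCoordChange (𝓡 d) p x x a

/-- The linearization of `X` at a singularity `σ`, an endomorphism of `T_σ M` (whose elements are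
read, as usual, in the preferred chart at `σ`). -/
def linearization (X : ∀ x : M, TangentSpace (𝓡 d) x) (σ : M) : Model d →L[ℝ] Model d :=
  fderiv ℝ (coordField X σ) (extChartAt (𝓡 d) σ σ)

/-- `σ` is a hyperbolic singularity of `X`: `X` vanishes there and no (complex) eigenvalue of the
linearization lies on the imaginary axis. -/
def IsHyperbolicSingularity (X : ∀ x : M, TangentSpace (𝓡 d) x) (σ : M) : Prop :=
  X σ = 0 ∧ ∀ z : ℂ, Polynomial.aeval z (linearization X σ).toLinearMap.charpoly = 0 → z.re ≠ 0

end VectorFields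

/-! ### The hyperbolic splitting and adapted inner products -/

/-- The stable subspace of the linear flow `e^{tA}`. -/
def stableSet {d : ℕ} (A : Model d →L[ℝ] Model d) : Set (Model d) :=
  {v | Tendsto (fun t : ℝ => NormedSpace.exp (t • A) v) atTop (𝓝 0)}

/-- The unstable subspace of the linear flow `e^{tA}`. -/
def unstableSet {d : ℕ} (A : Model d →L[ℝ] Model d) : Set (Model d) :=
  {v | Tendsto (fun t : ℝ => NormedSpace.exp (t • A) v) atBot (𝓝 0)}

/-- `g` is an inner product adapted to `A`: the splitting into stable and unstable subspaces is
orthogonal, and `e^{tA}` is immediately contracting on the former and expanding on the latter. -/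
structure IsAdapted {d : ℕ} (A : Model d →L[ℝ] Model d) (g : LinearMap.BilinForm ℝ (Model d)) :
    Prop where
  symm : ∀ v w, g v w = g w v
  pos : ∀ v, v ≠ 0 → 0 < g v v
  orthogonal : ∀ v ∈ stableSet A, ∀ w ∈ unstableSet A, g v w = 0
  rate : ∃ ρ : ℝ, 0 < ρ ∧ (∀ v ∈ stableSet A, g (A v) v ≤ -ρ * g v v) ∧
    ∀ w ∈ unstableSet A, ρ * g w w ≤ g (A w) w

/-- The `n`-th layer `{v = vˢ + vᵘ : |vˢ| = |vᵘ|, e^{-(n+1)} ≤ |v| < e^{-n}}` of the cone, where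
`|v| = max (|vˢ|, |vᵘ|)` is the box norm built from the inner product `g`. -/
def coneLayer {d : ℕ} (A : Model d →L[ℝ] Model d) (g : LinearMap.BilinForm ℝ (Model d)) (n : ℕ) :
    Set (Model d) :=
  {v | ∃ vs ∈ stableSet A, ∃ vu ∈ unstableSet A, v = vs + vu ∧
    Real.sqrt (g vs vs) = Real.sqrt (g vu vu) ∧
    Real.exp (-((n : ℝ) + 1)) ≤ max (Real.sqrt (g vs vs)) (Real.sqrt (g vu vu)) ∧
    max (Real.sqrt (g vs vs)) (Real.sqrt (g vu vu)) < Real.exp (-(n : ℝ))}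

/-! ### Geodesics, the exponential map, scaled normal sections -/

section Riemannian

variable {d : ℕ} {M : Type*} [EMetricSpace M] [ChartedSpace (Model d) M]
  [IsManifold (𝓡 d) ∞ M] [RiemannianBundle (fun x : M => TangentSpace (𝓡 d) x)]

/-- The coefficients of the Riemannian metric in the chart around `p`, at the point with
coordinates `u`, evaluated on two coordinate vectors `a`, `b`. -/
def metricCoeff (p : M) (u a b : Model d) : ℝ :=
  let x : M := (extChartAt (𝓡 d) p).symm u
  inner ℝ (chartVector p x a) (chartVector p x b)

/-- `γ` satisfies the geodesic equation on `s`. In coordinates the equation is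
`g_{lk} u''^l + ∂_i g_{jk} u'^i u'^j - (1/2) ∂_k g_{ij} u'^i u'^j = 0`; it does not depend on
the chart. -/
def IsGeodesicOn (γ : ℝ → M) (s : Set ℝ) : Prop :=
  ∀ t ∈ s, ContinuousAt γ t ∧ ∃ p : M, γ t ∈ (chartAt (Model d) p).source ∧
    let u : ℝ → Model d := fun τ => extChartAt (𝓡 d) p (γ τ)
    ContDiffAt ℝ 2 u t ∧ ∀ c : Model d,
      metricCoeff p (u t) (deriv (deriv u) t) c
        + fderiv ℝ (fun w => metricCoeff p w (deriv u t) c) (u t) (deriv u t)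
        - (1 / 2) * fderiv ℝ (fun w => metricCoeff p w (deriv u t) (deriv u t)) (u t) c = 0

/-- `y = exp_x v`: there is a geodesic starting at `x` with velocity `v` that is at `y` at
time `1`. -/
def IsExp (x : M) (v : Model d) (y : M) : Prop :=
  ∃ (γ : ℝ → M) (ε : ℝ), 0 < ε ∧ IsGeodesicOn (d := d) γ (Ioo (-ε) (1 + ε)) ∧ γ 0 = x ∧
    HasDerivAt (fun t => extChartAt (𝓡 d) x (γ t)) v 0 ∧ γ 1 = y

/-- The normal section `N_x(β |X(x)|)`: the image under `exp_x` of the vectors orthogonal to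
`X(x)` of length less than `β |X(x)|`. -/
def scaledNormalSection (X : ∀ x : M, TangentSpace (𝓡 d) x) (β : ℝ) (x : M) : Set M :=
  {y | ∃ v : TangentSpace (𝓡 d) x, inner ℝ v (X x) = 0 ∧ ‖v‖ < β * ‖X x‖ ∧ IsExp (d := d) x v y}

/-- The interval of times around `0` during which the orbit of `x` stays in the (closed) ball of
radius `r` around `σ`. -/
def stayTimes (φ : ℝ → M → M) (σ : M) (r : ℝ) (x : M) : Set ℝ :=
  {t | ∀ s ∈ uIcc 0 t, edist (φ s x) σ ≤ ENNReal.ofReal r}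

/-- `y`, together with its orbit, is in the `β`-scaled tubular neighbourhood
`⋃ₜ N_{φ_t x}(β |X(φ_t x)|)` of the orbit of `x`, in forward and in backward time, until the orbit
of `x` leaves the ball of radius `r` around `σ`: up to an increasing continuous change of time
the orbit of `y` follows the orbit of `x` inside the normal sections, and `y` itself is in one of
them. -/
def InTubeUntilExit (X : ∀ x : M, TangentSpace (𝓡 d) x) (φ : ℝ → M → M) (σ : M) (r β : ℝ)
    (x y : M) : Prop :=
  ∃ h : ℝ → ℝ, ContinuousOn h (stayTimes φ σ r x) ∧ StrictMonoOn h (stayTimes φ σ r x) ∧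
    (∀ t ∈ stayTimes φ σ r x, φ (h t) y ∈ scaledNormalSection X β (φ t x)) ∧
    ∃ s ∈ stayTimes φ σ r x, |s| ≤ 1 ∧ h s = 0

/-! ### The cross section, the coarse partition, exit times -/

/-- The layer `D_n` of the cross section: the image under `exp_σ` of the layer of the cone. -/
def sectionLayer (X : ∀ x : M, TangentSpace (𝓡 d) x) (σ : M)
    (g : LinearMap.BilinForm ℝ (Model d)) (n : ℕ) : Set M :=
  {y | ∃ v ∈ coneLayer (linearization X σ) g n, IsExp (d := d) σ v y}

/-- The cell `C_n = φ_{[0,1)}(D_n)`. -/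
def coarseCell (X : ∀ x : M, TangentSpace (𝓡 d) x) (φ : ℝ → M → M) (σ : M)
    (g : LinearMap.BilinForm ℝ (Model d)) (n : ℕ) : Set M :=
  {z | ∃ x ∈ sectionLayer X σ g n, ∃ s ∈ Ico (0 : ℝ) 1, φ s x = z}

/-- The coarse partition `{C_n : n > n₀} ∪ {(⋃_{n > n₀} C_n)ᶜ}`. -/
def coarsePartition (X : ∀ x : M, TangentSpace (𝓡 d) x) (φ : ℝ → M → M) (σ : M)
    (g : LinearMap.BilinForm ℝ (Model d)) (n₀ : ℕ) : Set (Set M) :=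
  {C | ∃ n > n₀, C = coarseCell X φ σ g n} ∪ {(⋃ n > n₀, coarseCell X φ σ g n)ᶜ}

/-- The first positive time at which the orbit of `x` meets the boundary of the ball of radius `r`
around `σ`. (If there is no such time, the value is `0`.) -/
def exitTime (φ : ℝ → M → M) (σ : M) (r : ℝ) (x : M) : ℝ :=
  sInf {τ : ℝ | 0 < τ ∧ φ τ x ∈ frontier {z : M | edist z σ < ENNReal.ofReal r}}

end Riemannian

/-! ### Partitions and entropy -/

/-- `𝒜` is a countable measurable partition of `M` (into nonempty sets). -/
structure IsCountablePartition {M : Type*} [MeasurableSpace M] (𝒜 : Set (Set M)) : Prop where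
  countable : 𝒜.Countable
  measurable : ∀ A ∈ 𝒜, MeasurableSet A
  partition : Setoid.IsPartition 𝒜

/-- `𝒜` refines `𝒞`. -/
def Refines {M : Type*} (𝒜 𝒞 : Set (Set M)) : Prop := ∀ A ∈ 𝒜, ∃ C ∈ 𝒞, A ⊆ C

/-- The entropy `H_μ(𝒜) = -∑_{A ∈ 𝒜} μ(A) log μ(A)`, in `[0, ∞]`, of a partition with respect to
a probability measure. -/
def partitionEntropy {M : Type*} [MeasurableSpace M] (μ : Measure M) (𝒜 : Set (Set M)) : ℝ≥0∞ :=
  ∑' A : 𝒜, ENNReal.ofReal (Real.negMulLog (μ.real (A : Set M)))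

end SingFlow

end

noncomputable section

namespace SingFlow

set_option linter.unusedSectionVars false

/-! ### Linear flows -/

section LinearFlow

variable {d : ℕ}

/-! Near the singularity everything is compared with a linear field. Hyperbolicity yields two
semidefinite forms S and U, with S + U definite, measuring the stable and the unstable component;
the linear field contracts S and expands U at a rate ρ. A cone argument makes ρ and the other bounds
uniform over all linear maps close to DX(σ) (`exists_uniform_hyperbolicForms`), so one tuple of
constants `SaddleConst` serves every Y that is C¹-close to X (`exists_saddleChart`). The work is
done in the chart at σ, with S and U evaluated on the logarithm `Lg`, the local inverse of the
exponential map: since D_n is defined through exp, in these coordinates it is the set where S = U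
lies in [e^{-2(n+1)}, e^{-2n}).

Two opposite estimates control an orbit that starts on D_n. By Gronwall it moves away from the
saddle by a factor at most e^{Λ|t|}, so it remains at distance O(e^{-n/2}) for |t| ≤ n/(2Λ). By
`LocalSaddle.growth`, as soon as S ≤ U the form U grows at least like e^{ρt/2} and U - S grows
strictly; reversing time exchanges S and U, so the same holds in the past. Hence the orbit leaves
the ball before time 5n/ρ in both directions, its speed stays above a constant times e^{-(n+1)}
during the whole stay, and it does not meet any layer again while |t| ≤ n/(2Λ). This gives the speed
and exit time bounds and the disjointness of the C_n.

Each C_n is cut, in the chart, into cubes whose diameter is a small multiple of β (L')^{-n}. Two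
points of a cube separate by a factor at most e^{6Λn/ρ} while the first one stays in the ball, with
a unit of time to spare. With K₁ = 6/ρ and L ≥ e^Λ, the number L' = L^{K₁} e compensates this factor
and leaves another e^{-n}, which is the order of the minimal speed; so the orbits stay close
relative to β times the speed. Closeness relative to the speed is what the tube needs: the component
along the field of the logarithm from x_t to y_s increases in s and decreases in t, so its zeros
form the graph of the required increasing time change (`LocalSaddle.exists_tube`).

For the entropy, the preimages of C_n under the first ⌊n/(2Λ)⌋ integer times are disjoint, also for
different n, so an invariant probability measure satisfies ∑ n μ(C_n) ≤ 4Λ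
(`tsum_mul_measure_cell_le`). As C_n has at most exponentially many pieces, the tangent line bound
-t log t ≤ a t + e^{-a-1} with a proportional to n sums to a bound that does not depend on μ
(`partitionEntropy_le`). -/

theorem hasDerivAt_exp_smul_apply (B : Model d →L[ℝ] Model d) (v : Model d) (t : ℝ) :
    HasDerivAt (fun s : ℝ => NormedSpace.exp (s • B) v) (B (NormedSpace.exp (t • B) v)) t := by
  have h := hasDerivAt_exp_smul_const' (𝕂 := ℝ) B t
  simpa using h.clm_apply (hasDerivAt_const t v)

theorem eq_exp_smul_apply_of_hasDerivAt {B : Model d →L[ℝ] Model d} {w : ℝ → Model d}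
    (hw : ∀ t, HasDerivAt w (B (w t)) t) (t : ℝ) : w t = NormedSpace.exp (t • B) (w 0) := by
  have := ODE_solution_unique_univ (v := fun _ x => B x) (s := fun _ => univ) (K := ‖B‖₊)
    (f := w) (g := fun s : ℝ => NormedSpace.exp (s • B) (w 0)) (t₀ := 0)
    (fun _ => B.lipschitz.lipschitzOnWith) (fun t => ⟨hw t, mem_univ _⟩)
    (fun t => ⟨hasDerivAt_exp_smul_apply B (w 0) t, mem_univ _⟩)
    (by rw [zero_smul ℝ B, NormedSpace.exp_zero]; rfl)
  exact congrFun this t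

theorem tendsto_exp_mul_abs_pow {c : ℝ} (hc : c < 0) (k : ℕ) :
    Tendsto (fun t : ℝ => Real.exp (c * t) * |t| ^ k) atTop (𝓝 0) := by
  have h := (isLittleO_pow_exp_pos_mul_atTop k (neg_pos.2 hc)).tendsto_div_nhds_zero
  refine h.congr' ?_
  filter_upwards [eventually_ge_atTop 0] with t ht
  rw [abs_of_nonneg ht, neg_mul, Real.exp_neg, div_inv_eq_mul, mul_comm]

/-- The solution `e^{tμ} ∑ t^k/k! (T - μ)^k x` of `y' = T y`. -/
def genEigenCurve {V : Type*} [AddCommGroup V] [Module ℂ V] (T : Module.End ℂ V) (μ : ℂ) (N : ℕ)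
    (x : V) (t : ℝ) : V :=
  Complex.exp (t * μ) • ∑ k ∈ Finset.range (N + 1),
    (((t ^ k / k.factorial : ℝ) : ℂ)) • ((T - algebraMap ℂ _ μ) ^ k) x

/-- The sum is the exponential series of the part of `T` that is nilpotent on `x`. Differentiating
shifts the series by one index, and the term lost at the top is the one annihilated by `hx`. -/
theorem hasDerivAt_genEigenCurve (T : Module.End ℂ (Fin d → ℂ)) (μ : ℂ) (N : ℕ)
    (x : Fin d → ℂ) (hx : ((T - algebraMap ℂ _ μ) ^ (N + 1)) x = 0) (t : ℝ) :
    HasDerivAt (genEigenCurve T μ N x) (T (genEigenCurve T μ N x t)) t := by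
  set S := T - algebraMap ℂ (Module.End ℂ (Fin d → ℂ)) μ with hS
  have hTS : ∀ y, T y = μ • y + S y := fun y => by
    simp [hS, Module.algebraMap_end_apply]
  have hterm : ∀ k : ℕ, HasDerivAt (fun s : ℝ => (((s ^ k / k.factorial : ℝ) : ℂ)) • (S ^ k) x)
      ((((k * t ^ (k - 1) / k.factorial : ℝ) : ℂ)) • (S ^ k) x) t := fun k => by
    have h1 : HasDerivAt (fun s : ℝ => (s ^ k / k.factorial : ℝ))
        (k * t ^ (k - 1) / k.factorial) t := (hasDerivAt_pow k t).div_const _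
    exact h1.ofReal_comp.smul_const _
  have hsum := HasDerivAt.fun_sum (u := Finset.range (N + 1)) (fun k _ => hterm k)
  have he : HasDerivAt (fun s : ℝ => Complex.exp (s * μ)) (Complex.exp (t * μ) * μ) t := by
    have h1 : HasDerivAt (fun s : ℝ => (s : ℂ) * μ) μ t := by
      simpa using (Complex.ofRealCLM.hasDerivAt (x := t)).mul_const μ
    exact h1.cexp
  have hshift : ∑ k ∈ Finset.range (N + 1), (((k * t ^ (k - 1) / k.factorial : ℝ) : ℂ)) • (S ^ k) x
      = S (∑ k ∈ Finset.range (N + 1), (((t ^ k / k.factorial : ℝ) : ℂ)) • (S ^ k) x) := by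
    rw [map_sum, Finset.sum_range_succ', Finset.sum_range_succ]
    have h0 : S ((((t ^ N / N.factorial : ℝ) : ℂ)) • (S ^ N) x) = 0 := by
      rw [map_smul, ← Module.End.mul_apply, ← pow_succ', hx, smul_zero]
    rw [h0]
    simp only [Nat.cast_zero, zero_mul, zero_div, Complex.ofReal_zero, zero_smul]
    congr 1
    refine Finset.sum_congr rfl fun k _ => ?_
    rw [map_smul, ← Module.End.mul_apply, ← pow_succ']
    congr 2
    rw [Nat.factorial_succ]
    push_cast
    have : (k.factorial : ℝ) ≠ 0 := by positivity
    have h2 : (k : ℝ) + 1 ≠ 0 := by positivity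
    field_simp
  have := he.smul hsum
  unfold genEigenCurve
  refine this.congr_deriv ?_
  rw [← hS, hshift, hTS, map_smul]
  module

theorem tendsto_genEigenCurve {l : Filter ℝ} (T : Module.End ℂ (Fin d → ℂ)) (μ : ℂ) (N : ℕ)
    (x : Fin d → ℂ)
    (hl : ∀ k : ℕ, Tendsto (fun t : ℝ => Real.exp (μ.re * t) * |t| ^ k) l (𝓝 0)) :
    Tendsto (genEigenCurve T μ N x) l (𝓝 0) := by
  unfold genEigenCurve
  simp_rw [Finset.smul_sum]
  rw [← Finset.sum_const_zero (s := Finset.range (N + 1))]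
  refine tendsto_finsetSum _ fun k _ => ?_
  rw [tendsto_zero_iff_norm_tendsto_zero]
  have := (hl k).mul_const (((k.factorial : ℝ))⁻¹ * ‖((T - algebraMap ℂ _ μ) ^ k) x‖)
  rw [zero_mul] at this
  refine this.congr fun t => ?_
  rw [norm_smul, norm_smul, Complex.norm_exp, Complex.norm_real, Real.norm_eq_abs, abs_div, abs_pow,
    Nat.abs_cast]
  have : ((t : ℂ) * μ).re = μ.re * t := by simp [mul_comm]
  rw [this, div_eq_mul_inv]
  ring

theorem tendsto_exp_mul_abs_pow_atBot {c : ℝ} (hc : 0 < c) (k : ℕ) :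
    Tendsto (fun t : ℝ => Real.exp (c * t) * |t| ^ k) atBot (𝓝 0) := by
  have := (tendsto_exp_mul_abs_pow (neg_lt_zero.2 hc) k).comp tendsto_neg_atBot_atTop
  refine this.congr fun t => ?_
  simp [Function.comp]

/-- If `T` has no eigenvalue on the imaginary axis, then every vector is the sum of the initial
values of a solution of `y' = T y` decaying in the future and of one decaying in the past. -/
theorem exists_decaying_solutions (T : Module.End ℂ (Fin d → ℂ))
    (hT : ∀ μ : ℂ, T.HasEigenvalue μ → μ.re ≠ 0) (x : Fin d → ℂ) :
    ∃ y z : ℝ → Fin d → ℂ, (∀ t, HasDerivAt y (T (y t)) t) ∧ (∀ t, HasDerivAt z (T (z t)) t) ∧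
      Tendsto y atTop (𝓝 0) ∧ Tendsto z atBot (𝓝 0) ∧ y 0 + z 0 = x := by
  -- Over ℂ the generalized eigenspaces span, and the claim is stable under sums, so it is enough to
  -- treat a generalized eigenvector; the sign of the real part of its eigenvalue decides which of
  -- the two solutions is nonzero.
  have hx : x ∈ ⨆ μ : ℂ, T.maxGenEigenspace μ := by
    rw [Module.End.iSup_maxGenEigenspace_eq_top]; trivial
  induction hx using Submodule.iSup_induction' with
  | mem μ x hx =>
    have h00 : ∀ t, HasDerivAt (fun _ : ℝ => (0 : Fin d → ℂ)) (T 0) t := fun t => by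
      simpa using hasDerivAt_const t (0 : Fin d → ℂ)
    -- The supremum runs over all `μ`, including those with trivial eigenspace; only a nonzero `x`
    -- shows that `μ` is an eigenvalue, so that its real part is nonzero.
    by_cases hx0 : x = 0
    · exact ⟨fun _ => 0, fun _ => 0, h00, h00, tendsto_const_nhds, tendsto_const_nhds, by simp [hx0]⟩
    have hμ : T.HasEigenvalue μ := by
      rw [Module.End.mem_maxGenEigenspace] at hx
      obtain ⟨k, hk⟩ := hx
      refine Module.End.hasEigenvalue_of_hasGenEigenvalue (k := k) ?_
      intro hbot
      have : x ∈ T.genEigenspace μ k := by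
        rw [Module.End.mem_genEigenspace_nat, LinearMap.mem_ker]
        simpa [Algebra.algebraMap_eq_smul_one] using hk
      rw [hbot] at this
      exact hx0 (by simpa using this)
    rw [Module.End.mem_maxGenEigenspace] at hx
    obtain ⟨k, hk⟩ := hx
    have hk' : ((T - algebraMap ℂ _ μ) ^ (k + 1)) x = 0 := by
      rw [pow_succ', Module.End.mul_apply]
      rw [show (T - algebraMap ℂ _ μ) = T - μ • 1 by rw [Algebra.algebraMap_eq_smul_one], hk,
        map_zero]
    have hzero : genEigenCurve T μ k x 0 = x := by
      unfold genEigenCurve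
      rw [Finset.sum_range_succ']
      simp
    rcases lt_or_gt_of_ne (hT μ hμ) with h | h
    · exact ⟨genEigenCurve T μ k x, fun _ => 0, hasDerivAt_genEigenCurve T μ k x hk', h00,
        tendsto_genEigenCurve T μ k x (tendsto_exp_mul_abs_pow h), tendsto_const_nhds, by simp [hzero]⟩
    · exact ⟨fun _ => 0, genEigenCurve T μ k x, h00, hasDerivAt_genEigenCurve T μ k x hk',
        tendsto_const_nhds, tendsto_genEigenCurve T μ k x (tendsto_exp_mul_abs_pow_atBot h),
        by simp [hzero]⟩
  | zero =>
    have h00 : ∀ t, HasDerivAt (fun _ : ℝ => (0 : Fin d → ℂ)) (T 0) t := fun t => by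
      simpa using hasDerivAt_const t (0 : Fin d → ℂ)
    exact ⟨fun _ => 0, fun _ => 0, h00, h00, tendsto_const_nhds, tendsto_const_nhds, by simp⟩
  | add x y hx hy ihx ihy =>
    obtain ⟨y₁, z₁, a₁, b₁, c₁, e₁, f₁⟩ := ihx
    obtain ⟨y₂, z₂, a₂, b₂, c₂, e₂, f₂⟩ := ihy
    refine ⟨y₁ + y₂, z₁ + z₂, fun t => ?_, fun t => ?_, ?_, ?_, ?_⟩
    · simpa using (a₁ t).add (a₂ t)
    · simpa using (b₁ t).add (b₂ t)
    · rw [← add_zero (0 : Fin d → ℂ)]; exact c₁.add c₂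
    · rw [← add_zero (0 : Fin d → ℂ)]; exact e₁.add e₂
    · rw [← f₁, ← f₂]; simp only [Pi.add_apply]; abel

/-- The complexification of a real endomorphism, in coordinates. -/
def complexify (B : Model d →L[ℝ] Model d) : Matrix (Fin d) (Fin d) ℂ :=
  (LinearMap.toMatrix (EuclideanSpace.basisFun (Fin d) ℝ).toBasis
    (EuclideanSpace.basisFun (Fin d) ℝ).toBasis B.toLinearMap).map (algebraMap ℝ ℂ)

/-- The real part of a complex vector. -/
def rePart (d : ℕ) : (Fin d → ℂ) →L[ℝ] Model d :=
  (EuclideanSpace.equiv (Fin d) ℝ).symm.toContinuousLinearMap.comp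
    (ContinuousLinearMap.pi fun i => Complex.reCLM.comp (ContinuousLinearMap.proj i))

@[simp] theorem rePart_apply (y : Fin d → ℂ) (i : Fin d) : rePart d y i = (y i).re := rfl

theorem apply_eq_sum (B : Model d →L[ℝ] Model d) (v : Model d) (i : Fin d) :
    B v i = ∑ j, B (EuclideanSpace.single j 1) i * v j := by
  have hv : v = ∑ j, v j • EuclideanSpace.single j (1 : ℝ) := by
    ext k
    simp [Pi.single_apply]
  conv_lhs => rw [hv]
  simp [mul_comm]

theorem complexify_apply (B : Model d →L[ℝ] Model d) (i j : Fin d) :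
    complexify B i j = ((B (EuclideanSpace.single j 1) i : ℝ) : ℂ) := by
  simp [complexify, LinearMap.toMatrix_apply]

theorem rePart_complexify_mulVec (B : Model d →L[ℝ] Model d) (y : Fin d → ℂ) :
    rePart d ((complexify B).mulVec y) = B (rePart d y) := by
  ext i
  rw [apply_eq_sum, rePart_apply, Matrix.mulVec, dotProduct, Complex.re_sum]
  refine Finset.sum_congr rfl fun j _ => ?_
  rw [complexify_apply, Complex.re_ofReal_mul]
  rfl

theorem charpoly_complexify (B : Model d →L[ℝ] Model d) :
    (complexify B).charpoly = B.toLinearMap.charpoly.map (algebraMap ℝ ℂ) := by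
  rw [complexify, Matrix.charpoly_map, LinearMap.charpoly_toMatrix]

theorem aeval_charpoly_eq_zero_iff (B : Model d →L[ℝ] Model d) (z : ℂ) :
    Polynomial.aeval z B.toLinearMap.charpoly = 0 ↔
      Module.End.HasEigenvalue (Matrix.toLin' (complexify B)) z := by
  rw [Module.End.hasEigenvalue_iff_isRoot_charpoly, Matrix.charpoly_toLin',
    charpoly_complexify, Polynomial.IsRoot.def, Polynomial.eval_map_algebraMap]

/-- A linear map without purely imaginary eigenvalues. -/
def IsHyperbolicLinear (B : Model d →L[ℝ] Model d) : Prop :=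
  ∀ z : ℂ, Polynomial.aeval z B.toLinearMap.charpoly = 0 → z.re ≠ 0

/-- Decompose the vector after complexification and take real parts. As the matrix is real, real
parts of solutions are solutions, and by uniqueness they are the curves `exp (t • B)` applied to
their initial values; decay puts these values in the stable and unstable sets. -/
theorem IsHyperbolicLinear.exists_stable_add_unstable {B : Model d →L[ℝ] Model d}
    (hB : IsHyperbolicLinear B) (v : Model d) :
    ∃ a ∈ stableSet B, ∃ b ∈ unstableSet B, v = a + b := by
  obtain ⟨y, z, hy, hz, hy0, hz0, hyz⟩ := exists_decaying_solutions
    (Matrix.toLin' (complexify B)) (fun μ hμ => hB μ ((aeval_charpoly_eq_zero_iff B μ).2 hμ))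
    (fun i => (v i : ℂ))
  have key : ∀ y : ℝ → Fin d → ℂ, (∀ t, HasDerivAt y (Matrix.toLin' (complexify B) (y t)) t) →
      ∀ t, rePart d (y t) = NormedSpace.exp (t • B) (rePart d (y 0)) := fun y hy t => by
    refine eq_exp_smul_apply_of_hasDerivAt (w := fun t => rePart d (y t)) (fun t => ?_) t
    have := (rePart d).hasFDerivAt.comp_hasDerivAt t (hy t)
    rw [Matrix.toLin'_apply, rePart_complexify_mulVec] at this
    exact this
  refine ⟨rePart d (y 0), ?_, rePart d (z 0), ?_, ?_⟩
  · have := ((rePart d).continuous.tendsto 0).comp hy0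
    rw [map_zero] at this
    exact this.congr fun t => key y hy t
  · have := ((rePart d).continuous.tendsto 0).comp hz0
    rw [map_zero] at this
    exact this.congr fun t => key z hz t
  · rw [← map_add, hyz]
    ext i
    simp

/-- A quadratic form that strictly increases along the linear flow excludes imaginary eigenvalues:
for an eigenvector a + ib with eigenvalue iω one has Ba = -ωb and Bb = ωa, so q(Ba, a) + q(Bb, b) =
0. The hypothesis is open in `B`, which is how hyperbolicity passes to nearby maps. -/
theorem IsHyperbolicLinear.of_bilin {B : Model d →L[ℝ] Model d}
    {q : Model d →L[ℝ] Model d →L[ℝ] ℝ} (hsymm : ∀ v w, q v w = q w v)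
    (hq : ∀ v, v ≠ 0 → 0 < q (B v) v) : IsHyperbolicLinear B := by
  intro z hz hre
  rw [aeval_charpoly_eq_zero_iff] at hz
  obtain ⟨x, hx⟩ := hz.exists_hasEigenvector
  have hx1 : (complexify B).mulVec x = z • x := by
    simpa using hx.apply_eq_smul
  set a := rePart d x with ha
  -- Re(-ix) is the imaginary part of x.
  set b := rePart d ((-Complex.I) • x) with hb
  have hBa : B a = -z.im • b := by
    rw [ha, ← rePart_complexify_mulVec, hx1]
    ext i
    simp [hb, hre]
  have hBb : B b = z.im • a := by
    rw [hb, ← rePart_complexify_mulVec, Matrix.mulVec_smul, hx1]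
    ext i
    simp [ha, hre]
  have hnn : ∀ v, 0 ≤ q (B v) v := fun v => by
    rcases eq_or_ne v 0 with rfl | h
    · simp
    · exact (hq v h).le
  have hsum : q (B a) a + q (B b) b = 0 := by
    rw [hBa, hBb]
    simp only [map_smul, smul_apply, smul_eq_mul, hsymm a b]
    ring
  have hab : a = 0 ∧ b = 0 := by
    constructor
    · by_contra h
      have := hq a h; have := hnn b; linarith
    · by_contra h
      have := hq b h; have := hnn a; linarith
  apply hx.2
  ext i
  have h1 : (x i).re = 0 := by
    have := congrArg (fun v : Model d => v i) hab.1
    simpa [ha] using this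
  have h2 : (x i).im = 0 := by
    have := congrArg (fun v : Model d => v i) hab.2
    simpa [hb] using this
  exact Complex.ext h1 h2

end LinearFlow


/-! ### Stable and unstable subspaces; contracting inner products. -/

section Splitting

variable {E : Type*} [NormedAddCommGroup E] [InnerProductSpace ℝ E] [FiniteDimensional ℝ E]
  [CompleteSpace E] {B : E →L[ℝ] E}

/-- The stable subspace of the linear flow `e^{tA}` on an inner product space. -/
def stableVectors (A : E →L[ℝ] E) : Set E :=
  {v | Tendsto (fun t : ℝ => NormedSpace.exp (t • A) v) atTop (𝓝 0)}

/-- The unstable subspace of the linear flow `e^{tA}` on an inner product space. -/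
def unstableVectors (A : E →L[ℝ] E) : Set E :=
  {v | Tendsto (fun t : ℝ => NormedSpace.exp (t • A) v) atBot (𝓝 0)}

theorem hasDerivAt_exp_smul_vector (B : E →L[ℝ] E) (v : E) (t : ℝ) :
    HasDerivAt (fun s : ℝ => NormedSpace.exp (s • B) v) (B (NormedSpace.exp (t • B) v)) t := by
  have h := hasDerivAt_exp_smul_const' (𝕂 := ℝ) B t
  simpa using h.clm_apply (hasDerivAt_const t v)

theorem exp_neg_smul_exp_smul_apply (B : E →L[ℝ] E) (t : ℝ) (v : E) :
    NormedSpace.exp ((-t) • B) (NormedSpace.exp (t • B) v) = v := by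
  let +nondep : NormedAlgebra ℚ (E →L[ℝ] E) := .restrictScalars ℚ ℝ (E →L[ℝ] E)
  have h2 : NormedSpace.exp ((-t) • B) * NormedSpace.exp (t • B) = 1 := by
    rw [← NormedSpace.exp_add_of_commute, ← add_smul, neg_add_cancel, zero_smul ℝ B,
      NormedSpace.exp_zero]
    exact ((Commute.refl B).smul_right t).smul_left (-t)
  exact congrArg (fun L : E →L[ℝ] E => L v) h2


theorem commute_exp_smul (B : E →L[ℝ] E) (t : ℝ) :
    Commute B (NormedSpace.exp (t • B)) :=
  ((Commute.refl B).smul_right t).exp_right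

theorem exp_smul_apply_comm (B : E →L[ℝ] E) (t : ℝ) (v : E) :
    NormedSpace.exp (t • B) (B v) = B (NormedSpace.exp (t • B) v) :=
  (congrArg (fun L : E →L[ℝ] E => L v) (commute_exp_smul B t).eq).symm

theorem exp_smul_apply_exp_smul_comm (B : E →L[ℝ] E) (s t : ℝ) (v : E) :
    NormedSpace.exp (t • B) (NormedSpace.exp (s • B) v)
      = NormedSpace.exp (s • B) (NormedSpace.exp (t • B) v) :=
  congrArg (fun L : E →L[ℝ] E => L v)
    ((((Commute.refl B).smul_right s).smul_left t).exp).eq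

theorem exp_zero_smul_apply (B : E →L[ℝ] E) (v : E) :
    NormedSpace.exp ((0 : ℝ) • B) v = v := by
  rw [zero_smul ℝ B, NormedSpace.exp_zero]; rfl

/-- Time reversal: statements about unstable subspaces follow from those about stable ones. -/
theorem unstableVectors_eq_stableVectors_neg (B : E →L[ℝ] E) :
    unstableVectors B = stableVectors (-B) := by
  ext v
  simp only [unstableVectors, stableVectors, mem_ofPred_eq]
  have : ∀ t : ℝ, NormedSpace.exp (t • -B) v = NormedSpace.exp ((-t) • B) v := fun t => by
    congr 2; rw [smul_neg, neg_smul]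
  constructor
  · intro h
    exact (h.comp tendsto_neg_atTop_atBot).congr fun t => (this t).symm
  · intro h
    refine (h.comp tendsto_neg_atBot_atTop).congr fun t => ?_
    simp only [Function.comp, this, neg_neg]

/-- The stable subspace as a submodule. -/
def stableSub (B : E →L[ℝ] E) : Submodule ℝ (E) where
  carrier := stableVectors B
  add_mem' := fun {a b} ha hb => by
    have : Tendsto _ atTop (𝓝 ((0 : E) + 0)) := Tendsto.add ha hb
    rw [add_zero] at this
    exact this.congr fun t => (map_add _ a b).symm
  zero_mem' := by
    simp only [stableVectors, mem_ofPred_eq, map_zero]; exact tendsto_const_nhds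
  smul_mem' := fun c a ha => by
    have : Tendsto _ atTop (𝓝 (c • (0 : E))) := Tendsto.const_smul ha c
    rw [smul_zero] at this
    exact this.congr fun t => (map_smul _ c a).symm

/-- The unstable subspace as a submodule. -/
def unstableSub (B : E →L[ℝ] E) : Submodule ℝ (E) := stableSub (-B)

theorem mem_unstableSub {v : E} : v ∈ unstableSub B ↔ v ∈ unstableVectors B := by
  rw [unstableVectors_eq_stableVectors_neg]; rfl

theorem map_mem_stableSub {v : E} (hv : v ∈ stableSub B) : B v ∈ stableSub B := by
  have : Tendsto _ atTop (𝓝 (B 0)) := (B.continuous.tendsto 0).comp hv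
  rw [map_zero] at this
  exact this.congr fun t => (exp_smul_apply_comm B t v).symm

theorem exp_map_mem_stableSub {v : E} (hv : v ∈ stableSub B) (s : ℝ) :
    NormedSpace.exp (s • B) v ∈ stableSub B := by
  have : Tendsto _ atTop (𝓝 (NormedSpace.exp (s • B) 0)) :=
    ((NormedSpace.exp (s • B)).continuous.tendsto 0).comp hv
  rw [map_zero] at this
  exact this.congr fun t => (exp_smul_apply_exp_smul_comm B s t v).symm

theorem map_mem_unstableSub {v : E} (hv : v ∈ unstableSub B) : B v ∈ unstableSub B := by
  have := map_mem_stableSub hv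
  rw [neg_apply] at this
  simpa using (unstableSub B).neg_mem this

/-- Pointwise decay becomes uniform because the stable subspace has a finite basis: wait until every
basis vector is small, with the margin required by the operator norm bound in terms of the basis. -/
theorem exists_contraction_time (B : E →L[ℝ] E) :
    ∃ T : ℝ, 0 < T ∧ ∀ v ∈ stableSub B, ‖NormedSpace.exp (T • B) v‖ ≤ (1 / 2) * ‖v‖ := by
  let b := Module.finBasis ℝ (stableSub B)
  obtain ⟨C, hC, hb⟩ := b.exists_opNorm_le (F := E)
  have h1 : ∀ i, ∀ᶠ t : ℝ in atTop, ‖NormedSpace.exp (t • B) (b i : E)‖ ≤ 1 / (2 * C) :=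
    fun i => by
      have h2 : Tendsto (fun t : ℝ => ‖NormedSpace.exp (t • B) (b i : E)‖) atTop (𝓝 0) := by
        simpa using (show Tendsto _ atTop (𝓝 (0 : E)) from (b i).2).norm
      exact (h2.eventually (gt_mem_nhds (by positivity))).mono fun t ht => ht.le
  obtain ⟨T, hT, hT0⟩ := ((eventually_all.2 h1).and (eventually_gt_atTop 0)).exists
  refine ⟨T, hT0, fun v hv => ?_⟩
  have := hb (u := (NormedSpace.exp (T • B)).comp (stableSub B).subtypeL) (M := 1 / (2 * C))
    (by positivity) hT
  have h3 := ContinuousLinearMap.le_of_opNorm_le _ this ⟨v, hv⟩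
  calc ‖NormedSpace.exp (T • B) v‖ ≤ C * (1 / (2 * C)) * ‖v‖ := h3
    _ = 1 / 2 * ‖v‖ := by field_simp

/-- The quadratic form `q` increases along the linear flow if `q (B v) v ≥ 0`. -/
theorem monotone_quadratic {q : E →L[ℝ] E →L[ℝ] ℝ} (hsymm : ∀ v w, q v w = q w v)
    {v : E}
    (h : ∀ t : ℝ, 0 ≤ q (B (NormedSpace.exp (t • B) v)) (NormedSpace.exp (t • B) v)) :
    Monotone fun t : ℝ => q (NormedSpace.exp (t • B) v) (NormedSpace.exp (t • B) v) := by
  have hd : ∀ t : ℝ, HasDerivAt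
      (fun t : ℝ => q (NormedSpace.exp (t • B) v) (NormedSpace.exp (t • B) v))
      (2 * q (B (NormedSpace.exp (t • B) v)) (NormedSpace.exp (t • B) v)) t := fun t => by
    have h1 := hasDerivAt_exp_smul_vector B v t
    have h2 := (q.hasFDerivAt.comp_hasDerivAt t h1).clm_apply h1
    refine h2.congr_deriv ?_
    simp only [Function.comp]
    rw [hsymm (NormedSpace.exp (t • B) v)]
    ring
  refine monotone_of_deriv_nonneg (fun t => (hd t).differentiableAt) fun t => ?_
  rw [(hd t).deriv]
  linarith [h t]

/-- The form is nondecreasing along the orbit and tends to its value 0 at the origin. This, and its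
unstable counterpart below, locate the invariant subspaces of a perturbed map inside cones. -/
theorem quadratic_nonpos_of_mem_stableVectors {q : E →L[ℝ] E →L[ℝ] ℝ}
    (hsymm : ∀ v w, q v w = q w v) {v : E} (hv : v ∈ stableVectors B)
    (h : ∀ t : ℝ, 0 ≤ q (B (NormedSpace.exp (t • B) v)) (NormedSpace.exp (t • B) v)) :
    q v v ≤ 0 := by
  have hlim : Tendsto (fun t : ℝ => q (NormedSpace.exp (t • B) v) (NormedSpace.exp (t • B) v))
      atTop (𝓝 (q 0 0)) := by
    have hv' : Tendsto (fun t : ℝ => NormedSpace.exp (t • B) v) atTop (𝓝 0) := hv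
    have : Continuous fun w : E => q w w := by fun_prop
    exact (this.tendsto 0).comp hv'
  have := (monotone_quadratic hsymm h).ge_of_tendsto hlim 0
  simp only [exp_zero_smul_apply, map_zero] at this
  exact this

theorem quadratic_nonneg_of_mem_unstableVectors {q : E →L[ℝ] E →L[ℝ] ℝ}
    (hsymm : ∀ v w, q v w = q w v) {v : E} (hv : v ∈ unstableVectors B)
    (h : ∀ t : ℝ, 0 ≤ q (B (NormedSpace.exp (t • B) v)) (NormedSpace.exp (t • B) v)) :
    0 ≤ q v v := by
  have hlim : Tendsto (fun t : ℝ => q (NormedSpace.exp (t • B) v) (NormedSpace.exp (t • B) v))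
      atBot (𝓝 (q 0 0)) := by
    have hv' : Tendsto (fun t : ℝ => NormedSpace.exp (t • B) v) atBot (𝓝 0) := hv
    have : Continuous fun w : E => q w w := by fun_prop
    exact (this.tendsto 0).comp hv'
  have := (monotone_quadratic hsymm h).le_of_tendsto hlim 0
  simp only [exp_zero_smul_apply, map_zero] at this
  exact this

set_option synthInstance.maxHeartbeats 400000 in
/-- An inner product for which the linear flow immediately contracts its stable subspace. -/
theorem exists_contracting_form (B : E →L[ℝ] E) :
    ∃ (G : E →L[ℝ] E →L[ℝ] ℝ) (c ρ : ℝ), 0 < c ∧ 0 < ρ ∧ (∀ v w, G v w = G w v) ∧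
      (∀ v, c * ‖v‖ ^ 2 ≤ G v v) ∧ ∀ v ∈ stableSub B, G (B v) v ≤ -ρ * G v v := by
  obtain ⟨T, hT, hcontr⟩ := exists_contraction_time B
  have hexpc : Continuous fun t : ℝ => NormedSpace.exp (t • B) :=
    continuous_iff_continuousAt.2 fun t => (hasDerivAt_exp_smul_const (𝕂 := ℝ) B t).continuousAt
  obtain ⟨C, hC⟩ := (isCompact_Icc (a := (0 : ℝ)) (b := T)).exists_bound_of_continuousOn
    (hexpc.comp continuous_neg).continuousOn
  -- The new inner product is the average of the pullbacks of the old one under the flow over [0,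
  -- T], with `T` the contraction time. Its derivative along the flow is then a pure boundary term.
  let H : ℝ → E →L[ℝ] E →L[ℝ] ℝ := fun t =>
    (innerSL ℝ (E := E)).bilinearComp (NormedSpace.exp (t • B)) (NormedSpace.exp (t • B))
  have hHapp : ∀ t v w, H t v w
      = inner ℝ (NormedSpace.exp (t • B) v) (NormedSpace.exp (t • B) w) := fun t v w => rfl
  have happc : ∀ v : E, Continuous fun t : ℝ => NormedSpace.exp (t • B) v := fun v =>
    hexpc.clm_apply continuous_const
  have hH : Continuous H := by
    refine continuous_clm_apply.2 fun v => continuous_clm_apply.2 fun w => ?_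
    simp only [hHapp]
    exact (happc v).inner (happc w)
  let G : E →L[ℝ] E →L[ℝ] ℝ := ∫ t in (0 : ℝ)..T, H t
  have hG : ∀ v w, G v w = ∫ t in (0 : ℝ)..T,
      inner ℝ (NormedSpace.exp (t • B) v) (NormedSpace.exp (t • B) w) := fun v w => by
    have h1 : G v = ∫ t in (0 : ℝ)..T, H t v :=
      (ContinuousLinearMap.intervalIntegral_apply (hH.intervalIntegrable 0 T) v)
    have h2 : (∫ t in (0 : ℝ)..T, H t v) w = ∫ t in (0 : ℝ)..T, H t v w :=
      (ContinuousLinearMap.intervalIntegral_apply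
        ((hH.clm_apply continuous_const).intervalIntegrable 0 T) w)
    rw [h1, h2]
    rfl
  -- On [0, T] the inverse maps e^{-tB} are bounded by `C`, so no vector shrinks by more than that
  -- factor.
  have hlow : ∀ v : E, T * (1 / (|C| + 1) ^ 2) * ‖v‖ ^ 2 ≤ G v v := fun v => by
    rw [hG]
    have hpt : ∀ t ∈ Icc 0 T, 1 / (|C| + 1) ^ 2 * ‖v‖ ^ 2 ≤
        inner ℝ (NormedSpace.exp (t • B) v) (NormedSpace.exp (t • B) v) := fun t ht => by
      rw [real_inner_self_eq_norm_sq]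
      have h3 : ‖v‖ ≤ (|C| + 1) * ‖NormedSpace.exp (t • B) v‖ := by
        conv_lhs => rw [← exp_neg_smul_exp_smul_apply B t v]
        refine ContinuousLinearMap.le_of_opNorm_le _ ((hC t ht).trans ?_) _
        linarith [le_abs_self C]
      have h4 := pow_le_pow_left₀ (norm_nonneg v) h3 2
      rw [one_div, inv_mul_le_iff₀ (by positivity)]
      linarith [mul_pow (|C| + 1) ‖NormedSpace.exp (t • B) v‖ 2]
    have h5 := intervalIntegral.integral_mono_on hT.le
      (intervalIntegrable_const (μ := volume))
      (((happc v).inner (happc v)).intervalIntegrable 0 T) hpt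
    rw [intervalIntegral.integral_const, smul_eq_mul, sub_zero] at h5
    linarith
  have hder : ∀ v : E, G (B v) v
      = (1 / 2) * (‖NormedSpace.exp (T • B) v‖ ^ 2 - ‖v‖ ^ 2) := fun v => by
    have hd : ∀ t : ℝ, HasDerivAt (fun t : ℝ => ‖NormedSpace.exp (t • B) v‖ ^ 2)
        (2 * inner ℝ (NormedSpace.exp (t • B) v) (B (NormedSpace.exp (t • B) v))) t := fun t =>
      (hasDerivAt_exp_smul_vector B v t).norm_sq
    have hint : ∫ t in (0 : ℝ)..T,
        2 * inner ℝ (NormedSpace.exp (t • B) v) (B (NormedSpace.exp (t • B) v))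
        = ‖NormedSpace.exp (T • B) v‖ ^ 2 - ‖v‖ ^ 2 := by
      rw [intervalIntegral.integral_eq_sub_of_hasDerivAt (fun t _ => hd t)]
      · rw [exp_zero_smul_apply]
      · refine Continuous.intervalIntegrable ?_ 0 T
        exact continuous_const.mul ((happc v).inner (B.continuous.comp (happc v)))
    rw [hG, ← hint, intervalIntegral.integral_const_mul, ← mul_assoc]
    norm_num
    refine intervalIntegral.integral_congr fun t _ => ?_
    simp only [exp_smul_apply_comm, real_inner_comm]
  have hc : 0 < T * (1 / (|C| + 1) ^ 2) := by positivity
  -- 3/8 is (1 - 1/4)/2: on the stable subspace the boundary term is at most half of (1/2)² - 1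
  -- times the squared norm.
  refine ⟨G, _, 3 / 8 / (‖G‖ + 1), hc, by positivity, fun v w => ?_, hlow, fun v hv => ?_⟩
  · rw [hG, hG]
    exact intervalIntegral.integral_congr fun t _ => real_inner_comm _ _
  · rw [hder]
    have h1 := pow_le_pow_left₀ (norm_nonneg _) (hcontr v hv) 2
    have h2 : G v v ≤ (‖G‖ + 1) * ‖v‖ ^ 2 := by
      have := (le_abs_self _).trans (G.le_opNorm₂ v v)
      nlinarith [sq_nonneg ‖v‖]
    have h3 : 3 / 8 / (‖G‖ + 1) * G v v ≤ 3 / 8 * ‖v‖ ^ 2 := by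
      rw [div_mul_eq_mul_div, div_le_iff₀ (by positivity)]
      nlinarith
    nlinarith

end Splitting


/-! ### Pairs of forms contracted and expanded by a linear field, uniformly under perturbation. -/

section SplitForms

variable {E : Type*} [NormedAddCommGroup E] [InnerProductSpace ℝ E]

/-- Semi-definite forms `S`, `U`, with `S + U` definite, such that the linear field `B` contracts
`S` and expands `U`. -/
structure SplitForms (B : E →L[ℝ] E) (S U : E →L[ℝ] E →L[ℝ] ℝ) (ρ m K : ℝ) : Prop where
  symmS : ∀ v w, S v w = S w v
  symmU : ∀ v w, U v w = U w v
  nonnegS : ∀ v, 0 ≤ S v v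
  nonnegU : ∀ v, 0 ≤ U v v
  lower : ∀ v, m * ‖v‖ ^ 2 ≤ S v v + U v v
  boundS : ∀ v w, |S v w| ≤ K * ‖v‖ * ‖w‖
  boundU : ∀ v w, |U v w| ≤ K * ‖v‖ * ‖w‖
  rateS : ∀ v, S (B v) v ≤ -ρ * S v v
  rateU : ∀ v, ρ * U v v ≤ U (B v) v

/-- Reversing time exchanges the two forms and keeps all constants, so every estimate is needed only
for positive times. -/
theorem SplitForms.neg {B : E →L[ℝ] E} {S U : E →L[ℝ] E →L[ℝ] ℝ} {ρ m K : ℝ}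
    (h : SplitForms B S U ρ m K) : SplitForms (-B) U S ρ m K where
  symmS := h.symmU
  symmU := h.symmS
  nonnegS := h.nonnegU
  nonnegU := h.nonnegS
  lower := fun v => by rw [add_comm]; exact h.lower v
  boundS := h.boundU
  boundU := h.boundS
  rateS := fun v => by
    simp only [neg_apply, map_neg]
    linarith [h.rateU v]
  rateU := fun v => by
    simp only [neg_apply, map_neg]
    linarith [h.rateS v]

variable [FiniteDimensional ℝ E] [CompleteSpace E]

/-- `SplitForms` whose kernels are the unstable and the stable subspaces. -/
structure HyperbolicForms (B : E →L[ℝ] E) (S U : E →L[ℝ] E →L[ℝ] ℝ) (ρ m K : ℝ) : Prop extends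
    SplitForms B S U ρ m K where
  nullS : ∀ b ∈ unstableVectors B, ∀ v, S b v = 0
  nullU : ∀ a ∈ stableVectors B, ∀ v, U a v = 0
  decomp : ∀ v, ∃ a ∈ stableVectors B, ∃ b ∈ unstableVectors B, v = a + b

/-- `S` and `U` are the pullbacks of `Gs` and `Gu` under the projections of the splitting. The
subspaces are invariant, so `B` commutes with the projections and the rates carry over; `P` bounds
the projections, and the loss of a factor 2 in the lower bound comes from |a + b|² ≤ 2|a|² + 2|b|².
-/
theorem exists_hyperbolicForms {B : E →L[ℝ] E}
    (hdec : ∀ v, ∃ a ∈ stableVectors B, ∃ b ∈ unstableVectors B, v = a + b)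
    {Gs Gu : E →L[ℝ] E →L[ℝ] ℝ} (hGs : ∀ v w, Gs v w = Gs w v) (hGu : ∀ v w, Gu v w = Gu w v)
    {c Kg ρ P : ℝ} (hc : 0 < c) (hcs : ∀ v, c * ‖v‖ ^ 2 ≤ Gs v v) (hcu : ∀ v, c * ‖v‖ ^ 2 ≤ Gu v v)
    (hKs : ∀ v w, |Gs v w| ≤ Kg * ‖v‖ * ‖w‖) (hKu : ∀ v w, |Gu v w| ≤ Kg * ‖v‖ * ‖w‖)
    (hKg : 0 ≤ Kg)
    (hrs : ∀ v ∈ stableVectors B, Gs (B v) v ≤ -ρ * Gs v v)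
    (hru : ∀ v ∈ unstableVectors B, ρ * Gu v v ≤ Gu (B v) v)
    (hP : ∀ a ∈ stableVectors B, ∀ b ∈ unstableVectors B, ‖a‖ ≤ P * ‖a + b‖ ∧ ‖b‖ ≤ P * ‖a + b‖) :
    ∃ S U : E →L[ℝ] E →L[ℝ] ℝ, HyperbolicForms B S U ρ (c / 2) (Kg * P ^ 2) ∧
      ∀ a ∈ stableVectors B, ∀ b ∈ unstableVectors B, ∀ a' ∈ stableVectors B,
        ∀ b' ∈ unstableVectors B,
        S (a + b) (a' + b') = Gs a a' ∧ U (a + b) (a' + b') = Gu b b' := by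
  have hcompl : IsCompl (stableSub B) (unstableSub B) := by
    constructor
    · rw [Submodule.disjoint_def]
      intro x hx hx'
      have h := (hP x hx (-x) (mem_unstableSub.1 ((unstableSub B).neg_mem hx'))).1
      rw [add_neg_cancel, norm_zero, mul_zero] at h
      exact norm_le_zero_iff.1 h
    · rw [codisjoint_iff, Submodule.eq_top_iff']
      intro v
      obtain ⟨a, ha, b, hb, rfl⟩ := hdec v
      exact Submodule.add_mem_sup ha (mem_unstableSub.2 hb)
  let Ps : E →L[ℝ] E := LinearMap.toContinuousLinearMap
    ((stableSub B).projection (unstableSub B) hcompl)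
  let Pu : E →L[ℝ] E := LinearMap.toContinuousLinearMap
    ((unstableSub B).projection (stableSub B) hcompl.symm)
  have hPs : ∀ a ∈ stableVectors B, ∀ b ∈ unstableVectors B, Ps (a + b) = a := fun a ha b hb => by
    change (stableSub B).projection (unstableSub B) hcompl (a + b) = a
    rw [map_add, Submodule.projection_apply_of_mem_left hcompl ha,
      (Submodule.projection_apply_eq_zero_iff hcompl).2 (mem_unstableSub.2 hb), add_zero]
  have hPu : ∀ a ∈ stableVectors B, ∀ b ∈ unstableVectors B, Pu (a + b) = b := fun a ha b hb => by
    change (unstableSub B).projection (stableSub B) hcompl.symm (a + b) = b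
    rw [map_add, Submodule.projection_apply_of_mem_left hcompl.symm (mem_unstableSub.2 hb),
      (Submodule.projection_apply_eq_zero_iff hcompl.symm).2 ha, zero_add]
  have hBst : ∀ a ∈ stableVectors B, B a ∈ stableVectors B := fun a ha => map_mem_stableSub ha
  have hBun : ∀ a ∈ unstableVectors B, B a ∈ unstableVectors B := fun a ha =>
    mem_unstableSub.1 (map_mem_unstableSub (mem_unstableSub.2 ha))
  let S : E →L[ℝ] E →L[ℝ] ℝ := Gs.bilinearComp Ps Ps
  let U : E →L[ℝ] E →L[ℝ] ℝ := Gu.bilinearComp Pu Pu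
  have hS : ∀ v w, S v w = Gs (Ps v) (Ps w) := fun v w => rfl
  have hU : ∀ v w, U v w = Gu (Pu v) (Pu w) := fun v w => rfl
  have h0s : (0 : E) ∈ stableVectors B := (stableSub B).zero_mem
  have h0u : (0 : E) ∈ unstableVectors B := mem_unstableSub.1 (unstableSub B).zero_mem
  have hbd : ∀ (G : E →L[ℝ] E →L[ℝ] ℝ) (L : E →L[ℝ] E), (∀ v w, |G v w| ≤ Kg * ‖v‖ * ‖w‖) →
      (∀ v, ‖L v‖ ≤ P * ‖v‖) → ∀ v w, |G (L v) (L w)| ≤ Kg * P ^ 2 * ‖v‖ * ‖w‖ :=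
    fun G L hG hL v w => by
      calc |G (L v) (L w)| ≤ Kg * ‖L v‖ * ‖L w‖ := hG _ _
        _ ≤ Kg * (P * ‖v‖) * (P * ‖w‖) := by
            have h1 := hL v
            have h2 := hL w
            have h3 := (norm_nonneg _).trans h1
            gcongr
        _ = _ := by ring
  refine ⟨S, U, ⟨⟨?_, ?_, ?_, ?_, ?_, ?_, ?_, ?_, ?_⟩, ?_, ?_, hdec⟩, ?_⟩
  · intro v w; rw [hS, hS, hGs]
  · intro v w; rw [hU, hU, hGu]
  · intro v; rw [hS]; exact le_trans (by positivity) (hcs _)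
  · intro v; rw [hU]; exact le_trans (by positivity) (hcu _)
  · intro v
    obtain ⟨a, ha, b, hb, rfl⟩ := hdec v
    rw [hS, hU, hPs a ha b hb, hPu a ha b hb]
    have h1 : ‖a + b‖ ^ 2 ≤ 2 * ‖a‖ ^ 2 + 2 * ‖b‖ ^ 2 := by
      have := pow_le_pow_left₀ (norm_nonneg _) (norm_add_le a b) 2
      nlinarith [sq_nonneg (‖a‖ - ‖b‖)]
    nlinarith [hcs a, hcu b]
  · refine fun v w => hbd Gs Ps hKs (fun v => ?_) v w
    obtain ⟨a, ha, b, hb, rfl⟩ := hdec v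
    rw [hPs a ha b hb]; exact (hP a ha b hb).1
  · refine fun v w => hbd Gu Pu hKu (fun v => ?_) v w
    obtain ⟨a, ha, b, hb, rfl⟩ := hdec v
    rw [hPu a ha b hb]; exact (hP a ha b hb).2
  · intro v
    obtain ⟨a, ha, b, hb, rfl⟩ := hdec v
    rw [hS, hS, map_add B, hPs a ha b hb, hPs _ (hBst a ha) _ (hBun b hb)]
    exact hrs a ha
  · intro v
    obtain ⟨a, ha, b, hb, rfl⟩ := hdec v
    rw [hU, hU, map_add B, hPu a ha b hb, hPu _ (hBst a ha) _ (hBun b hb)]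
    exact hru b hb
  · intro b hb v
    have := hPs 0 h0s b hb
    rw [zero_add] at this
    rw [hS, this, map_zero]; rfl
  · intro a ha v
    have := hPu a ha 0 h0u
    rw [add_zero] at this
    rw [hU, this, map_zero]; rfl
  · intro a ha b hb a' ha' b' hb'
    rw [hS, hU, hPs a ha b hb, hPu a ha b hb, hPs a' ha' b' hb', hPu a' ha' b' hb']
    exact ⟨rfl, rfl⟩

theorem abs_apply_le (G : E →L[ℝ] E →L[ℝ] ℝ) (v w : E) : |G v w| ≤ ‖G‖ * ‖v‖ * ‖w‖ :=
  G.le_opNorm₂ v w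

set_option synthInstance.maxHeartbeats 400000 in
set_option maxHeartbeats 800000 in
/-- A linear field whose space splits into stable and unstable vectors admits `SplitForms`. -/
theorem exists_hyperbolicForms_of_decomp {A : E →L[ℝ] E}
    (hdec : ∀ v, ∃ a ∈ stableVectors A, ∃ b ∈ unstableVectors A, v = a + b) :
    ∃ (S U : E →L[ℝ] E →L[ℝ] ℝ) (ρ m K Λ : ℝ), 0 < ρ ∧ 0 < m ∧ 0 < K ∧ 0 ≤ Λ ∧
      HyperbolicForms A S U ρ m K ∧ (∀ v, -(Λ * S v v) ≤ S (A v) v) ∧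
      ∀ v, U (A v) v ≤ Λ * U v v := by
  obtain ⟨Gs, cs, ρs, hcs, hρs, hsymms, hlows, hrs⟩ := exists_contracting_form A
  obtain ⟨Gu, cu, ρu, hcu, hρu, hsymmu, hlowu, hru⟩ := exists_contracting_form (-A)
  have hru' : ∀ v ∈ unstableVectors A, ρu * Gu v v ≤ Gu (A v) v := fun v hv => by
    have := hru v (mem_unstableSub.2 hv)
    simp only [neg_apply, map_neg] at this
    linarith
  -- On stable vectors -`Gs` increases with time; if the orbit also vanishes at -∞, then -`Gs` is
  -- nonnegative at `x`, which forces x = 0.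
  have hdisj : ∀ x ∈ stableVectors A, x ∈ unstableVectors A → x = 0 := fun x hx hx' => by
    have h1 : 0 ≤ (-Gs) x x := by
      refine quadratic_nonneg_of_mem_unstableVectors (B := A) (fun v w => ?_) hx' fun t => ?_
      · simp only [neg_apply, hsymms v w]
      · have h2 := hrs _ (exp_map_mem_stableSub hx t)
        have h3 := hlows (NormedSpace.exp (t • A) x)
        simp only [neg_apply]
        have h4 : 0 ≤ Gs (NormedSpace.exp (t • A) x) (NormedSpace.exp (t • A) x) :=
          le_trans (by positivity) h3
        nlinarith
    simp only [neg_apply] at h1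
    have h2 := hlows x
    have h3 : ‖x‖ ^ 2 ≤ 0 := by
      by_contra hcon
      push Not at hcon
      have := mul_pos hcs hcon
      linarith
    have h4 : ‖x‖ = 0 := by nlinarith [norm_nonneg x]
    exact norm_eq_zero.1 h4
  have hcompl : IsCompl (stableSub A) (unstableSub A) := by
    constructor
    · rw [Submodule.disjoint_def]
      exact fun x hx hx' => hdisj x hx (mem_unstableSub.1 hx')
    · rw [codisjoint_iff, Submodule.eq_top_iff']
      intro v
      obtain ⟨a, ha, b, hb, rfl⟩ := hdec v
      exact Submodule.add_mem_sup ha (mem_unstableSub.2 hb)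
  let Ps : E →L[ℝ] E := LinearMap.toContinuousLinearMap
    ((stableSub A).projection (unstableSub A) hcompl)
  let Pu : E →L[ℝ] E := LinearMap.toContinuousLinearMap
    ((unstableSub A).projection (stableSub A) hcompl.symm)
  have hP : ∀ a ∈ stableVectors A, ∀ b ∈ unstableVectors A,
      ‖a‖ ≤ (‖Ps‖ + ‖Pu‖) * ‖a + b‖ ∧ ‖b‖ ≤ (‖Ps‖ + ‖Pu‖) * ‖a + b‖ := fun a ha b hb => by
    have h1 : Ps (a + b) = a := by
      change (stableSub A).projection (unstableSub A) hcompl (a + b) = a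
      rw [map_add, Submodule.projection_apply_of_mem_left hcompl ha,
        (Submodule.projection_apply_eq_zero_iff hcompl).2 (mem_unstableSub.2 hb), add_zero]
    have h2 : Pu (a + b) = b := by
      change (unstableSub A).projection (stableSub A) hcompl.symm (a + b) = b
      rw [map_add, Submodule.projection_apply_of_mem_left hcompl.symm (mem_unstableSub.2 hb),
        (Submodule.projection_apply_eq_zero_iff hcompl.symm).2 ha, zero_add]
    have h3 := Ps.le_opNorm (a + b)
    have h4 := Pu.le_opNorm (a + b)
    rw [h1] at h3
    rw [h2] at h4
    have h5 := mul_nonneg (norm_nonneg Ps) (norm_nonneg (a + b))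
    have h6 := mul_nonneg (norm_nonneg Pu) (norm_nonneg (a + b))
    constructor <;> linarith
  have hpos : ∀ v, 0 ≤ Gs v v ∧ 0 ≤ Gu v v := fun v =>
    ⟨le_trans (by positivity) (hlows v), le_trans (by positivity) (hlowu v)⟩
  set P := ‖Ps‖ + ‖Pu‖
  set Kg := ‖Gs‖ + ‖Gu‖
  set c := min cs cu with hcdef
  have hc : 0 < c := lt_min hcs hcu
  have hKle : ∀ v w : E, ‖Gs‖ * ‖v‖ * ‖w‖ ≤ Kg * ‖v‖ * ‖w‖ ∧ ‖Gu‖ * ‖v‖ * ‖w‖ ≤ Kg * ‖v‖ * ‖w‖ :=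
    fun v w => by
      constructor <;> gcongr
      · exact le_add_of_nonneg_right (norm_nonneg Gu)
      · exact le_add_of_nonneg_left (norm_nonneg Gs)
  obtain ⟨S, U, hSU, hval⟩ := exists_hyperbolicForms (ρ := min ρs ρu) (c := c) (Kg := Kg) (P := P)
    hdec hsymms hsymmu hc
    (fun v => le_trans (by gcongr; exact min_le_left _ _) (hlows v))
    (fun v => le_trans (by gcongr; exact min_le_right _ _) (hlowu v))
    (fun v w => (abs_apply_le Gs v w).trans (hKle v w).1)
    (fun v w => (abs_apply_le Gu v w).trans (hKle v w).2) (by positivity)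
    (fun v hv => by
      have h1 := hrs v hv
      have h2 := min_le_left ρs ρu
      nlinarith [(hpos v).1])
    (fun v hv => by
      have h1 := hru' v hv
      have h2 := min_le_right ρs ρu
      nlinarith [(hpos v).2]) hP
  have hBst : ∀ a ∈ stableVectors A, A a ∈ stableVectors A := fun a ha => map_mem_stableSub ha
  have hBun : ∀ a ∈ unstableVectors A, A a ∈ unstableVectors A := fun a ha =>
    mem_unstableSub.1 (map_mem_unstableSub (mem_unstableSub.2 ha))
  refine ⟨S, U, min ρs ρu, c / 2, Kg * P ^ 2 + 1, Kg * ‖A‖ / c, lt_min hρs hρu, by positivity,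
    by positivity, by positivity, ⟨⟨hSU.symmS, hSU.symmU, hSU.nonnegS, hSU.nonnegU, hSU.lower,
      fun v w => (hSU.boundS v w).trans ?_, fun v w => (hSU.boundU v w).trans ?_, hSU.rateS,
      hSU.rateU⟩, hSU.nullS, hSU.nullU, hSU.decomp⟩, fun v => ?_, fun v => ?_⟩
  · gcongr; linarith
  · gcongr; linarith
  · obtain ⟨a, ha, b, hb, rfl⟩ := hdec v
    rw [map_add A, (hval _ (hBst a ha) _ (hBun b hb) a ha b hb).1, (hval a ha b hb a ha b hb).1]
    have h1 : |Gs (A a) a| ≤ Kg * ‖A‖ * ‖a‖ ^ 2 := by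
      refine ((abs_apply_le Gs _ _).trans (hKle _ _).1).trans ?_
      calc Kg * ‖A a‖ * ‖a‖ ≤ Kg * (‖A‖ * ‖a‖) * ‖a‖ := by gcongr; exact A.le_opNorm a
        _ = _ := by ring
    have h2 : c * ‖a‖ ^ 2 ≤ Gs a a := le_trans (by gcongr; exact min_le_left _ _) (hlows a)
    have h3 : Kg * ‖A‖ * ‖a‖ ^ 2 ≤ Kg * ‖A‖ / c * Gs a a := by
      calc Kg * ‖A‖ * ‖a‖ ^ 2 = Kg * ‖A‖ / c * (c * ‖a‖ ^ 2) := by field_simp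
        _ ≤ _ := by gcongr
    linarith [neg_abs_le (Gs (A a) a)]
  · obtain ⟨a, ha, b, hb, rfl⟩ := hdec v
    rw [map_add A, (hval _ (hBst a ha) _ (hBun b hb) a ha b hb).2, (hval a ha b hb a ha b hb).2]
    have h1 : |Gu (A b) b| ≤ Kg * ‖A‖ * ‖b‖ ^ 2 := by
      refine ((abs_apply_le Gu _ _).trans (hKle _ _).2).trans ?_
      calc Kg * ‖A b‖ * ‖b‖ ≤ Kg * (‖A‖ * ‖b‖) * ‖b‖ := by gcongr; exact A.le_opNorm b
        _ = _ := by ring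
    have h2 : c * ‖b‖ ^ 2 ≤ Gu b b := le_trans (by gcongr; exact min_le_right _ _) (hlowu b)
    have h3 : Kg * ‖A‖ * ‖b‖ ^ 2 ≤ Kg * ‖A‖ / c * Gu b b := by
      calc Kg * ‖A‖ * ‖b‖ ^ 2 = Kg * ‖A‖ / c * (c * ‖b‖ ^ 2) := by field_simp
        _ ≤ _ := by gcongr
    linarith [le_abs_self (Gu (A b) b)]

set_option synthInstance.maxHeartbeats 400000 in
set_option maxHeartbeats 1600000 in
/-- Uniform `HyperbolicForms` for all linear fields close to a hyperbolic one. -/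
theorem exists_uniform_hyperbolicForms {A : E →L[ℝ] E}
    (hdec : ∀ v, ∃ a ∈ stableVectors A, ∃ b ∈ unstableVectors A, v = a + b) :
    ∃ (q : E →L[ℝ] E →L[ℝ] ℝ) (ρ m K η : ℝ), 0 < ρ ∧ 0 < m ∧ 0 < K ∧ 0 < η ∧
      (∀ v w, q v w = q w v) ∧ ∀ B : E →L[ℝ] E, ‖B - A‖ ≤ η → (∀ v, v ≠ 0 → 0 < q (B v) v) ∧
        ((∀ v, ∃ a ∈ stableVectors B, ∃ b ∈ unstableVectors B, v = a + b) →
          ∃ S U, HyperbolicForms B S U ρ m K) := by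
  obtain ⟨S, U, ρ, m, K, Λ, hρ, hm, hK, hΛ, hSU, hSΛ, hUΛ⟩ := exists_hyperbolicForms_of_decomp hdec
  -- `κ` is the aperture of the cones U ≤ κS and S ≤ κU. The condition on Λκ says that the
  -- uncontrolled direction, growing at a rate at most `Λ`, cannot spoil the rate of contraction
  -- inside the cone.
  obtain ⟨κ, hκ, hκ4, hκρ⟩ : ∃ κ : ℝ, 0 < κ ∧ κ ≤ 1 / 4 ∧ Λ * κ ≤ ρ / 8 := by
    refine ⟨min (1 / 4) (ρ / (8 * (Λ + 1))), by positivity, min_le_left _ _, ?_⟩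
    calc Λ * min (1 / 4) (ρ / (8 * (Λ + 1))) ≤ Λ * (ρ / (8 * (Λ + 1))) := by
          gcongr; exact min_le_right _ _
      _ ≤ (Λ + 1) * (ρ / (8 * (Λ + 1))) := by gcongr; linarith
      _ = ρ / 8 := by field_simp
  have hη : 0 < κ * ρ * m / (4 * K) := by positivity
  set η := κ * ρ * m / (4 * K) with hηdef
  have hKη : 2 * K * η = κ * ρ * m / 2 := by rw [hηdef]; field_simp; norm_num
  have hpert : ∀ B : E →L[ℝ] E, ‖B - A‖ ≤ η → ∀ v,
      |S (B v) v - S (A v) v| ≤ K * η * ‖v‖ ^ 2 ∧ |U (B v) v - U (A v) v| ≤ K * η * ‖v‖ ^ 2 := by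
    intro B hB v
    have h1 : ‖(B - A) v‖ ≤ η * ‖v‖ := ContinuousLinearMap.le_of_opNorm_le _ hB v
    have h2 : K * ‖(B - A) v‖ * ‖v‖ ≤ K * η * ‖v‖ ^ 2 := by
      calc K * ‖(B - A) v‖ * ‖v‖ ≤ K * (η * ‖v‖) * ‖v‖ := by gcongr
        _ = _ := by ring
    have h3 := (hSU.boundS ((B - A) v) v).trans h2
    have h4 := (hSU.boundU ((B - A) v) v).trans h2
    simp only [sub_apply, map_sub] at h3 h4
    exact ⟨h3, h4⟩
  -- The two forms U - κS and κU - S both increase strictly along the flow of every nearby `B`. The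
  -- first yields the hyperbolicity criterion, and together they confine the stable and unstable
  -- subspaces of `B` to narrow cones.
  have hq : ∀ B : E →L[ℝ] E, ‖B - A‖ ≤ η → ∀ v,
      κ * ρ * m / 2 * ‖v‖ ^ 2 ≤ U (B v) v - κ * S (B v) v ∧
      κ * ρ * m / 2 * ‖v‖ ^ 2 ≤ κ * U (B v) v - S (B v) v := by
    intro B hB v
    obtain ⟨h1, h2⟩ := hpert B hB v
    have h3 := abs_le.1 h1
    have h4 := abs_le.1 h2
    have h5 := hSU.rateS v
    have h6 := hSU.rateU v
    have h7 := hSU.lower v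
    have h8 := hSU.nonnegS v
    have h9 := hSU.nonnegU v
    have h10 : 0 ≤ K * η * ‖v‖ ^ 2 := by positivity
    have h11 : K * η * ‖v‖ ^ 2 = κ * ρ * m / 4 * ‖v‖ ^ 2 := by
      rw [show K * η = κ * ρ * m / 4 by linarith]
    have h12 : κ * ρ * (m * ‖v‖ ^ 2) ≤ κ * ρ * (S v v + U v v) := by gcongr
    have h13 : κ * (ρ * U v v) ≤ 1 * (ρ * U v v) := by gcongr; linarith
    have h14 : κ * (ρ * S v v) ≤ 1 * (ρ * S v v) := by gcongr; linarith
    have h15 : κ * (K * η * ‖v‖ ^ 2) ≤ 1 * (K * η * ‖v‖ ^ 2) := by gcongr; linarith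
    have h16 := mul_le_mul_of_nonneg_left h5 hκ.le
    have h17 := mul_le_mul_of_nonneg_left h6 hκ.le
    have h18 := mul_le_mul_of_nonneg_left h3.2 hκ.le
    have h19 := mul_le_mul_of_nonneg_left h4.1 hκ.le
    constructor <;> nlinarith
  have hs1 : ∀ v w, (U - κ • S) v w = (U - κ • S) w v := fun v w => by
    simp only [sub_apply, smul_apply, hSU.symmS v w, hSU.symmU v w]
  have hs2 : ∀ v w, (κ • U - S) v w = (κ • U - S) w v := fun v w => by
    simp only [sub_apply, smul_apply, hSU.symmS v w, hSU.symmU v w]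
  refine ⟨U - κ • S, ρ / 4, m / 2, 2 * K * (Real.sqrt (16 * K / m)) ^ 2, η, by positivity,
    by positivity, by positivity, hη, hs1, fun B hB => ⟨fun v hv => ?_, fun hdecB => ?_⟩⟩
  · have h1 := (hq B hB v).1
    have h2 : 0 < κ * ρ * m / 2 * ‖v‖ ^ 2 := by
      have := norm_pos_iff.2 hv
      positivity
    simp only [sub_apply, smul_apply, smul_eq_mul]
    linarith
  have hst : ∀ a ∈ stableVectors B, U a a ≤ κ * S a a := fun a ha => by
    have := quadratic_nonpos_of_mem_stableVectors hs1 ha fun t => by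
      have := (hq B hB (NormedSpace.exp (t • B) a)).1
      simp only [sub_apply, smul_apply, smul_eq_mul]
      exact le_trans (by positivity) this
    simp only [sub_apply, smul_apply, smul_eq_mul] at this
    linarith
  have hun : ∀ b ∈ unstableVectors B, S b b ≤ κ * U b b := fun b hb => by
    have := quadratic_nonneg_of_mem_unstableVectors hs2 hb fun t => by
      have := (hq B hB (NormedSpace.exp (t • B) b)).2
      simp only [sub_apply, smul_apply, smul_eq_mul]
      exact le_trans (by positivity) this
    simp only [sub_apply, smul_apply, smul_eq_mul] at this
    linarith
  have hG : ∀ v w, (S + U) v w = S v w + U v w := fun v w => rfl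
  have herr : ∀ v, 2 * (K * η * ‖v‖ ^ 2) ≤ ρ / 8 * (S v v + U v v) := fun v => by
    have h1 := hSU.lower v
    have h2 : 2 * (K * η * ‖v‖ ^ 2) = κ * ρ / 2 * (m * ‖v‖ ^ 2) := by
      rw [show 2 * (K * η * ‖v‖ ^ 2) = 2 * K * η * ‖v‖ ^ 2 by ring, hKη]; ring
    rw [h2]
    have h3 : κ * ρ / 2 * (m * ‖v‖ ^ 2) ≤ κ * ρ / 2 * (S v v + U v v) := by gcongr
    have h4 : κ * ρ / 2 * (S v v + U v v) ≤ ρ / 8 * (S v v + U v v) := by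
      have h5 : κ * ρ ≤ 1 / 4 * ρ := by gcongr
      exact mul_le_mul_of_nonneg_right (by linarith)
        (add_nonneg (hSU.nonnegS v) (hSU.nonnegU v))
    linarith
  -- The inner product S + U of `A` serves for both subspaces of `B`: they lie in the narrow cones,
  -- where the rate `ρ` of `A` survives as ρ/4.
  obtain ⟨S', U', h, -⟩ := exists_hyperbolicForms (Gs := S + U) (Gu := S + U) (c := m)
    (Kg := 2 * K) (ρ := ρ / 4) (P := Real.sqrt (16 * K / m)) hdecB
    (fun v w => by rw [hG, hG, hSU.symmS v w, hSU.symmU v w])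
    (fun v w => by rw [hG, hG, hSU.symmS v w, hSU.symmU v w]) hm hSU.lower hSU.lower
    (fun v w => by
      rw [hG]
      have h1 := abs_add_le (S v w) (U v w)
      have h2 := hSU.boundS v w
      have h3 := hSU.boundU v w
      linarith)
    (fun v w => by
      rw [hG]
      have h1 := abs_add_le (S v w) (U v w)
      have h2 := hSU.boundS v w
      have h3 := hSU.boundU v w
      linarith) (by positivity)
    (fun a ha => by
      rw [hG, hG]
      obtain ⟨h1, h2⟩ := hpert B hB a
      have h3 := (abs_le.1 h1).2
      have h4 := (abs_le.1 h2).2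
      have h5 := hSU.rateS a
      have h6 := hUΛ a
      have h7 := hst a ha
      have h8 := hSU.nonnegS a
      have h9 := herr a
      have h10 := mul_le_mul_of_nonneg_left h7 hΛ
      have h11 := mul_le_mul_of_nonneg_right hκρ h8
      nlinarith [mul_nonneg hρ.le h8])
    (fun b hb => by
      rw [hG, hG]
      obtain ⟨h1, h2⟩ := hpert B hB b
      have h3 := (abs_le.1 h1).1
      have h4 := (abs_le.1 h2).1
      have h5 := hSU.rateU b
      have h6 := hSΛ b
      have h7 := hun b hb
      have h8 := hSU.nonnegU b
      have h9 := herr b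
      have h10 := mul_le_mul_of_nonneg_left h7 hΛ
      have h11 := mul_le_mul_of_nonneg_right hκρ h8
      nlinarith [mul_nonneg hρ.le h8])
    (fun a ha b hb => by
      -- Positivity of G at x + 2y bounds the cross term. Applied to `S` and `U`, it shows that
      -- vectors of the two cones cannot cancel, which bounds the projections uniformly.
      have hexp : ∀ G : E →L[ℝ] E →L[ℝ] ℝ, (∀ v w, G v w = G w v) → (∀ v, 0 ≤ G v v) →
          ∀ x y, G x x / 2 - G y y ≤ G (x + y) (x + y) := fun G hs hn x y => by
        have h1 := hn (x + (2 : ℝ) • y)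
        simp only [map_add, add_apply, map_smul, smul_apply, smul_eq_mul, hs y x] at h1 ⊢
        linarith
      have h1 := hexp S hSU.symmS hSU.nonnegS a b
      have h2 := hexp U hSU.symmU hSU.nonnegU b a
      rw [add_comm b a] at h2
      have h3 := hst a ha
      have h4 := hun b hb
      have h5 := hSU.nonnegS a
      have h6 := hSU.nonnegU b
      have h7 := hSU.lower a
      have h8 := hSU.lower b
      have h9 := le_abs_self (S (a + b) (a + b))
      have h10 := le_abs_self (U (a + b) (a + b))
      have h11 := hSU.boundS (a + b) (a + b)
      have h12 := hSU.boundU (a + b) (a + b)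
      have hκS : κ * S a a ≤ 1 / 4 * S a a := by gcongr
      have hκU : κ * U b b ≤ 1 / 4 * U b b := by gcongr
      have h15 : K * ‖a + b‖ * ‖a + b‖ = K * ‖a + b‖ ^ 2 := by ring
      have h16 : 0 ≤ K * ‖a + b‖ ^ 2 := by positivity
      rw [h15] at h11 h12
      have h13 : m * ‖a‖ ^ 2 ≤ 16 * K * ‖a + b‖ ^ 2 := by linarith
      have h14 : m * ‖b‖ ^ 2 ≤ 16 * K * ‖a + b‖ ^ 2 := by linarith
      have hfin : ∀ x : E, m * ‖x‖ ^ 2 ≤ 16 * K * ‖a + b‖ ^ 2 →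
          ‖x‖ ≤ Real.sqrt (16 * K / m) * ‖a + b‖ := fun x hx => by
        refine le_of_sq_le_sq ?_ (by positivity)
        rw [mul_pow, Real.sq_sqrt (by positivity), div_mul_eq_mul_div, le_div_iff₀ hm]
        linarith
      exact ⟨hfin a h13, hfin b h14⟩)
  exact ⟨S', U', h⟩

end SplitForms

/-! ### Adapted inner products and cone layers in terms of the forms. -/

section AdaptedForms

variable {d : ℕ}

/-- The increasing form `q` of `A` certifies that a nearby `B` has no imaginary eigenvalue; this
provides the splitting for `B` that the uniform construction takes as input. -/
theorem exists_uniform_hyperbolicForms_of_hyperbolic {A : Model d →L[ℝ] Model d}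
    (hA : IsHyperbolicLinear A) :
    ∃ (ρ m K η : ℝ), 0 < ρ ∧ 0 < m ∧ 0 < K ∧ 0 < η ∧ ∀ B : Model d →L[ℝ] Model d, ‖B - A‖ ≤ η →
      IsHyperbolicLinear B ∧ ∃ S U, HyperbolicForms B S U ρ m K := by
  obtain ⟨q, ρ, m, K, η, hρ, hm, hK, hη, hq, h⟩ :=
    exists_uniform_hyperbolicForms (A := A) hA.exists_stable_add_unstable
  refine ⟨ρ, m, K, η, hρ, hm, hK, hη, fun B hB => ?_⟩
  have hB' : IsHyperbolicLinear B := IsHyperbolicLinear.of_bilin hq (h B hB).1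
  exact ⟨hB', (h B hB).2 hB'.exists_stable_add_unstable⟩

variable {A B : Model d →L[ℝ] Model d} {T : Model d ≃L[ℝ] Model d}

theorem exp_smul_conj (hT : ∀ v, A (T v) = T (B v)) (t : ℝ) (v : Model d) :
    NormedSpace.exp (t • A) (T v) = T (NormedSpace.exp (t • B) v) := by
  have h := eq_exp_smul_apply_of_hasDerivAt (B := A)
    (w := fun t : ℝ => T (NormedSpace.exp (t • B) v)) (fun t => by
      rw [hT]
      exact (T : Model d →L[ℝ] Model d).hasFDerivAt.comp_hasDerivAt t
        (hasDerivAt_exp_smul_apply B v t)) t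
  rw [h]
  congr 1
  rw [exp_zero_smul_apply]

theorem map_mem_stableSet_iff (hT : ∀ v, A (T v) = T (B v)) (v : Model d) :
    T v ∈ stableSet A ↔ v ∈ stableVectors B := by
  have h := fun t => exp_smul_conj hT t v
  constructor
  · intro hv
    have h2 : Tendsto _ atTop (𝓝 (T.symm 0)) := (T.symm.continuous.tendsto 0).comp hv
    rw [map_zero] at h2
    exact h2.congr fun t => by simp only [Function.comp, h, T.symm_apply_apply]
  · intro hv
    have h2 : Tendsto _ atTop (𝓝 (T 0)) := (T.continuous.tendsto 0).comp hv
    rw [map_zero] at h2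
    exact h2.congr fun t => (h t).symm

theorem map_mem_unstableSet_iff (hT : ∀ v, A (T v) = T (B v)) (v : Model d) :
    T v ∈ unstableSet A ↔ v ∈ unstableVectors B := by
  have h := fun t => exp_smul_conj hT t v
  constructor
  · intro hv
    have h2 : Tendsto _ atBot (𝓝 (T.symm 0)) := (T.symm.continuous.tendsto 0).comp hv
    rw [map_zero] at h2
    exact h2.congr fun t => by simp only [Function.comp, h, T.symm_apply_apply]
  · intro hv
    have h2 : Tendsto _ atBot (𝓝 (T 0)) := (T.continuous.tendsto 0).comp hv
    rw [map_zero] at h2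
    exact h2.congr fun t => (h t).symm

theorem IsHyperbolicLinear.conj (hT : ∀ v, A (T v) = T (B v)) (hB : IsHyperbolicLinear B) :
    IsHyperbolicLinear A := by
  have h : A.toLinearMap = T.toLinearEquiv.conj B.toLinearMap := by
    ext1 v
    obtain ⟨w, rfl⟩ := T.surjective v
    rw [LinearEquiv.conj_apply]
    simp [hT]
  intro z hz
  rw [h, LinearEquiv.charpoly_conj] at hz
  exact hB z hz

/-- The inner product `S + U`, transported by `T`. -/
def adaptedForm (S U : Model d →L[ℝ] Model d →L[ℝ] ℝ) (T : Model d ≃L[ℝ] Model d) :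
    LinearMap.BilinForm ℝ (Model d) :=
  LinearMap.mk₂ ℝ (fun v w => S (T.symm v) (T.symm w) + U (T.symm v) (T.symm w))
    (fun v v' w => by simp only [map_add, add_apply]; ring)
    (fun c v w => by simp only [map_smul, smul_apply, smul_eq_mul]; ring)
    (fun v w w' => by simp only [map_add]; ring)
    (fun c v w => by simp only [map_smul, smul_eq_mul]; ring)

theorem adaptedForm_map (S U : Model d →L[ℝ] Model d →L[ℝ] ℝ) (T : Model d ≃L[ℝ] Model d)
    (v w : Model d) : adaptedForm S U T (T v) (T w) = S v w + U v w := by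
  simp [adaptedForm]

variable {S U : Model d →L[ℝ] Model d →L[ℝ] ℝ} {ρ m K : ℝ}

/-- `S` vanishes on unstable vectors and `U` on stable ones, so the splitting is orthogonal for S +
U and each rate involves one form only. -/
theorem HyperbolicForms.isAdapted (h : HyperbolicForms B S U ρ m K) (hρ : 0 < ρ) (hm : 0 < m)
    (hT : ∀ v, A (T v) = T (B v)) : IsAdapted A (adaptedForm S U T) where
  symm v w := by
    obtain ⟨v, rfl⟩ := T.surjective v
    obtain ⟨w, rfl⟩ := T.surjective w
    rw [adaptedForm_map, adaptedForm_map, h.symmS, h.symmU]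
  pos v hv := by
    obtain ⟨v, rfl⟩ := T.surjective v
    rw [adaptedForm_map]
    have hv' : v ≠ 0 := fun h0 => hv (by rw [h0, map_zero])
    have := norm_pos_iff.2 hv'
    exact lt_of_lt_of_le (by positivity) (h.lower v)
  orthogonal v hv w hw := by
    obtain ⟨v, rfl⟩ := T.surjective v
    obtain ⟨w, rfl⟩ := T.surjective w
    rw [map_mem_stableSet_iff hT] at hv
    rw [map_mem_unstableSet_iff hT] at hw
    rw [adaptedForm_map, h.symmS, h.nullS w hw, h.nullU v hv, add_zero]
  rate := by
    refine ⟨ρ, hρ, fun v hv => ?_, fun v hv => ?_⟩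
    · obtain ⟨v, rfl⟩ := T.surjective v
      rw [map_mem_stableSet_iff hT] at hv
      rw [hT, adaptedForm_map, adaptedForm_map, h.symmU, h.nullU v hv, h.nullU v hv, add_zero,
        add_zero]
      exact h.rateS v
    · obtain ⟨v, rfl⟩ := T.surjective v
      rw [map_mem_unstableSet_iff hT] at hv
      rw [hT, adaptedForm_map, adaptedForm_map, h.symmS (B v), h.nullS v hv, h.nullS v hv, zero_add,
        zero_add]
      exact h.rateU v

/-- At a + b the values of `S` and `U` are the squared lengths of the components a and b. Hence a
layer is described by the two forms alone, without the splitting, and can be followed along the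
nonlinear flow. -/
theorem HyperbolicForms.map_mem_coneLayer_iff (h : HyperbolicForms B S U ρ m K)
    (hT : ∀ v, A (T v) = T (B v)) (n : ℕ) (v : Model d) :
    T v ∈ coneLayer A (adaptedForm S U T) n ↔ S v v = U v v ∧
      Real.exp (-((n : ℝ) + 1)) ≤ Real.sqrt (S v v) ∧ Real.sqrt (S v v) < Real.exp (-(n : ℝ)) := by
  have key : ∀ a ∈ stableVectors B, ∀ b ∈ unstableVectors B,
      adaptedForm S U T (T a) (T a) = S (a + b) (a + b) ∧
      adaptedForm S U T (T b) (T b) = U (a + b) (a + b) := fun a ha b hb => by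
    rw [adaptedForm_map, adaptedForm_map]
    have h1 := h.nullS b hb
    have h2 := h.nullU a ha
    simp only [map_add, add_apply, h1, h2, h.symmS a b, h.symmU b a]
    constructor <;> ring
  constructor
  · rintro ⟨vs, hvs, vu, hvu, hv, heq, hlo, hhi⟩
    obtain ⟨a, rfl⟩ := T.surjective vs
    obtain ⟨b, rfl⟩ := T.surjective vu
    rw [map_mem_stableSet_iff hT] at hvs
    rw [map_mem_unstableSet_iff hT] at hvu
    rw [← map_add] at hv
    have hv' := T.injective hv
    obtain ⟨h1, h2⟩ := key a hvs b hvu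
    rw [← hv'] at h1 h2
    rw [h1, h2] at heq hlo hhi
    rw [← heq, max_self] at hlo hhi
    exact ⟨(Real.sqrt_inj (h.nonnegS v) (h.nonnegU v)).1 heq, hlo, hhi⟩
  · rintro ⟨heq, hlo, hhi⟩
    obtain ⟨a, ha, b, hb, hv⟩ := h.decomp v
    obtain ⟨h1, h2⟩ := key a ha b hb
    rw [← hv] at h1 h2
    refine ⟨T a, (map_mem_stableSet_iff hT a).2 ha, T b, (map_mem_unstableSet_iff hT b).2 hb, ?_, ?_,
      ?_, ?_⟩
    · rw [hv, map_add]
    · rw [h1, h2, heq]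
    · rw [h1, h2, ← heq, max_self]; exact hlo
    · rw [h1, h2, ← heq, max_self]; exact hhi

end AdaptedForms

-- Besides existence, the fixed point construction of Picard and Lindelöf provides a solution
-- confined to the ball. Confinement holds for all times since the solution is extended by clamping
-- time to the interval.
open Metric in
theorem IsPicardLindelof.exists_mem_closedBall {E : Type*} [NormedAddCommGroup E]
    [NormedSpace ℝ E] [CompleteSpace E] {f : ℝ → E → E} {tmin tmax : ℝ} {t₀ : Icc tmin tmax}
    {x₀ x : E} {a r L K : NNReal} (hf : IsPicardLindelof f t₀ x₀ a r L K)
    (hx : x ∈ closedBall x₀ r) :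
    ∃ α : ℝ → E, α t₀ = x ∧ (∀ t, α t ∈ closedBall x₀ a) ∧
      ∀ t ∈ Icc tmin tmax, HasDerivWithinAt α (f t (α t)) (Icc tmin tmax) t := by
  obtain ⟨α, hα⟩ := ODE.FunSpace.exists_isFixedPt_next hf hx
  refine ⟨α.compProj, by rw [ODE.FunSpace.compProj_val, ← hα, ODE.FunSpace.next_apply₀],
    fun t => α.compProj_mem_closedBall hf.mul_max_le, fun t ht => ?_⟩
  apply ODE.hasDerivWithinAt_picard_Icc t₀.2 hf.continuousOn_uncurry
    α.continuous_compProj.continuousOn (fun _ ht' ↦ α.compProj_mem_closedBall hf.mul_max_le)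
    x ht |>.congr_of_mem _ ht
  intro t' ht'
  nth_rw 1 [← hα]
  rw [ODE.FunSpace.compProj_of_mem ht', ODE.FunSpace.next_apply]


/-! ### Second order equations and their exponential map. -/

section Spray

variable {E : Type*} [NormedAddCommGroup E] [NormedSpace ℝ E] [CompleteSpace E]

/-- A second order equation `u'' = Γ (u, u')`, quadratic in the velocity and Lipschitz near `e₀`. -/
structure IsLipschitzSpray (Γ : E → E → E) (e₀ : E) (a K : ℝ) : Prop where
  smul : ∀ x (c : ℝ) w, Γ x (c • w) = c ^ 2 • Γ x w
  lipschitz : ∀ x ∈ Metric.closedBall e₀ a, ∀ x' ∈ Metric.closedBall e₀ a, ∀ w w' : E, ∀ θ : ℝ,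
    0 < θ → ‖w‖ ≤ θ → ‖w'‖ ≤ θ → ‖Γ x w - Γ x' w'‖ ≤ K * (θ ^ 2 * ‖x - x'‖ + θ * ‖w - w'‖)

namespace IsLipschitzSpray

variable {Γ : E → E → E} {e₀ : E} {a K : ℝ}

theorem norm_le (h : IsLipschitzSpray Γ e₀ a K) {x : E} (hx : x ∈ Metric.closedBall e₀ a) {w : E}
    {θ : ℝ} (hθ : 0 < θ) (hw : ‖w‖ ≤ θ) : ‖Γ x w‖ ≤ K * (θ * ‖w‖) := by
  have h0 : Γ x 0 = 0 := by
    have := h.smul x 0 0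
    simpa using this
  have := h.lipschitz x hx x hx w 0 θ hθ hw (by rw [norm_zero]; exact hθ.le)
  simpa [h0] using this

/-- A solution of the second order equation on `(-1, 2)`. -/
structure IsSolution (Γ : E → E → E) (e₀ : E) (b θ : ℝ) (x v : E) (u c : ℝ → E) : Prop where
  pos : u 0 = x
  vel : c 0 = v
  hasDerivAt : ∀ t ∈ Ioo (-1 : ℝ) 2, HasDerivAt u (c t) t
  hasDerivAt' : ∀ t ∈ Ioo (-1 : ℝ) 2, HasDerivAt c (Γ (u t) (c t)) t
  mem : ∀ t, u t ∈ Metric.closedBall e₀ b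
  norm_le : ∀ t, ‖c t‖ ≤ θ

/-- Writing the velocity as δw and using that `Γ` is quadratic, the equation becomes the first order
system u' = δw, w' = δΓ(u, w), which is slow on a ball of fixed radius. With δ = b/(4(K + 1)) the
solution cannot leave that ball on [-1, 2], an interval containing [0, 1] in its interior as
geodesics joining time 0 to time 1 require. -/
theorem exists_isSolution (h : IsLipschitzSpray Γ e₀ a K) (hK : 0 ≤ K) {b : ℝ}
    (hb : 0 < b) (hba : b ≤ a) (hb1 : b ≤ 1) {x v : E} (hx : ‖x - e₀‖ ≤ b / 2)
    (hv : ‖v‖ ≤ b / (4 * (K + 1)) * (b / 2)) :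
    ∃ u c, IsSolution Γ e₀ b (b / (4 * (K + 1)) * b) x v u c := by
  set δ := b / (4 * (K + 1)) with hδ
  have hδ0 : 0 < δ := by positivity
  let f : E × E → E × E := fun p => (δ • p.2, δ • Γ p.1 p.2)
  have hmem : ∀ p ∈ Metric.closedBall ((e₀, 0) : E × E) b,
      p.1 ∈ Metric.closedBall e₀ a ∧ ‖p.2‖ ≤ b ∧ ‖p.2‖ ≤ 1 := fun p hp => by
    rw [mem_closedBall_iff_norm, Prod.norm_def, max_le_iff] at hp
    simp only [Prod.fst_sub, Prod.snd_sub, sub_zero] at hp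
    exact ⟨mem_closedBall_iff_norm.2 (hp.1.trans hba), hp.2, hp.2.trans hb1⟩
  have hbound : ∀ p ∈ Metric.closedBall ((e₀, 0) : E × E) b, ‖f p‖ ≤ δ * (K + 1) := fun p hp => by
    obtain ⟨h1, -, h3⟩ := hmem p hp
    have h4 := h.norm_le h1 one_pos h3
    rw [Prod.norm_def, max_le_iff]
    simp only [f, norm_smul, Real.norm_eq_abs, abs_of_pos hδ0]
    constructor
    · gcongr; linarith
    · gcongr; nlinarith [norm_nonneg p.2]
  have hlip : LipschitzOnWith (Real.toNNReal (δ * (2 * K + 1))) f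
      (Metric.closedBall ((e₀, 0) : E × E) b) := by
    refine LipschitzOnWith.of_dist_le_mul fun p hp p' hp' => ?_
    obtain ⟨h1, -, h3⟩ := hmem p hp
    obtain ⟨h1', -, h3'⟩ := hmem p' hp'
    have h4 := h.lipschitz p.1 h1 p'.1 h1' p.2 p'.2 1 one_pos h3 h3'
    rw [Real.coe_toNNReal _ (by positivity), dist_eq_norm, dist_eq_norm, Prod.norm_def, max_le_iff]
    have h5 : ‖p.1 - p'.1‖ ≤ ‖p - p'‖ := norm_fst_le (p - p')
    have h6 : ‖p.2 - p'.2‖ ≤ ‖p - p'‖ := norm_snd_le (p - p')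
    simp only [f, Prod.fst_sub, Prod.snd_sub, ← smul_sub, norm_smul, Real.norm_eq_abs,
      abs_of_pos hδ0, mul_assoc]
    constructor
    · gcongr
      nlinarith [norm_nonneg (p - p')]
    · gcongr
      nlinarith [norm_nonneg (p - p')]
  have hpl : IsPicardLindelof (fun _ => f) (tmin := -1) (tmax := 2) ⟨0, by norm_num, by norm_num⟩
      ((e₀, 0) : E × E) ⟨b, hb.le⟩ ⟨b / 2, by positivity⟩ ⟨δ * (K + 1), by positivity⟩
      (Real.toNNReal (δ * (2 * K + 1))) := by
    refine IsPicardLindelof.of_time_independent hbound hlip ?_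
    change δ * (K + 1) * max (2 - 0) (0 - -1) ≤ b - b / 2
    rw [max_eq_left (by norm_num)]
    have : δ * (K + 1) = b / 4 := by rw [hδ]; field_simp
    linarith
  obtain ⟨α, h0, hαm, hα⟩ := IsPicardLindelof.exists_mem_closedBall hpl (x := (x, δ⁻¹ • v)) (by
    rw [mem_closedBall_iff_norm, Prod.norm_def, max_le_iff]
    simp only [Prod.fst_sub, Prod.snd_sub, sub_zero]
    refine ⟨hx, ?_⟩
    rw [norm_smul, norm_inv, Real.norm_eq_abs, abs_of_pos hδ0, inv_mul_le_iff₀ hδ0]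
    exact hv)
  have hα' : ∀ t ∈ Ioo (-1 : ℝ) 2, HasDerivAt α (f (α t)) t := fun t ht =>
    (hα t (Ioo_subset_Icc_self ht)).hasDerivAt (Icc_mem_nhds ht.1 ht.2)
  refine ⟨fun t => (α t).1, fun t => δ • (α t).2, ⟨?_, ?_, fun t ht => ?_, fun t ht => ?_,
    fun t => ?_, fun t => ?_⟩⟩
  · exact congrArg Prod.fst h0
  · have := congrArg Prod.snd h0
    change δ • (α 0).2 = v
    rw [show (α 0).2 = δ⁻¹ • v from this, smul_smul, mul_inv_cancel₀ hδ0.ne', one_smul]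
  · exact (hα' t ht).fst
  · rw [h.smul]
    have h2 : HasDerivAt (fun s => (α s).2) (δ • Γ (α t).1 (α t).2) t := (hα' t ht).snd
    refine (h2.const_smul δ).congr_deriv ?_
    rw [smul_smul, sq]
  · have := hαm t
    rw [mem_closedBall_iff_norm, Prod.norm_def, max_le_iff] at this
    exact mem_closedBall_iff_norm.2 this.1
  · rw [norm_smul, Real.norm_eq_abs, abs_of_pos hδ0]
    exact mul_le_mul_of_nonneg_left (hmem _ (hαm t)).2.1 hδ0.le

/-- Velocities stay comparable to the initial one. -/
theorem IsSolution.norm_vel_le (h : IsLipschitzSpray Γ e₀ a K) {b : ℝ} (hba : b ≤ a)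
    {θ : ℝ} (hθ : 0 < θ) (hKθ : K * θ ≤ 1 / 4) {x v : E} {u c : ℝ → E}
    (hs : IsSolution Γ e₀ b θ x v u c) {t : ℝ} (ht : t ∈ Icc (0 : ℝ) 1) : ‖c t‖ ≤ 2 * ‖v‖ := by
  have hcont : ContinuousOn c (Icc 0 1) := fun s hs' =>
    (hs.hasDerivAt' s ⟨by linarith [hs'.1], by linarith [hs'.2]⟩).continuousAt.continuousWithinAt
  have := norm_le_gronwallBound_of_norm_deriv_right_le (δ := ‖v‖) (K := 1 / 4) (ε := 0)
    (f' := fun t => Γ (u t) (c t)) hcont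
    (fun s hs' => (hs.hasDerivAt' s ⟨by linarith [hs'.1], by linarith [hs'.2]⟩).hasDerivWithinAt)
    (by rw [hs.vel]) (fun s _ => by
      have h1 := h.norm_le (Metric.closedBall_subset_closedBall hba (hs.mem s)) hθ (hs.norm_le s)
      have h2 := mul_le_mul_of_nonneg_right hKθ (norm_nonneg (c s))
      linarith) t ht
  rw [gronwallBound_ε0, sub_zero] at this
  have h2 : Real.exp (1 / 4 * t) ≤ 2 := by
    have : Real.exp (1 / 4 * t) ≤ Real.exp (1 / 4) := Real.exp_le_exp.2 (by linarith [ht.2])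
    have h3 : Real.exp (1 / 4) ≤ 1 / (1 - 1 / 4) := Real.exp_bound_div_one_sub_of_interval
      (by norm_num) (by norm_num)
    linarith
  nlinarith [norm_nonneg v]

/-- For small velocities exp is close to (x, v) ↦ x + v in the Lipschitz sense. Gronwall bounds the
distance of the two phase curves by `M`; accelerations are quadratic in the velocities, of size at
most 2δ, so they differ by O(δ)M; integrating twice gives the factor δ. -/
theorem IsSolution.sub_le (h : IsLipschitzSpray Γ e₀ a K) (hK : 0 ≤ K) {b : ℝ} (hba : b ≤ a)
    {θ : ℝ} (hθ : 0 < θ) (hθ1 : θ ≤ 1) (hKθ : K * θ ≤ 1 / 4) {x v x' v' : E} {u c u' c' : ℝ → E}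
    (hs : IsSolution Γ e₀ b θ x v u c) (hs' : IsSolution Γ e₀ b θ x' v' u' c') {δ : ℝ}
    (hδ : 0 < δ) (hδ1 : δ ≤ 1) (hv : ‖v‖ ≤ δ) (hv' : ‖v'‖ ≤ δ) :
    ‖(u 1 - x - v) - (u' 1 - x' - v')‖
      ≤ 6 * K * Real.exp (1 + 2 * K) * δ * (‖x - x'‖ + ‖v - v'‖) := by
  have hIoo : ∀ s ∈ Icc (0 : ℝ) 1, s ∈ Ioo (-1 : ℝ) 2 := fun s hs =>
    ⟨by linarith [hs.1], by linarith [hs.2]⟩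
  have hmem : ∀ s, u s ∈ Metric.closedBall e₀ a := fun s =>
    Metric.closedBall_subset_closedBall hba (hs.mem s)
  have hmem' : ∀ s, u' s ∈ Metric.closedBall e₀ a := fun s =>
    Metric.closedBall_subset_closedBall hba (hs'.mem s)
  have hdu : ∀ s ∈ Icc (0 : ℝ) 1, HasDerivAt (fun s => u s - u' s) (c s - c' s) s := fun s hs1 =>
    (hs.hasDerivAt s (hIoo s hs1)).sub (hs'.hasDerivAt s (hIoo s hs1))
  have hdc : ∀ s ∈ Icc (0 : ℝ) 1,
      HasDerivAt (fun s => c s - c' s) (Γ (u s) (c s) - Γ (u' s) (c' s)) s := fun s hs1 =>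
    (hs.hasDerivAt' s (hIoo s hs1)).sub (hs'.hasDerivAt' s (hIoo s hs1))
  set M := Real.exp (1 + 2 * K) * (‖x - x'‖ + ‖v - v'‖) with hM
  have hD : ∀ s ∈ Icc (0 : ℝ) 1, ‖u s - u' s‖ ≤ M ∧ ‖c s - c' s‖ ≤ M := by
    intro s hs1
    have := norm_le_gronwallBound_of_norm_deriv_right_le (δ := ‖x - x'‖ + ‖v - v'‖)
      (K := 1 + 2 * K) (ε := 0) (f := fun s => (u s - u' s, c s - c' s))
      (f' := fun s => (c s - c' s, Γ (u s) (c s) - Γ (u' s) (c' s))) (a := 0) (b := 1)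
      (fun s hs1 => ((hdu s hs1).prodMk (hdc s hs1)).continuousAt.continuousWithinAt)
      (fun s hs1 => ((hdu s (Ico_subset_Icc_self hs1)).prodMk
        (hdc s (Ico_subset_Icc_self hs1))).hasDerivWithinAt)
      (by
        rw [hs.pos, hs.vel, hs'.pos, hs'.vel, Prod.norm_def]
        exact max_le (le_add_of_nonneg_right (norm_nonneg _))
          (le_add_of_nonneg_left (norm_nonneg _)))
      (fun s _ => by
        have h1 := h.lipschitz _ (hmem s) _ (hmem' s) (c s) (c' s) θ hθ (hs.norm_le s)
          (hs'.norm_le s)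
        have h2 : ‖u s - u' s‖ ≤ ‖(u s - u' s, c s - c' s)‖ := norm_fst_le (u s - u' s, c s - c' s)
        have h3 : ‖c s - c' s‖ ≤ ‖(u s - u' s, c s - c' s)‖ := norm_snd_le (u s - u' s, c s - c' s)
        set N := ‖(u s - u' s, c s - c' s)‖
        have hN : 0 ≤ N := (norm_nonneg _).trans h2
        rw [add_zero, Prod.norm_def]
        refine max_le (by nlinarith) (h1.trans ?_)
        calc K * (θ ^ 2 * ‖u s - u' s‖ + θ * ‖c s - c' s‖)
            ≤ K * (1 ^ 2 * N + 1 * N) := by gcongr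
          _ ≤ (1 + 2 * K) * N := by nlinarith) s hs1
    rw [gronwallBound_ε0, sub_zero] at this
    have h4 : (‖x - x'‖ + ‖v - v'‖) * Real.exp ((1 + 2 * K) * s) ≤ M := by
      rw [hM, mul_comm]
      gcongr
      nlinarith [hs1.2]
    exact ⟨(norm_fst_le (u s - u' s, c s - c' s)).trans (this.trans h4),
      (norm_snd_le (u s - u' s, c s - c' s)).trans (this.trans h4)⟩
  have hM0 : 0 ≤ M := by positivity
  have hΓ : ∀ s ∈ Icc (0 : ℝ) 1, ‖Γ (u s) (c s) - Γ (u' s) (c' s)‖ ≤ 6 * K * δ * M := by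
    intro s hs1
    have h1 := (hs.norm_vel_le h hba hθ hKθ hs1).trans
      (mul_le_mul_of_nonneg_left hv zero_le_two)
    have h2 := (hs'.norm_vel_le h hba hθ hKθ hs1).trans
      (mul_le_mul_of_nonneg_left hv' zero_le_two)
    refine (h.lipschitz _ (hmem s) _ (hmem' s) (c s) (c' s) (2 * δ) (by positivity) h1 h2).trans ?_
    obtain ⟨h3, h4⟩ := hD s hs1
    calc K * ((2 * δ) ^ 2 * ‖u s - u' s‖ + 2 * δ * ‖c s - c' s‖)
        ≤ K * ((2 * δ) ^ 2 * M + 2 * δ * M) := by gcongr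
      _ = K * δ * M * (4 * δ + 2) := by ring
      _ ≤ K * δ * M * (4 * 1 + 2) := by gcongr
      _ = _ := by ring
  have hc : ∀ s ∈ Icc (0 : ℝ) 1, ‖(c s - c' s) - (v - v')‖ ≤ 6 * K * δ * M := by
    intro s hs1
    have := norm_image_sub_le_of_norm_deriv_le_segment' (f := fun s => c s - c' s)
      (f' := fun s => Γ (u s) (c s) - Γ (u' s) (c' s)) (C := 6 * K * δ * M) (a := 0) (b := 1)
      (fun s hs1 => (hdc s hs1).hasDerivWithinAt)
      (fun s hs1 => hΓ s (Ico_subset_Icc_self hs1)) s hs1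
    simp only [hs.vel, hs'.vel, sub_zero] at this
    refine this.trans ?_
    have : 0 ≤ 6 * K * δ * M := by positivity
    nlinarith [hs1.2]
  have hfin := norm_image_sub_le_of_norm_deriv_le_segment' (f := fun s => u s - u' s - s • (v - v'))
    (f' := fun s => (c s - c' s) - (v - v')) (C := 6 * K * δ * M) (a := 0) (b := 1)
    (fun s hs1 => by
      have := (hdu s hs1).sub ((hasDerivAt_id s).smul_const (v - v'))
      simp only [one_smul] at this
      exact this.hasDerivWithinAt)
    (fun s hs1 => hc s (Ico_subset_Icc_self hs1)) 1 (right_mem_Icc.2 zero_le_one)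
  simp only [one_smul, zero_smul, sub_zero, mul_one, hs.pos, hs'.pos] at hfin
  calc ‖(u 1 - x - v) - (u' 1 - x' - v')‖ = ‖u 1 - u' 1 - (v - v') - (x - x')‖ := by
        congr 1; abel
    _ ≤ _ := hfin
    _ = _ := by rw [hM]; ring

/-- The exponential map of a spray near a point. -/
theorem exists_exp (h : IsLipschitzSpray Γ e₀ a K) (hK : 0 ≤ K) {b : ℝ}
    (hb : 0 < b) (hba : b ≤ a) (hb1 : b ≤ 1) :
    ∃ (Ex : E → E → E) (δ₀ C : ℝ), 0 < δ₀ ∧ 0 < C ∧ δ₀ ≤ 1 ∧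
      (∀ x v, ‖x - e₀‖ ≤ b / 2 → ‖v‖ ≤ δ₀ →
        ∃ u c θ, 0 < θ ∧ IsSolution Γ e₀ b θ x v u c ∧ Ex x v = u 1) ∧
      (∀ x x' v v' δ, ‖x - e₀‖ ≤ b / 2 → ‖x' - e₀‖ ≤ b / 2 → ‖v‖ ≤ δ → ‖v'‖ ≤ δ → 0 < δ → δ ≤ δ₀ →
        ‖(Ex x v - x - v) - (Ex x' v' - x' - v')‖ ≤ C * δ * (‖x - x'‖ + ‖v - v'‖)) ∧
      ∀ x, ‖x - e₀‖ ≤ b / 2 → Ex x 0 = x := by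
  set δ := b / (4 * (K + 1)) with hδ
  have hδ0 : 0 < δ := by positivity
  have hex : ∀ p : E × E, ∃ u c : ℝ → E, ‖p.1 - e₀‖ ≤ b / 2 → ‖p.2‖ ≤ δ * (b / 2) →
      IsSolution Γ e₀ b (δ * b) p.1 p.2 u c := fun p => by
    by_cases hp : ‖p.1 - e₀‖ ≤ b / 2 ∧ ‖p.2‖ ≤ δ * (b / 2)
    · obtain ⟨u, c, huc⟩ := h.exists_isSolution hK hb hba hb1 hp.1 hp.2
      exact ⟨u, c, fun _ _ => huc⟩
    · exact ⟨0, 0, fun h1 h2 => absurd ⟨h1, h2⟩ hp⟩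
  choose u c huc using hex
  have hδK : δ * (K + 1) = b / 4 := by rw [hδ]; field_simp
  have hθ1 : δ * b ≤ 1 := by
    have : δ ≤ 1 := by
      rw [hδ, div_le_one (by positivity)]; linarith
    nlinarith
  have hKθ : K * (δ * b) ≤ 1 / 4 := by nlinarith
  refine ⟨fun x v => u (x, v) 1, δ * (b / 2), 6 * K * Real.exp (1 + 2 * K) + 1, by positivity,
    by positivity, by nlinarith, fun x v hx hv => ⟨_, _, _, by positivity, huc (x, v) hx hv, rfl⟩, ?_, ?_⟩
  · intro x x' v v' ε hx hx' hv hv' hε hε0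
    have hs := huc (x, v) hx (hv.trans hε0)
    have hs' := huc (x', v') hx' (hv'.trans hε0)
    refine (hs.sub_le h hK hba (by positivity) hθ1 hKθ hs' hε (by nlinarith) hv hv').trans ?_
    gcongr
    linarith
  · intro x hx
    have hs := huc (x, 0) hx (by rw [norm_zero]; positivity)
    have hfin := norm_image_sub_le_of_norm_deriv_le_segment' (f := u (x, 0))
      (f' := c (x, 0)) (C := 0) (a := 0) (b := 1)
      (fun s hs1 => (hs.hasDerivAt s ⟨by linarith [hs1.1], by linarith [hs1.2]⟩).hasDerivWithinAt)
      (fun s hs1 => by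
        have := hs.norm_vel_le h hba (by positivity) hKθ (Ico_subset_Icc_self hs1)
        simpa using this) 1 (right_mem_Icc.2 zero_le_one)
    rw [zero_mul, hs.pos] at hfin
    exact sub_eq_zero.1 (norm_le_zero_iff.1 hfin)

end IsLipschitzSpray

end Spray


section Shortcuts

variable {E : Type*} [NormedAddCommGroup E] [NormedSpace ℝ E]

set_option synthInstance.maxHeartbeats 400000

scoped instance bilinAddCommGroup : AddCommGroup (E →L[ℝ] E →L[ℝ] ℝ) := inferInstance

scoped instance bilinNormedAddCommGroup : NormedAddCommGroup (E →L[ℝ] E →L[ℝ] ℝ) := inferInstance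

scoped instance bilinNormedSpace : NormedSpace ℝ (E →L[ℝ] E →L[ℝ] ℝ) := inferInstance

scoped instance trilinNormedAddCommGroup : NormedAddCommGroup (E →L[ℝ] E →L[ℝ] E →L[ℝ] ℝ) :=
  inferInstance

scoped instance trilinNormedSpace : NormedSpace ℝ (E →L[ℝ] E →L[ℝ] E →L[ℝ] ℝ) := inferInstance

end Shortcuts

/-! ### The geodesic equation as a spray, and its behaviour under changes of coordinates. -/

section EulerLagrange

variable {E : Type*} [NormedAddCommGroup E] [InnerProductSpace ℝ E] [FiniteDimensional ℝ E]
  [CompleteSpace E]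

/-- The Euler--Lagrange covector, evaluated at `c`, of a curve of position `x`, velocity `w` and
acceleration `a`, for the metric `G`. -/
def eulerLagrange (G : E → E →L[ℝ] E →L[ℝ] ℝ) (x w a c : E) : ℝ :=
  G x a c + fderiv ℝ G x w w c - (1 / 2) * fderiv ℝ G x c w w

theorem fderiv_bilin_apply {G : E → E →L[ℝ] E →L[ℝ] ℝ} {x : E} (hG : DifferentiableAt ℝ G x)
    (a b c : E) : fderiv ℝ (fun z => G z a b) x c = fderiv ℝ G x c a b := by
  have h := (hG.hasFDerivAt.clm_apply (hasFDerivAt_const a x)).clm_apply (hasFDerivAt_const b x)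
  rw [h.fderiv]
  simp

theorem exists_equiv_of_pos {B : E →L[ℝ] E →L[ℝ] ℝ} (hB : ∀ v, v ≠ 0 → 0 < B v v) :
    ∃ e : E ≃L[ℝ] (E →L[ℝ] ℝ), (e : E →L[ℝ] (E →L[ℝ] ℝ)) = B := by
  have hinj : Function.Injective B.toLinearMap := by
    rw [← LinearMap.ker_eq_bot, LinearMap.ker_eq_bot']
    intro v hv
    by_contra h
    have h1 := hB v h
    have h2 : B v = 0 := hv
    rw [h2] at h1
    simp at h1
  have hfin : Module.finrank ℝ E = Module.finrank ℝ (E →L[ℝ] ℝ) :=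
    (InnerProductSpace.toDual ℝ E).toLinearEquiv.finrank_eq
  have : FiniteDimensional ℝ (E →L[ℝ] ℝ) :=
    (InnerProductSpace.toDual ℝ E).toLinearEquiv.finiteDimensional
  let l := LinearEquiv.ofInjectiveOfFinrankEq B.toLinearMap hinj hfin
  exact ⟨l.toContinuousLinearEquiv, by ext v w; rfl⟩

/-- The geodesic spray of the metric `G`. -/
def spray (G : E → E →L[ℝ] E →L[ℝ] ℝ) (x w : E) : E :=
  (G x).inverse ((1 / 2 : ℝ) • ((fderiv ℝ G x).flip w).flip w - fderiv ℝ G x w w)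

theorem eulerLagrange_eq_zero_iff {G : E → E →L[ℝ] E →L[ℝ] ℝ} {x : E}
    (hG : ∀ v, v ≠ 0 → 0 < G x v v) (w a : E) :
    (∀ c, eulerLagrange G x w a c = 0) ↔ a = spray G x w := by
  obtain ⟨e, he⟩ := exists_equiv_of_pos hG
  rw [spray, ← he, ContinuousLinearMap.inverse_equiv]
  change _ ↔ a = e.symm _
  rw [e.eq_symm_apply, ContinuousLinearMap.ext_iff]
  refine forall_congr' fun c => ?_
  have : e a c = G x a c := by rw [← he]; rfl
  rw [this, eulerLagrange]
  simp only [sub_apply, smul_apply, ContinuousLinearMap.flip_apply, smul_eq_mul]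
  constructor <;> intro h <;> linarith

theorem spray_smul (G : E → E →L[ℝ] E →L[ℝ] ℝ) (x : E) (c : ℝ) (w : E) :
    spray G x (c • w) = c ^ 2 • spray G x w := by
  refine (congrArg (G x).inverse (ContinuousLinearMap.ext fun b => ?_)).trans
    ((G x).inverse.map_smul (c ^ 2) _)
  simp only [ContinuousLinearMap.map_smul, sub_apply, smul_apply, ContinuousLinearMap.flip_apply, smul_eq_mul]
  ring

/-- The spray is C¹ near (e₀, 0), hence Lipschitz on a small ball. Homogeneity of degree two scales
velocities of size θ to the size of that ball, and scaling back produces the weights θ² and θ. -/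
theorem exists_isLipschitzSpray {G : E → E →L[ℝ] E →L[ℝ] ℝ} {e₀ : E} (hG : ContDiffAt ℝ ∞ G e₀)
    (hpos : ∀ v, v ≠ 0 → 0 < G e₀ v v) :
    ∃ a K, 0 < a ∧ 0 ≤ K ∧ IsLipschitzSpray (spray G) e₀ a K := by
  obtain ⟨e, he⟩ := exists_equiv_of_pos hpos
  have h1 : ContDiffAt ℝ 1 (fun p : E × E => (G p.1).inverse) (e₀, 0) := by
    have hi : ContDiffAt ℝ 1 (ContinuousLinearMap.inverse : (E →L[ℝ] (E →L[ℝ] ℝ)) → _) (G e₀) := by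
      rw [← he]; exact contDiffAt_map_inverse e
    exact hi.comp ((e₀, 0) : E × E) ((hG.of_le (by exact_mod_cast le_top)).comp (e₀, (0 : E))
      contDiffAt_fst)
  have h2 : ContDiffAt ℝ 1 (fun p : E × E => fderiv ℝ G p.1) (e₀, 0) :=
    (hG.fderiv_right (m := 1) (by rw [one_add_one_eq_two]; exact ENat.LEInfty.out)).comp (e₀, (0 : E)) contDiffAt_fst
  have h3 : ContDiffAt ℝ 1 (fun p : E × E => (fderiv ℝ G p.1).flip) (e₀, 0) :=
    (ContinuousLinearMap.flipₗᵢ ℝ E E (E →L[ℝ] ℝ)).contDiff.contDiffAt.comp _ h2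
  have h4 : ContDiffAt ℝ 1 (fun p : E × E => ((fderiv ℝ G p.1).flip p.2).flip) (e₀, 0) :=
    (ContinuousLinearMap.flipₗᵢ ℝ E E ℝ).contDiff.contDiffAt.comp _ (h3.clm_apply contDiffAt_snd)
  have h5 : ContDiffAt ℝ 1 (fun p : E × E => spray G p.1 p.2) (e₀, 0) :=
    h1.clm_apply (((h4.clm_apply contDiffAt_snd).const_smul (1 / 2 : ℝ)).sub
      ((h2.clm_apply contDiffAt_snd).clm_apply contDiffAt_snd))
  obtain ⟨K, s, hs, hK⟩ := h5.exists_lipschitzOnWith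
  obtain ⟨ε, hε, hεs⟩ := Metric.nhds_basis_closedBall.mem_iff.1 hs
  refine ⟨ε, K * (1 / ε ^ 2 + 1 / ε), hε, by positivity, spray_smul G, ?_⟩
  intro x hx x' hx' w w' θ hθ hw hw'
  have hmem : ∀ x ∈ Metric.closedBall e₀ ε, ∀ w : E, ‖w‖ ≤ θ → (x, (ε / θ) • w) ∈ s := by
    intro x hx w hw
    refine hεs ?_
    rw [mem_closedBall_iff_norm] at hx ⊢
    rw [Prod.norm_def, max_le_iff]
    refine ⟨hx, ?_⟩
    change ‖(ε / θ) • w - 0‖ ≤ ε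
    rw [sub_zero, norm_smul, Real.norm_eq_abs, abs_of_pos (by positivity), div_mul_eq_mul_div,
      div_le_iff₀ hθ]
    gcongr
  have hscale : ∀ x w, spray G x w = (θ / ε) ^ 2 • spray G x ((ε / θ) • w) := fun x w => by
    rw [spray_smul, smul_smul, ← mul_pow, div_mul_div_cancel₀ hε.ne', div_self hθ.ne', one_pow,
      one_smul]
  have h6 := hK.dist_le_mul _ (hmem x hx w hw) _ (hmem x' hx' w' hw')
  rw [dist_eq_norm, dist_eq_norm, Prod.norm_def] at h6
  change ‖spray G x ((ε / θ) • w) - spray G x' ((ε / θ) • w')‖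
    ≤ K * max ‖x - x'‖ ‖(ε / θ) • w - (ε / θ) • w'‖ at h6
  rw [← smul_sub, norm_smul, Real.norm_eq_abs, abs_of_pos (by positivity : 0 < ε / θ)] at h6
  rw [hscale x w, hscale x' w', ← smul_sub, norm_smul, Real.norm_eq_abs,
    abs_of_pos (by positivity : 0 < (θ / ε) ^ 2)]
  have h7 : max ‖x - x'‖ (ε / θ * ‖w - w'‖) ≤ ‖x - x'‖ + ε / θ * ‖w - w'‖ :=
    max_le (le_add_of_nonneg_right (by positivity)) (le_add_of_nonneg_left (by positivity))
  calc (θ / ε) ^ 2 * _ ≤ (θ / ε) ^ 2 * (K * (‖x - x'‖ + ε / θ * ‖w - w'‖)) := by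
        gcongr
        exact h6.trans (by gcongr)
    _ = K * (1 / ε ^ 2 * (θ ^ 2 * ‖x - x'‖) + 1 / ε * (θ * ‖w - w'‖)) := by
        field_simp
    _ ≤ K * ((1 / ε ^ 2 + 1 / ε) * (θ ^ 2 * ‖x - x'‖) + (1 / ε ^ 2 + 1 / ε) * (θ * ‖w - w'‖)) := by
        gcongr
        · exact le_add_of_nonneg_right (by positivity)
        · exact le_add_of_nonneg_left (by positivity)
    _ = _ := by ring

/-- The Euler--Lagrange expression is a covector: change of coordinates. -/
theorem eulerLagrange_comp {G : E → E →L[ℝ] E →L[ℝ] ℝ} {g : E → E → E → ℝ} {ψ : E → E} {z : E}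
    (hψ : ContDiffAt ℝ 2 ψ z) (hG : DifferentiableAt ℝ G (ψ z))
    (hsymm : ∀ a b, G (ψ z) a b = G (ψ z) b a)
    (hg : ∀ᶠ y in 𝓝 z, ∀ a b, g y a b = G (ψ y) (fderiv ℝ ψ y a) (fderiv ℝ ψ y b)) (w a c : E) :
    g z a c + fderiv ℝ (fun y => g y w c) z w - (1 / 2) * fderiv ℝ (fun y => g y w w) z c
      = eulerLagrange G (ψ z) (fderiv ℝ ψ z w) (fderiv ℝ ψ z a + fderiv ℝ (fderiv ℝ ψ) z w w)
          (fderiv ℝ ψ z c) := by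
  have hψ1 : DifferentiableAt ℝ ψ z := hψ.differentiableAt (by norm_num)
  have hψ2 : DifferentiableAt ℝ (fderiv ℝ ψ) z :=
    (hψ.fderiv_right (m := 1) (by norm_num)).differentiableAt (by norm_num)
  -- With the symmetry of D²ψ the terms containing it cancel, except for the one that corrects the
  -- acceleration.
  have hs2 : ∀ a b, fderiv ℝ (fderiv ℝ ψ) z a b = fderiv ℝ (fderiv ℝ ψ) z b a := fun a b =>
    (hψ.isSymmSndFDerivAt (by simp)) a b
  have hd : ∀ a b c, fderiv ℝ (fun y => g y a b) z c
      = fderiv ℝ G (ψ z) (fderiv ℝ ψ z c) (fderiv ℝ ψ z a) (fderiv ℝ ψ z b)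
        + G (ψ z) (fderiv ℝ (fderiv ℝ ψ) z c a) (fderiv ℝ ψ z b)
        + G (ψ z) (fderiv ℝ ψ z a) (fderiv ℝ (fderiv ℝ ψ) z c b) := by
    intro a b c
    have h1 : (fun y => g y a b) =ᶠ[𝓝 z] fun y => G (ψ y) (fderiv ℝ ψ y a) (fderiv ℝ ψ y b) :=
      hg.mono fun y hy => hy a b
    have hGψ : HasFDerivAt (fun y => G (ψ y)) (fderiv ℝ G (ψ z) ∘L fderiv ℝ ψ z) z :=
      hG.hasFDerivAt.comp z hψ1.hasFDerivAt
    have hψa : ∀ a, HasFDerivAt (fun y => fderiv ℝ ψ y a) ((fderiv ℝ (fderiv ℝ ψ) z).flip a) z :=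
      fun a => by
        have := hψ2.hasFDerivAt.clm_apply (hasFDerivAt_const a z)
        refine this.congr_fderiv ?_
        ext; simp
    rw [h1.fderiv_eq, ((hGψ.clm_apply (hψa a)).clm_apply (hψa b)).fderiv]
    simp only [add_apply, ContinuousLinearMap.comp_apply,
      ContinuousLinearMap.flip_apply]
    ring
  rw [hd, hd, hg.self_of_nhds, eulerLagrange, map_add, add_apply,
    hsymm (fderiv ℝ (fderiv ℝ ψ) z c w), hs2 c w]
  ring

end EulerLagrange


/-! ### Coordinates of points, curves and vector fields in different charts. -/

section CoordinateChange

variable {d : ℕ} {M : Type*} [TopologicalSpace M] [ChartedSpace (Model d) M]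
  [IsManifold (𝓡 d) ∞ M]

scoped instance isManifold_one : IsManifold (𝓡 d) 1 M := IsManifold.of_le (n := ∞) ENat.LEInfty.out

scoped instance isManifold_two : IsManifold (𝓡 d) 2 M := IsManifold.of_le (n := ∞) ENat.LEInfty.out

/-- The change of coordinates from the chart at `p` to the chart at `q`. -/
def coordChange (p q : M) : Model d → Model d := extChartAt (𝓡 d) q ∘ (extChartAt (𝓡 d) p).symm

theorem coordChange_apply_extChartAt {p q x : M} (hx : x ∈ (extChartAt (𝓡 d) p).source) :
    coordChange (d := d) p q (extChartAt (𝓡 d) p x) = extChartAt (𝓡 d) q x :=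
  congrArg _ ((extChartAt (𝓡 d) p).left_inv hx)

theorem contDiffAt_coordChange {p q x : M} (hp : x ∈ (extChartAt (𝓡 d) p).source)
    (hq : x ∈ (extChartAt (𝓡 d) q).source) :
    ContDiffAt ℝ ∞ (coordChange (d := d) p q) (extChartAt (𝓡 d) p x) := by
  have := contDiffWithinAt_ext_coord_change (I := 𝓡 d) (n := ∞) q p
    (y := extChartAt (𝓡 d) p x) (by
      rw [PartialEquiv.trans_source'', PartialEquiv.symm_symm, PartialEquiv.symm_target]
      exact mem_image_of_mem _ ⟨hp, hq⟩)
  rwa [ModelWithCorners.range_eq_univ, contDiffWithinAt_univ] at this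

theorem hasFDerivAt_coordChange {p q x : M} (hp : x ∈ (extChartAt (𝓡 d) p).source)
    (hq : x ∈ (extChartAt (𝓡 d) q).source) :
    HasFDerivAt (coordChange (d := d) p q) (tangentCoordChange (𝓡 d) p q x)
      (extChartAt (𝓡 d) p x) := by
  have := hasFDerivWithinAt_tangentCoordChange (I := 𝓡 d) (x := p) (y := q) ⟨hp, hq⟩
  rwa [ModelWithCorners.range_eq_univ, hasFDerivWithinAt_univ] at this

theorem tangentCoordChange_symm_apply {p q x : M} (hp : x ∈ (extChartAt (𝓡 d) p).source)
    (hq : x ∈ (extChartAt (𝓡 d) q).source) (v : Model d) :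
    tangentCoordChange (𝓡 d) p q x (tangentCoordChange (𝓡 d) q p x v) = v := by
  rw [tangentCoordChange_comp ⟨⟨hq, hp⟩, hq⟩, tangentCoordChange_self hq]

/-- Coordinates of curves in two charts. -/
theorem HasDerivAt.coordChange {γ : ℝ → M} {t : ℝ} {p q : M} (hγ : ContinuousAt γ t)
    (hp : γ t ∈ (extChartAt (𝓡 d) p).source) (hq : γ t ∈ (extChartAt (𝓡 d) q).source)
    {v : Model d} (h : HasDerivAt (fun τ => extChartAt (𝓡 d) p (γ τ)) v t) :
    HasDerivAt (fun τ => extChartAt (𝓡 d) q (γ τ)) (tangentCoordChange (𝓡 d) p q (γ t) v) t := by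
  have h1 := (hasFDerivAt_coordChange hp hq).comp_hasDerivAt t h
  refine h1.congr_of_eventuallyEq ?_
  filter_upwards [hγ.preimage_mem_nhds ((isOpen_extChartAt_source p).mem_nhds hp)] with τ hτ
  exact (coordChange_apply_extChartAt hτ).symm

/-- An integral curve, in coordinates. -/
theorem hasDerivAt_extChartAt_comp {Y : ∀ x : M, TangentSpace (𝓡 d) x} {γ : ℝ → M}
    (hγ : IsMIntegralCurve γ Y) {t : ℝ} {p : M} (hp : γ t ∈ (extChartAt (𝓡 d) p).source) :
    HasDerivAt (fun τ => extChartAt (𝓡 d) p (γ τ))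
      (coordField Y p (extChartAt (𝓡 d) p (γ t))) t := by
  have h1 := ((hγ.isMIntegralCurveAt t).eventually_hasDerivAt).self_of_nhds
  have h3 := tangentCoordChange_self (I := 𝓡 d) (v := (show Model d from Y (γ t)))
    (mem_extChartAt_source (γ t))
  replace h1 := h1.congr_deriv h3
  have h2 := HasDerivAt.coordChange (hγ.continuous.continuousAt) (mem_extChartAt_source _) hp h1
  refine h2.congr_deriv ?_
  rw [coordField, (extChartAt (𝓡 d) p).left_inv hp]

theorem chartVector_eq_symm (p : M) {x : M} (hx : x ∈ (extChartAt (𝓡 d) p).source) (a : Model d) :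
    chartVector p x a = (trivializationAt (Model d) (TangentSpace (𝓡 d)) p).symmL ℝ x a := by
  rw [extChartAt_source] at hx
  rw [TangentBundle.symmL_trivializationAt_eq_core hx]
  rfl

theorem contMDiffOn_chartVector (p : M) (a : Model d) :
    ContMDiffOn (𝓡 d) (𝓡 d).tangent ∞
      (fun x => (⟨x, chartVector p x a⟩ : TangentBundle (𝓡 d) M)) (extChartAt (𝓡 d) p).source := by
  let e := trivializationAt (Model d) (TangentSpace (𝓡 d) : M → Type _) p
  have h1 : ContMDiffOn (𝓡 d) ((𝓡 d).prod 𝓘(ℝ, Model d)) ∞ (fun x : M => (x, a))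
      (extChartAt (𝓡 d) p).source := (contMDiff_id.prodMk contMDiff_const).contMDiffOn
  have hb : (extChartAt (𝓡 d) p).source = e.baseSet := by
    rw [extChartAt_source, TangentBundle.trivializationAt_baseSet]
  have h2 := (e.contMDiffOn_symm (IB := 𝓡 d) (n := ∞)).comp h1 (fun x hx => by
    rw [e.target_eq]; exact ⟨by rwa [hb] at hx, mem_univ _⟩)
  refine h2.congr fun x hx => ?_
  have hx' : x ∈ e.baseSet := by rwa [hb] at hx
  rw [Function.comp_apply, ← e.mk_symm hx', chartVector_eq_symm p hx,
    e.symmL_apply hx']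

theorem coordField_eq {Y : ∀ x : M, TangentSpace (𝓡 d) x} (p : M) (u : Model d) :
    coordField Y p u =
      (trivializationAt (Model d) (TangentSpace (𝓡 d) : M → Type _) p
        (⟨_, Y ((extChartAt (𝓡 d) p).symm u)⟩ : TangentBundle (𝓡 d) M)).2 := by
  rw [TangentBundle.trivializationAt_apply]
  rfl

theorem contDiffOn_coordField {Y : ∀ x : M, TangentSpace (𝓡 d) x} (hY : IsC1VectorField Y) (p : M) :
    ContDiffOn ℝ 1 (coordField Y p) (extChartAt (𝓡 d) p).target := by
  let e := trivializationAt (Model d) (TangentSpace (𝓡 d) : M → Type _) p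
  have h1 : ContMDiffOn (𝓡 d) 𝓘(ℝ, Model d) 1
      (fun x => (e (⟨x, Y x⟩ : TangentBundle (𝓡 d) M)).2) e.baseSet :=
    e.contMDiffOn_section_baseSet_iff.1 (ContMDiff.contMDiffOn hY)
  have h2 := h1.comp (contMDiffOn_extChartAt_symm (I := 𝓡 d) (n := 1) p) (fun u hu => by
    have := (extChartAt (𝓡 d) p).map_target hu
    rwa [extChartAt_source] at this)
  exact (contMDiffOn_iff_contDiffOn.1 h2).congr fun u hu => coordField_eq p u

theorem chartVector_coordField {Y : ∀ x : M, TangentSpace (𝓡 d) x} (p : M) {x : M}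
    (hx : x ∈ (extChartAt (𝓡 d) p).source) :
    chartVector p x (coordField Y p (extChartAt (𝓡 d) p x)) = Y x := by
  rw [coordField, (extChartAt (𝓡 d) p).left_inv hx, chartVector]
  exact tangentCoordChange_symm_apply hx (mem_extChartAt_source x) (Y x : Model d)

theorem chartVector_add (p x : M) (a b : Model d) :
    chartVector p x (a + b) = chartVector p x a + chartVector p x b :=
  (tangentCoordChange (𝓡 d) p x x).map_add a b

theorem chartVector_smul (p x : M) (c : ℝ) (a : Model d) :
    chartVector p x (c • a) = c • chartVector p x a :=
  (tangentCoordChange (𝓡 d) p x x).map_smul c a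

theorem chartVector_eq_zero {p x : M} (hx : x ∈ (extChartAt (𝓡 d) p).source) {a : Model d}
    (h : chartVector p x a = 0) : a = 0 := by
  have := tangentCoordChange_symm_apply (mem_extChartAt_source (I := 𝓡 d) x) hx a
  rw [← this]
  change tangentCoordChange (𝓡 d) x p x (chartVector p x a) = 0
  rw [h]
  exact (tangentCoordChange (𝓡 d) x p x).map_zero

theorem chartVector_tangentCoordChange {p q x : M} (hp : x ∈ (extChartAt (𝓡 d) p).source)
    (hq : x ∈ (extChartAt (𝓡 d) q).source) (a : Model d) :
    chartVector q x (tangentCoordChange (𝓡 d) p q x a) = chartVector p x a := by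
  have h := tangentCoordChange_comp (I := 𝓡 d) (v := a) ⟨⟨hp, hq⟩, mem_extChartAt_source x⟩
  exact h

end CoordinateChange


/-! ### The Riemannian metric and geodesics in charts. -/

section Metric

variable {d : ℕ} {M : Type*} [EMetricSpace M] [ChartedSpace (Model d) M]
  [IsManifold (𝓡 d) ∞ M] [RiemannianBundle (fun x : M => TangentSpace (𝓡 d) x)]

/-- The metric in the chart around `p`, as a continuous bilinear form. -/
def metricForm (p : M) (u : Model d) : Model d →L[ℝ] Model d →L[ℝ] ℝ :=
  LinearMap.toContinuousBilinearMap (LinearMap.mk₂ ℝ (metricCoeff (d := d) p u)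
    (fun a b c => by simp only [metricCoeff, chartVector_add, inner_add_left])
    (fun t a b => by simp only [metricCoeff, chartVector_smul, real_inner_smul_left, smul_eq_mul])
    (fun a b c => by simp only [metricCoeff, chartVector_add, inner_add_right])
    (fun t a b => by simp only [metricCoeff, chartVector_smul, real_inner_smul_right, smul_eq_mul]))

theorem metricForm_apply (p : M) (u a b : Model d) :
    metricForm p u a b = metricCoeff p u a b := rfl

theorem metricForm_symm (p : M) (u a b : Model d) : metricForm p u a b = metricForm p u b a := by
  rw [metricForm_apply, metricForm_apply, metricCoeff, metricCoeff, real_inner_comm]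

theorem metricForm_pos (p : M) {u : Model d} (hu : u ∈ (extChartAt (𝓡 d) p).target) {a : Model d}
    (ha : a ≠ 0) : 0 < metricForm p u a a := by
  rw [metricForm_apply, metricCoeff]
  refine real_inner_self_pos.2 fun h => ha ?_
  exact chartVector_eq_zero ((extChartAt (𝓡 d) p).map_target hu) h

theorem metricForm_extChartAt (p : M) {x : M} (hx : x ∈ (extChartAt (𝓡 d) p).source)
    (a b : Model d) : metricForm p (extChartAt (𝓡 d) p x) a b
      = inner ℝ (chartVector p x a) (chartVector p x b) := by
  rw [metricForm_apply, metricCoeff, (extChartAt (𝓡 d) p).left_inv hx]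

theorem metricForm_coordChange {p q x : M} (hp : x ∈ (extChartAt (𝓡 d) p).source)
    (hq : x ∈ (extChartAt (𝓡 d) q).source) (a b : Model d) :
    metricCoeff p (extChartAt (𝓡 d) p x) a b =
      metricForm q (coordChange p q (extChartAt (𝓡 d) p x))
        (fderiv ℝ (coordChange p q) (extChartAt (𝓡 d) p x) a)
        (fderiv ℝ (coordChange p q) (extChartAt (𝓡 d) p x) b) := by
  rw [coordChange_apply_extChartAt hp, metricForm_extChartAt q hq,
    (hasFDerivAt_coordChange hp hq).fderiv, chartVector_tangentCoordChange hp hq,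
    chartVector_tangentCoordChange hp hq, ← metricForm_apply, metricForm_extChartAt p hp]

variable [IsContMDiffRiemannianBundle (𝓡 d) ∞ (Model d) (fun x : M => TangentSpace (𝓡 d) x)]

theorem contDiffOn_metricForm (p : M) :
    ContDiffOn ℝ ∞ (metricForm (d := d) p) (extChartAt (𝓡 d) p).target := by
  refine contDiffOn_clm_apply.2 fun a => contDiffOn_clm_apply.2 fun b => ?_
  have h1 : ContMDiffOn (𝓡 d) 𝓘(ℝ, ℝ) ∞
      (fun x : M => inner ℝ (chartVector p x a) (chartVector p x b)) (extChartAt (𝓡 d) p).source :=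
    (contMDiffOn_chartVector p a).inner_bundle (contMDiffOn_chartVector p b)
  have h2 := h1.comp (contMDiffOn_extChartAt_symm (I := 𝓡 d) (n := ∞) p)
    (fun u hu => (extChartAt (𝓡 d) p).map_target hu)
  exact contMDiffOn_iff_contDiffOn.1 h2

theorem contDiffAt_metricForm {p : M} {u : Model d} (hu : u ∈ (extChartAt (𝓡 d) p).target) :
    ContDiffAt ℝ ∞ (metricForm (d := d) p) u :=
  (contDiffOn_metricForm p).contDiffAt ((isOpen_extChartAt_target p).mem_nhds hu)

theorem deriv_deriv_comp {E : Type*} [NormedAddCommGroup E] [NormedSpace ℝ E] {ψ : E → E}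
    {u : ℝ → E} {t : ℝ} (hψ : ContDiffAt ℝ 2 ψ (u t)) (hu : ContDiffAt ℝ 2 u t) :
    deriv (fun τ => ψ (u τ)) t = fderiv ℝ ψ (u t) (deriv u t) ∧
      deriv (deriv fun τ => ψ (u τ)) t = fderiv ℝ ψ (u t) (deriv (deriv u) t)
        + fderiv ℝ (fderiv ℝ ψ) (u t) (deriv u t) (deriv u t) := by
  have h1 : ∀ᶠ τ in 𝓝 t, deriv (fun τ => ψ (u τ)) τ = fderiv ℝ ψ (u τ) (deriv u τ) := by
    have hψ' : ∀ᶠ τ in 𝓝 t, ContDiffAt ℝ 2 ψ (u τ) :=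
      hu.continuousAt.eventually (hψ.eventually (by simp))
    filter_upwards [hψ', hu.eventually (by simp)] with τ h2 h3
    exact ((h2.differentiableAt (by simp)).hasFDerivAt.comp_hasDerivAt τ
      (h3.differentiableAt (by simp)).hasDerivAt).deriv
  refine ⟨h1.self_of_nhds, ?_⟩
  rw [Filter.EventuallyEq.deriv_eq h1]
  have h4 : HasFDerivAt (fderiv ℝ ψ) (fderiv ℝ (fderiv ℝ ψ) (u t)) (u t) :=
    ((hψ.fderiv_right (m := 1) (by norm_num)).differentiableAt (by simp)).hasFDerivAt
  have h5 : HasDerivAt (deriv u) (deriv (deriv u) t) t := by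
    have : ContDiffAt ℝ 1 (deriv u) t :=
      (hu.fderiv_right (m := 1) (by norm_num)).clm_apply contDiffAt_const
    exact (this.differentiableAt (by simp)).hasDerivAt
  have h6 := (h4.comp_hasDerivAt t (hu.differentiableAt (by simp)).hasDerivAt).clm_apply h5
  exact h6.deriv.trans (add_comm _ _)

/-- The geodesic equation in the chart at `q`. -/
theorem IsGeodesicOn.chart {γ : ℝ → M} {s : Set ℝ} (hγ : IsGeodesicOn (d := d) γ s) {t : ℝ}
    (ht : t ∈ s) {q : M} (hq : γ t ∈ (extChartAt (𝓡 d) q).source) :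
    ContDiffAt ℝ 2 (fun τ => extChartAt (𝓡 d) q (γ τ)) t ∧
      deriv (deriv fun τ => extChartAt (𝓡 d) q (γ τ)) t
        = spray (metricForm q) (extChartAt (𝓡 d) q (γ t))
            (deriv (fun τ => extChartAt (𝓡 d) q (γ τ)) t) := by
  obtain ⟨hc, p, hp, hu, heq⟩ := hγ t ht
  rw [← extChartAt_source (𝓡 d)] at hp
  have hev : (fun τ => extChartAt (𝓡 d) q (γ τ)) =ᶠ[𝓝 t]
      fun τ => coordChange p q (extChartAt (𝓡 d) p (γ τ)) := by
    filter_upwards [hc.preimage_mem_nhds ((isOpen_extChartAt_source p).mem_nhds hp)] with τ hτ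
    exact (coordChange_apply_extChartAt hτ).symm
  have hψ : ContDiffAt ℝ 2 (coordChange p q) (extChartAt (𝓡 d) p (γ t)) :=
    (contDiffAt_coordChange hp hq).of_le ENat.LEInfty.out
  obtain ⟨h1, h2⟩ := deriv_deriv_comp hψ hu
  refine ⟨(ContDiffAt.comp (g := coordChange p q) t hψ hu).congr_of_eventuallyEq hev, ?_⟩
  rw [hev.deriv.deriv_eq, hev.deriv_eq, h1, h2, ← coordChange_apply_extChartAt (q := q) hp]
  have ht : coordChange p q (extChartAt (𝓡 d) p (γ t)) ∈ (extChartAt (𝓡 d) q).target := by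
    rw [coordChange_apply_extChartAt hp]
    exact (extChartAt (𝓡 d) q).map_source hq
  rw [← eulerLagrange_eq_zero_iff fun v hv => metricForm_pos q ht hv]
  intro c
  have hg : ∀ᶠ y in 𝓝 (extChartAt (𝓡 d) p (γ t)), ∀ a b, metricCoeff p y a b =
      metricForm q (coordChange p q y) (fderiv ℝ (coordChange p q) y a)
        (fderiv ℝ (coordChange p q) y b) := by
    have h3 : (extChartAt (𝓡 d) p).target ∩
        (extChartAt (𝓡 d) p).symm ⁻¹' (extChartAt (𝓡 d) q).source ∈
          𝓝 (extChartAt (𝓡 d) p (γ t)) := by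
      refine inter_mem (extChartAt_target_mem_nhds' ((extChartAt (𝓡 d) p).map_source hp)) ?_
      refine (continuousAt_extChartAt_symm' hp).preimage_mem_nhds ?_
      rw [(extChartAt (𝓡 d) p).left_inv hp]
      exact (isOpen_extChartAt_source q).mem_nhds hq
    filter_upwards [h3] with y hy a b
    have := metricForm_coordChange ((extChartAt (𝓡 d) p).map_target hy.1) hy.2 a b
    rwa [(extChartAt (𝓡 d) p).right_inv hy.1] at this
  -- The given equation is tested in the chart at `p` against the vector that the coordinate change
  -- sends to `c`.
  have h4 := eulerLagrange_comp (G := metricForm q) hψ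
    ((contDiffAt_metricForm ht).differentiableAt (by simp)) (metricForm_symm q _) hg
    (deriv (fun τ => extChartAt (𝓡 d) p (γ τ)) t)
    (deriv (deriv fun τ => extChartAt (𝓡 d) p (γ τ)) t) (tangentCoordChange (𝓡 d) q p (γ t) c)
  rw [heq, (hasFDerivAt_coordChange hp hq).fderiv, tangentCoordChange_symm_apply hp hq] at h4
  rw [(hasFDerivAt_coordChange hp hq).fderiv]
  exact h4.symm

/-- A geodesic in the manifold could leave the chart, so uniqueness of solutions does not apply at
once. But the times at which position and velocity agree with those of the chart solution form a
closed set containing 0, and where they agree the geodesic is inside the chart, so local uniqueness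
makes the set open. -/
theorem IsGeodesicOn.eq_of_isSolution {q : M} {e₀ : Model d} {a K b θ : ℝ}
    (hS : IsLipschitzSpray (spray (metricForm q)) e₀ a K) (hK : 0 ≤ K) (hba : b < a) (hθ : 0 < θ)
    (hsub : Metric.closedBall e₀ b ⊆ (extChartAt (𝓡 d) q).target) {x v : Model d}
    {u c : ℝ → Model d}
    (hs : IsLipschitzSpray.IsSolution (spray (metricForm q)) e₀ b θ x v u c) {γ : ℝ → M} {ε : ℝ}
    (hε : 0 < ε) (hγ : IsGeodesicOn (d := d) γ (Ioo (-ε) (1 + ε)))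
    (h0 : γ 0 = (extChartAt (𝓡 d) q).symm x)
    (hv : HasDerivAt (fun τ => extChartAt (𝓡 d) q (γ τ)) v 0) :
    ∀ t ∈ Icc (0 : ℝ) 1, γ t = (extChartAt (𝓡 d) q).symm (u t) := by
  set w : ℝ → Model d := fun τ => extChartAt (𝓡 d) q (γ τ) with hw
  have hut : ∀ t, u t ∈ (extChartAt (𝓡 d) q).target := fun t => hsub (hs.mem t)
  have hsrc : ∀ t, γ t = (extChartAt (𝓡 d) q).symm (u t) →
      γ t ∈ (extChartAt (𝓡 d) q).source := fun t h => by
    rw [h]; exact (extChartAt (𝓡 d) q).map_target (hut t)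
  have hwu : ∀ t, γ t = (extChartAt (𝓡 d) q).symm (u t) → w t = u t := fun t h => by
    simp only [hw]
    rw [h, (extChartAt (𝓡 d) q).right_inv (hut t)]
  have hI : ∀ t ∈ Icc (0 : ℝ) 1, t ∈ Ioo (-ε) (1 + ε) ∧ t ∈ Ioo (-1 : ℝ) 2 := fun t ht =>
    ⟨⟨by linarith [ht.1], by linarith [ht.2]⟩, ⟨by linarith [ht.1], by linarith [ht.2]⟩⟩
  have hdc : ∀ t, ContDiffAt ℝ 2 w t → ContDiffAt ℝ 1 (deriv w) t := fun t h =>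
    (h.fderiv_right (m := 1) (by norm_num)).clm_apply contDiffAt_const
  suffices h : Icc (0 : ℝ) 1 ⊆ {t | γ t = (extChartAt (𝓡 d) q).symm (u t) ∧ deriv w t = c t} from
    fun t ht => (h ht).1
  refine IsClosed.Icc_subset_of_forall_mem_nhdsWithin ?_ ⟨by rw [h0, hs.pos], ?_⟩ ?_
  · refine isClosed_of_closure_subset fun t ht => ?_
    have ht1 : t ∈ Icc (0 : ℝ) 1 := closure_minimal inter_subset_right isClosed_Icc ht
    have hne := mem_closure_iff_nhdsWithin_neBot.1 ht
    have hle := nhdsWithin_le_nhds (a := t)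
      (s := {t | γ t = (extChartAt (𝓡 d) q).symm (u t) ∧ deriv w t = c t} ∩ Icc 0 1)
    have hγt : ContinuousAt γ t := (hγ t (hI t ht1).1).1
    have h1 : γ t = (extChartAt (𝓡 d) q).symm (u t) := by
      have h2 : ContinuousAt (fun τ => (extChartAt (𝓡 d) q).symm (u τ)) t :=
        ContinuousAt.comp (g := (extChartAt (𝓡 d) q).symm)
          (continuousAt_extChartAt_symm'' (hut t)) (hs.hasDerivAt t (hI t ht1).2).continuousAt
      refine tendsto_nhds_unique_of_eventuallyEq (hγt.mono_left hle) (h2.mono_left hle) ?_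
      filter_upwards [self_mem_nhdsWithin] with τ hτ using hτ.1.1
    refine ⟨⟨h1, ?_⟩, ht1⟩
    have h3 : ContinuousAt (deriv w) t :=
      (hdc t (hγ.chart (hI t ht1).1 (hsrc t h1)).1).continuousAt
    refine tendsto_nhds_unique_of_eventuallyEq (h3.mono_left hle)
      ((hs.hasDerivAt' t (hI t ht1).2).continuousAt.mono_left hle) ?_
    filter_upwards [self_mem_nhdsWithin] with τ hτ using hτ.1.2
  · rw [hs.vel]; exact hv.deriv
  · rintro t ⟨⟨h1, h2⟩, ht⟩
    have ht1 := Ico_subset_Icc_self ht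
    obtain ⟨hg, hI2⟩ := hI t ht1
    have hγt : ContinuousAt γ t := (hγ t hg).1
    have hs1 : ∀ᶠ τ in 𝓝 t, γ τ ∈ (extChartAt (𝓡 d) q).source :=
      hγt.preimage_mem_nhds ((isOpen_extChartAt_source q).mem_nhds (hsrc t h1))
    have hsol : ∀ᶠ τ in 𝓝 t, HasDerivAt w (deriv w τ) τ ∧
        HasDerivAt (deriv w) (spray (metricForm q) (w τ) (deriv w τ)) τ := by
      filter_upwards [hs1, isOpen_Ioo.mem_nhds hg] with τ h3 h4
      obtain ⟨h5, h6⟩ := hγ.chart h4 h3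
      refine ⟨(h5.differentiableAt (by simp)).hasDerivAt, ?_⟩
      rw [← h6]
      exact ((hdc τ h5).differentiableAt (by simp)).hasDerivAt
    have hwt : ContinuousAt w t := hsol.self_of_nhds.1.continuousAt
    have hw't : ContinuousAt (deriv w) t := hsol.self_of_nhds.2.continuousAt
    let F : Model d × Model d → Model d × Model d := fun z => (z.2, spray (metricForm q) z.1 z.2)
    -- The strict inequalities b < a and θ < θ + 1 leave room for the geodesic to be in the
    -- Lipschitz region for times near t.
    let D : Set (Model d × Model d) := Metric.closedBall e₀ a ×ˢ Metric.closedBall 0 (θ + 1)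
    have hθ1 : 0 < θ + 1 := by linarith
    have hF : LipschitzOnWith (Real.toNNReal (1 + K * ((θ + 1) ^ 2 + (θ + 1)))) F D := by
      refine LipschitzOnWith.of_dist_le_mul fun z hz z' hz' => ?_
      have h4 := hS.lipschitz z.1 hz.1 z'.1 hz'.1 z.2 z'.2 (θ + 1) hθ1
        (mem_closedBall_zero_iff.1 hz.2) (mem_closedBall_zero_iff.1 hz'.2)
      rw [Real.coe_toNNReal _ (by positivity), dist_eq_norm, dist_eq_norm, Prod.norm_def,
        max_le_iff]
      have h5 : ‖z.1 - z'.1‖ ≤ ‖z - z'‖ := norm_fst_le (z - z')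
      have h6 : ‖z.2 - z'.2‖ ≤ ‖z - z'‖ := norm_snd_le (z - z')
      have h7 : 0 ≤ K * ((θ + 1) ^ 2 + (θ + 1)) := by positivity
      have h8 : 0 ≤ ‖z - z'‖ := norm_nonneg _
      constructor
      · refine h6.trans ?_
        nlinarith
      · refine h4.trans ?_
        calc K * ((θ + 1) ^ 2 * ‖z.1 - z'.1‖ + (θ + 1) * ‖z.2 - z'.2‖)
            ≤ K * ((θ + 1) ^ 2 * ‖z - z'‖ + (θ + 1) * ‖z - z'‖) := by gcongr
          _ = K * ((θ + 1) ^ 2 + (θ + 1)) * ‖z - z'‖ := by ring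
          _ ≤ _ := by
            gcongr
            linarith
    have hwb : ∀ᶠ τ in 𝓝 t, w τ ∈ Metric.closedBall e₀ a := by
      refine hwt.eventually (Metric.isOpen_ball.mem_nhds ?_ |> fun h =>
        mem_of_superset h Metric.ball_subset_closedBall)
      rw [hwu t h1]
      exact lt_of_le_of_lt (hs.mem t) hba
    have hw'b : ∀ᶠ τ in 𝓝 t, deriv w τ ∈ Metric.closedBall (0 : Model d) (θ + 1) := by
      refine hw't.eventually (Metric.isOpen_ball.mem_nhds ?_ |> fun h =>
        mem_of_superset h Metric.ball_subset_closedBall)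
      rw [h2, mem_ball_zero_iff]
      linarith [hs.norm_le t]
    have huniq := ODE_solution_unique_of_eventually (v := fun _ => F) (s := fun _ => D)
      (f := fun τ => (w τ, deriv w τ)) (g := fun τ => (u τ, c τ)) (t₀ := t)
      (Eventually.of_forall fun _ => hF)
      (by
        filter_upwards [hsol, hwb, hw'b] with τ h3 h4 h5
        exact ⟨h3.1.prodMk h3.2, h4, h5⟩)
      (by
        filter_upwards [isOpen_Ioo.mem_nhds hI2] with τ h3
        exact ⟨(hs.hasDerivAt τ h3).prodMk (hs.hasDerivAt' τ h3),
          Metric.closedBall_subset_closedBall hba.le (hs.mem τ),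
          mem_closedBall_zero_iff.2 ((hs.norm_le τ).trans (by linarith))⟩)
      (by simp only [hwu t h1, h2])
    refine nhdsWithin_le_nhds ?_
    filter_upwards [huniq, hs1] with τ h3 h4
    have h5 : w τ = u τ := congrArg Prod.fst h3
    refine ⟨?_, congrArg Prod.snd h3⟩
    rw [← h5]
    exact ((extChartAt (𝓡 d) q).left_inv h4).symm

/-- The acceleration is a continuous function of time, by the Lipschitz bound on `Γ`; so the
velocity is C¹ and the position C². -/
theorem IsLipschitzSpray.IsSolution.contDiffAt {E : Type*} [NormedAddCommGroup E]
    [NormedSpace ℝ E] [CompleteSpace E] {Γ : E → E → E} {e₀ : E} {a K b θ : ℝ}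
    (hS : IsLipschitzSpray Γ e₀ a K) (hba : b ≤ a) (hθ : 0 < θ) {x v : E} {u c : ℝ → E}
    (hs : IsLipschitzSpray.IsSolution Γ e₀ b θ x v u c) {t : ℝ} (ht : t ∈ Ioo (-1 : ℝ) 2) :
    ContDiffAt ℝ 2 u t := by
  have hΓ : ContinuousOn (fun τ => Γ (u τ) (c τ)) (Ioo (-1) 2) := fun τ hτ => by
    refine ContinuousAt.continuousWithinAt ?_
    have h1 : Tendsto (fun s => K * (θ ^ 2 * ‖u s - u τ‖ + θ * ‖c s - c τ‖)) (𝓝 τ) (𝓝 0) := by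
      have hu : ContinuousAt u τ := (hs.hasDerivAt τ hτ).continuousAt
      have hc : ContinuousAt c τ := (hs.hasDerivAt' τ hτ).continuousAt
      have h2 : ContinuousAt (fun s => K * (θ ^ 2 * ‖u s - u τ‖ + θ * ‖c s - c τ‖)) τ := by
        fun_prop
      simpa [ContinuousAt] using h2
    rw [ContinuousAt, tendsto_iff_norm_sub_tendsto_zero]
    refine squeeze_zero (fun _ => norm_nonneg _) (fun s => ?_) h1
    exact hS.lipschitz _ (Metric.closedBall_subset_closedBall hba (hs.mem s)) _
      (Metric.closedBall_subset_closedBall hba (hs.mem τ)) _ _ θ hθ (hs.norm_le s) (hs.norm_le τ)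
  have hc : ContDiffOn ℝ 1 c (Ioo (-1) 2) := by
    rw [show (1 : ℕ∞ω) = 0 + 1 by simp, contDiffOn_succ_iff_deriv_of_isOpen isOpen_Ioo]
    refine ⟨fun τ hτ => (hs.hasDerivAt' τ hτ).differentiableAt.differentiableWithinAt, by simp, ?_⟩
    rw [contDiffOn_zero]
    exact hΓ.congr fun τ hτ => (hs.hasDerivAt' τ hτ).deriv
  have hu : ContDiffOn ℝ 2 u (Ioo (-1) 2) := by
    rw [show (2 : ℕ∞ω) = 1 + 1 by norm_num, contDiffOn_succ_iff_deriv_of_isOpen isOpen_Ioo]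
    exact ⟨fun τ hτ => (hs.hasDerivAt τ hτ).differentiableAt.differentiableWithinAt, by simp,
      hc.congr fun τ hτ => (hs.hasDerivAt τ hτ).deriv⟩
  exact hu.contDiffAt (isOpen_Ioo.mem_nhds ht)

/-- A solution of the geodesic equation in a chart is a geodesic. -/
theorem isGeodesicOn_of_isSolution {q : M} {e₀ : Model d} {a K b θ : ℝ}
    (hS : IsLipschitzSpray (spray (metricForm q)) e₀ a K) (hba : b ≤ a) (hθ : 0 < θ)
    (hsub : Metric.closedBall e₀ b ⊆ (extChartAt (𝓡 d) q).target) {x v : Model d}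
    {u c : ℝ → Model d}
    (hs : IsLipschitzSpray.IsSolution (spray (metricForm q)) e₀ b θ x v u c) :
    IsGeodesicOn (d := d) (fun t => (extChartAt (𝓡 d) q).symm (u t)) (Ioo (-1) 2) := by
  intro t ht
  have hut : ∀ t, u t ∈ (extChartAt (𝓡 d) q).target := fun t => hsub (hs.mem t)
  have heq : (fun τ => extChartAt (𝓡 d) q ((extChartAt (𝓡 d) q).symm (u τ))) = u :=
    funext fun τ => (extChartAt (𝓡 d) q).right_inv (hut τ)
  refine ⟨ContinuousAt.comp (g := (extChartAt (𝓡 d) q).symm)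
    (continuousAt_extChartAt_symm'' (hut t)) (hs.hasDerivAt t ht).continuousAt, q, ?_, ?_⟩
  · rw [← extChartAt_source (𝓡 d)]
    exact (extChartAt (𝓡 d) q).map_target (hut t)
  · simp only [heq]
    refine ⟨hs.contDiffAt hS hba hθ ht, fun z => ?_⟩
    have h1 : deriv u t = c t := (hs.hasDerivAt t ht).deriv
    have h2 : deriv (deriv u) t = spray (metricForm q) (u t) (c t) := by
      have : deriv u =ᶠ[𝓝 t] c := by
        filter_upwards [isOpen_Ioo.mem_nhds ht] with τ hτ using (hs.hasDerivAt τ hτ).deriv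
      rw [this.deriv_eq]
      exact (hs.hasDerivAt' t ht).deriv
    have hG := (contDiffAt_metricForm (hut t)).differentiableAt (by simp)
    have h3 := (eulerLagrange_eq_zero_iff (fun v hv => metricForm_pos q (hut t) hv) (c t)
      (spray (metricForm q) (u t) (c t))).2 rfl z
    rw [eulerLagrange, ← fderiv_bilin_apply hG, ← fderiv_bilin_apply hG] at h3
    rw [(extChartAt (𝓡 d) q).right_inv (hut t), h1, h2]
    exact h3

/-- The exponential map in a chart. -/
theorem exists_chart_exp (q : M) : ∃ (Ex : Model d → Model d → Model d) (b δ₀ C : ℝ),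
    0 < b ∧ 0 < δ₀ ∧ 0 < C ∧
    Metric.closedBall (extChartAt (𝓡 d) q q) b ⊆ (extChartAt (𝓡 d) q).target ∧
    (∀ x x' v v' δ, ‖x - extChartAt (𝓡 d) q q‖ ≤ b → ‖x' - extChartAt (𝓡 d) q q‖ ≤ b →
      ‖v‖ ≤ δ → ‖v'‖ ≤ δ → 0 < δ → δ ≤ δ₀ →
      ‖(Ex x v - x - v) - (Ex x' v' - x' - v')‖ ≤ C * δ * (‖x - x'‖ + ‖v - v'‖)) ∧
    (∀ x, ‖x - extChartAt (𝓡 d) q q‖ ≤ b → Ex x 0 = x) ∧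
    ∀ x v, ‖x - extChartAt (𝓡 d) q q‖ ≤ b → ‖v‖ ≤ δ₀ → Ex x v ∈ (extChartAt (𝓡 d) q).target ∧
      ∀ y, IsExp (d := d) ((extChartAt (𝓡 d) q).symm x)
        (chartVector q ((extChartAt (𝓡 d) q).symm x) v) y ↔
          y = (extChartAt (𝓡 d) q).symm (Ex x v) := by
  have hq := mem_extChartAt_target (I := 𝓡 d) q
  obtain ⟨a, K, ha, hK, hS⟩ := exists_isLipschitzSpray (contDiffAt_metricForm hq)
    fun v hv => metricForm_pos q hq hv
  obtain ⟨b₁, hb₁, hsub⟩ := Metric.nhds_basis_closedBall.mem_iff.1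
    (extChartAt_target_mem_nhds (I := 𝓡 d) q)
  set b := min (min b₁ (a / 2)) 1 with hb
  have hb0 : 0 < b := by positivity
  have hbb : b ≤ b₁ := (min_le_left _ _).trans (min_le_left _ _)
  have hba : b < a := ((min_le_left _ _).trans (min_le_right _ _)).trans_lt (by linarith)
  have hsub' : Metric.closedBall (extChartAt (𝓡 d) q q) b ⊆ (extChartAt (𝓡 d) q).target :=
    (Metric.closedBall_subset_closedBall hbb).trans hsub
  obtain ⟨Ex, δ₀, C, hδ₀, hC, -, hex, hdiff, hzero⟩ := hS.exists_exp hK hb0 hba.le (min_le_right _ _)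
  refine ⟨Ex, b / 2, δ₀, C, by positivity, hδ₀, hC,
    (Metric.closedBall_subset_closedBall (by linarith)).trans hsub', hdiff, hzero, ?_⟩
  intro x v hx hv
  obtain ⟨u, c, θ, hθ, hs, hE⟩ := hex x v hx hv
  have hxt : x ∈ (extChartAt (𝓡 d) q).target := by
    rw [← hs.pos]; exact hsub' (hs.mem 0)
  have hxs := (extChartAt (𝓡 d) q).map_target hxt
  set p := (extChartAt (𝓡 d) q).symm x with hp
  have hut : ∀ t, u t ∈ (extChartAt (𝓡 d) q).target := fun t => hsub' (hs.mem t)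
  rw [hE]
  refine ⟨hut 1, fun y => ⟨?_, ?_⟩⟩
  · rintro ⟨γ, ε, hε, hγ, h0, hv0, h1⟩
    rw [← h1]
    refine hγ.eq_of_isSolution hS hK hba hθ hsub' hs hε h0 ?_ 1 (right_mem_Icc.2 zero_le_one)
    have h2 : γ 0 ∈ (extChartAt (𝓡 d) p).source := by rw [h0]; exact mem_extChartAt_source p
    have h3 : γ 0 ∈ (extChartAt (𝓡 d) q).source := by rw [h0]; exact hxs
    have h4 := HasDerivAt.coordChange (hγ 0 ⟨by linarith, by linarith⟩).1 h2 h3 hv0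
    rw [h0] at h4
    exact h4.congr_deriv (tangentCoordChange_symm_apply (mem_extChartAt_source p) hxs v)
  · rintro rfl
    refine ⟨fun t => (extChartAt (𝓡 d) q).symm (u t), 1, one_pos, ?_,
      congrArg (extChartAt (𝓡 d) q).symm hs.pos, ?_, rfl⟩
    · rw [one_add_one_eq_two]
      exact isGeodesicOn_of_isSolution hS hba.le hθ hsub' hs
    · have h0 : (extChartAt (𝓡 d) q).symm (u 0) = p := by rw [hs.pos]
      have h2 : HasDerivAt (fun t => extChartAt (𝓡 d) q ((extChartAt (𝓡 d) q).symm (u t))) v 0 := by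
        have heq : (fun τ => extChartAt (𝓡 d) q ((extChartAt (𝓡 d) q).symm (u τ))) = u :=
          funext fun τ => (extChartAt (𝓡 d) q).right_inv (hut τ)
        rw [heq, ← hs.vel]
        exact hs.hasDerivAt 0 (by norm_num)
      have hc : ContinuousAt (fun t => (extChartAt (𝓡 d) q).symm (u t)) 0 :=
        ContinuousAt.comp (g := (extChartAt (𝓡 d) q).symm)
          (continuousAt_extChartAt_symm'' (hut 0)) (hs.hasDerivAt 0 (by norm_num)).continuousAt
      have h4 := HasDerivAt.coordChange (q := p) hc ((extChartAt (𝓡 d) q).map_target (hut 0))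
        (by rw [h0]; exact mem_extChartAt_source p) h2
      rw [h0] at h4
      exact h4

end Metric


/-! ### Comparison of the Riemannian distance with the chart norm. -/

section Distance

variable {d : ℕ} {M : Type*} [EMetricSpace M] [ChartedSpace (Model d) M]
  [IsManifold (𝓡 d) ∞ M] [RiemannianBundle (fun x : M => TangentSpace (𝓡 d) x)]

theorem norm_chartVector_le (p : M) {x : M} (hx : x ∈ (extChartAt (𝓡 d) p).source) {C : ℝ}
    (hC : 0 ≤ C) (hm : ‖metricForm p (extChartAt (𝓡 d) p x)‖ ≤ C ^ 2) (a : Model d) :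
    ‖chartVector p x a‖ ≤ C * ‖a‖ := by
  refine abs_le_of_sq_le_sq' ?_ (by positivity) |>.2
  rw [← real_inner_self_eq_norm_sq, ← metricForm_extChartAt p hx, mul_pow]
  refine (le_abs_self _).trans (((metricForm p (extChartAt (𝓡 d) p x)).le_opNorm₂ a a).trans ?_)
  rw [mul_assoc, ← sq]
  gcongr

theorem fderiv_lineMap_apply_one {E : Type*} [NormedAddCommGroup E] [NormedSpace ℝ E] (u v : E)
    (t : ℝ) : fderiv ℝ (ContinuousAffineMap.lineMap (R := ℝ) u v) t 1 = v - u := by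
  simp

variable [IsContMDiffRiemannianBundle (𝓡 d) ∞ (Model d) (fun x : M => TangentSpace (𝓡 d) x)]
  [IsRiemannianManifold (𝓡 d) M]

theorem mfderivWithin_extChartAt_symm_comp_lineMap (p : M) {u v : Model d} {t : ℝ}
    (ht : t ∈ Icc (0 : ℝ) 1)
    (h : ∀ t ∈ Icc (0 : ℝ) 1, AffineMap.lineMap (k := ℝ) u v t ∈ (extChartAt (𝓡 d) p).target) :
    mfderivWithin 𝓘(ℝ) (𝓡 d)
      ((extChartAt (𝓡 d) p).symm ∘ ContinuousAffineMap.lineMap (R := ℝ) u v) (Icc 0 1) t 1 =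
    chartVector p ((extChartAt (𝓡 d) p).symm (AffineMap.lineMap (k := ℝ) u v t)) (v - u) := by
  have hη : ContMDiff 𝓘(ℝ) 𝓘(ℝ, Model d) 1 (ContinuousAffineMap.lineMap (R := ℝ) u v) := by
    rw [contMDiff_iff_contDiff]
    exact ContinuousAffineMap.contDiff _
  have h2 := mfderivWithin_comp (I := 𝓘(ℝ)) (I' := 𝓘(ℝ, Model d)) (I'' := 𝓡 d) (u := range (𝓡 d))
    (f := ContinuousAffineMap.lineMap (R := ℝ) u v) (s := Icc 0 1) t
    (mdifferentiableWithinAt_extChartAt_symm (I := 𝓡 d) (h t ht))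
    (hη.contMDiffOn.mdifferentiableOn one_ne_zero t ht)
    (fun t _ => by rw [ModelWithCorners.range_eq_univ]; trivial)
    (by
      rw [uniqueMDiffWithinAt_iff_uniqueDiffWithinAt]
      exact uniqueDiffOn_Icc zero_lt_one t ht)
  rw [h2]
  have hs := (extChartAt (𝓡 d) p).map_target (h t ht)
  have h3 := TangentBundle.symmL_trivializationAt (I := 𝓡 d) (x₀ := p)
    (x := (extChartAt (𝓡 d) p).symm (AffineMap.lineMap (k := ℝ) u v t))
    (by rwa [extChartAt_source] at hs)
  rw [(extChartAt (𝓡 d) p).right_inv (h t ht)] at h3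
  rw [chartVector_eq_symm p hs, h3]
  have h4 : mfderivWithin 𝓘(ℝ) 𝓘(ℝ, Model d) (ContinuousAffineMap.lineMap (R := ℝ) u v)
      (Icc 0 1) t 1 = v - u := by
    rw [mfderivWithin_eq_fderivWithin,
      fderivWithin_eq_fderiv (uniqueDiffOn_Icc zero_lt_one _ ht)
        (ContinuousAffineMap.differentiableAt _)]
    exact fderiv_lineMap_apply_one u v t
  exact congrArg _ h4

/-- The inverse of a chart is locally Lipschitz. -/
theorem exists_edist_extChartAt_symm_le (p : M) : ∃ C R : ℝ, 0 < C ∧ 0 < R ∧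
    ∀ u ∈ Metric.ball (extChartAt (𝓡 d) p p) R, ∀ v ∈ Metric.ball (extChartAt (𝓡 d) p p) R,
      edist ((extChartAt (𝓡 d) p).symm u) ((extChartAt (𝓡 d) p).symm v)
        ≤ ENNReal.ofReal (C * ‖u - v‖) := by
  set C := ‖metricForm (d := d) p (extChartAt (𝓡 d) p p)‖ + 1 with hC
  have hC1 : 1 ≤ C := le_add_of_nonneg_left (norm_nonneg _)
  have hev : ∀ᶠ u in 𝓝 (extChartAt (𝓡 d) p p),
      u ∈ (extChartAt (𝓡 d) p).target ∧ ‖metricForm (d := d) p u‖ ≤ C ^ 2 := by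
    have h1 : ContinuousAt (fun u => ‖metricForm (d := d) p u‖) (extChartAt (𝓡 d) p p) :=
      (contDiffAt_metricForm (mem_extChartAt_target p)).continuousAt.norm
    filter_upwards [h1.eventually (gt_mem_nhds (lt_add_one _)),
      extChartAt_target_mem_nhds (I := 𝓡 d) p] with u hu hu'
    exact ⟨hu', hu.le.trans (by nlinarith)⟩
  obtain ⟨R, hR, hsub⟩ := Metric.mem_nhds_iff.1 hev
  refine ⟨C, R, by positivity, hR, fun u hu v hv => ?_⟩
  have hη : ∀ t ∈ Icc (0 : ℝ) 1, AffineMap.lineMap (k := ℝ) u v t ∈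
      Metric.ball (extChartAt (𝓡 d) p p) R := fun t ht =>
    (convex_ball _ _).segment_subset hu hv (by
      rw [segment_eq_image_lineMap]; exact mem_image_of_mem _ ht)
  -- The preimage of the straight segment is a competitor for the distance; its speed is at most `C`
  -- times the length of the segment.
  have h1 : riemannianEDist (𝓡 d) ((extChartAt (𝓡 d) p).symm u) ((extChartAt (𝓡 d) p).symm v)
      ≤ pathELength (𝓡 d)
        ((extChartAt (𝓡 d) p).symm ∘ ContinuousAffineMap.lineMap (R := ℝ) u v) 0 1 := by
    apply riemannianEDist_le_pathELength _ _ _ zero_le_one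
    · refine (contMDiffOn_extChartAt_symm p).comp (t := (extChartAt (𝓡 d) p).target)
        (ContMDiff.contMDiffOn ?_) fun t ht => (hsub (hη t ht)).1
      rw [contMDiff_iff_contDiff]
      exact ContinuousAffineMap.contDiff _
    · simp [ContinuousAffineMap.coe_lineMap_eq]
    · simp [ContinuousAffineMap.coe_lineMap_eq]
  rw [IsRiemannianManifold.out (I := 𝓡 d)]
  refine h1.trans ?_
  rw [pathELength_eq_lintegral_mfderivWithin_Icc]
  refine (setLIntegral_mono' (g := fun _ => ENNReal.ofReal (C * ‖u - v‖)) measurableSet_Icc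
    fun t ht ↦ ?_).trans ?_
  · have h2 : ‖chartVector p ((extChartAt (𝓡 d) p).symm (AffineMap.lineMap (k := ℝ) u v t))
        (v - u)‖ ≤ C * ‖u - v‖ := by
      rw [norm_sub_rev u v]
      refine norm_chartVector_le p ((extChartAt (𝓡 d) p).map_target (hsub (hη t ht)).1)
        (by positivity) ?_ _
      rw [(extChartAt (𝓡 d) p).right_inv (hsub (hη t ht)).1]
      exact (hsub (hη t ht)).2
    have h3 : ‖chartVector p ((extChartAt (𝓡 d) p).symm (AffineMap.lineMap (k := ℝ) u v t))
        (v - u)‖ₑ ≤ ENNReal.ofReal (C * ‖u - v‖) := by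
      rw [← ofReal_norm]
      exact ENNReal.ofReal_le_ofReal h2
    rw [mfderivWithin_extChartAt_symm_comp_lineMap p ht fun t ht => (hsub (hη t ht)).1]
    exact h3
  · simp

end Distance

/-! ### Singularities and linearizations in different charts. -/

section Linearization

variable {d : ℕ} {M : Type*} [TopologicalSpace M] [ChartedSpace (Model d) M]
  [IsManifold (𝓡 d) ∞ M]

theorem coordField_eq_zero_iff {Y : ∀ x : M, TangentSpace (𝓡 d) x} (p : M) {x : M}
    (hx : x ∈ (extChartAt (𝓡 d) p).source) :
    coordField Y p (extChartAt (𝓡 d) p x) = 0 ↔ Y x = 0 := by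
  rw [← chartVector_coordField (Y := Y) p hx]
  refine ⟨fun h => ?_, fun h => chartVector_eq_zero hx h⟩
  rw [h]
  exact (tangentCoordChange (𝓡 d) p x x).map_zero

theorem coordField_coordChange {Y : ∀ x : M, TangentSpace (𝓡 d) x} {p q x : M}
    (hp : x ∈ (extChartAt (𝓡 d) p).source) (hq : x ∈ (extChartAt (𝓡 d) q).source) :
    coordField Y q (coordChange p q (extChartAt (𝓡 d) p x)) =
      fderiv ℝ (coordChange p q) (extChartAt (𝓡 d) p x)
        (coordField Y p (extChartAt (𝓡 d) p x)) := by
  rw [(hasFDerivAt_coordChange hp hq).fderiv, coordChange_apply_extChartAt hp]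
  simp only [coordField]
  rw [(extChartAt (𝓡 d) p).left_inv hp, (extChartAt (𝓡 d) q).left_inv hq]
  exact (tangentCoordChange_comp (I := 𝓡 d) (v := (show Model d from Y x))
    ⟨⟨mem_extChartAt_source x, hp⟩, hq⟩).symm

theorem differentiableAt_coordField {Y : ∀ x : M, TangentSpace (𝓡 d) x} (hY : IsC1VectorField Y)
    {p : M} {u : Model d} (hu : u ∈ (extChartAt (𝓡 d) p).target) :
    DifferentiableAt ℝ (coordField Y p) u :=
  ((contDiffOn_coordField hY p).contDiffAt
    ((isOpen_extChartAt_target p).mem_nhds hu)).differentiableAt (by simp)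

/-- The linearization at a singularity does not depend on the chart, up to conjugation. -/
theorem linearization_tangentCoordChange {Y : ∀ x : M, TangentSpace (𝓡 d) x}
    (hY : IsC1VectorField Y) {p q : M} (hp : q ∈ (extChartAt (𝓡 d) p).source) (h0 : Y q = 0)
    (v : Model d) :
    linearization Y q (tangentCoordChange (𝓡 d) p q q v) =
      tangentCoordChange (𝓡 d) p q q
        (fderiv ℝ (coordField Y p) (extChartAt (𝓡 d) p q) v) := by
  have hq := mem_extChartAt_source (I := 𝓡 d) q
  have hψ : ContDiffAt ℝ 2 (coordChange p q) (extChartAt (𝓡 d) p q) :=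
    (contDiffAt_coordChange hp hq).of_le ENat.LEInfty.out
  have hψ2 : HasFDerivAt (fderiv ℝ (coordChange p q))
      (fderiv ℝ (fderiv ℝ (coordChange p q)) (extChartAt (𝓡 d) p q)) (extChartAt (𝓡 d) p q) :=
    ((hψ.fderiv_right (m := 1) (by norm_num)).differentiableAt (by simp)).hasFDerivAt
  have hYp : HasFDerivAt (coordField Y p)
      (fderiv ℝ (coordField Y p) (extChartAt (𝓡 d) p q)) (extChartAt (𝓡 d) p q) :=
    (differentiableAt_coordField hY ((extChartAt (𝓡 d) p).map_source hp)).hasFDerivAt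
  have hYq : HasFDerivAt (coordField Y q)
      (fderiv ℝ (coordField Y q) (extChartAt (𝓡 d) q q))
      (coordChange p q (extChartAt (𝓡 d) p q)) := by
    rw [coordChange_apply_extChartAt hp]
    exact (differentiableAt_coordField hY ((extChartAt (𝓡 d) q).map_source hq)).hasFDerivAt
  have h1 := hYq.comp _ (hasFDerivAt_coordChange hp hq)
  have h2 := hψ2.clm_apply hYp
  have hev : (coordField Y q ∘ coordChange p q) =ᶠ[𝓝 (extChartAt (𝓡 d) p q)] fun u =>
      fderiv ℝ (coordChange p q) u (coordField Y p u) := by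
    have h3 : (extChartAt (𝓡 d) p).target ∩
        (extChartAt (𝓡 d) p).symm ⁻¹' (extChartAt (𝓡 d) q).source ∈
          𝓝 (extChartAt (𝓡 d) p q) := by
      refine inter_mem (extChartAt_target_mem_nhds' ((extChartAt (𝓡 d) p).map_source hp)) ?_
      refine (continuousAt_extChartAt_symm' hp).preimage_mem_nhds ?_
      rw [(extChartAt (𝓡 d) p).left_inv hp]
      exact (isOpen_extChartAt_source q).mem_nhds hq
    filter_upwards [h3] with u hu
    have := coordField_coordChange (Y := Y) ((extChartAt (𝓡 d) p).map_target hu.1) hu.2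
    rwa [(extChartAt (𝓡 d) p).right_inv hu.1] at this
  -- The identity Y_q ∘ ψ = Dψ · Y_p is differentiated at the singularity; the term with D²ψ is
  -- multiplied by Y_p, which vanishes there.
  have h4 := h1.unique (h2.congr_of_eventuallyEq hev)
  have h5 := congrArg (fun L : Model d →L[ℝ] Model d => L v) h4
  have h6 : coordField Y p (extChartAt (𝓡 d) p q) = 0 := (coordField_eq_zero_iff p hp).2 h0
  simp only [ContinuousLinearMap.comp_apply, h6,
    map_zero, add_zero, (hasFDerivAt_coordChange hp hq).fderiv] at h5
  exact h5

/-- A coordinate change of the tangent space, as an isomorphism. -/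
def tangentEquiv {p q x : M} (hp : x ∈ (extChartAt (𝓡 d) p).source)
    (hq : x ∈ (extChartAt (𝓡 d) q).source) : Model d ≃L[ℝ] Model d :=
  ContinuousLinearEquiv.equivOfInverse (tangentCoordChange (𝓡 d) p q x)
    (tangentCoordChange (𝓡 d) q p x) (tangentCoordChange_symm_apply hq hp)
    (tangentCoordChange_symm_apply hp hq)

end Linearization


/-! ### Gronwall estimates for orbits of a Lipschitz field. -/

section Orbits

variable {E : Type*} [NormedAddCommGroup E] [NormedSpace ℝ E]

/-- `u` solves `u' = F u` and stays in `W` during the times of `I`. -/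
def IsOrbitOn (F : E → E) (W : Set E) (u : ℝ → E) (I : Set ℝ) : Prop :=
  ∀ t ∈ I, HasDerivAt u (F (u t)) t ∧ u t ∈ W

namespace IsOrbitOn

variable {F : E → E} {W : Set E} {u v : ℝ → E} {I J : Set ℝ} {Λ : ℝ}

theorem mono (h : IsOrbitOn F W u I) (hJ : J ⊆ I) : IsOrbitOn F W u J := fun t ht => h t (hJ ht)

theorem const {p : E} (hp : F p = 0) (hW : p ∈ W) (I : Set ℝ) : IsOrbitOn F W (fun _ => p) I :=
  fun t _ => ⟨by rw [hp]; exact hasDerivAt_const t p, hW⟩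

theorem neg (h : IsOrbitOn F W u I) :
    IsOrbitOn (fun x => -F x) W (fun t => u (-t)) {t | -t ∈ I} := fun t ht => by
  refine ⟨?_, (h (-t) ht).2⟩
  have := (h (-t) ht).1.scomp t (hasDerivAt_neg t)
  simpa [Function.comp_def] using this

theorem continuousOn (h : IsOrbitOn F W u I) : ContinuousOn u I := fun t ht =>
  (h t ht).1.continuousAt.continuousWithinAt

theorem norm_sub_le_Icc (hΛ : 0 ≤ Λ) (hF : ∀ x ∈ W, ∀ y ∈ W, ‖F x - F y‖ ≤ Λ * ‖x - y‖) {a b : ℝ}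
    (hu : IsOrbitOn F W u (Icc a b)) (hv : IsOrbitOn F W v (Icc a b)) {t : ℝ} (ht : t ∈ Icc a b) :
    ‖u t - v t‖ ≤ Real.exp (Λ * (t - a)) * ‖u a - v a‖ := by
  have hlip : LipschitzOnWith (Real.toNNReal Λ) F W := LipschitzOnWith.of_dist_le_mul
    fun x hx y hy => by
      rw [dist_eq_norm, dist_eq_norm, Real.coe_toNNReal _ hΛ]; exact hF x hx y hy
  have := dist_le_of_trajectories_ODE_of_mem (v := fun _ => F) (s := fun _ => W)
    (δ := ‖u a - v a‖) (fun _ _ => hlip) hu.continuousOn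
    (fun t ht => (hu t (Ico_subset_Icc_self ht)).1.hasDerivWithinAt)
    (fun t ht => (hu t (Ico_subset_Icc_self ht)).2) hv.continuousOn
    (fun t ht => (hv t (Ico_subset_Icc_self ht)).1.hasDerivWithinAt)
    (fun t ht => (hv t (Ico_subset_Icc_self ht)).2) (dist_eq_norm _ _).le t ht
  rwa [dist_eq_norm, Real.coe_toNNReal _ hΛ, mul_comm] at this

theorem norm_sub_le (hΛ : 0 ≤ Λ) (hF : ∀ x ∈ W, ∀ y ∈ W, ‖F x - F y‖ ≤ Λ * ‖x - y‖) {s t : ℝ}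
    (hu : IsOrbitOn F W u (uIcc s t)) (hv : IsOrbitOn F W v (uIcc s t)) :
    ‖u t - v t‖ ≤ Real.exp (Λ * |t - s|) * ‖u s - v s‖ := by
  rcases le_total s t with h | h
  · rw [uIcc_of_le h] at hu hv
    rw [abs_of_nonneg (sub_nonneg.2 h)]
    exact norm_sub_le_Icc hΛ hF hu hv (right_mem_Icc.2 h)
  · rw [uIcc_of_ge h] at hu hv
    rw [abs_of_nonpos (sub_nonpos.2 h)]
    have hsub : Icc (-s) (-t) ⊆ {τ | -τ ∈ Icc t s} := fun τ hτ =>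
      ⟨by linarith [hτ.2], by linarith [hτ.1]⟩
    have := norm_sub_le_Icc hΛ (F := fun x => -F x)
      (fun x hx y hy => by
        rw [neg_sub_neg, norm_sub_rev]; exact hF x hx y hy)
      (hu.neg.mono hsub) (hv.neg.mono hsub) (right_mem_Icc.2 (neg_le_neg h))
    simp only [neg_neg] at this
    rwa [show -(t - s) = -t - -s by ring]

/-- The speed exceeds its initial value by at most Λ times the displacement, so Gronwall applies to
the displacement; the factor 2 comes from e^x - 1 ≤ 2x on [0, 1]. The bound is relative to the
initial speed, which matters near a singularity. -/
theorem norm_step_le_Icc (hΛ : 0 < Λ) (hF : ∀ x ∈ W, ∀ y ∈ W, ‖F x - F y‖ ≤ Λ * ‖x - y‖) {a b : ℝ}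
    (hab : a ≤ b) (hu : IsOrbitOn F W u (Icc a b)) (h1 : Λ * (b - a) ≤ 1) :
    ‖u b - u a‖ ≤ 2 * (b - a) * ‖F (u a)‖ := by
  have := norm_le_gronwallBound_of_norm_deriv_right_le (f := fun t => u t - u a)
    (f' := fun t => F (u t)) (δ := 0) (K := Λ) (ε := ‖F (u a)‖) (a := a) (b := b)
    (hu.continuousOn.sub continuousOn_const)
    (fun t ht => ((hu t (Ico_subset_Icc_self ht)).1.sub_const (u a)).hasDerivWithinAt)
    (by simp) (fun t ht => by
      have h2 := hF _ (hu t (Ico_subset_Icc_self ht)).2 _ (hu a (left_mem_Icc.2 hab)).2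
      have h3 := norm_add_le (F (u t) - F (u a)) (F (u a))
      rw [sub_add_cancel] at h3
      linarith) b (right_mem_Icc.2 hab)
  refine this.trans ?_
  rw [gronwallBound_of_K_ne_0 hΛ.ne']
  simp only [zero_mul, zero_add]
  set x := Λ * (b - a) with hx
  have hx0 : 0 ≤ x := mul_nonneg hΛ.le (sub_nonneg.2 hab)
  have h4 : Real.exp x - 1 ≤ 2 * x := by
    have := Real.abs_exp_sub_one_le (x := x) (by rwa [abs_of_nonneg hx0])
    rw [abs_of_nonneg hx0] at this
    exact (le_abs_self _).trans this
  calc ‖F (u a)‖ / Λ * (Real.exp x - 1) ≤ ‖F (u a)‖ / Λ * (2 * x) := by gcongr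
    _ = _ := by rw [hx]; field_simp

theorem norm_step_le (hΛ : 0 < Λ) (hF : ∀ x ∈ W, ∀ y ∈ W, ‖F x - F y‖ ≤ Λ * ‖x - y‖) {s t : ℝ}
    (hu : IsOrbitOn F W u (uIcc s t)) (h1 : Λ * |t - s| ≤ 1) :
    ‖u t - u s‖ ≤ 2 * |t - s| * ‖F (u s)‖ := by
  rcases le_total s t with h | h
  · rw [uIcc_of_le h] at hu
    rw [abs_of_nonneg (sub_nonneg.2 h)] at h1 ⊢
    exact norm_step_le_Icc hΛ hF h hu h1
  · rw [uIcc_of_ge h] at hu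
    rw [abs_of_nonpos (sub_nonpos.2 h), show -(t - s) = -t - -s by ring] at h1 ⊢
    have hsub : Icc (-s) (-t) ⊆ {τ | -τ ∈ Icc t s} := fun τ hτ =>
      ⟨by linarith [hτ.2], by linarith [hτ.1]⟩
    have := norm_step_le_Icc hΛ (F := fun x => -F x)
      (fun x hx y hy => by
        rw [neg_sub_neg, norm_sub_rev]; exact hF x hx y hy) (neg_le_neg h) (hu.neg.mono hsub) h1
    simpa only [neg_neg, norm_neg] using this

/-- If the speed is almost constant then so is the velocity vector. -/
theorem norm_sub_smul_le {a b C : ℝ} {w : E} (hab : a ≤ b) (hu : IsOrbitOn F W u (Icc a b))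
    (hC : ∀ t ∈ Icc a b, ‖F (u t) - w‖ ≤ C) : ‖u b - u a - (b - a) • w‖ ≤ C * (b - a) := by
  have := norm_image_sub_le_of_norm_deriv_le_segment' (f := fun t => u t - (t - a) • w)
    (f' := fun t => F (u t) - w) (C := C) (a := a) (b := b)
    (fun t ht => by
      have h1 := (hu t ht).1.sub (((hasDerivAt_id t).sub_const a).smul_const w)
      rw [one_smul] at h1
      exact h1.hasDerivWithinAt)
    (fun t ht => hC t (Ico_subset_Icc_self ht)) b (right_mem_Icc.2 hab)
  simpa [sub_right_comm] using this

end IsOrbitOn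

/-- A transitive relation that holds for short steps holds for all steps. -/
theorem forall_of_short_steps {R : ℝ → ℝ → Prop} {a b τ : ℝ} (hτ : 0 < τ)
    (htrans : ∀ s ∈ Icc a b, ∀ t ∈ Icc a b, ∀ r ∈ Icc a b, s ≤ t → t ≤ r → R s t → R t r → R s r)
    (hstep : ∀ s ∈ Icc a b, ∀ t ∈ Icc a b, s ≤ t → t - s ≤ τ → R s t) :
    ∀ s ∈ Icc a b, ∀ t ∈ Icc a b, s ≤ t → R s t := by
  have key : ∀ n : ℕ, ∀ s ∈ Icc a b, ∀ t ∈ Icc a b, s ≤ t → t - s ≤ (n + 1) * τ → R s t := by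
    intro n
    induction n with
    | zero => intro s hs t ht hst h; exact hstep s hs t ht hst (by simpa using h)
    | succ n ih =>
      intro s hs t ht hst h
      push_cast at h
      by_cases h1 : t - s ≤ τ
      · exact hstep s hs t ht hst h1
      · push Not at h1
        have hm : t - τ ∈ Icc a b := ⟨by linarith [hs.1], by linarith [ht.2]⟩
        exact htrans s hs _ hm t ht (by linarith) (by linarith)
          (ih s hs _ hm (by linarith) (by linarith)) (hstep _ hm t ht (by linarith) (by linarith))
  intro s hs t ht hst
  obtain ⟨n, hn⟩ := exists_nat_ge ((t - s) / τ)
  refine key n s hs t ht hst ?_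
  rw [div_le_iff₀ hτ] at hn
  linarith

end Orbits

/-! ### Growth of the expanding form along approximate solutions. -/

section Growth

variable {E : Type*} [NormedAddCommGroup E] [InnerProductSpace ℝ E]

theorem bilin_add_self {S : E →L[ℝ] E →L[ℝ] ℝ} (hS : ∀ v w, S v w = S w v) (x y : E) :
    S (x + y) (x + y) = S x x + 2 * S x y + S y y := by
  have h : S (x + y) = S x + S y := map_add S x y
  rw [h, add_apply, map_add, map_add, hS y x]
  ring

/-- First order expansion of the quadratic form over an approximate Euler step. Twice the pairing of
`x` with the error contributes 28 and the form at the increment 4, together the constant 32. -/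
theorem abs_bilin_step_le {B : E →L[ℝ] E} {S : E →L[ℝ] E →L[ℝ] ℝ} (hS : ∀ v w, S v w = S w v)
    {K : ℝ} (hK : 0 ≤ K) (hSK : ∀ v w, |S v w| ≤ K * ‖v‖ * ‖w‖) {Λ ε Δ : ℝ} (hΛ : 0 ≤ Λ)
    (hB : ‖B‖ ≤ Λ) (hε1 : 14 * ε ≤ 1) (hΔ : 0 ≤ Δ) (hΛΔ : Λ * Δ ≤ ε) {x x' : E}
    (he : ‖x' - x - Δ • B x‖ ≤ 14 * Λ * ε * Δ * ‖x‖) :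
    |S x' x' - (S x x + 2 * Δ * S (B x) x)| ≤ 32 * K * Λ * ε * (Δ * ‖x‖ ^ 2) := by
  set e := x' - x - Δ • B x with hedef
  set y := Δ • B x + e with hy
  have hzt : x' = x + y := by rw [hy, hedef]; abel
  have hP : 0 ≤ Λ * Δ * ‖x‖ := by positivity
  have hy1 : ‖y‖ ≤ 2 * Λ * Δ * ‖x‖ := by
    have h1 : ‖Δ • B x‖ ≤ Δ * (Λ * ‖x‖) := by
      rw [norm_smul, Real.norm_eq_abs, abs_of_nonneg hΔ]
      exact mul_le_mul_of_nonneg_left ((B.le_opNorm x).trans (by gcongr)) hΔ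
    have h2 := norm_add_le (Δ • B x) e
    nlinarith
  have hxe : ‖x‖ * ‖e‖ ≤ 14 * Λ * ε * Δ * ‖x‖ ^ 2 := by
    calc ‖x‖ * ‖e‖ ≤ ‖x‖ * (14 * Λ * ε * Δ * ‖x‖) := by gcongr
      _ = _ := by ring
  have hyy : ‖y‖ * ‖y‖ ≤ 4 * Λ * ε * Δ * ‖x‖ ^ 2 := by
    calc ‖y‖ * ‖y‖ ≤ (2 * Λ * Δ * ‖x‖) * (2 * Λ * Δ * ‖x‖) := by gcongr
      _ = 4 * Λ * (Λ * Δ) * Δ * ‖x‖ ^ 2 := by ring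
      _ ≤ 4 * Λ * ε * Δ * ‖x‖ ^ 2 := by gcongr
  have h1 : S x y = Δ * S (B x) x + S x e := by
    rw [hy, map_add, map_smul, smul_eq_mul, hS x (B x)]
  rw [hzt, bilin_add_self hS, h1]
  have h2 := hSK x e
  have h3 := hSK y y
  have h4 := mul_le_mul_of_nonneg_left hxe hK
  have h5 := mul_le_mul_of_nonneg_left hyy hK
  have h6 : S x x + 2 * (Δ * S (B x) x + S x e) + S y y - (S x x + 2 * Δ * S (B x) x)
      = 2 * S x e + S y y := by ring
  rw [h6]
  refine (abs_add_le _ _).trans ?_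
  rw [abs_mul, abs_two]
  linarith

/-- Growth of the expanding form along an approximate solution of a linear equation. -/
theorem SplitForms.growth {B : E →L[ℝ] E} {S U : E →L[ℝ] E →L[ℝ] ℝ} {ρ m K : ℝ}
    (h : SplitForms B S U ρ m K) (hρ : 0 < ρ) (hm : 0 < m) (hK : 0 < K) {Λ ε τ : ℝ} (hΛ : 1 ≤ Λ)
    (hε : 0 < ε) (hB : ‖B‖ ≤ Λ) (hsmall : 128 * K * Λ * ε ≤ ρ * m) (hε1 : 14 * ε ≤ 1) (hτ : 0 < τ)
    (hτε : Λ * τ ≤ ε) (hτρ : ρ * τ ≤ 1) {z : ℝ → E} {a b : ℝ}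
    (hz : ∀ s ∈ Icc a b, ∀ t ∈ Icc a b, s ≤ t → t - s ≤ τ →
      ‖z t - z s - (t - s) • B (z s)‖ ≤ 14 * Λ * ε * (t - s) * ‖z s‖)
    (h0 : S (z a) (z a) ≤ U (z a) (z a)) {t : ℝ} (ht : t ∈ Icc a b) :
    Real.exp (ρ / 2 * (t - a)) * U (z a) (z a) ≤ U (z t) (z t) ∧
      ρ * m / K * (t - a) * U (z a) (z a) + (U (z a) (z a) - S (z a) (z a))
        ≤ U (z t) (z t) - S (z t) (z t) := by
  -- The second inequality propagates the assumption S ≤ U to time `t`, which makes the relation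
  -- transitive; so it need only be checked for steps shorter than `τ`.
  let R : ℝ → ℝ → Prop := fun s t => S (z s) (z s) ≤ U (z s) (z s) →
    Real.exp (ρ / 2 * (t - s)) * U (z s) (z s) ≤ U (z t) (z t) ∧
      ρ * m / K * (t - s) * U (z s) (z s) + (U (z s) (z s) - S (z s) (z s))
        ≤ U (z t) (z t) - S (z t) (z t)
  suffices hR : R a t from hR h0
  have ha : a ∈ Icc a b := ⟨le_rfl, ht.1.trans ht.2⟩
  refine forall_of_short_steps (R := R) hτ ?_ ?_ a ha t ht ht.1
  · intro s _ t _ r _ hst htr h1 h2 hQ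
    obtain ⟨h3, h4⟩ := h1 hQ
    have hU := h.nonnegU (z s)
    have hc : 0 ≤ ρ * m / K := by positivity
    have hQ' : S (z t) (z t) ≤ U (z t) (z t) := by
      have : 0 ≤ ρ * m / K * (t - s) * U (z s) (z s) :=
        mul_nonneg (mul_nonneg hc (sub_nonneg.2 hst)) hU
      linarith
    obtain ⟨h5, h6⟩ := h2 hQ'
    constructor
    · calc Real.exp (ρ / 2 * (r - s)) * U (z s) (z s)
          = Real.exp (ρ / 2 * (r - t)) * (Real.exp (ρ / 2 * (t - s)) * U (z s) (z s)) := by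
            rw [← mul_assoc, ← Real.exp_add]; ring_nf
        _ ≤ Real.exp (ρ / 2 * (r - t)) * U (z t) (z t) := by gcongr
        _ ≤ _ := h5
    · have h7 : U (z s) (z s) ≤ U (z t) (z t) := by
        refine le_trans ?_ h3
        refine le_mul_of_one_le_left hU (Real.one_le_exp ?_)
        exact mul_nonneg (by positivity) (sub_nonneg.2 hst)
      have h8 : ρ * m / K * (r - t) * U (z s) (z s) ≤ ρ * m / K * (r - t) * U (z t) (z t) :=
        mul_le_mul_of_nonneg_left h7 (mul_nonneg hc (sub_nonneg.2 htr))
      have h9 : ρ * m / K * (r - s) * U (z s) (z s) = ρ * m / K * (t - s) * U (z s) (z s)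
        + ρ * m / K * (r - t) * U (z s) (z s) := by ring
      linarith
  · intro s hs t ht hst hts hQ
    set Δ := t - s with hΔ
    have hΔ0 : 0 ≤ Δ := sub_nonneg.2 hst
    set x := z s with hx
    have hΛΔ : Λ * Δ ≤ ε := (mul_le_mul_of_nonneg_left hts (by linarith)).trans hτε
    set N := ‖x‖ ^ 2 with hN
    have hN0 : 0 ≤ N := sq_nonneg _
    have hS1 := abs_bilin_step_le h.symmS hK.le h.boundS (by linarith) hB hε1 hΔ0 hΛΔ
      (hz s hs t ht hst hts)
    have hU1 := abs_bilin_step_le h.symmU hK.le h.boundU (by linarith) hB hε1 hΔ0 hΛΔ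
      (hz s hs t ht hst hts)
    rw [← hx, ← hN] at hS1 hU1
    rw [abs_le] at hS1 hU1
    have hSr := mul_le_mul_of_nonneg_left (h.rateS x) hΔ0
    have hUr := mul_le_mul_of_nonneg_left (h.rateU x) hΔ0
    have hΔN : 0 ≤ Δ * N := by positivity
    -- The error is at most a quarter of ρΔ(S + U), hence half of ρΔU as S ≤ U, and is absorbed by
    -- the gain 2ρΔU. What is left suffices because e^{ρΔ/2} ≤ 1 + ρΔ.
    have hs0 : 32 * K * Λ * ε * (Δ * N) ≤ ρ * m / 4 * (Δ * N) :=
      mul_le_mul_of_nonneg_right (by linarith) hΔN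
    have hlow := h.lower x
    have hUx := h.nonnegU x
    have hSx := h.nonnegS x
    have hρΔ : 0 ≤ ρ * Δ := by positivity
    have hlow' := mul_le_mul_of_nonneg_left hlow hρΔ
    rw [← hN] at hlow'
    have hQx : ρ * Δ * S x x ≤ ρ * Δ * U x x := mul_le_mul_of_nonneg_left hQ hρΔ
    have hρU : 0 ≤ ρ * Δ * U x x := by positivity
    constructor
    · have h1 : (1 + ρ * Δ) * U x x ≤ U (z t) (z t) := by linarith [hU1.1]
      refine le_trans (mul_le_mul_of_nonneg_right ?_ hUx) h1
      have hρΔ1 : ρ * Δ ≤ 1 := (mul_le_mul_of_nonneg_left hts hρ.le).trans hτρ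
      have := Real.abs_exp_sub_one_le (x := ρ / 2 * Δ) (by
        rw [abs_of_nonneg (by positivity)]; linarith)
      rw [abs_of_nonneg (by positivity : 0 ≤ ρ / 2 * Δ)] at this
      have := (le_abs_self _).trans this
      linarith
    · have hUN : U x x ≤ K * N := by
        have := (le_abs_self _).trans (h.boundU x x)
        rwa [mul_assoc, ← sq] at this
      have h1 : ρ * m / K * Δ * U x x ≤ ρ * Δ * (m * N) := by
        calc ρ * m / K * Δ * U x x ≤ ρ * m / K * Δ * (K * N) := by gcongr
          _ = _ := by field_simp
      have h3 : 0 ≤ ρ * Δ * (m * N) := by positivity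
      linarith [hU1.1, hS1.2]

end Growth


/-- An implicit function theorem for functions that increase in the second variable and decrease
in the first one. -/
theorem exists_increasing_zero {I : Set ℝ} {δ : ℝ} (hδ : 0 < δ) {g : ℝ → ℝ → ℝ}
    (hs : ∀ t ∈ I, ∀ s s', t - δ ≤ s → s < s' → s' ≤ t + δ → g t s < g t s')
    (ht : ∀ t ∈ I, ∀ t' ∈ I, t < t' → ∀ s, |s - t| ≤ δ → |s - t'| ≤ δ → g t' s < g t s)
    (hneg : ∀ t ∈ I, g t (t - δ) < 0) (hpos : ∀ t ∈ I, 0 < g t (t + δ))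
    (hcs : ∀ t ∈ I, ContinuousOn (g t) (Icc (t - δ) (t + δ)))
    (hct : ∀ s, ContinuousOn (fun t => g t s) {t | t ∈ I ∧ |s - t| ≤ δ}) :
    ∃ h : ℝ → ℝ, ContinuousOn h I ∧ StrictMonoOn h I ∧ ∀ t ∈ I, |h t - t| < δ ∧ g t (h t) = 0 := by
  have hex : ∀ t, ∃ s, t ∈ I → |s - t| < δ ∧ g t s = 0 := by
    intro t
    by_cases htI : t ∈ I
    · obtain ⟨s, hsI, hs0⟩ := intermediate_value_Icc (by linarith : t - δ ≤ t + δ) (hcs t htI)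
        (show (0 : ℝ) ∈ Icc (g t (t - δ)) (g t (t + δ)) from ⟨(hneg t htI).le, (hpos t htI).le⟩)
      refine ⟨s, fun _ => ⟨abs_lt.2 ⟨?_, ?_⟩, hs0⟩⟩
      · have : s ≠ t - δ := fun h => by
          have := hneg t htI
          rw [← h, hs0] at this
          exact lt_irrefl _ this
        have := lt_of_le_of_ne hsI.1 this.symm
        linarith
      · have : s ≠ t + δ := fun h => by
          have := hpos t htI
          rw [← h, hs0] at this
          exact lt_irrefl _ this
        have := lt_of_le_of_ne hsI.2 this
        linarith
    · exact ⟨0, fun h => absurd h htI⟩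
  choose h hh using hex
  have hlt : ∀ t ∈ I, ∀ s, t - δ ≤ s → s ≤ t + δ → g t s < 0 → s < h t := fun t htI s h1 h2 h3 => by
    by_contra hcon
    push Not at hcon
    obtain ⟨h4, h5⟩ := hh t htI
    rw [abs_lt] at h4
    rcases hcon.lt_or_eq with h6 | h6
    · have := hs t htI (h t) s (by linarith) h6 h2
      linarith
    · rw [← h6, h5] at h3
      exact lt_irrefl _ h3
  have hgt : ∀ t ∈ I, ∀ s, t - δ ≤ s → s ≤ t + δ → 0 < g t s → h t < s := fun t htI s h1 h2 h3 => by
    by_contra hcon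
    push Not at hcon
    obtain ⟨h4, h5⟩ := hh t htI
    rw [abs_lt] at h4
    rcases hcon.lt_or_eq with h6 | h6
    · have := hs t htI s (h t) h1 h6 (by linarith)
      linarith
    · rw [h6, h5] at h3
      exact lt_irrefl _ h3
  refine ⟨h, fun t htI => ?_, fun t htI t' htI' htt' => ?_, hh⟩
  · obtain ⟨h4, h5⟩ := hh t htI
    have h4' := abs_lt.1 h4
    have hnear : ∀ s, |s - t| < δ → ∀ᶠ t' in 𝓝[I] t, |s - t'| ≤ δ := fun s hst => by
      have hc : ContinuousAt (fun t' => |s - t'|) t := by fun_prop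
      exact ((hc.eventually (gt_mem_nhds hst)).mono fun _ hx => hx.le).filter_mono
        nhdsWithin_le_nhds
    have hcont : ∀ s, |s - t| < δ → Tendsto (fun t' => g t' s) (𝓝[I] t) (𝓝 (g t s)) :=
      fun s hst => by
        have h6 := hct s t ⟨htI, hst.le⟩
        refine h6.mono_left ?_
        have : 𝓝[I] t ≤ 𝓝[{t' | |s - t'| ≤ δ}] t :=
          le_inf nhdsWithin_le_nhds (le_principal_iff.2 (hnear s hst))
        calc 𝓝[I] t ≤ 𝓝[I] t ⊓ 𝓝[{t' | |s - t'| ≤ δ}] t := le_inf le_rfl this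
          _ = 𝓝[I ∩ {t' | |s - t'| ≤ δ}] t := (nhdsWithin_inter t _ _).symm
    rw [ContinuousWithinAt, tendsto_order]
    constructor
    · intro a ha
      set s := max ((a + h t) / 2) (h t - (δ + (h t - t)) / 2) with hsdef
      have hs1 : s < h t := max_lt (by linarith) (by linarith)
      have hs2 : a < s := lt_max_of_lt_left (by linarith)
      have hs3 : |s - t| < δ := by
        rw [abs_lt]
        refine ⟨?_, by linarith⟩
        have : h t - (δ + (h t - t)) / 2 ≤ s := le_max_right _ _
        linarith
      have hs4 := abs_lt.1 hs3
      have h6 : g t s < 0 := by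
        have := hs t htI s (h t) (by linarith) hs1 (by linarith)
        linarith
      filter_upwards [(hcont s hs3).eventually (gt_mem_nhds h6), hnear s hs3, self_mem_nhdsWithin]
        with t' h7 h8 h9
      rw [abs_le] at h8
      exact hs2.trans (hlt t' h9 s (by linarith) (by linarith) h7)
    · intro a ha
      set s := min ((a + h t) / 2) (h t + (δ - (h t - t)) / 2) with hsdef
      have hs1 : h t < s := lt_min (by linarith) (by linarith)
      have hs2 : s < a := min_lt_of_left_lt (by linarith)
      have hs3 : |s - t| < δ := by
        rw [abs_lt]
        refine ⟨by linarith, ?_⟩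
        have : s ≤ h t + (δ - (h t - t)) / 2 := min_le_right _ _
        linarith
      have hs4 := abs_lt.1 hs3
      have h6 : 0 < g t s := by
        have := hs t htI (h t) s (by linarith) hs1 (by linarith)
        linarith
      filter_upwards [(hcont s hs3).eventually (lt_mem_nhds h6), hnear s hs3, self_mem_nhdsWithin]
        with t' h7 h8 h9
      rw [abs_le] at h8
      exact (hgt t' h9 s (by linarith) (by linarith) h7).trans hs2
  · obtain ⟨h4, h5⟩ := hh t htI
    obtain ⟨h6, h7⟩ := hh t' htI'
    rw [abs_lt] at h4 h6
    -- If h(t) is in the window of t', the function at t' is already negative there, so its zero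
    -- lies further right; otherwise h(t) is to the left of the whole window.
    by_cases h8 : t' - δ ≤ h t
    · have h9 := ht t htI t' htI' htt' (h t) (abs_le.2 ⟨by linarith, by linarith⟩)
        (abs_le.2 ⟨by linarith, by linarith⟩)
      exact hlt t' htI' (h t) h8 (by linarith) (by linarith)
    · linarith

/-- The constants of a `LocalSaddle`. -/
structure SaddleConst where
  (R Λ lam ρ m K ε κ k : ℝ)
  R_pos : 0 < R
  R_le : R ≤ 1
  one_le_Λ : 1 ≤ Λ
  lam_pos : 0 < lam
  ρ_pos : 0 < ρ
  m_pos : 0 < m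
  K_pos : 0 < K
  ε_pos : 0 < ε
  κ_pos : 0 < κ
  κ_le : κ ≤ 1
  one_le_k : 1 ≤ k
  small_form : 128 * K * Λ * ε ≤ ρ * m
  small : 14 * ε ≤ 1
  small_metric : 8 * k * ε ≤ κ

/-! ### Nonlinear saddles in a ball of a normed space. -/

section LocalSaddle

variable {E : Type*} [NormedAddCommGroup E] [InnerProductSpace ℝ E]

/-- A vector field `F`, almost linear in a ball, with a saddle at `p`, together with a logarithm
`Lg` and a metric `G`. -/
structure LocalSaddle (c : SaddleConst) (F : E → E) (B : E →L[ℝ] E) (S U : E →L[ℝ] E →L[ℝ] ℝ)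
    (Lg : E → E → E) (G : E → E →L[ℝ] E →L[ℝ] ℝ) (e₀ p : E) : Prop where
  forms : SplitForms B S U c.ρ c.m c.K
  mem : ‖p - e₀‖ ≤ c.R / 2
  zero : F p = 0
  norm_le : ‖B‖ ≤ c.Λ
  approx : ∀ x ∈ Metric.closedBall e₀ c.R, ∀ y ∈ Metric.closedBall e₀ c.R,
    ‖F x - F y - B (x - y)‖ ≤ c.ε * ‖x - y‖
  lipschitz : ∀ x ∈ Metric.closedBall e₀ c.R, ∀ y ∈ Metric.closedBall e₀ c.R,
    ‖F x - F y‖ ≤ c.Λ * ‖x - y‖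
  expanding : ∀ x ∈ Metric.closedBall e₀ c.R, ∀ y ∈ Metric.closedBall e₀ c.R,
    c.lam * ‖x - y‖ ≤ ‖F x - F y‖
  log_self : ∀ x ∈ Metric.closedBall e₀ c.R, Lg x x = 0
  log_sub : ∀ x ∈ Metric.closedBall e₀ c.R, ∀ y ∈ Metric.closedBall e₀ c.R,
    ∀ x' ∈ Metric.closedBall e₀ c.R, ∀ y' ∈ Metric.closedBall e₀ c.R,
    ‖(Lg x y - Lg x' y') - ((y - y') - (x - x'))‖ ≤ c.ε * (‖x - x'‖ + ‖y - y'‖)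
  metric_lower : ∀ x ∈ Metric.closedBall e₀ c.R, ∀ v, c.κ * ‖v‖ ^ 2 ≤ G x v v
  metric_norm : ∀ x ∈ Metric.closedBall e₀ c.R, ‖G x‖ ≤ c.k
  metric_lipschitz : ∀ x ∈ Metric.closedBall e₀ c.R, ∀ y ∈ Metric.closedBall e₀ c.R,
    ‖G x - G y‖ ≤ c.k * ‖x - y‖

namespace LocalSaddle

variable {c : SaddleConst} {F : E → E} {B : E →L[ℝ] E} {S U : E →L[ℝ] E →L[ℝ] ℝ}
  {Lg : E → E → E} {G : E → E →L[ℝ] E →L[ℝ] ℝ} {e₀ p : E}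

/-- The notion is symmetric under time reversal with unchanged constants, so growth estimates in the
past follow from those in the future. -/
theorem neg (h : LocalSaddle c F B S U Lg G e₀ p) :
    LocalSaddle c (fun x => -F x) (-B) U S Lg G e₀ p where
  forms := h.forms.neg
  mem := h.mem
  zero := by rw [h.zero, neg_zero]
  norm_le := by rw [norm_neg]; exact h.norm_le
  approx := fun x hx y hy => by
    rw [neg_apply, show -F x - -F y - -(B (x - y)) = -(F x - F y - B (x - y)) by abel, norm_neg]
    exact h.approx x hx y hy
  lipschitz := fun x hx y hy => by
    rw [neg_sub_neg, norm_sub_rev]; exact h.lipschitz x hx y hy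
  expanding := fun x hx y hy => by
    rw [neg_sub_neg, norm_sub_rev (F y)]; exact h.expanding x hx y hy
  log_self := h.log_self
  log_sub := h.log_sub
  metric_lower := h.metric_lower
  metric_norm := h.metric_norm
  metric_lipschitz := h.metric_lipschitz

theorem p_mem (h : LocalSaddle c F B S U Lg G e₀ p) : p ∈ Metric.closedBall e₀ c.R := by
  rw [mem_closedBall_iff_norm]
  linarith [h.mem, c.R_pos]

theorem log_sub_le (h : LocalSaddle c F B S U Lg G e₀ p) {x y : E}
    (hx : x ∈ Metric.closedBall e₀ c.R) (hy : y ∈ Metric.closedBall e₀ c.R) :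
    ‖Lg x y - (y - x)‖ ≤ c.ε * ‖y - x‖ := by
  have := h.log_sub x hx y hy x hx x hx
  simpa [h.log_self x hx] using this

theorem norm_log_le (h : LocalSaddle c F B S U Lg G e₀ p) {x y : E}
    (hx : x ∈ Metric.closedBall e₀ c.R) (hy : y ∈ Metric.closedBall e₀ c.R) :
    ‖Lg x y‖ ≤ 2 * ‖y - x‖ := by
  have h1 := h.log_sub_le hx hy
  have h2 := norm_add_le (Lg x y - (y - x)) (y - x)
  rw [sub_add_cancel] at h2
  have h3 := c.small
  have h4 := mul_le_mul_of_nonneg_right (show c.ε ≤ 1 by linarith) (norm_nonneg (y - x))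
  linarith

theorem le_norm_log (h : LocalSaddle c F B S U Lg G e₀ p) {x y : E}
    (hx : x ∈ Metric.closedBall e₀ c.R) (hy : y ∈ Metric.closedBall e₀ c.R) :
    ‖y - x‖ ≤ 2 * ‖Lg x y‖ := by
  have h1 := h.log_sub_le hx hy
  have h2 := norm_sub_le (Lg x y) (Lg x y - (y - x))
  rw [sub_sub_cancel] at h2
  have h3 := c.small
  have h4 := mul_le_mul_of_nonneg_right (show c.ε ≤ 1 / 2 by linarith) (norm_nonneg (y - x))
  linarith

theorem norm_field_le (h : LocalSaddle c F B S U Lg G e₀ p) {x : E}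
    (hx : x ∈ Metric.closedBall e₀ c.R) : ‖F x‖ ≤ c.Λ * ‖x - p‖ := by
  have := h.lipschitz x hx p h.p_mem
  rwa [h.zero, sub_zero] at this

theorem le_norm_field (h : LocalSaddle c F B S U Lg G e₀ p) {x : E}
    (hx : x ∈ Metric.closedBall e₀ c.R) : c.lam * ‖x - p‖ ≤ ‖F x‖ := by
  have := h.expanding x hx p h.p_mem
  rwa [h.zero, sub_zero] at this

theorem metric_le (h : LocalSaddle c F B S U Lg G e₀ p) {x : E}
    (hx : x ∈ Metric.closedBall e₀ c.R) (v w : E) : |G x v w| ≤ c.k * ‖v‖ * ‖w‖ := by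
  have h1 := (G x).le_opNorm₂ v w
  rw [Real.norm_eq_abs] at h1
  refine h1.trans ?_
  have := h.metric_norm x hx
  gcongr

theorem metric_sub_le (h : LocalSaddle c F B S U Lg G e₀ p) {x y : E}
    (hx : x ∈ Metric.closedBall e₀ c.R) (hy : y ∈ Metric.closedBall e₀ c.R) (v w : E) :
    |G x v w - G y v w| ≤ c.k * ‖x - y‖ * ‖v‖ * ‖w‖ := by
  have h1 := (G x - G y).le_opNorm₂ v w
  rw [Real.norm_eq_abs] at h1
  refine h1.trans ?_
  have := h.metric_lipschitz x hx y hy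
  gcongr

/-- In logarithmic coordinates at the saddle, orbits almost solve the linear equation. -/
theorem log_step (h : LocalSaddle c F B S U Lg G e₀ p) {u : ℝ → E} {s t : ℝ} (hst : s ≤ t)
    (hu : IsOrbitOn F (Metric.closedBall e₀ c.R) u (Icc s t)) (hts : c.Λ * (t - s) ≤ c.ε) :
    ‖Lg p (u t) - Lg p (u s) - (t - s) • B (Lg p (u s))‖
      ≤ 14 * c.Λ * c.ε * (t - s) * ‖Lg p (u s)‖ := by
  have hΛ := c.one_le_Λ
  have hΛ0 : 0 < c.Λ := by linarith
  have hε := c.ε_pos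
  have hsm := c.small
  have hs := left_mem_Icc.2 hst
  have ht := right_mem_Icc.2 hst
  set Δ := t - s with hΔ
  have hΔ0 : 0 ≤ Δ := sub_nonneg.2 hst
  set w := u s - p with hw
  set z := Lg p (u s) with hz
  have hw0 := norm_nonneg w
  have hFs : ‖F (u s)‖ ≤ c.Λ * ‖w‖ := h.norm_field_le (hu s hs).2
  have h1 : ∀ r ∈ Icc s t, ‖u r - u s‖ ≤ 2 * Δ * (c.Λ * ‖w‖) := fun r hr => by
    have hrs : r - s ≤ Δ := by linarith [hr.2]
    refine (IsOrbitOn.norm_step_le_Icc hΛ0 h.lipschitz hr.1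
      (hu.mono (Icc_subset_Icc_right hr.2)) ?_).trans ?_
    · have := mul_le_mul_of_nonneg_left hrs hΛ0.le
      linarith
    · have : 0 ≤ r - s := sub_nonneg.2 hr.1
      gcongr
  have h2 : ∀ r ∈ Icc s t, ‖F (u r) - B w‖ ≤ 3 * c.Λ * c.ε * ‖w‖ := fun r hr => by
    have h3 := h.lipschitz _ (hu r hr).2 _ (hu s hs).2
    have h4 := h.approx _ (hu s hs).2 _ h.p_mem
    rw [h.zero, sub_zero] at h4
    have h5 := norm_add_le (F (u r) - F (u s)) (F (u s) - B w)
    rw [sub_add_sub_cancel] at h5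
    have h6 := mul_le_mul_of_nonneg_left (h1 r hr) hΛ0.le
    have h7 : c.Λ * (2 * Δ * (c.Λ * ‖w‖)) ≤ 2 * c.Λ * c.ε * ‖w‖ := by
      have := mul_le_mul_of_nonneg_left hts (by positivity : 0 ≤ 2 * c.Λ * ‖w‖)
      linarith
    have h8 : c.ε * ‖w‖ ≤ c.Λ * c.ε * ‖w‖ := by
      have : 0 ≤ c.ε * ‖w‖ := by positivity
      nlinarith
    linarith
  have h3 := hu.norm_sub_smul_le hst h2
  rw [← hΔ] at h3
  have h4 := h.log_sub p h.p_mem (u t) (hu t ht).2 p h.p_mem (u s) (hu s hs).2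
  rw [sub_self, sub_zero, norm_zero, zero_add] at h4
  have h5 : ‖Δ • (B w - B z)‖ ≤ Δ * (c.Λ * (c.ε * ‖w‖)) := by
    rw [norm_smul, Real.norm_eq_abs, abs_of_nonneg hΔ0, ← map_sub, ← norm_neg, ← map_neg, neg_sub]
    refine mul_le_mul_of_nonneg_left ((B.le_opNorm _).trans ?_) hΔ0
    have := h.log_sub_le h.p_mem (hu s hs).2
    have := h.norm_le
    gcongr
  have h6 : ‖w‖ ≤ 2 * ‖z‖ := h.le_norm_log h.p_mem (hu s hs).2
  -- Three errors: the logarithm differs from the displacement, the orbit from its Euler step, and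
  -- the vector u(s) - p from its logarithm. Each is of order Λ ε Δ times the size of z.
  have h7 : Lg p (u t) - z - Δ • B z = (Lg p (u t) - z - (u t - u s)) + (u t - u s - Δ • B w)
      + Δ • (B w - B z) := by
    rw [smul_sub]; abel
  rw [h7]
  have h8 := norm_add₃_le (a := Lg p (u t) - z - (u t - u s)) (b := u t - u s - Δ • B w)
    (c := Δ • (B w - B z))
  have h9 := mul_le_mul_of_nonneg_left (h1 t ht) hε.le
  have h10 := mul_le_mul_of_nonneg_left h6 (by positivity : 0 ≤ 6 * c.Λ * c.ε * Δ)
  have h11 : 0 ≤ c.Λ * c.ε * Δ * ‖z‖ := by positivity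
  linarith

/-- Growth of the unstable component of an orbit. -/
theorem growth (h : LocalSaddle c F B S U Lg G e₀ p) {u : ℝ → E} {a b : ℝ}
    (hu : IsOrbitOn F (Metric.closedBall e₀ c.R) u (Icc a b))
    (h0 : S (Lg p (u a)) (Lg p (u a)) ≤ U (Lg p (u a)) (Lg p (u a))) {t : ℝ} (ht : t ∈ Icc a b) :
    Real.exp (c.ρ / 2 * (t - a)) * U (Lg p (u a)) (Lg p (u a)) ≤ U (Lg p (u t)) (Lg p (u t)) ∧
      c.ρ * c.m / c.K * (t - a) * U (Lg p (u a)) (Lg p (u a))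
          + (U (Lg p (u a)) (Lg p (u a)) - S (Lg p (u a)) (Lg p (u a)))
        ≤ U (Lg p (u t)) (Lg p (u t)) - S (Lg p (u t)) (Lg p (u t)) := by
  have hΛ0 : 0 < c.Λ := by linarith [c.one_le_Λ]
  have hτ : c.Λ * min (c.ε / c.Λ) (1 / c.ρ) ≤ c.ε := by
    have := mul_le_mul_of_nonneg_left (min_le_left (c.ε / c.Λ) (1 / c.ρ)) hΛ0.le
    rwa [mul_div_cancel₀ _ hΛ0.ne'] at this
  have hτ' : c.ρ * min (c.ε / c.Λ) (1 / c.ρ) ≤ 1 := by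
    have := mul_le_mul_of_nonneg_left (min_le_right (c.ε / c.Λ) (1 / c.ρ)) c.ρ_pos.le
    rwa [mul_div_cancel₀ _ c.ρ_pos.ne'] at this
  refine h.forms.growth c.ρ_pos c.m_pos c.K_pos c.one_le_Λ c.ε_pos h.norm_le c.small_form c.small
    (τ := min (c.ε / c.Λ) (1 / c.ρ)) (lt_min (div_pos c.ε_pos hΛ0) (one_div_pos.2 c.ρ_pos)) hτ hτ'
    (z := fun t => Lg p (u t)) (fun s hs t ht hst hts => ?_) h0 ht
  exact h.log_step hst (hu.mono (Icc_subset_Icc hs.1 ht.2))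
    ((mul_le_mul_of_nonneg_left hts hΛ0.le).trans hτ)

end LocalSaddle

end LocalSaddle


/-! ### Following an orbit in the normal sections of another one. -/

namespace LocalSaddle

section Tube

variable {E : Type*} [NormedAddCommGroup E] [InnerProductSpace ℝ E]
  {c : SaddleConst} {F : E → E} {B : E →L[ℝ] E} {S U : E →L[ℝ] E →L[ℝ] ℝ}
  {Lg : E → E → E} {G : E → E →L[ℝ] E →L[ℝ] ℝ} {e₀ p : E}

/-- Two orbits `x`, `y` are close, relative to the speed, at times `t` and `s` when they are close
at time `t` and `s` is close to `t`. -/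
theorem near (h : LocalSaddle c F B S U Lg G e₀ p) {x y : ℝ → E} {t s α δ : ℝ}
    (hx : x t ∈ Metric.closedBall e₀ c.R)
    (hy : IsOrbitOn F (Metric.closedBall e₀ c.R) y (uIcc t s)) (hα : 0 < α) (hαδ : α ≤ δ)
    (hδ : 5 * c.Λ * δ ≤ 1) (hst : |s - t| ≤ δ) (hxy : ‖y t - x t‖ ≤ α * ‖F (x t)‖) :
    ‖y s - x t‖ ≤ 5 * δ * ‖F (x t)‖ ∧ ‖F (y s) - F (x t)‖ ≤ 5 * c.Λ * δ * ‖F (x t)‖ ∧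
      ‖F (y s)‖ ≤ 2 * ‖F (x t)‖ ∧ ‖Lg (x t) (y s)‖ ≤ 10 * δ * ‖F (x t)‖ := by
  have hΛ := c.one_le_Λ
  have hΛ0 : 0 < c.Λ := by linarith
  have hδ0 : 0 < δ := hα.trans_le hαδ
  set f := ‖F (x t)‖ with hf
  have hf0 : 0 ≤ f := norm_nonneg _
  have hyt := (hy t left_mem_uIcc).2
  have hys := (hy s right_mem_uIcc).2
  have h1 : ‖F (y t)‖ ≤ 2 * f := by
    have h2 := h.lipschitz _ hyt _ hx
    have h3 := norm_add_le (F (y t) - F (x t)) (F (x t))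
    rw [sub_add_cancel] at h3
    have h4 := mul_le_mul_of_nonneg_left hxy hΛ0.le
    have h5 : c.Λ * (α * f) ≤ 1 * f := by
      rw [← mul_assoc]
      refine mul_le_mul_of_nonneg_right ?_ hf0
      have := mul_le_mul_of_nonneg_left hαδ hΛ0.le
      have : 0 ≤ c.Λ * δ := by positivity
      linarith
    linarith
  have h2 : ‖y s - y t‖ ≤ 4 * δ * f := by
    refine (hy.norm_step_le hΛ0 h.lipschitz ?_).trans ?_
    · have := mul_le_mul_of_nonneg_left hst hΛ0.le
      have : 0 ≤ c.Λ * δ := by positivity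
      linarith
    · calc 2 * |s - t| * ‖F (y t)‖ ≤ 2 * δ * (2 * f) := by gcongr
        _ = _ := by ring
  have h3 : ‖y s - x t‖ ≤ 5 * δ * f := by
    have h4 := norm_add_le (y s - y t) (y t - x t)
    rw [sub_add_sub_cancel] at h4
    have h5 := mul_le_mul_of_nonneg_right hαδ hf0
    linarith
  have h4 : ‖F (y s) - F (x t)‖ ≤ 5 * c.Λ * δ * f := by
    refine (h.lipschitz _ hys _ hx).trans ?_
    have := mul_le_mul_of_nonneg_left h3 hΛ0.le
    linarith
  refine ⟨h3, h4, ?_, ?_⟩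
  · have h5 := norm_add_le (F (y s) - F (x t)) (F (x t))
    rw [sub_add_cancel] at h5
    have := mul_le_mul_of_nonneg_right hδ hf0
    linarith
  · have := h.norm_log_le hx hys
    linarith

theorem continuousOn_log (h : LocalSaddle c F B S U Lg G e₀ p) :
    ContinuousOn (fun q : E × E => Lg q.1 q.2)
      (Metric.closedBall e₀ c.R ×ˢ Metric.closedBall e₀ c.R) := by
  intro q hq
  have h1 : Tendsto (fun q' : E × E => c.ε * (‖q'.1 - q.1‖ + ‖q'.2 - q.2‖)
      + ‖(q'.2 - q.2) - (q'.1 - q.1)‖) (𝓝 q) (𝓝 0) := by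
    have h2 : ContinuousAt (fun q' : E × E => c.ε * (‖q'.1 - q.1‖ + ‖q'.2 - q.2‖)
      + ‖(q'.2 - q.2) - (q'.1 - q.1)‖) q := by fun_prop
    simpa [ContinuousAt] using h2
  rw [ContinuousWithinAt, tendsto_iff_norm_sub_tendsto_zero]
  refine squeeze_zero' (Eventually.of_forall fun _ => norm_nonneg _) ?_
    (h1.mono_left nhdsWithin_le_nhds)
  filter_upwards [self_mem_nhdsWithin] with q' hq'
  have h3 := h.log_sub q'.1 hq'.1 q'.2 hq'.2 q.1 hq.1 q.2 hq.2
  have h4 := norm_add_le (Lg q'.1 q'.2 - Lg q.1 q.2 - (q'.2 - q.2 - (q'.1 - q.1)))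
    (q'.2 - q.2 - (q'.1 - q.1))
  rw [sub_add_cancel] at h4
  linarith

theorem continuousOn_field (h : LocalSaddle c F B S U Lg G e₀ p) :
    ContinuousOn F (Metric.closedBall e₀ c.R) :=
  (LipschitzOnWith.of_dist_le_mul (K := Real.toNNReal c.Λ) fun x hx y hy => by
    rw [dist_eq_norm, dist_eq_norm, Real.coe_toNNReal _ (by linarith [c.one_le_Λ])]
    exact h.lipschitz x hx y hy).continuousOn

theorem continuousOn_metric (h : LocalSaddle c F B S U Lg G e₀ p) :
    ContinuousOn G (Metric.closedBall e₀ c.R) :=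
  (LipschitzOnWith.of_dist_le_mul (K := Real.toNNReal c.k) fun x hx y hy => by
    rw [dist_eq_norm, dist_eq_norm, Real.coe_toNNReal _ (by linarith [c.one_le_k])]
    exact h.metric_lipschitz x hx y hy).continuousOn

/-- The component of `Lg (x t) (y s)` along the field increases with `s`. -/
theorem along_lt_right (h : LocalSaddle c F B S U Lg G e₀ p) {x : E} {y : ℝ → E} {s s' δ : ℝ}
    (hx : x ∈ Metric.closedBall e₀ c.R) (hss : s ≤ s')
    (hy : IsOrbitOn F (Metric.closedBall e₀ c.R) y (Icc s s')) (hδ0 : 0 < δ)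
    (hδ : 1000 * c.k * c.Λ * δ ≤ c.κ)
    (hF : ∀ r ∈ Icc s s', ‖F (y r) - F x‖ ≤ 5 * c.Λ * δ * ‖F x‖) :
    G x (Lg x (y s)) (F x) + (s' - s) * (c.κ / 2 * ‖F x‖ ^ 2) ≤ G x (Lg x (y s')) (F x) := by
  have hΛ := c.one_le_Λ
  have hk := c.one_le_k
  have hκ := c.κ_pos
  have hκ1 := c.κ_le
  have hε := c.ε_pos
  have hsm := c.small_metric
  set f := ‖F x‖ with hf
  have hf0 : 0 ≤ f := norm_nonneg _
  set Δ := s' - s with hΔ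
  have hΔ0 : 0 ≤ Δ := sub_nonneg.2 hss
  have hΛδ : 0 < c.Λ * δ := by positivity
  have h1 := hy.norm_sub_smul_le hss hF
  rw [← hΔ] at h1
  have h5 : 5 * c.Λ * δ ≤ 1 := by nlinarith
  have h2 : ‖y s' - y s‖ ≤ 2 * Δ * f := by
    have h3 := norm_add_le (y s' - y s - Δ • F x) (Δ • F x)
    rw [sub_add_cancel, norm_smul, Real.norm_eq_abs, abs_of_nonneg hΔ0] at h3
    have h4 : 5 * c.Λ * δ * f * Δ ≤ 1 * f * Δ := by gcongr
    linarith
  have h3 := h.log_sub x hx (y s') (hy s' (right_mem_Icc.2 hss)).2 x hx (y s)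
    (hy s (left_mem_Icc.2 hss)).2
  rw [sub_self, sub_zero, norm_zero, zero_add] at h3
  set e := Lg x (y s') - Lg x (y s) - Δ • F x with he
  have he1 : ‖e‖ ≤ (5 * c.Λ * δ + 2 * c.ε) * f * Δ := by
    have h4 := norm_add_le (Lg x (y s') - Lg x (y s) - (y s' - y s)) (y s' - y s - Δ • F x)
    rw [sub_add_sub_cancel] at h4
    have := mul_le_mul_of_nonneg_left h2 hε.le
    linarith
  -- The main term is at least κ Δ |F|²; the smallness of `δ` and ε keeps the error below half of
  -- it.
  have h6 : G x (Lg x (y s')) (F x) = G x (Lg x (y s)) (F x) + Δ * G x (F x) (F x)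
      + G x e (F x) := by
    have : Lg x (y s') = Lg x (y s) + Δ • F x + e := by rw [he]; abel
    rw [this, map_add, map_add, map_smul, add_apply, add_apply, smul_apply, smul_eq_mul]
  have h7 := mul_le_mul_of_nonneg_left (h.metric_lower x hx (F x)) hΔ0
  have h8 := (abs_le.1 (h.metric_le hx e (F x))).1
  have h9 : c.k * ‖e‖ * f ≤ c.κ / 2 * f ^ 2 * Δ := by
    calc c.k * ‖e‖ * f ≤ c.k * ((5 * c.Λ * δ + 2 * c.ε) * f * Δ) * f := by gcongr
      _ = (5 * (c.k * c.Λ * δ) + 2 * c.k * c.ε) * (f ^ 2 * Δ) := by ring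
      _ ≤ (c.κ / 2) * (f ^ 2 * Δ) := by
        gcongr
        have : 0 ≤ c.k * c.Λ * δ := by positivity
        linarith
      _ = _ := by ring
  rw [h6]
  linarith

/-- The component of `Lg (x t) (y s)` along the field decreases with `t`. -/
theorem along_lt_left (h : LocalSaddle c F B S U Lg G e₀ p) {x : ℝ → E} {y : E} {t t' δ : ℝ}
    (hy : y ∈ Metric.closedBall e₀ c.R) (htt : t < t')
    (hx : IsOrbitOn F (Metric.closedBall e₀ c.R) x (Icc t t')) (hδ0 : 0 < δ)
    (hδ : 1000 * c.k * c.Λ * δ ≤ c.κ) (htδ : t' - t ≤ 2 * δ) (hF0 : F (x t) ≠ 0)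
    (hL : ‖Lg (x t') y‖ ≤ 10 * δ * ‖F (x t')‖) :
    G (x t') (Lg (x t') y) (F (x t')) < G (x t) (Lg (x t) y) (F (x t)) := by
  have hΛ := c.one_le_Λ
  have hΛ0 : 0 < c.Λ := by linarith
  have hk := c.one_le_k
  have hκ := c.κ_pos
  have hκ1 := c.κ_le
  have hε := c.ε_pos
  have hsm := c.small_metric
  have ht := left_mem_Icc.2 htt.le
  have ht' := right_mem_Icc.2 htt.le
  set f := ‖F (x t)‖ with hf
  have hf0 : 0 < f := norm_pos_iff.2 hF0
  set Δ := t' - t with hΔ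
  have hΔ0 : 0 < Δ := sub_pos.2 htt
  have hΛδ : 0 < c.Λ * δ := by positivity
  have hΛδ1 : 1000 * c.Λ * δ ≤ 1 := by nlinarith
  have hstep : ∀ r ∈ Icc t t', ‖x r - x t‖ ≤ 2 * (r - t) * f := fun r hr =>
    IsOrbitOn.norm_step_le_Icc hΛ0 h.lipschitz hr.1 (hx.mono (Icc_subset_Icc_right hr.2)) (by
      have : r - t ≤ 2 * δ := by linarith [hr.2]
      have := mul_le_mul_of_nonneg_left this hΛ0.le
      linarith)
  have hFr : ∀ r ∈ Icc t t', ‖F (x r) - F (x t)‖ ≤ 4 * c.Λ * δ * f := fun r hr => by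
    refine (h.lipschitz _ (hx r hr).2 _ (hx t ht).2).trans ?_
    have h1 : r - t ≤ 2 * δ := by linarith [hr.2]
    calc c.Λ * ‖x r - x t‖ ≤ c.Λ * (2 * (2 * δ) * f) := by
          gcongr
          exact (hstep r hr).trans (by gcongr)
      _ = _ := by ring
  have h1 := hx.norm_sub_smul_le htt.le hFr
  rw [← hΔ] at h1
  have hxt' := hstep t' ht'
  rw [← hΔ] at hxt'
  have hFt' : ‖F (x t') - F (x t)‖ ≤ 2 * c.Λ * Δ * f := by
    refine (h.lipschitz _ (hx t' ht').2 _ (hx t ht).2).trans ?_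
    have := mul_le_mul_of_nonneg_left hxt' hΛ0.le
    linarith
  have hf' : ‖F (x t')‖ ≤ 2 * f := by
    have h5 := norm_add_le (F (x t') - F (x t)) (F (x t))
    rw [sub_add_cancel] at h5
    have h6 := hFr t' ht'
    have h7 : 4 * c.Λ * δ * f ≤ 1 * f := by
      refine mul_le_mul_of_nonneg_right ?_ hf0.le
      linarith
    linarith
  have hL' : ‖Lg (x t') y‖ ≤ 20 * δ * f := by
    refine hL.trans ?_
    calc 10 * δ * ‖F (x t')‖ ≤ 10 * δ * (2 * f) := by gcongr
      _ = _ := by ring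
  have h3 := h.log_sub (x t') (hx t' ht').2 y hy (x t) (hx t ht).2 y hy
  rw [sub_self, norm_zero, add_zero, zero_sub, sub_neg_eq_add] at h3
  set e := Lg (x t') y - Lg (x t) y + Δ • F (x t) with he
  have he1 : ‖e‖ ≤ (4 * c.Λ * δ + 2 * c.ε) * f * Δ := by
    have h4 := norm_sub_le (Lg (x t') y - Lg (x t) y + (x t' - x t)) (x t' - x t - Δ • F (x t))
    rw [show Lg (x t') y - Lg (x t) y + (x t' - x t) - (x t' - x t - Δ • F (x t)) = e by
      rw [he]; abel] at h4
    have := mul_le_mul_of_nonneg_left hxt' hε.le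
    linarith
  have h6 : G (x t) (Lg (x t') y) (F (x t)) = G (x t) (Lg (x t) y) (F (x t))
      - Δ * G (x t) (F (x t)) (F (x t)) + G (x t) e (F (x t)) := by
    have : Lg (x t') y = Lg (x t) y - Δ • F (x t) + e := by rw [he]; abel
    rw [this, map_add, map_sub, map_smul, add_apply, sub_apply, smul_apply, smul_eq_mul]
  have h7 := mul_le_mul_of_nonneg_left (h.metric_lower _ (hx t ht).2 (F (x t))) hΔ0.le
  have h8 := (abs_le.1 (h.metric_le (hx t ht).2 e (F (x t)))).2
  have h9 : c.k * ‖e‖ * f ≤ c.κ / 2 * f ^ 2 * Δ := by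
    calc c.k * ‖e‖ * f ≤ c.k * ((4 * c.Λ * δ + 2 * c.ε) * f * Δ) * f := by gcongr
      _ = (4 * (c.k * c.Λ * δ) + 2 * c.k * c.ε) * (f ^ 2 * Δ) := by ring
      _ ≤ (c.κ / 2) * (f ^ 2 * Δ) := by
        gcongr
        have : 0 ≤ c.k * c.Λ * δ := by positivity
        linarith
      _ = _ := by ring
  have h10 := (abs_le.1 (h.metric_le (hx t ht).2 (Lg (x t') y) (F (x t') - F (x t)))).2
  have h11 := (abs_le.1 (h.metric_sub_le (hx t' ht').2 (hx t ht).2 (Lg (x t') y) (F (x t')))).2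
  have h12 : c.k * ‖Lg (x t') y‖ * ‖F (x t') - F (x t)‖ ≤ 40 * (c.k * c.Λ * δ) * (f ^ 2 * Δ) := by
    calc c.k * ‖Lg (x t') y‖ * ‖F (x t') - F (x t)‖
        ≤ c.k * (20 * δ * f) * (2 * c.Λ * Δ * f) := by gcongr
      _ = _ := by ring
  have hfΛ : f ≤ 2 * c.Λ := by
    have h13 := h.norm_field_le (hx t ht).2
    have h14 : ‖x t - p‖ ≤ 2 := by
      have h15 := mem_closedBall_iff_norm.1 (hx t ht).2
      have h16 := mem_closedBall_iff_norm.1 h.p_mem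
      have h17 := norm_sub_le (x t - e₀) (p - e₀)
      rw [sub_sub_sub_cancel_right] at h17
      linarith [c.R_le]
    have := mul_le_mul_of_nonneg_left h14 hΛ0.le
    linarith
  have h13 : c.k * ‖x t' - x t‖ * ‖Lg (x t') y‖ * ‖F (x t')‖
      ≤ 160 * (c.k * c.Λ * δ) * (f ^ 2 * Δ) := by
    calc c.k * ‖x t' - x t‖ * ‖Lg (x t') y‖ * ‖F (x t')‖
        ≤ c.k * (2 * Δ * f) * (20 * δ * f) * (2 * (2 * c.Λ)) := by
          gcongr
          exact hf'.trans (by gcongr)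
      _ = _ := by ring
  -- When the base point moves, the field and the metric coefficients change as well. These changes
  -- act on a logarithm of length O(δ|F|), and their contributions 40 and 160 add up to less than
  -- what remains of the main term.
  have h14 : 200 * (c.k * c.Λ * δ) * (f ^ 2 * Δ) ≤ c.κ / 5 * (f ^ 2 * Δ) := by
    gcongr
    linarith
  have h15 : 0 < c.κ * (f ^ 2 * Δ) := by positivity
  rw [map_sub] at h10
  linarith

/-- An orbit that stays close, relative to the speed, to another one, follows it in the normal
sections up to a change of time. -/
theorem exists_tube (h : LocalSaddle c F B S U Lg G e₀ p) {I : Set ℝ} (hI : I.OrdConnected)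
    {x y : ℝ → E} (hx : IsOrbitOn F (Metric.closedBall e₀ c.R) x I)
    (hy : IsOrbitOn F (Metric.closedBall e₀ c.R) y {s | ∃ t ∈ I, |s - t| ≤ 1})
    (hF : ∀ t ∈ I, F (x t) ≠ 0) {α : ℝ} (hα : 0 < α) (hα1 : 5000 * c.k ^ 2 * c.Λ * α ≤ c.κ ^ 2)
    (hxy : ∀ t ∈ I, ‖y t - x t‖ ≤ α * ‖F (x t)‖) :
    ∃ τ : ℝ → ℝ, ContinuousOn τ I ∧ StrictMonoOn τ I ∧ ∀ t ∈ I, |τ t - t| < 1 / 2 ∧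
      G (x t) (Lg (x t) (y (τ t))) (F (x t)) = 0 ∧
      ‖Lg (x t) (y (τ t))‖ ≤ 50 * c.k / c.κ * α * ‖F (x t)‖ := by
  have hΛ := c.one_le_Λ
  have hΛ0 : 0 < c.Λ := by linarith
  have hk := c.one_le_k
  have hκ := c.κ_pos
  have hκ1 := c.κ_le
  -- At s = t the component along the field is at most 2kα|F|² in absolute value, and it grows at a
  -- rate of at least κ|F|²/2 in s. Over a time `δ` the gain is (5/2)kα|F|², so the zero lies within
  -- `δ` of t.
  set δ := 5 * c.k / c.κ * α with hδdef
  have hδ0 : 0 < δ := by positivity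
  have hδκ : δ * c.κ = 5 * c.k * α := by rw [hδdef]; field_simp
  have hδ : 1000 * c.k * c.Λ * δ ≤ c.κ := by
    have h1 : (1000 * c.k * c.Λ * δ) * c.κ ≤ c.κ * c.κ := by
      calc (1000 * c.k * c.Λ * δ) * c.κ = 1000 * c.k * c.Λ * (δ * c.κ) := by ring
        _ = 5000 * c.k ^ 2 * c.Λ * α := by rw [hδκ]; ring
        _ ≤ c.κ ^ 2 := hα1
        _ = _ := by ring
    exact le_of_mul_le_mul_right h1 hκ
  have hαδ : α ≤ δ := by
    have : 1 ≤ 5 * c.k / c.κ := by rw [le_div_iff₀ hκ]; linarith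
    exact le_mul_of_one_le_left hα.le this
  have hΛδ0 : 0 < c.Λ * δ := by positivity
  have h1000 : 1000 * (c.Λ * δ) ≤ 1 := by nlinarith
  have hδ1 : δ < 1 / 2 := by nlinarith
  have h5 : 5 * c.Λ * δ ≤ 1 := by linarith
  have hy' : ∀ t ∈ I, ∀ s, |s - t| ≤ δ → IsOrbitOn F (Metric.closedBall e₀ c.R) y (uIcc t s) :=
    fun t ht s hs => hy.mono fun r hr => ⟨t, ht, by
      have := abs_sub_left_of_mem_uIcc hr
      linarith⟩
  have hnear : ∀ t ∈ I, ∀ s, |s - t| ≤ δ → _ := fun t ht s hs =>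
    h.near (hx t ht).2 (hy' t ht s hs) hα hαδ h5 hs (hxy t ht)
  have hmem : ∀ t, ∀ s, |s - t| ≤ δ → ∀ s', |s' - t| ≤ δ → ∀ r ∈ Icc s s', |r - t| ≤ δ :=
    fun t s hs s' hs' r hr => abs_le.2 ⟨by linarith [(abs_le.1 hs).1, hr.1],
      by linarith [(abs_le.1 hs').2, hr.2]⟩
  have hright : ∀ t ∈ I, ∀ s s', |s - t| ≤ δ → |s' - t| ≤ δ → s ≤ s' → _ :=
    fun t ht s s' hs hs' hss => h.along_lt_right (hx t ht).2 hss
      (fun r hr => hy' t ht r (hmem t s hs s' hs' r hr) r right_mem_uIcc) hδ0 hδ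
      (fun r hr => (hnear t ht r (hmem t s hs s' hs' r hr)).2.1)
  have hG0 : ∀ t ∈ I, |G (x t) (Lg (x t) (y t)) (F (x t))| ≤ 2 * c.k * α * ‖F (x t)‖ ^ 2 := by
    intro t ht
    have hyt := (hy' t ht t (by rw [sub_self, abs_zero]; exact hδ0.le) t right_mem_uIcc).2
    refine (h.metric_le (hx t ht).2 _ _).trans ?_
    calc c.k * ‖Lg (x t) (y t)‖ * ‖F (x t)‖ ≤ c.k * (2 * (α * ‖F (x t)‖)) * ‖F (x t)‖ := by
          have := (h.norm_log_le (hx t ht).2 hyt).trans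
            (mul_le_mul_of_nonneg_left (hxy t ht) zero_le_two)
          gcongr
      _ = _ := by ring
  have hδδ : |δ| ≤ δ := (abs_of_pos hδ0).le
  suffices hex : ∃ τ : ℝ → ℝ, ContinuousOn τ I ∧ StrictMonoOn τ I ∧
      ∀ t ∈ I, |τ t - t| < δ ∧ G (x t) (Lg (x t) (y (τ t))) (F (x t)) = 0 by
    obtain ⟨τ, hτc, hτm, hτ⟩ := hex
    refine ⟨τ, hτc, hτm, fun t ht => ?_⟩
    obtain ⟨h1, h2⟩ := hτ t ht
    refine ⟨h1.trans hδ1, h2, (hnear t ht (τ t) h1.le).2.2.2.trans_eq ?_⟩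
    rw [hδdef]; ring
  -- The six conditions are monotonicity in `s`, monotonicity in `t`, the two signs at the ends of
  -- the window, and continuity in each variable.
  refine exists_increasing_zero hδ0
    (g := fun t s => G (x t) (Lg (x t) (y s)) (F (x t))) ?_ ?_ ?_ ?_ ?_ ?_
  · intro t ht s s' hs hss hs'
    have hf : 0 < ‖F (x t)‖ := norm_pos_iff.2 (hF t ht)
    have h1 := hright t ht s s' (abs_le.2 ⟨by linarith, by linarith⟩)
      (abs_le.2 ⟨by linarith, by linarith⟩) hss.le
    have h2 : 0 < (s' - s) * (c.κ / 2 * ‖F (x t)‖ ^ 2) := by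
      have := sub_pos.2 hss
      positivity
    linarith
  · intro t ht t' ht' htt s hs hs'
    refine h.along_lt_left (hy' t ht s hs s right_mem_uIcc).2 htt (hx.mono (hI.out ht ht')) hδ0 hδ
      ?_ (hF t ht) (hnear t' ht' s hs').2.2.2
    linarith [(abs_le.1 hs).2, (abs_le.1 hs').1]
  · intro t ht
    have hf : 0 < ‖F (x t)‖ := norm_pos_iff.2 (hF t ht)
    have h1 := hright t ht (t - δ) t (by rw [sub_sub_cancel_left, abs_neg]; exact hδδ)
      (by rw [sub_self, abs_zero]; exact hδ0.le) (by linarith)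
    have h2 := (abs_le.1 (hG0 t ht)).2
    rw [sub_sub_cancel] at h1
    have h3 : δ * (c.κ / 2 * ‖F (x t)‖ ^ 2) = 5 / 2 * c.k * α * ‖F (x t)‖ ^ 2 := by
      calc δ * (c.κ / 2 * ‖F (x t)‖ ^ 2) = (δ * c.κ) / 2 * ‖F (x t)‖ ^ 2 := by ring
        _ = _ := by rw [hδκ]; ring
    have h4 : 0 < c.k * α * ‖F (x t)‖ ^ 2 := by positivity
    linarith
  · intro t ht
    have hf : 0 < ‖F (x t)‖ := norm_pos_iff.2 (hF t ht)
    have h1 := hright t ht t (t + δ) (by rw [sub_self, abs_zero]; exact hδ0.le)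
      (by rw [add_sub_cancel_left]; exact hδδ) (by linarith)
    have h2 := (abs_le.1 (hG0 t ht)).1
    rw [add_sub_cancel_left] at h1
    have h3 : δ * (c.κ / 2 * ‖F (x t)‖ ^ 2) = 5 / 2 * c.k * α * ‖F (x t)‖ ^ 2 := by
      calc δ * (c.κ / 2 * ‖F (x t)‖ ^ 2) = (δ * c.κ) / 2 * ‖F (x t)‖ ^ 2 := by ring
        _ = _ := by rw [hδκ]; ring
    have h4 : 0 < c.k * α * ‖F (x t)‖ ^ 2 := by positivity
    linarith
  · intro t ht
    have hys : ∀ s ∈ Icc (t - δ) (t + δ), HasDerivAt y (F (y s)) s ∧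
        y s ∈ Metric.closedBall e₀ c.R := fun s hs =>
      hy' t ht s (abs_le.2 ⟨by linarith [hs.1], by linarith [hs.2]⟩) s right_mem_uIcc
    have h1 : ContinuousOn (fun s => Lg (x t) (y s)) (Icc (t - δ) (t + δ)) :=
      h.continuousOn_log.comp (f := fun s => (x t, y s))
        (continuousOn_const.prodMk fun s hs => (hys s hs).1.continuousAt.continuousWithinAt)
        fun s hs => ⟨(hx t ht).2, (hys s hs).2⟩
    exact ((G (x t)).continuous.comp_continuousOn h1).clm_apply continuousOn_const
  · intro s
    by_cases hne : ∃ t ∈ I, |s - t| ≤ δ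
    · obtain ⟨t₀, ht₀, hst₀⟩ := hne
      have hys := (hy' t₀ ht₀ s hst₀ s right_mem_uIcc).2
      have hxc : ContinuousOn x {t | t ∈ I ∧ |s - t| ≤ δ} := hx.continuousOn.mono fun t ht => ht.1
      have hxm : MapsTo x {t | t ∈ I ∧ |s - t| ≤ δ} (Metric.closedBall e₀ c.R) := fun t ht =>
        (hx t ht.1).2
      have h1 : ContinuousOn (fun t => Lg (x t) (y s)) {t | t ∈ I ∧ |s - t| ≤ δ} :=
        h.continuousOn_log.comp (f := fun t => (x t, y s)) (hxc.prodMk continuousOn_const)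
          fun t ht => ⟨hxm ht, hys⟩
      exact ((h.continuousOn_metric.comp hxc hxm).clm_apply h1).clm_apply
        (h.continuousOn_field.comp hxc hxm)
    · intro t ht
      exact absurd ⟨t, ht.1, ht.2⟩ hne

end Tube

end LocalSaddle


/-! ### Quantitative inversion: zeros of almost linear fields and the logarithm. -/

section Perturbation

variable {E : Type*} [NormedAddCommGroup E] [InnerProductSpace ℝ E] [FiniteDimensional ℝ E]
  [CompleteSpace E]

/-- Surjectivity of a map within Lipschitz distance 1/2 of the identity: the image of a ball of
radius r covers the ball of radius (1 - 1/2)r. -/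
theorem exists_eq_of_almost_id {f : E → E} {b : E} {r : ℝ} (hr : 0 ≤ r)
    (hf : ∀ x ∈ Metric.closedBall b r, ∀ y ∈ Metric.closedBall b r,
      ‖f x - f y - (x - y)‖ ≤ 1 / 2 * ‖x - y‖) {y : E} (hy : ‖y - f b‖ ≤ r / 2) :
    ∃ x ∈ Metric.closedBall b r, f x = y := by
  have h1 : ApproximatesLinearOn f (ContinuousLinearMap.id ℝ E) (Metric.closedBall b r)
      (1 / 2 : NNReal) := fun x hx y hy => by
    simpa using hf x hx y hy
  let g : (ContinuousLinearMap.id ℝ E).NonlinearRightInverse :=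
    { toFun := id
      nnnorm := 1
      bound' := fun y => by simp
      right_inv' := fun y => rfl }
  have h2 := h1.surjOn_closedBall_of_nonlinearRightInverse g hr Subset.rfl
  refine h2 (mem_closedBall_iff_norm.2 (hy.trans_eq ?_))
  simp only [g]
  norm_num
  ring

theorem exists_eq_of_almost_linear {A : E →L[ℝ] E} {lam η : ℝ} (hlam : 0 < lam)
    (hA : ∀ v, lam * ‖v‖ ≤ ‖A v‖) (hη : 2 * η ≤ lam) {f : E → E} {b : E} {r : ℝ} (hr : 0 ≤ r)
    (hf : ∀ x ∈ Metric.closedBall b r, ∀ y ∈ Metric.closedBall b r,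
      ‖f x - f y - A (x - y)‖ ≤ η * ‖x - y‖) {y : E} (hy : ‖y - f b‖ ≤ lam / 2 * r) :
    ∃ x ∈ Metric.closedBall b r, f x = y := by
  have hinj : Function.Injective A.toLinearMap := by
    rw [← LinearMap.ker_eq_bot, LinearMap.ker_eq_bot']
    intro v hv
    have h1 := hA v
    rw [show A v = 0 from hv, norm_zero] at h1
    have : ‖v‖ ≤ 0 := by
      by_contra h
      push Not at h
      have := mul_pos hlam h
      linarith
    exact norm_le_zero_iff.1 this
  let e := LinearEquiv.ofInjectiveEndo A.toLinearMap hinj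
  have he : ∀ v, e v = A v := fun v => rfl
  have hes : ∀ w, lam * ‖e.symm w‖ ≤ ‖w‖ := fun w => by
    have := hA (e.symm w)
    rwa [← he, e.apply_symm_apply] at this
  obtain ⟨x, hx, hxy⟩ := exists_eq_of_almost_id (f := fun x => e.symm (f x)) (b := b) (y := e.symm y)
    hr (fun x hx y hy => by
      have h1 : e.symm (f x) - e.symm (f y) - (x - y) = e.symm (f x - f y - A (x - y)) := by
        rw [map_sub, map_sub, ← he, e.symm_apply_apply]
      have h2 := (hes (f x - f y - A (x - y))).trans (hf x hx y hy)
      rw [h1]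
      have h3 : lam * ‖e.symm (f x - f y - A (x - y))‖ ≤ lam * (1 / 2 * ‖x - y‖) := by
        have := mul_le_mul_of_nonneg_right hη (norm_nonneg (x - y))
        linarith
      exact le_of_mul_le_mul_left h3 hlam)
    (by
      rw [← map_sub]
      have h2 := (hes (y - f b)).trans hy
      exact le_of_mul_le_mul_left (by linarith) hlam)
  exact ⟨x, hx, e.symm.injective hxy⟩

/-- The rates give U(Bv, v) - S(Bv, v) ≥ ρ(S + U)(v, v) ≥ ρm|v|², and the left side is at most
2K|Bv||v|. -/
theorem SplitForms.norm_lower {B : E →L[ℝ] E} {S U : E →L[ℝ] E →L[ℝ] ℝ} {ρ m K : ℝ}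
    (h : SplitForms B S U ρ m K) (hρ : 0 < ρ) (hK : 0 < K) (v : E) :
    ρ * m / (2 * K) * ‖v‖ ≤ ‖B v‖ := by
  rw [div_mul_eq_mul_div, div_le_iff₀ (by positivity)]
  rcases (norm_nonneg v).eq_or_lt with h0 | h0
  · rw [← h0, mul_zero]; positivity
  · refine le_of_mul_le_mul_right ?_ h0
    have h1 := h.lower v
    have h2 := h.rateS v
    have h3 := h.rateU v
    have h4 := (abs_le.1 (h.boundS (B v) v)).1
    have h5 := (abs_le.1 (h.boundU (B v) v)).2
    have h6 := mul_le_mul_of_nonneg_left h1 hρ.le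
    linarith

theorem exists_bilin_lower {G : E →L[ℝ] E →L[ℝ] ℝ} (hG : ∀ v, v ≠ 0 → 0 < G v v) :
    ∃ κ > 0, ∀ v, κ * ‖v‖ ^ 2 ≤ G v v := by
  rcases subsingleton_or_nontrivial E with hE | hE
  · exact ⟨1, one_pos, fun v => by rw [Subsingleton.elim v 0]; simp⟩
  have hc : Continuous fun v : E => G v v := G.continuous.clm_apply continuous_id
  obtain ⟨v₀, hv₀, hmin⟩ := (isCompact_sphere (0 : E) 1).exists_isMinOn
    (NormedSpace.sphere_nonempty.2 zero_le_one) hc.continuousOn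
  have hv₀' : ‖v₀‖ = 1 := mem_sphere_zero_iff_norm.1 hv₀
  refine ⟨G v₀ v₀, hG v₀ fun h => by simp [h] at hv₀', fun v => ?_⟩
  rcases eq_or_ne v 0 with rfl | hv
  · simp
  have hn : 0 < ‖v‖ := norm_pos_iff.2 hv
  have h1 : (‖v‖⁻¹ : ℝ) • v ∈ Metric.sphere (0 : E) 1 := by
    rw [mem_sphere_zero_iff_norm, norm_smul, norm_inv, norm_norm, inv_mul_cancel₀ hn.ne']
  have h2 : G v₀ v₀ ≤ G ((‖v‖⁻¹ : ℝ) • v) ((‖v‖⁻¹ : ℝ) • v) := hmin h1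
  rw [map_smul, map_smul, smul_apply, smul_eq_mul, smul_eq_mul] at h2
  calc G v₀ v₀ * ‖v‖ ^ 2 ≤ ‖v‖⁻¹ * (‖v‖⁻¹ * G v v) * ‖v‖ ^ 2 := by gcongr
    _ = G v v := by field_simp

/-- The local inverse of the exponential map. -/
theorem exists_log {Ex : E → E → E} {e₀ : E} {b δ₀ C : ℝ} (hb : 0 < b) (hδ₀ : 0 < δ₀) (hC : 0 < C)
    (hEx : ∀ x x' v v' δ, ‖x - e₀‖ ≤ b → ‖x' - e₀‖ ≤ b → ‖v‖ ≤ δ → ‖v'‖ ≤ δ → 0 < δ → δ ≤ δ₀ →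
      ‖(Ex x v - x - v) - (Ex x' v' - x' - v')‖ ≤ C * δ * (‖x - x'‖ + ‖v - v'‖))
    (h0 : ∀ x, ‖x - e₀‖ ≤ b → Ex x 0 = x) {ε : ℝ} (hε : 0 < ε) :
    ∃ (Lg : E → E → E) (R δ : ℝ), 0 < R ∧ 0 < δ ∧ δ ≤ δ₀ ∧ R ≤ b ∧
      (∀ x ∈ Metric.closedBall e₀ R, Lg x x = 0) ∧
      (∀ x ∈ Metric.closedBall e₀ R, ∀ y ∈ Metric.closedBall e₀ R, ∀ x' ∈ Metric.closedBall e₀ R,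
        ∀ y' ∈ Metric.closedBall e₀ R,
        ‖(Lg x y - Lg x' y') - ((y - y') - (x - x'))‖ ≤ ε * (‖x - x'‖ + ‖y - y'‖)) ∧
      (∀ x ∈ Metric.closedBall e₀ R, ∀ y ∈ Metric.closedBall e₀ R,
        ‖Lg x y‖ ≤ δ ∧ Ex x (Lg x y) = y) ∧
      ∀ x ∈ Metric.closedBall e₀ R, ∀ v, ‖v‖ ≤ δ → ‖Ex x v - x‖ ≤ 2 * ‖v‖ ∧
        (Ex x v ∈ Metric.closedBall e₀ R → Lg x (Ex x v) = v) := by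
  -- The bound 1/2 makes exp invertible and gives a crude Lipschitz constant 3 for the logarithm;
  -- inserting that constant into the same estimate multiplies ε' by at most 4, so ε/8 is enough.
  set ε' := min (1 / 2) (ε / 8) with hε'
  have hε0 : 0 < ε' := by positivity
  set δ := min δ₀ (ε' / C) with hδ
  have hδ0 : 0 < δ := by positivity
  have hCδ : C * δ ≤ ε' := by
    have := mul_le_mul_of_nonneg_left (min_le_right δ₀ (ε' / C)) hC.le
    rwa [mul_div_cancel₀ _ hC.ne'] at this
  set R := min b (δ / 4) with hR
  have hR0 : 0 < R := by positivity
  have hdiff : ∀ x ∈ Metric.closedBall e₀ R, ∀ x' ∈ Metric.closedBall e₀ R, ∀ v v', ‖v‖ ≤ δ →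
      ‖v'‖ ≤ δ → ‖(Ex x v - x - v) - (Ex x' v' - x' - v')‖ ≤ ε' * (‖x - x'‖ + ‖v - v'‖) :=
    fun x hx x' hx' v v' hv hv' => by
      refine (hEx x x' v v' δ ((mem_closedBall_iff_norm.1 hx).trans (min_le_left _ _))
        ((mem_closedBall_iff_norm.1 hx').trans (min_le_left _ _)) hv hv' hδ0
        (min_le_left _ _)).trans ?_
      gcongr
  have h0' : ∀ x ∈ Metric.closedBall e₀ R, Ex x 0 = x := fun x hx =>
    h0 x ((mem_closedBall_iff_norm.1 hx).trans (min_le_left _ _))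
  have hhalf : ε' ≤ 1 / 2 := min_le_left _ _
  have hinj : ∀ x ∈ Metric.closedBall e₀ R, ∀ v v', ‖v‖ ≤ δ → ‖v'‖ ≤ δ → Ex x v = Ex x v' →
      v = v' := fun x hx v v' hv hv' h => by
    have := hdiff x hx x hx v v' hv hv'
    rw [h, sub_self, norm_zero, zero_add, sub_sub_sub_cancel_left, norm_sub_rev] at this
    have h2 : ‖v - v'‖ ≤ 0 := by nlinarith [norm_nonneg (v - v')]
    exact sub_eq_zero.1 (norm_le_zero_iff.1 h2)
  have hex : ∀ x y, ∃ v, x ∈ Metric.closedBall e₀ R → y ∈ Metric.closedBall e₀ R →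
      ‖v‖ ≤ δ ∧ Ex x v = y := fun x y => by
    by_cases hxy : x ∈ Metric.closedBall e₀ R ∧ y ∈ Metric.closedBall e₀ R
    · obtain ⟨hx, hy⟩ := hxy
      obtain ⟨v, hv, hvy⟩ := exists_eq_of_almost_id (f := Ex x) (b := 0) (y := y) hδ0.le
        (fun v hv v' hv' => by
          have := hdiff x hx x hx v v' (mem_closedBall_zero_iff.1 hv) (mem_closedBall_zero_iff.1 hv')
          rw [sub_self, norm_zero, zero_add] at this
          rw [show Ex x v - Ex x v' - (v - v') = (Ex x v - x - v) - (Ex x v' - x - v') by abel]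
          exact this.trans (by gcongr))
        (by
          rw [h0' x hx]
          have h1 := mem_closedBall_iff_norm.1 hx
          have h2 := mem_closedBall_iff_norm.1 hy
          have h3 := norm_sub_le (y - e₀) (x - e₀)
          rw [sub_sub_sub_cancel_right] at h3
          have h4 : R ≤ δ / 4 := min_le_right _ _
          linarith)
      exact ⟨v, fun _ _ => ⟨mem_closedBall_zero_iff.1 hv, hvy⟩⟩
    · exact ⟨0, fun h1 h2 => absurd ⟨h1, h2⟩ hxy⟩
  choose Lg hLg using hex
  refine ⟨Lg, R, δ, hR0, hδ0, min_le_left _ _, min_le_left _ _, ?_, ?_,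
    fun x hx y hy => hLg x y hx hy, ?_⟩
  · intro x hx
    obtain ⟨h1, h2⟩ := hLg x x hx hx
    exact hinj x hx _ _ h1 (by rw [norm_zero]; exact hδ0.le) (by rw [h2, h0' x hx])
  · intro x hx y hy x' hx' y' hy'
    obtain ⟨h1, h2⟩ := hLg x y hx hy
    obtain ⟨h3, h4⟩ := hLg x' y' hx' hy'
    have h5 := hdiff x hx x' hx' _ _ h1 h3
    rw [h2, h4] at h5
    set D := Lg x y - Lg x' y' with hD
    have h6 : y - x - Lg x y - (y' - x' - Lg x' y') = (y - y') - (x - x') - D := by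
      rw [hD]; abel
    rw [h6] at h5
    have h7 := norm_sub_le ((y - y') - (x - x')) ((y - y') - (x - x') - D)
    rw [sub_sub_cancel] at h7
    have h8 := norm_sub_le (y - y') (x - x')
    have h9 : ‖D‖ ≤ 3 * (‖x - x'‖ + ‖y - y'‖) := by
      nlinarith [norm_nonneg (x - x'), norm_nonneg (y - y'), norm_nonneg D]
    rw [norm_sub_rev]
    refine h5.trans ?_
    have h10 : ε' ≤ ε / 8 := min_le_right _ _
    have h11 := norm_nonneg (x - x')
    have h12 := norm_nonneg (y - y')
    calc ε' * (‖x - x'‖ + ‖D‖) ≤ ε / 8 * (‖x - x'‖ + 3 * (‖x - x'‖ + ‖y - y'‖)) := by gcongr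
      _ ≤ ε / 8 * (8 * (‖x - x'‖ + ‖y - y'‖)) := by gcongr; linarith
      _ = _ := by ring
  · intro x hx v hv
    refine ⟨?_, fun h => ?_⟩
    · have h1 := hdiff x hx x hx v 0 hv (by rw [norm_zero]; exact hδ0.le)
      rw [h0' x hx, sub_self x, norm_zero, zero_add, sub_zero, sub_zero, sub_zero] at h1
      have h2 := norm_add_le (Ex x v - x - v) v
      rw [sub_add_cancel] at h2
      nlinarith [norm_nonneg v]
    · obtain ⟨h1, h2⟩ := hLg x (Ex x v) hx h
      exact hinj x hx _ _ h1 hv h2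

/-- Fields that are `C¹`-close to a hyperbolic linear map. -/
theorem norm_sub_sub_le_of_fderiv {F : E → E} {A : E →L[ℝ] E} {e₀ : E} {R η : ℝ}
    (hd : ∀ x ∈ Metric.closedBall e₀ R, DifferentiableAt ℝ F x)
    (hb : ∀ x ∈ Metric.closedBall e₀ R, ‖fderiv ℝ F x - A‖ ≤ η) :
    ∀ x ∈ Metric.closedBall e₀ R, ∀ y ∈ Metric.closedBall e₀ R,
      ‖F x - F y - A (x - y)‖ ≤ η * ‖x - y‖ := fun _ hx _ hy =>
  (convex_closedBall e₀ R).norm_image_sub_le_of_norm_fderiv_le' hd hb hy hx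

end Perturbation


/-! ### Persistence of the saddle. -/

section PerturbedSaddle

variable {E : Type*} [NormedAddCommGroup E] [InnerProductSpace ℝ E] [FiniteDimensional ℝ E]

/-- The conditions on a logarithm and a metric in a ball that are part of a `LocalSaddle`. -/
structure LogMetric (c : SaddleConst) (Lg : E → E → E) (G : E → E →L[ℝ] E →L[ℝ] ℝ) (e₀ : E) :
    Prop where
  log_self : ∀ x ∈ Metric.closedBall e₀ c.R, Lg x x = 0
  log_sub : ∀ x ∈ Metric.closedBall e₀ c.R, ∀ y ∈ Metric.closedBall e₀ c.R,
    ∀ x' ∈ Metric.closedBall e₀ c.R, ∀ y' ∈ Metric.closedBall e₀ c.R,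
    ‖(Lg x y - Lg x' y') - ((y - y') - (x - x'))‖ ≤ c.ε * (‖x - x'‖ + ‖y - y'‖)
  metric_lower : ∀ x ∈ Metric.closedBall e₀ c.R, ∀ v, c.κ * ‖v‖ ^ 2 ≤ G x v v
  metric_norm : ∀ x ∈ Metric.closedBall e₀ c.R, ‖G x‖ ≤ c.k
  metric_lipschitz : ∀ x ∈ Metric.closedBall e₀ c.R, ∀ y ∈ Metric.closedBall e₀ c.R,
    ‖G x - G y‖ ≤ c.k * ‖x - y‖

/-- A field that is `C¹`-close to a linear hyperbolic one has a saddle. -/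
theorem exists_localSaddle {c : SaddleConst} {A : E →L[ℝ] E} {Lg : E → E → E}
    {G : E → E →L[ℝ] E →L[ℝ] ℝ} {e₀ : E} (hLG : LogMetric c Lg G e₀)
    (hA : ‖A‖ + c.ε ≤ c.Λ) (hAlam : ∀ v, 2 * c.lam * ‖v‖ ≤ ‖A v‖) (hε : c.ε ≤ c.lam)
    {F : E → E} (hd : ∀ x ∈ Metric.closedBall e₀ c.R, DifferentiableAt ℝ F x)
    (hF : ∀ x ∈ Metric.closedBall e₀ c.R, ‖fderiv ℝ F x - A‖ ≤ c.ε / 2) {r : ℝ} (hr : 0 ≤ r)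
    (hrR : r ≤ c.R / 2) (h0 : ‖F e₀‖ ≤ c.lam * r) :
    ∃ p, ‖p - e₀‖ ≤ r ∧ p ∈ Metric.closedBall e₀ c.R ∧ F p = 0 ∧
      ∀ S U, SplitForms (fderiv ℝ F p) S U c.ρ c.m c.K →
        LocalSaddle c F (fderiv ℝ F p) S U Lg G e₀ p := by
  have hε0 := c.ε_pos
  have hlam := c.lam_pos
  have hR := c.R_pos
  have h1 := norm_sub_sub_le_of_fderiv hd hF
  have hsub : Metric.closedBall e₀ r ⊆ Metric.closedBall e₀ c.R :=
    Metric.closedBall_subset_closedBall (by linarith)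
  -- The singularity is the preimage of 0, which lies in the image because the field is small at
  -- `e₀`.
  obtain ⟨p, hp, hp0⟩ := exists_eq_of_almost_linear (A := A) (lam := 2 * c.lam) (η := c.ε / 2)
    (by linarith) hAlam (by linarith) (f := F) (b := e₀) hr
    (fun x hx y hy => h1 x (hsub hx) y (hsub hy)) (y := 0)
    (by rw [zero_sub, norm_neg]; linarith)
  have hpR := hsub hp
  rw [mem_closedBall_iff_norm] at hp
  have hBA := hF p hpR
  refine ⟨p, hp, hpR, hp0, fun S U hSU =>
    { forms := hSU
      mem := by linarith
      zero := hp0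
      norm_le := ?_
      approx := fun x hx y hy => ?_
      lipschitz := fun x hx y hy => ?_
      expanding := fun x hx y hy => ?_
      log_self := hLG.log_self
      log_sub := hLG.log_sub
      metric_lower := hLG.metric_lower
      metric_norm := hLG.metric_norm
      metric_lipschitz := hLG.metric_lipschitz }⟩
  · have := norm_add_le (fderiv ℝ F p - A) A
    rw [sub_add_cancel] at this
    linarith
  · have h2 := (fderiv ℝ F p - A).le_of_opNorm_le hBA (x - y)
    have h3 := norm_sub_le (F x - F y - A (x - y)) ((fderiv ℝ F p - A) (x - y))
    have h4 := h1 x hx y hy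
    rw [sub_apply] at h2 h3
    rw [show F x - F y - A (x - y) - (fderiv ℝ F p (x - y) - A (x - y)) =
      F x - F y - fderiv ℝ F p (x - y) by abel] at h3
    linarith
  · have h2 := norm_add_le (F x - F y - A (x - y)) (A (x - y))
    rw [sub_add_cancel] at h2
    have h4 := h1 x hx y hy
    have h5 := A.le_opNorm (x - y)
    have h6 := mul_le_mul_of_nonneg_right (show ‖A‖ + c.ε / 2 ≤ c.Λ by linarith)
      (norm_nonneg (x - y))
    linarith
  · have h2 := norm_sub_le (F x - F y) (F x - F y - A (x - y))
    rw [sub_sub_cancel] at h2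
    have h4 := h1 x hx y hy
    have h5 := hAlam (x - y)
    have h6 := mul_le_mul_of_nonneg_right hε (norm_nonneg (x - y))
    have h7 : 0 ≤ c.lam * ‖x - y‖ := by positivity
    linarith

end PerturbedSaddle

/-! ### Uniform constants for all fields close to the given one. -/

section SaddleChart

variable {d : ℕ} {M : Type*} [EMetricSpace M] [ChartedSpace (Model d) M]
  [IsManifold (𝓡 d) ∞ M] [RiemannianBundle (fun x : M => TangentSpace (𝓡 d) x)]

/-- The distance and the exponential map in a ball of the chart around `σ`. -/
structure SaddleChart (c : SaddleConst) (Lg : Model d → Model d → Model d) (Cd δ : ℝ) (σ : M) :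
    Prop where
  Cd_pos : 0 < Cd
  δ_pos : 0 < δ
  subset : Metric.closedBall (extChartAt (𝓡 d) σ σ) c.R ⊆ (extChartAt (𝓡 d) σ).target
  edist_le : ∀ u ∈ Metric.closedBall (extChartAt (𝓡 d) σ σ) c.R,
    ∀ v ∈ Metric.closedBall (extChartAt (𝓡 d) σ σ) c.R,
    edist ((extChartAt (𝓡 d) σ).symm u) ((extChartAt (𝓡 d) σ).symm v)
      ≤ ENNReal.ofReal (Cd * ‖u - v‖)
  isExp_log : ∀ u ∈ Metric.closedBall (extChartAt (𝓡 d) σ σ) c.R,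
    ∀ v ∈ Metric.closedBall (extChartAt (𝓡 d) σ σ) c.R,
    IsExp (d := d) ((extChartAt (𝓡 d) σ).symm u)
      (chartVector σ ((extChartAt (𝓡 d) σ).symm u) (Lg u v)) ((extChartAt (𝓡 d) σ).symm v)
  of_isExp : ∀ u ∈ Metric.closedBall (extChartAt (𝓡 d) σ σ) c.R, ∀ v, ‖v‖ ≤ δ → ∀ y,
    IsExp (d := d) ((extChartAt (𝓡 d) σ).symm u)
      (chartVector σ ((extChartAt (𝓡 d) σ).symm u) v) y →
    ∃ y', y = (extChartAt (𝓡 d) σ).symm y' ∧ ‖y' - u‖ ≤ 2 * ‖v‖ ∧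
      (y' ∈ Metric.closedBall (extChartAt (𝓡 d) σ σ) c.R → Lg u y' = v)

variable [IsContMDiffRiemannianBundle (𝓡 d) ∞ (Model d) (fun x : M => TangentSpace (𝓡 d) x)]

/-- The metric is positive definite at the centre and Lipschitz near it; the radius is so small that
it changes by at most half of its lower bound. -/
theorem exists_metric_bounds (σ : M) : ∃ κ k R : ℝ, 0 < κ ∧ κ ≤ 1 ∧ 1 ≤ k ∧ 0 < R ∧
    (∀ x ∈ Metric.closedBall (extChartAt (𝓡 d) σ σ) R, ∀ v,
      κ * ‖v‖ ^ 2 ≤ metricForm (d := d) σ x v v) ∧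
    (∀ x ∈ Metric.closedBall (extChartAt (𝓡 d) σ σ) R, ‖metricForm (d := d) σ x‖ ≤ k) ∧
    ∀ x ∈ Metric.closedBall (extChartAt (𝓡 d) σ σ) R,
      ∀ y ∈ Metric.closedBall (extChartAt (𝓡 d) σ σ) R,
      ‖metricForm (d := d) σ x - metricForm σ y‖ ≤ k * ‖x - y‖ := by
  have he := mem_extChartAt_target (I := 𝓡 d) σ
  set e₀ := extChartAt (𝓡 d) σ σ with he₀
  obtain ⟨κ₀, hκ₀, hG₀⟩ := exists_bilin_lower (G := metricForm (d := d) σ e₀)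
    fun v hv => metricForm_pos σ he hv
  obtain ⟨L, s, hs, hL⟩ := ((contDiffAt_metricForm he).of_le
    (show (1 : ℕ∞ω) ≤ (∞ : ℕ∞ω) from ENat.LEInfty.out)).exists_lipschitzOnWith
  obtain ⟨R₁, hR₁, hR₁s⟩ := Metric.nhds_basis_closedBall.mem_iff.1 hs
  set R := min R₁ (κ₀ / (2 * (L + 1))) with hR
  have hL0 : (0 : ℝ) ≤ L := L.2
  have hR0 : 0 < R := by positivity
  have hLR : L * R ≤ κ₀ / 2 := by
    have h1 := mul_le_mul_of_nonneg_left (min_le_right R₁ (κ₀ / (2 * (L + 1))))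
      (show (0 : ℝ) ≤ L + 1 by linarith)
    rw [show (L + 1) * (κ₀ / (2 * (L + 1))) = κ₀ / 2 by field_simp] at h1
    have : L * R ≤ (L + 1) * R := by nlinarith
    exact this.trans h1
  have hlip : ∀ x ∈ Metric.closedBall e₀ R, ∀ y ∈ Metric.closedBall e₀ R,
      ‖metricForm (d := d) σ x - metricForm σ y‖ ≤ L * ‖x - y‖ := fun x hx y hy => by
    have h1 : ∀ z ∈ Metric.closedBall e₀ R, z ∈ s := fun z hz =>
      hR₁s (Metric.closedBall_subset_closedBall (min_le_left _ _) hz)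
    have := hL.dist_le_mul x (h1 x hx) y (h1 y hy)
    rwa [dist_eq_norm, dist_eq_norm] at this
  have hself : e₀ ∈ Metric.closedBall e₀ R := Metric.mem_closedBall_self hR0.le
  have hnear : ∀ x ∈ Metric.closedBall e₀ R,
      ‖metricForm (d := d) σ x - metricForm σ e₀‖ ≤ κ₀ / 2 := fun x hx => by
    refine (hlip x hx e₀ hself).trans (le_trans ?_ hLR)
    rw [mem_closedBall_iff_norm] at hx
    gcongr
  refine ⟨min 1 (κ₀ / 2), max 1 (max L (‖metricForm (d := d) σ e₀‖ + κ₀ / 2)), R,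
    by positivity, min_le_left _ _, le_max_left _ _, hR0, fun x hx v => ?_, fun x hx => ?_,
    fun x hx y hy => (hlip x hx y hy).trans ?_⟩
  · have h1 := (abs_le.1 ((abs_apply_le (metricForm (d := d) σ x - metricForm σ e₀) v v).trans
      (mul_le_mul_of_nonneg_right (mul_le_mul_of_nonneg_right (hnear x hx) (norm_nonneg v))
        (norm_nonneg v)))).1
    rw [sub_apply, sub_apply] at h1
    have h2 := hG₀ v
    have h3 := mul_le_mul_of_nonneg_right (min_le_right 1 (κ₀ / 2)) (sq_nonneg ‖v‖)
    nlinarith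
  · have h1 := norm_add_le (metricForm (d := d) σ x - metricForm σ e₀) (metricForm σ e₀)
    rw [sub_add_cancel] at h1
    refine (le_trans ?_ (le_max_right _ _)).trans (le_max_right _ _)
    linarith [hnear x hx]
  · gcongr
    exact (le_max_left _ _).trans (le_max_right _ _)

variable [IsRiemannianManifold (𝓡 d) M]

/-- All `C¹` fields near a hyperbolic singularity have a saddle, with uniform constants. -/
theorem exists_saddleChart {X : ∀ x : M, TangentSpace (𝓡 d) x} (hX : IsC1VectorField X) {σ : M}
    (hσ : IsHyperbolicSingularity X σ) :
    ∃ (c : SaddleConst) (Lg : Model d → Model d → Model d) (Cd δ : ℝ), SaddleChart c Lg Cd δ σ ∧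
      ∀ r > 0, ∃ ε > 0, ∀ Y : ∀ x : M, TangentSpace (𝓡 d) x, IsC1VectorField Y →
        (∀ u ∈ Metric.closedBall (extChartAt (𝓡 d) σ σ) c.R,
          ‖coordField Y σ u - coordField X σ u‖ < ε ∧
          ‖fderiv ℝ (coordField Y σ) u - fderiv ℝ (coordField X σ) u‖ < ε) →
        ∃ p B S U, ‖p - extChartAt (𝓡 d) σ σ‖ ≤ r ∧ B = fderiv ℝ (coordField Y σ) p ∧
          IsHyperbolicLinear B ∧ HyperbolicForms B S U c.ρ c.m c.K ∧
          LocalSaddle c (coordField Y σ) B S U Lg (metricForm σ) (extChartAt (𝓡 d) σ σ) p := by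
  have he := mem_extChartAt_target (I := 𝓡 d) σ
  set e₀ := extChartAt (𝓡 d) σ σ with he₀
  set A := linearization X σ with hA
  obtain ⟨ρ, m, K, η, hρ, hm, hK, hη, hforms⟩ :=
    exists_uniform_hyperbolicForms_of_hyperbolic (A := A) hσ.2
  obtain ⟨κ, k, R₁, hκ, hκ1, hk, hR₁, hm1, hm2, hm3⟩ := exists_metric_bounds (d := d) σ
  obtain ⟨Ex, b, δ₀, C, hb, hδ₀, hC, hbt, hEx, hE0, hExp⟩ := exists_chart_exp (d := d) σ
  obtain ⟨Cd, R₂, hCd, hR₂, hedist⟩ := exists_edist_extChartAt_symm_le (d := d) σ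
  set lam := ρ * m / (2 * K) / 2 with hlam
  have hlam0 : 0 < lam := by positivity
  set Λ := ‖A‖ + 1 with hΛ
  have hΛ1 : 1 ≤ Λ := by linarith [norm_nonneg A]
  -- `ε` collects the smallness required by the forms, the metric and the expansion. It is chosen
  -- before the radius `R`, which then makes both the logarithm and the derivative of the field
  -- almost linear to this precision; neither depends on the later radius `r`.
  set ε := min (min (1 / 14) η) (min lam (min (ρ * m / (128 * K * Λ)) (κ / (8 * k))))
    with hε
  have hε0 : 0 < ε := by positivity
  have hε14 : ε ≤ 1 / 14 := (min_le_left _ _).trans (min_le_left _ _)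
  have hεη : ε ≤ η := (min_le_left _ _).trans (min_le_right _ _)
  have hεlam : ε ≤ lam := (min_le_right _ _).trans (min_le_left _ _)
  have hεf : ε ≤ ρ * m / (128 * K * Λ) :=
    (min_le_right _ _).trans ((min_le_right _ _).trans (min_le_left _ _))
  have hεk : ε ≤ κ / (8 * k) :=
    (min_le_right _ _).trans ((min_le_right _ _).trans (min_le_right _ _))
  obtain ⟨Lg, R₃, δ, hR₃, hδ, hδδ₀, hR₃b, hl1, hl2, hl3, hl4⟩ := exists_log hb hδ₀ hC hEx hE0 hε0
  have hcont : ContinuousAt (fderiv ℝ (coordField X σ)) e₀ :=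
    (((contDiffOn_coordField hX σ).contDiffAt
      ((isOpen_extChartAt_target σ).mem_nhds he)).fderiv_right (m := 0) (by simp)).continuousAt
  obtain ⟨R₄, hR₄, hR₄s⟩ := Metric.nhds_basis_closedBall.mem_iff.1
    (hcont.preimage_mem_nhds (Metric.closedBall_mem_nhds _ (show 0 < ε / 4 by linarith)))
  set R := min (min 1 R₁) (min (R₂ / 2) (min R₃ R₄)) with hR
  have hR0 : 0 < R := by positivity
  have hRR₁ : R ≤ R₁ := (min_le_left _ _).trans (min_le_right _ _)
  have hRR₂ : R ≤ R₂ / 2 := (min_le_right _ _).trans (min_le_left _ _)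
  have hRR₃ : R ≤ R₃ := (min_le_right _ _).trans ((min_le_right _ _).trans (min_le_left _ _))
  have hRR₄ : R ≤ R₄ := (min_le_right _ _).trans ((min_le_right _ _).trans (min_le_right _ _))
  let c : SaddleConst :=
    { R := R, Λ := Λ, lam := lam, ρ := ρ, m := m, K := K, ε := ε, κ := κ, k := k
      R_pos := hR0
      R_le := (min_le_left _ _).trans (min_le_left _ _)
      one_le_Λ := hΛ1
      lam_pos := hlam0
      ρ_pos := hρ
      m_pos := hm
      K_pos := hK
      ε_pos := hε0
      κ_pos := hκ
      κ_le := hκ1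
      one_le_k := hk
      small_form := by
        rw [le_div_iff₀ (by positivity)] at hεf
        linarith
      small := by linarith
      small_metric := by
        rw [le_div_iff₀ (by positivity)] at hεk
        linarith }
  have h₁ : ∀ u ∈ Metric.closedBall e₀ R, u ∈ Metric.closedBall e₀ R₁ := fun u hu =>
    Metric.closedBall_subset_closedBall hRR₁ hu
  have h₂ : ∀ u ∈ Metric.closedBall e₀ R, u ∈ Metric.ball e₀ R₂ := fun u hu =>
    Metric.closedBall_subset_ball (by linarith) hu
  have h₃ : ∀ u ∈ Metric.closedBall e₀ R, u ∈ Metric.closedBall e₀ R₃ := fun u hu =>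
    Metric.closedBall_subset_closedBall hRR₃ hu
  have hb' : ∀ u ∈ Metric.closedBall e₀ R, ‖u - e₀‖ ≤ b := fun u hu =>
    (mem_closedBall_iff_norm.1 hu).trans (hRR₃.trans hR₃b)
  have hsubset : Metric.closedBall e₀ R ⊆ (extChartAt (𝓡 d) σ).target := fun u hu =>
    hbt (mem_closedBall_iff_norm.2 (hb' u hu))
  have hLG : LogMetric c Lg (metricForm (d := d) σ) e₀ :=
    { log_self := fun x hx => hl1 x (h₃ x hx)
      log_sub := fun x hx y hy x' hx' y' hy' =>
        hl2 x (h₃ x hx) y (h₃ y hy) x' (h₃ x' hx') y' (h₃ y' hy')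
      metric_lower := fun x hx v => hm1 x (h₁ x hx) v
      metric_norm := fun x hx => hm2 x (h₁ x hx)
      metric_lipschitz := fun x hx y hy => hm3 x (h₁ x hx) y (h₁ y hy) }
  have hAforms : ∀ v, 2 * lam * ‖v‖ ≤ ‖A v‖ := fun v => by
    obtain ⟨-, S, U, hSU⟩ := hforms A (by rw [sub_self, norm_zero]; exact hη.le)
    have := hSU.toSplitForms.norm_lower hρ hK v
    rwa [show 2 * lam = ρ * m / (2 * K) by rw [hlam]; ring]
  refine ⟨c, Lg, Cd, δ,
    { Cd_pos := hCd
      δ_pos := hδ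
      subset := hsubset
      edist_le := fun u hu v hv => hedist u (h₂ u hu) v (h₂ v hv)
      isExp_log := fun u hu v hv => ?_
      of_isExp := fun u hu v hv y hy => ?_ }, fun r hr => ?_⟩
  · obtain ⟨h5, h6⟩ := hl3 u (h₃ u hu) v (h₃ v hv)
    refine ((hExp u (Lg u v) (hb' u hu) (h5.trans hδδ₀)).2 _).2 ?_
    rw [h6]
  · obtain ⟨h5, h6⟩ := hl4 u (h₃ u hu) v hv
    refine ⟨Ex u v, ((hExp u v (hb' u hu) (hv.trans hδδ₀)).2 y).1 hy, h5, fun h7 => ?_⟩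
    exact h6 (h₃ _ h7)
  -- Closeness ε/4 of the derivatives, added to the variation ε/4 of DX in the ball, gives ε/2;
  -- closeness of the values puts the zero of Y within `r` of the centre.
  · refine ⟨min (ε / 4) (lam * min r (R / 2)), by positivity, fun Y hY hYX => ?_⟩
    have hself : e₀ ∈ Metric.closedBall e₀ R := Metric.mem_closedBall_self hR0.le
    have hfd : ∀ x ∈ Metric.closedBall e₀ c.R, ‖fderiv ℝ (coordField Y σ) x - A‖ ≤ c.ε / 2 :=
      fun x hx => by
        have h5 := ((hYX x hx).2.trans_le (min_le_left _ _)).le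
        have h6 : ‖fderiv ℝ (coordField X σ) x - A‖ ≤ ε / 4 :=
          mem_closedBall_iff_norm.1 (hR₄s (Metric.closedBall_subset_closedBall hRR₄ hx))
        have h7 := norm_add_le (fderiv ℝ (coordField Y σ) x - fderiv ℝ (coordField X σ) x)
          (fderiv ℝ (coordField X σ) x - A)
        rw [sub_add_sub_cancel] at h7
        change _ ≤ ε / 2
        linarith
    have h0 : coordField X σ e₀ = 0 :=
      (coordField_eq_zero_iff σ (mem_extChartAt_source σ)).2 hσ.1
    obtain ⟨p, hp, hpR, hp0, hsaddle⟩ := exists_localSaddle (c := c) hLG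
      (show ‖A‖ + ε ≤ ‖A‖ + 1 by linarith) hAforms hεlam (F := coordField Y σ)
      (fun x hx => differentiableAt_coordField hY (hsubset hx)) hfd
      (r := min r (R / 2)) (by positivity) (min_le_right _ _) (by
        have := ((hYX e₀ hself).1.trans_le (min_le_right _ _)).le
        rwa [h0, sub_zero] at this)
    obtain ⟨hB, S, U, hSU⟩ := hforms _ ((hfd p hpR).trans (show ε / 2 ≤ η by linarith))
    exact ⟨p, _, S, U, hp.trans (min_le_left _ _), rfl, hB, hSU, hsaddle S U hSU.toSplitForms⟩

end SaddleChart


/-! ### Flows on the manifold seen in the chart. -/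

section Flow

variable {d : ℕ} {M : Type*} [EMetricSpace M] [ChartedSpace (Model d) M]
  [IsManifold (𝓡 d) ∞ M] [RiemannianBundle (fun x : M => TangentSpace (𝓡 d) x)]

theorem coordField_neg (Y : ∀ x : M, TangentSpace (𝓡 d) x) (p : M) :
    coordField (fun x => -Y x) p = fun u => -coordField Y p u :=
  funext fun _ => ContinuousLinearMap.map_neg _ _

theorem IsFlowOf.neg {Y : ∀ x : M, TangentSpace (𝓡 d) x} {φ : ℝ → M → M} (h : IsFlowOf Y φ) :
    IsFlowOf (fun x => -Y x) (fun t => φ (-t)) where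
  zero x := by rw [neg_zero]; exact h.zero x
  add s t x := by rw [neg_add]; exact h.add _ _ x
  integral x := by
    have := (h.integral x).comp_mul (-1)
    convert this using 1
    · funext t; simp
    · funext x; simp

theorem IsFlowOf.neg_apply {Y : ∀ x : M, TangentSpace (𝓡 d) x} {φ : ℝ → M → M} (h : IsFlowOf Y φ)
    (t : ℝ) (x : M) : φ (-t) (φ t x) = x := by
  rw [← h.add, neg_add_cancel, h.zero]

/-- The points at distance at most `ρ` from `p` in the chart around `σ`. -/
def chartBall (σ : M) (p : Model d) (ρ : ℝ) : Set M :=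
  {x | x ∈ (extChartAt (𝓡 d) σ).source ∧ ‖extChartAt (𝓡 d) σ x - p‖ ≤ ρ}

theorem chartBall_mono {σ : M} {p : Model d} {ρ ρ' : ℝ} (h : ρ ≤ ρ') :
    chartBall σ p ρ ⊆ chartBall σ p ρ' := fun _ hx => ⟨hx.1, hx.2.trans h⟩

theorem chartBall_eq_image {σ : M} {p : Model d} {ρ : ℝ}
    (h : Metric.closedBall p ρ ⊆ (extChartAt (𝓡 d) σ).target) :
    chartBall σ p ρ = (extChartAt (𝓡 d) σ).symm '' Metric.closedBall p ρ := by
  ext x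
  constructor
  · rintro ⟨hx, hxρ⟩
    exact ⟨_, mem_closedBall_iff_norm.2 hxρ, (extChartAt (𝓡 d) σ).left_inv hx⟩
  · rintro ⟨u, hu, rfl⟩
    refine ⟨(extChartAt (𝓡 d) σ).map_target (h hu), ?_⟩
    rw [(extChartAt (𝓡 d) σ).right_inv (h hu)]
    exact mem_closedBall_iff_norm.1 hu

/-- Closed in the whole manifold, as the image of a compact ball. Thus an orbit cannot leave it
through the boundary of the chart, which the continuation arguments below use. -/
theorem isClosed_chartBall {σ : M} {p : Model d} {ρ : ℝ}
    (h : Metric.closedBall p ρ ⊆ (extChartAt (𝓡 d) σ).target) : IsClosed (chartBall σ p ρ) := by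
  rw [chartBall_eq_image h]
  exact ((isCompact_closedBall p ρ).image_of_continuousOn
    ((continuousOn_extChartAt_symm σ).mono h)).isClosed

theorem chartBall_mem_nhds {σ : M} {p : Model d} {ρ : ℝ} {x : M}
    (hx : x ∈ (extChartAt (𝓡 d) σ).source) (h : ‖extChartAt (𝓡 d) σ x - p‖ < ρ) :
    chartBall σ p ρ ∈ 𝓝 x := by
  have h1 : ContinuousAt (fun x => ‖extChartAt (𝓡 d) σ x - p‖) x :=
    (((continuousOn_extChartAt σ).continuousAt
      ((isOpen_extChartAt_source σ).mem_nhds hx)).sub continuousAt_const).norm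
  filter_upwards [(isOpen_extChartAt_source σ).mem_nhds hx, h1.eventually (gt_mem_nhds h)]
    with y hy hy'
  exact ⟨hy, hy'.le⟩

theorem IsFlowOf.isOrbitOn {Y : ∀ x : M, TangentSpace (𝓡 d) x} {φ : ℝ → M → M} (h : IsFlowOf Y φ)
    {σ : M} {p : Model d} {ρ : ℝ} {x : M} {I : Set ℝ} (hI : ∀ t ∈ I, φ t x ∈ chartBall σ p ρ) :
    IsOrbitOn (coordField Y σ) (Metric.closedBall p ρ) (fun t => extChartAt (𝓡 d) σ (φ t x)) I :=
  fun t ht => ⟨hasDerivAt_extChartAt_comp (h.integral x) (hI t ht).1,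
    mem_closedBall_iff_norm.2 (hI t ht).2⟩

/-- A vector field with a saddle in the chart around `σ`. -/
structure FieldSaddle (c : SaddleConst) (Lg : Model d → Model d → Model d) (Cd δ : ℝ) (σ : M)
    (Y : ∀ x : M, TangentSpace (𝓡 d) x) (B : Model d →L[ℝ] Model d)
    (S U : Model d →L[ℝ] Model d →L[ℝ] ℝ) (p : Model d) : Prop where
  chart : SaddleChart c Lg Cd δ σ
  saddle : LocalSaddle c (coordField Y σ) B S U Lg (metricForm σ) (extChartAt (𝓡 d) σ σ) p
  near : ‖p - extChartAt (𝓡 d) σ σ‖ ≤ c.R / 4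

/-- The flow of a vector field with a saddle in the chart around `σ`. -/
structure FlowSaddle (c : SaddleConst) (Lg : Model d → Model d → Model d) (Cd δ : ℝ) (σ : M)
    (Y : ∀ x : M, TangentSpace (𝓡 d) x) (φ : ℝ → M → M) (B : Model d →L[ℝ] Model d)
    (S U : Model d →L[ℝ] Model d →L[ℝ] ℝ) (p : Model d) : Prop extends
    FieldSaddle c Lg Cd δ σ Y B S U p where
  flow : IsFlowOf Y φ

namespace FlowSaddle

variable {c : SaddleConst} {Lg : Model d → Model d → Model d} {Cd δ : ℝ} {σ : M}
  {Y : ∀ x : M, TangentSpace (𝓡 d) x} {φ : ℝ → M → M} {B : Model d →L[ℝ] Model d}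
  {S U : Model d →L[ℝ] Model d →L[ℝ] ℝ} {p : Model d}

theorem neg (h : FlowSaddle c Lg Cd δ σ Y φ B S U p) :
    FlowSaddle c Lg Cd δ σ (fun x => -Y x) (fun t => φ (-t)) (-B) U S p where
  chart := h.chart
  flow := h.flow.neg
  saddle := by rw [coordField_neg]; exact h.saddle.neg
  near := h.near

theorem closedBall_subset (h : FlowSaddle c Lg Cd δ σ Y φ B S U p) {ρ : ℝ}
    (hρ : ρ ≤ 3 * c.R / 4) :
    Metric.closedBall p ρ ⊆ Metric.closedBall (extChartAt (𝓡 d) σ σ) c.R :=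
  Metric.closedBall_subset_closedBall' (by rw [dist_eq_norm]; linarith [h.near])

theorem closedBall_subset_target (h : FlowSaddle c Lg Cd δ σ Y φ B S U p) {ρ : ℝ}
    (hρ : ρ ≤ 3 * c.R / 4) : Metric.closedBall p ρ ⊆ (extChartAt (𝓡 d) σ).target :=
  (h.closedBall_subset hρ).trans h.chart.subset

theorem extChartAt_mem (h : FlowSaddle c Lg Cd δ σ Y φ B S U p) {ρ : ℝ}
    (hρ : ρ ≤ 3 * c.R / 4) {x : M} (hx : x ∈ chartBall σ p ρ) :
    extChartAt (𝓡 d) σ x ∈ Metric.closedBall (extChartAt (𝓡 d) σ σ) c.R :=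
  h.closedBall_subset hρ (mem_closedBall_iff_norm.2 hx.2)

/-- Continuation argument: as long as the orbit of `y` stays in the ball of radius R/2, Gronwall
gives the estimate, and the estimate places it strictly inside that ball. So the set of good times
is closed and can be extended to the right. -/
theorem shadow_Icc (h : FlowSaddle c Lg Cd δ σ Y φ B S U p) {u : ℝ → Model d} {T : ℝ}
    (hT : 0 ≤ T) (hu : IsOrbitOn (coordField Y σ) (Metric.closedBall p (c.R / 4)) u (Icc 0 T))
    {y : M} (hy : y ∈ (extChartAt (𝓡 d) σ).source)
    (hyu : Real.exp (c.Λ * T) * ‖extChartAt (𝓡 d) σ y - u 0‖ < c.R / 4) :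
    ∀ t ∈ Icc 0 T, φ t y ∈ chartBall σ p (c.R / 2) ∧
      ‖extChartAt (𝓡 d) σ (φ t y) - u t‖ ≤ Real.exp (c.Λ * t) * ‖extChartAt (𝓡 d) σ y - u 0‖ := by
  have hR := c.R_pos
  have hΛ : 0 ≤ c.Λ := by linarith [c.one_le_Λ]
  have hW := h.closedBall_subset (ρ := c.R / 2) (by linarith)
  have key : ∀ t ∈ Icc 0 T, (∀ s ∈ Icc 0 t, φ s y ∈ chartBall σ p (c.R / 2)) →
      ‖extChartAt (𝓡 d) σ (φ t y) - u t‖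
        ≤ Real.exp (c.Λ * t) * ‖extChartAt (𝓡 d) σ y - u 0‖ := fun t ht hs => by
    have h1 := IsOrbitOn.norm_sub_le_Icc hΛ
      (fun x hx y hy => h.saddle.lipschitz x (hW hx) y (hW hy)) (h.flow.isOrbitOn hs)
      (fun s hs => ⟨(hu s ⟨hs.1, hs.2.trans ht.2⟩).1,
        Metric.closedBall_subset_closedBall (by linarith) (hu s ⟨hs.1, hs.2.trans ht.2⟩).2⟩)
      (right_mem_Icc.2 ht.1)
    simpa [h.flow.zero] using h1
  have hlt : ∀ t ∈ Icc 0 T, ‖extChartAt (𝓡 d) σ (φ t y) - u t‖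
      ≤ Real.exp (c.Λ * t) * ‖extChartAt (𝓡 d) σ y - u 0‖ →
      ‖extChartAt (𝓡 d) σ (φ t y) - p‖ < c.R / 2 := fun t ht hb => by
    have h1 := mem_closedBall_iff_norm.1 (hu t ht).2
    have h2 := norm_sub_le_norm_sub_add_norm_sub (extChartAt (𝓡 d) σ (φ t y)) (u t) p
    have h3 : Real.exp (c.Λ * t) * ‖extChartAt (𝓡 d) σ y - u 0‖
        ≤ Real.exp (c.Λ * T) * ‖extChartAt (𝓡 d) σ y - u 0‖ := by
      have := ht.2
      gcongr
    linarith
  have hclosed : IsClosed ({t | φ t y ∈ chartBall σ p (c.R / 2)} ∩ Icc 0 T) :=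
    ((isClosed_chartBall (h.closedBall_subset_target (by linarith))).preimage
      (h.flow.integral y).continuous).inter isClosed_Icc
  have h0 : φ 0 y ∈ chartBall σ p (c.R / 2) := by
    refine ⟨by rwa [h.flow.zero], (hlt 0 (left_mem_Icc.2 hT) ?_).le⟩
    rw [h.flow.zero, mul_zero, Real.exp_zero, one_mul]
  have hall : Icc 0 T ⊆ {t | φ t y ∈ chartBall σ p (c.R / 2)} := by
    refine hclosed.Icc_subset_of_forall_mem_nhdsGT_of_Icc_subset h0 fun t ht hs => ?_
    have ht' := Ico_subset_Icc_self ht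
    have h1 := hlt t ht' (key t ht' hs)
    have h2 := hs (right_mem_Icc.2 ht.1)
    exact mem_nhdsWithin_of_mem_nhds ((h.flow.integral y).continuous.continuousAt.preimage_mem_nhds
      (chartBall_mem_nhds h2.1 h1))
  exact fun t ht => ⟨hall ht, key t ht fun s hs => hall ⟨hs.1, hs.2.trans ht.2⟩⟩

/-- Orbits that start near an orbit in the chart stay near it for a while. -/
theorem shadow (h : FlowSaddle c Lg Cd δ σ Y φ B S U p) {u : ℝ → Model d} {t : ℝ}
    (hu : IsOrbitOn (coordField Y σ) (Metric.closedBall p (c.R / 4)) u (uIcc 0 t))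
    {y : M} (hy : y ∈ (extChartAt (𝓡 d) σ).source)
    (hyu : Real.exp (c.Λ * |t|) * ‖extChartAt (𝓡 d) σ y - u 0‖ < c.R / 4) :
    φ t y ∈ chartBall σ p (c.R / 2) ∧ ‖extChartAt (𝓡 d) σ (φ t y) - u t‖
      ≤ Real.exp (c.Λ * |t|) * ‖extChartAt (𝓡 d) σ y - u 0‖ := by
  rcases le_total 0 t with ht | ht
  · rw [uIcc_of_le ht] at hu
    rw [abs_of_nonneg ht] at hyu ⊢
    exact h.shadow_Icc ht hu hy hyu t (right_mem_Icc.2 ht)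
  · rw [uIcc_of_ge ht] at hu
    rw [abs_of_nonpos ht] at hyu ⊢
    have hu' : IsOrbitOn (coordField (fun x => -Y x) σ) (Metric.closedBall p (c.R / 4))
        (fun s => u (-s)) (Icc 0 (-t)) := by
      rw [coordField_neg]
      exact hu.neg.mono fun s hs => ⟨by linarith [hs.2], by linarith [hs.1]⟩
    have := h.neg.shadow_Icc (neg_nonneg.2 ht) hu' hy (by simpa using hyu) (-t)
      (right_mem_Icc.2 (neg_nonneg.2 ht))
    simpa using this

/-- Orbits that start near the saddle stay near it for a while. -/
theorem shadow_saddle (h : FlowSaddle c Lg Cd δ σ Y φ B S U p) {t ρ : ℝ} {y : M}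
    (hy : y ∈ chartBall σ p ρ) (hρ : Real.exp (c.Λ * |t|) * ρ < c.R / 4) :
    φ t y ∈ chartBall σ p (Real.exp (c.Λ * |t|) * ρ) := by
  have hR := c.R_pos
  have h1 : Real.exp (c.Λ * |t|) * ‖extChartAt (𝓡 d) σ y - p‖ ≤ Real.exp (c.Λ * |t|) * ρ := by
    gcongr
    exact hy.2
  obtain ⟨h2, h3⟩ := h.shadow (IsOrbitOn.const h.saddle.zero
    (Metric.mem_closedBall_self (by linarith)) _) hy.1 (h1.trans_lt hρ)
  exact ⟨h2.1, h3.trans h1⟩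

end FlowSaddle

end Flow


/-! ### The layers of the cross section and the orbits through them. -/

section Layer

variable {d : ℕ} {M : Type*} [EMetricSpace M] [ChartedSpace (Model d) M]
  [IsManifold (𝓡 d) ∞ M] [RiemannianBundle (fun x : M => TangentSpace (𝓡 d) x)]

/-- The factor between the radius of a layer of the cone and its size in the chart. -/
def SaddleConst.D (c : SaddleConst) : ℝ := 2 * Real.sqrt (2 / c.m)

theorem SaddleConst.D_pos (c : SaddleConst) : 0 < c.D := by
  have := c.m_pos
  unfold D
  positivity

/-- A quadratic form in the logarithmic coordinates at `p`. -/
def quadAt (Lg : Model d → Model d → Model d) (σ : M) (p : Model d)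
    (S : Model d →L[ℝ] Model d →L[ℝ] ℝ) (x : M) : ℝ :=
  S (Lg p (extChartAt (𝓡 d) σ x)) (Lg p (extChartAt (𝓡 d) σ x))

/-- The layers of the cross section in the chart around `σ`. -/
def layer (c : SaddleConst) (Lg : Model d → Model d → Model d) (σ : M) (p : Model d)
    (S U : Model d →L[ℝ] Model d →L[ℝ] ℝ) (n : ℕ) : Set M :=
  {x | x ∈ chartBall σ p (c.D * Real.exp (-(n : ℝ))) ∧ quadAt Lg σ p S x = quadAt Lg σ p U x ∧
    Real.exp (-((n : ℝ) + 1)) ≤ Real.sqrt (quadAt Lg σ p S x) ∧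
    Real.sqrt (quadAt Lg σ p S x) < Real.exp (-(n : ℝ))}

variable {c : SaddleConst} {Lg : Model d → Model d → Model d} {Cd δ : ℝ} {σ : M}
  {Y : ∀ x : M, TangentSpace (𝓡 d) x} {φ : ℝ → M → M} {B : Model d →L[ℝ] Model d}
  {S U : Model d →L[ℝ] Model d →L[ℝ] ℝ} {p : Model d}

/-- A layer lies on S = U and is therefore invariant under time reversal, which exchanges the forms.
-/
theorem layer_swap {n : ℕ} {x : M} (hx : x ∈ layer c Lg σ p S U n) :
    x ∈ layer c Lg σ p U S n := by
  obtain ⟨h1, h2, h3, h4⟩ := hx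
  exact ⟨h1, h2.symm, h2 ▸ h3, h2 ▸ h4⟩

theorem exp_le_quadAt_of_mem_layer {n : ℕ} {x : M} (hx : x ∈ layer c Lg σ p S U n) :
    Real.exp (-((n : ℝ) + 1)) ^ 2 ≤ quadAt Lg σ p S x := by
  have h0 : 0 < quadAt Lg σ p S x := Real.sqrt_pos.1 ((Real.exp_pos _).trans_le hx.2.2.1)
  exact (Real.le_sqrt (Real.exp_pos _).le h0.le).1 hx.2.2.1

theorem disjoint_layer {n m : ℕ} (hnm : n ≠ m) :
    Disjoint (layer c Lg σ p S U n) (layer c Lg σ p S U m) := by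
  have key : ∀ n m : ℕ, n < m → ∀ x, x ∈ layer c Lg σ p S U n → x ∈ layer c Lg σ p S U m → False :=
    fun n m hnm x h1 h2 => by
      have h3 := h1.2.2.1.trans_lt h2.2.2.2
      rw [Real.exp_lt_exp] at h3
      have : (n : ℝ) + 1 ≤ m := by exact_mod_cast hnm
      linarith
  rw [Set.disjoint_left]
  intro x h1 h2
  rcases lt_or_gt_of_ne hnm with h | h
  · exact key n m h x h1 h2
  · exact key m n h x h2 h1

namespace FieldSaddle

theorem extChartAt_symm (h : FieldSaddle c Lg Cd δ σ Y B S U p) :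
    extChartAt (𝓡 d) σ ((extChartAt (𝓡 d) σ).symm p) = p :=
  (extChartAt (𝓡 d) σ).right_inv (h.chart.subset h.saddle.p_mem)

theorem symm_mem_source (h : FieldSaddle c Lg Cd δ σ Y B S U p) :
    (extChartAt (𝓡 d) σ).symm p ∈ (extChartAt (𝓡 d) σ).source :=
  (extChartAt (𝓡 d) σ).map_target (h.chart.subset h.saddle.p_mem)

theorem apply_symm_eq_zero (h : FieldSaddle c Lg Cd δ σ Y B S U p) :
    Y ((extChartAt (𝓡 d) σ).symm p) = 0 := by
  rw [← coordField_eq_zero_iff σ h.symm_mem_source, h.extChartAt_symm]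
  exact h.saddle.zero

/-- `linearization` is read in the preferred chart at the singularity of `Y`, whereas `B` is the
derivative in the chart at `σ`. This conjugacy transports the forms from one to the other. -/
theorem linearization_conj (h : FieldSaddle c Lg Cd δ σ Y B S U p) (hY : IsC1VectorField Y)
    (hB : B = fderiv ℝ (coordField Y σ) p) (v : Model d) :
    linearization Y ((extChartAt (𝓡 d) σ).symm p)
        (tangentEquiv h.symm_mem_source (mem_extChartAt_source _) v) =
      tangentEquiv h.symm_mem_source (mem_extChartAt_source _) (B v) := by
  have := linearization_tangentCoordChange hY h.symm_mem_source h.apply_symm_eq_zero v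
  rw [h.extChartAt_symm, ← hB] at this
  exact this

end FieldSaddle

namespace FlowSaddle

/-- The layers of the cross section in the chart. -/
theorem sectionLayer_eq (h : FlowSaddle c Lg Cd δ σ Y φ B S U p) (hY : IsC1VectorField Y)
    (hB : B = fderiv ℝ (coordField Y σ) p) (hyp : HyperbolicForms B S U c.ρ c.m c.K) {n : ℕ}
    (hn : c.D * Real.exp (-(n : ℝ)) ≤ c.R / 4) (hnδ : c.D * Real.exp (-(n : ℝ)) ≤ δ) :
    sectionLayer Y ((extChartAt (𝓡 d) σ).symm p)
      (adaptedForm S U (tangentEquiv h.symm_mem_source (mem_extChartAt_source _))) n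
      = layer c Lg σ p S U n := by
  have hR := c.R_pos
  have hm := c.m_pos
  have hT := h.linearization_conj hY hB
  set T := tangentEquiv h.symm_mem_source (mem_extChartAt_source ((extChartAt (𝓡 d) σ).symm p))
    with hTdef
  ext x
  constructor
  · rintro ⟨v, hv, hx⟩
    obtain ⟨w, rfl⟩ := T.surjective v
    rw [hyp.map_mem_coneLayer_iff hT] at hv
    obtain ⟨h1, h2, h3⟩ := hv
    -- Origin of the constant `D`: S = U < e^{-2n} gives m|w|² ≤ 2e^{-2n}, and exp at most doubles
    -- lengths.
    have hw : 2 * ‖w‖ ≤ c.D * Real.exp (-(n : ℝ)) := by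
      rw [Real.sqrt_lt' (Real.exp_pos _)] at h3
      have h4 := hyp.lower w
      have h5 : ‖w‖ ^ 2 ≤ (Real.sqrt (2 / c.m) * Real.exp (-(n : ℝ))) ^ 2 := by
        rw [mul_pow, Real.sq_sqrt (by positivity), div_mul_eq_mul_div, le_div_iff₀ hm]
        linarith
      have h6 := abs_le_of_sq_le_sq' h5 (by positivity)
      unfold SaddleConst.D
      linarith [h6.2]
    obtain ⟨y', rfl, h5, h6⟩ := h.chart.of_isExp p h.saddle.p_mem w
      (by linarith [norm_nonneg w]) x hx
    have hy' : y' ∈ Metric.closedBall p (c.R / 4) := mem_closedBall_iff_norm.2 (by linarith)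
    have hyR := h.closedBall_subset (by linarith) hy'
    have hyt := h.chart.subset hyR
    have hr := (extChartAt (𝓡 d) σ).right_inv hyt
    refine ⟨⟨(extChartAt (𝓡 d) σ).map_target hyt, by rw [hr]; linarith⟩, ?_⟩
    simp only [quadAt, hr, h6 hyR]
    exact ⟨h1, h2, h3⟩
  · rintro ⟨h1, h2, h3, h4⟩
    have hxR := h.extChartAt_mem (by linarith) h1
    refine ⟨T (Lg p (extChartAt (𝓡 d) σ x)), (hyp.map_mem_coneLayer_iff hT n _).2 ⟨h2, h3, h4⟩, ?_⟩
    have h5 := h.chart.isExp_log p h.saddle.p_mem _ hxR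
    rw [(extChartAt (𝓡 d) σ).left_inv h1.1] at h5
    exact h5

theorem quadAt_le (h : FlowSaddle c Lg Cd δ σ Y φ B S U p) {x : M} {ρ : ℝ}
    (hρ : ρ ≤ 3 * c.R / 4) (hx : x ∈ chartBall σ p ρ) :
    quadAt Lg σ p U x ≤ 4 * c.K * ‖extChartAt (𝓡 d) σ x - p‖ ^ 2 := by
  have h1 := h.saddle.norm_log_le h.saddle.p_mem (h.extChartAt_mem hρ hx)
  have h2 := (abs_le.1 (h.saddle.forms.boundU (Lg p (extChartAt (𝓡 d) σ x))
    (Lg p (extChartAt (𝓡 d) σ x)))).2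
  have hK := c.K_pos
  calc quadAt Lg σ p U x ≤ c.K * ‖Lg p (extChartAt (𝓡 d) σ x)‖ * ‖Lg p (extChartAt (𝓡 d) σ x)‖ := h2
    _ ≤ c.K * (2 * ‖extChartAt (𝓡 d) σ x - p‖) * (2 * ‖extChartAt (𝓡 d) σ x - p‖) := by gcongr
    _ = _ := by ring

theorem growth (h : FlowSaddle c Lg Cd δ σ Y φ B S U p) {x : M} {t : ℝ} (ht : 0 ≤ t)
    (hx : ∀ s ∈ Icc 0 t, φ s x ∈ chartBall σ p (3 * c.R / 4))
    (h0 : quadAt Lg σ p S x ≤ quadAt Lg σ p U x) :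
    Real.exp (c.ρ / 2 * t) * quadAt Lg σ p U x ≤ quadAt Lg σ p U (φ t x) ∧
      c.ρ * c.m / c.K * t * quadAt Lg σ p U x + (quadAt Lg σ p U x - quadAt Lg σ p S x)
        ≤ quadAt Lg σ p U (φ t x) - quadAt Lg σ p S (φ t x) := by
  have h1 : IsOrbitOn (coordField Y σ) (Metric.closedBall (extChartAt (𝓡 d) σ σ) c.R)
      (fun t => extChartAt (𝓡 d) σ (φ t x)) (Icc 0 t) := fun s hs =>
    ⟨(h.flow.isOrbitOn hx s hs).1, h.closedBall_subset le_rfl (h.flow.isOrbitOn hx s hs).2⟩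
  have h2 := h.saddle.growth h1 (by simpa only [h.flow.zero, quadAt] using h0) (right_mem_Icc.2 ht)
  simpa only [h.flow.zero, sub_zero, quadAt] using h2

/-- Orbits that start in a layer leave the chart. -/
theorem exp_le_of_mem_layer (h : FlowSaddle c Lg Cd δ σ Y φ B S U p) {n : ℕ} {x : M}
    (hxn : x ∈ layer c Lg σ p S U n) {t : ℝ} (ht : 0 ≤ t)
    (hx : ∀ s ∈ Icc 0 t, φ s x ∈ chartBall σ p (3 * c.R / 4)) :
    Real.exp (c.ρ / 2 * t - 2 * (n + 1)) ≤ 4 * c.K := by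
  have h1 := (h.growth ht hx hxn.2.1.le).1
  have h2 := h.quadAt_le le_rfl (hx t (right_mem_Icc.2 ht))
  have h3 := exp_le_quadAt_of_mem_layer (layer_swap hxn)
  have h4 := (hx t (right_mem_Icc.2 ht)).2
  have h5 := c.R_le
  have hK := c.K_pos
  have h6 : ‖extChartAt (𝓡 d) σ (φ t x) - p‖ ^ 2 ≤ 1 := by
    rw [sq_le_one_iff₀ (norm_nonneg _)]
    linarith [c.R_pos]
  calc Real.exp (c.ρ / 2 * t - 2 * (n + 1))
      = Real.exp (c.ρ / 2 * t) * Real.exp (-((n : ℝ) + 1)) ^ 2 := by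
        rw [sq, ← Real.exp_add, ← Real.exp_add]; ring_nf
    _ ≤ Real.exp (c.ρ / 2 * t) * quadAt Lg σ p U x := by gcongr
    _ ≤ 4 * c.K * ‖extChartAt (𝓡 d) σ (φ t x) - p‖ ^ 2 := h1.trans h2
    _ ≤ 4 * c.K * 1 := by gcongr
    _ = _ := mul_one _

/-- U - S vanishes on the layer and increases strictly afterwards, so S = U fails and the orbit
meets no layer as long as it stays in the chart ball. -/
theorem quadAt_lt_of_mem_layer (h : FlowSaddle c Lg Cd δ σ Y φ B S U p) {n : ℕ} {x : M}
    (hxn : x ∈ layer c Lg σ p S U n) {t : ℝ} (ht : 0 < t)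
    (hx : ∀ s ∈ Icc 0 t, φ s x ∈ chartBall σ p (3 * c.R / 4)) :
    quadAt Lg σ p S (φ t x) < quadAt Lg σ p U (φ t x) := by
  have h1 := (h.growth ht.le hx hxn.2.1.le).2
  have h3 := (pow_pos (Real.exp_pos _) 2).trans_le (exp_le_quadAt_of_mem_layer (layer_swap hxn))
  have h4 : 0 < c.ρ * c.m / c.K * t * quadAt Lg σ p U x := by
    have := c.ρ_pos
    have := c.m_pos
    have := c.K_pos
    positivity
  have := hxn.2.1
  linarith

theorem field_ge_of_quadAt (h : FlowSaddle c Lg Cd δ σ Y φ B S U p) {x : M} {q : ℝ}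
    (hx : x ∈ chartBall σ p (3 * c.R / 4)) (hU : q ^ 2 ≤ quadAt Lg σ p U x) :
    c.lam / (2 * Real.sqrt c.K) * q ≤ ‖coordField Y σ (extChartAt (𝓡 d) σ x)‖ := by
  have h1 := h.quadAt_le le_rfl hx
  have hK := c.K_pos
  have hl := c.lam_pos
  refine le_trans ?_ (h.saddle.le_norm_field (h.extChartAt_mem le_rfl hx))
  have h2 : q ^ 2 ≤ (2 * Real.sqrt c.K * ‖extChartAt (𝓡 d) σ x - p‖) ^ 2 := by
    rw [mul_pow, mul_pow, Real.sq_sqrt hK.le]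
    linarith
  have h3 := (abs_le_of_sq_le_sq' h2 (by positivity)).2
  rw [div_mul_eq_mul_div, div_le_iff₀ (by positivity)]
  nlinarith

/-- A lower bound for the speed along orbits that start in a layer. -/
theorem field_ge_of_mem_layer (h : FlowSaddle c Lg Cd δ σ Y φ B S U p) {n : ℕ} {x : M}
    (hxn : x ∈ layer c Lg σ p S U n) {t : ℝ}
    (hx : ∀ s ∈ uIcc 0 t, φ s x ∈ chartBall σ p (3 * c.R / 4)) :
    c.lam / (2 * Real.sqrt c.K) * Real.exp (-((n : ℝ) + 1)) ≤
      ‖coordField Y σ (extChartAt (𝓡 d) σ (φ t x))‖ := by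
  -- Stated for arbitrary data so that it also applies to the reversed flow, where the stable form
  -- plays the role of the expanding one.
  have key : ∀ {Y : ∀ x : M, TangentSpace (𝓡 d) x} {φ : ℝ → M → M} {B : Model d →L[ℝ] Model d}
      {S U : Model d →L[ℝ] Model d →L[ℝ] ℝ}, FlowSaddle c Lg Cd δ σ Y φ B S U p →
      x ∈ layer c Lg σ p S U n → ∀ {t : ℝ}, 0 ≤ t →
      (∀ s ∈ Icc 0 t, φ s x ∈ chartBall σ p (3 * c.R / 4)) →
      c.lam / (2 * Real.sqrt c.K) * Real.exp (-((n : ℝ) + 1)) ≤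
        ‖coordField Y σ (extChartAt (𝓡 d) σ (φ t x))‖ := by
    intro Y φ B S U h hxn t ht hx
    refine h.field_ge_of_quadAt (hx t (right_mem_Icc.2 ht)) ?_
    have h1 := (h.growth ht hx hxn.2.1.le).1
    have h3 := exp_le_quadAt_of_mem_layer (layer_swap hxn)
    have h4 : 1 ≤ Real.exp (c.ρ / 2 * t) := Real.one_le_exp (by have := c.ρ_pos; positivity)
    have h5 := le_mul_of_one_le_left ((sq_nonneg _).trans h3) h4
    linarith
  rcases le_total 0 t with ht | ht
  · rw [uIcc_of_le ht] at hx
    exact key h hxn ht hx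
  · rw [uIcc_of_ge ht] at hx
    have := key h.neg (layer_swap hxn) (neg_nonneg.2 ht)
      (fun s hs => hx (-s) ⟨by linarith [hs.2], by linarith [hs.1]⟩)
    rwa [coordField_neg, norm_neg, neg_neg] at this

/-- Up to |t| = n/(2Λ) the factor e^{Λ|t|} turns e^{-n} into at most e^{-n/2}. This is the source of
the lower bound for exit times and of the time without returns. -/
theorem mem_chartBall_of_mem (h : FlowSaddle c Lg Cd δ σ Y φ B S U p) {n : ℕ} {x : M}
    (hx : x ∈ chartBall σ p (c.D * Real.exp (-(n : ℝ)))) (hn : c.D * Real.exp (-(n : ℝ) / 2) < c.R / 4) {t : ℝ}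
    (ht : |t| ≤ 1 / (2 * c.Λ) * n) :
    φ t x ∈ chartBall σ p (c.D * Real.exp (-(n : ℝ) / 2)) := by
  have hΛ := c.one_le_Λ
  have hD := c.D_pos
  have h1 : Real.exp (c.Λ * |t|) * (c.D * Real.exp (-(n : ℝ))) ≤ c.D * Real.exp (-(n : ℝ) / 2) := by
    rw [mul_left_comm, ← Real.exp_add]
    gcongr
    have := mul_le_mul_of_nonneg_left ht (show 0 ≤ c.Λ by linarith)
    rw [show c.Λ * (1 / (2 * c.Λ) * n) = n / 2 by field_simp] at this
    linarith
  exact chartBall_mono h1 (h.shadow_saddle hx (h1.trans_lt hn))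

theorem mem_chartBall_of_mem_layer (h : FlowSaddle c Lg Cd δ σ Y φ B S U p) {n : ℕ} {x : M}
    (hxn : x ∈ layer c Lg σ p S U n) (hn : c.D * Real.exp (-(n : ℝ) / 2) < c.R / 4) {t : ℝ}
    (ht : |t| ≤ 1 / (2 * c.Λ) * n) :
    φ t x ∈ chartBall σ p (c.D * Real.exp (-(n : ℝ) / 2)) :=
  h.mem_chartBall_of_mem hxn.1 hn ht

/-- Orbits that start in a layer do not meet the layers again for a while. -/
theorem notMem_layer (h : FlowSaddle c Lg Cd δ σ Y φ B S U p) {n m : ℕ} {x : M}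
    (hxn : x ∈ layer c Lg σ p S U n) (hn : c.D * Real.exp (-(n : ℝ) / 2) < c.R / 4) {t : ℝ}
    (ht0 : t ≠ 0) (ht : |t| ≤ 1 / (2 * c.Λ) * n) : φ t x ∉ layer c Lg σ p S U m := by
  have hR := c.R_pos
  intro hm
  have hmem : ∀ s, |s| ≤ |t| → φ s x ∈ chartBall σ p (3 * c.R / 4) := fun s hs =>
    chartBall_mono (by linarith) (h.mem_chartBall_of_mem_layer hxn hn (hs.trans ht))
  rcases lt_or_gt_of_ne ht0 with h0 | h0
  · have h1 := h.neg.quadAt_lt_of_mem_layer (layer_swap hxn) (neg_pos.2 h0) (fun s hs => hmem (-s) (by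
      rw [abs_neg, abs_of_nonneg hs.1, abs_of_neg h0]; exact hs.2))
    rw [neg_neg] at h1
    exact h1.ne hm.2.1.symm
  · have h1 := h.quadAt_lt_of_mem_layer hxn h0 (fun s hs => hmem s (by
      rw [abs_of_nonneg hs.1, abs_of_pos h0]; exact hs.2))
    exact h1.ne hm.2.1

end FlowSaddle

end Layer


/-! ### Speed and exit times. -/

section ExitTime

variable {d : ℕ} {M : Type*} [EMetricSpace M] [ChartedSpace (Model d) M]
  [IsManifold (𝓡 d) ∞ M] [RiemannianBundle (fun x : M => TangentSpace (𝓡 d) x)]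

/-- The index `n` is so large that the `n`-th layer lies deep inside the ball of radius `r`. -/
structure SaddleConst.IsLarge (c : SaddleConst) (Cd δ r : ℝ) (n : ℕ) : Prop where
  radius : c.D * Real.exp (-(n : ℝ) / 2) < c.R / 4
  dist : Cd * (c.D * Real.exp (-(n : ℝ) / 2)) < r
  exit : 4 * c.K < Real.exp (n / 2 - 2)
  two_le : 2 ≤ 1 / (2 * c.Λ) * n
  rate : 2 * c.ρ ≤ n
  log : c.D * Real.exp (-(n : ℝ)) ≤ δ

theorem SaddleConst.exists_isLarge (c : SaddleConst) (Cd : ℝ) {δ r : ℝ} (hδ : 0 < δ) (hr : 0 < r) :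
    ∃ n₀ : ℕ, ∀ n > n₀, c.IsLarge Cd δ r n := by
  have hR := c.R_pos
  have hΛ := c.one_le_Λ
  have h1 : Tendsto (fun n : ℕ => -(n : ℝ) / 2) atTop atBot :=
    (tendsto_neg_atTop_atBot.comp tendsto_natCast_atTop_atTop).atBot_div_const (by norm_num)
  have h2 : Tendsto (fun n : ℕ => c.D * Real.exp (-(n : ℝ) / 2)) atTop (𝓝 0) := by
    simpa using (Real.tendsto_exp_atBot.comp h1).const_mul c.D
  have h3 : Tendsto (fun n : ℕ => Cd * (c.D * Real.exp (-(n : ℝ) / 2))) atTop (𝓝 0) := by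
    simpa using h2.const_mul Cd
  have h4 : Tendsto (fun n : ℕ => c.D * Real.exp (-(n : ℝ))) atTop (𝓝 0) := by
    simpa using (Real.tendsto_exp_atBot.comp
      (tendsto_neg_atTop_atBot.comp tendsto_natCast_atTop_atTop)).const_mul c.D
  have h5 : Tendsto (fun n : ℕ => Real.exp ((n : ℝ) / 2 - 2)) atTop atTop :=
    Real.tendsto_exp_atTop.comp (tendsto_atTop_add_const_right _ (-2)
      (tendsto_natCast_atTop_atTop.atTop_div_const (by norm_num)))
  have h6 : Tendsto (fun n : ℕ => 1 / (2 * c.Λ) * (n : ℝ)) atTop atTop :=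
    tendsto_natCast_atTop_atTop.const_mul_atTop (by positivity)
  have h7 : Tendsto (fun n : ℕ => (n : ℝ)) atTop atTop := tendsto_natCast_atTop_atTop
  obtain ⟨n₀, hn₀⟩ := eventually_atTop.1
    ((h2.eventually (gt_mem_nhds (show 0 < c.R / 4 by linarith))).and
    ((h3.eventually (gt_mem_nhds hr)).and ((h5.eventually_gt_atTop (4 * c.K)).and
    ((h6.eventually_ge_atTop 2).and ((h7.eventually_ge_atTop (2 * c.ρ)).and
    (h4.eventually (ge_mem_nhds hδ)))))))
  refine ⟨n₀, fun n hn => ?_⟩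
  obtain ⟨h8, h9, h10, h11, h12, h13⟩ := hn₀ n hn.le
  exact ⟨h8, h9, h10, h11, h12, h13⟩

variable {c : SaddleConst} {Lg : Model d → Model d → Model d} {Cd δ : ℝ} {σ : M}
  {Y : ∀ x : M, TangentSpace (𝓡 d) x} {φ : ℝ → M → M} {B : Model d →L[ℝ] Model d}
  {S U : Model d →L[ℝ] Model d →L[ℝ] ℝ} {p : Model d} {n : ℕ} {r : ℝ} {x : M}

theorem _root_.IsPreconnected.exists_mem_frontier {X : Type*} [TopologicalSpace X] {s u : Set X}
    (hs : IsPreconnected s) (hu : IsOpen u) (h1 : (s ∩ u).Nonempty) (h2 : (s ∩ uᶜ).Nonempty) :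
    ∃ z ∈ s, z ∈ frontier u := by
  by_contra hcon
  push Not at hcon
  have h3 : ∀ z ∈ s, z ∈ closure u → z ∈ u := fun z hz hzu => by
    by_contra h
    exact hcon z hz (hu.frontier_eq ▸ ⟨hzu, h⟩)
  obtain ⟨z, hz, hzu⟩ := h2
  obtain ⟨w, -, hw, hw'⟩ := hs u (closure u)ᶜ hu isClosed_closure.isOpen_compl
    (fun z hz => (em (z ∈ closure u)).imp (h3 z hz) id) h1 ⟨z, hz, fun h => hzu (h3 z hz h)⟩
  exact hw' (subset_closure hw)

namespace FlowSaddle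

theorem edist_le (h : FlowSaddle c Lg Cd δ σ Y φ B S U p) {ρ : ℝ} (hρ : ρ ≤ 3 * c.R / 4)
    (hx : x ∈ chartBall σ p ρ) :
    edist x ((extChartAt (𝓡 d) σ).symm p) ≤ ENNReal.ofReal (Cd * ρ) := by
  have h1 := h.chart.edist_le _ (h.extChartAt_mem hρ hx) p h.saddle.p_mem
  rw [(extChartAt (𝓡 d) σ).left_inv hx.1] at h1
  refine h1.trans (ENNReal.ofReal_le_ofReal ?_)
  have := h.chart.Cd_pos
  have := hx.2
  gcongr

/-- The natural constant would be √κ; since κ ≤ 1, κ itself is a valid and simpler one. -/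
theorem le_norm_chartVector (h : FlowSaddle c Lg Cd δ σ Y φ B S U p)
    (hx : x ∈ chartBall σ p (3 * c.R / 4)) (a : Model d) : c.κ * ‖a‖ ≤ ‖chartVector σ x a‖ := by
  have h1 := h.saddle.metric_lower _ (h.extChartAt_mem le_rfl hx) a
  rw [metricForm_extChartAt σ hx.1, real_inner_self_eq_norm_sq] at h1
  refine (abs_le_of_sq_le_sq' (le_trans ?_ h1) (norm_nonneg _)).2
  rw [mul_pow]
  have h2 := c.κ_pos
  have h3 := c.κ_le
  gcongr
  nlinarith

theorem norm_chartVector_le (h : FlowSaddle c Lg Cd δ σ Y φ B S U p)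
    (hx : x ∈ chartBall σ p (3 * c.R / 4)) (a : Model d) : ‖chartVector σ x a‖ ≤ c.k * ‖a‖ := by
  have hk := c.one_le_k
  refine SingFlow.norm_chartVector_le σ hx.1 (by linarith) ?_ a
  refine (h.saddle.metric_norm _ (h.extChartAt_mem le_rfl hx)).trans ?_
  nlinarith

theorem le_norm_apply (h : FlowSaddle c Lg Cd δ σ Y φ B S U p)
    (hx : x ∈ chartBall σ p (3 * c.R / 4)) :
    c.κ * ‖coordField Y σ (extChartAt (𝓡 d) σ x)‖ ≤ ‖Y x‖ := by
  rw [← chartVector_coordField (Y := Y) σ hx.1]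
  exact h.le_norm_chartVector hx _

theorem norm_apply_le (h : FlowSaddle c Lg Cd δ σ Y φ B S U p)
    (hx : x ∈ chartBall σ p (3 * c.R / 4)) :
    ‖Y x‖ ≤ c.k * ‖coordField Y σ (extChartAt (𝓡 d) σ x)‖ := by
  rw [← chartVector_coordField (Y := Y) σ hx.1]
  exact h.norm_chartVector_le hx _

/-- The speed of the flow on the layers. -/
theorem norm_mem_Icc (h : FlowSaddle c Lg Cd δ σ Y φ B S U p) (hn : c.IsLarge Cd δ r n)
    (hx : x ∈ layer c Lg σ p S U n) :
    ‖Y x‖ ∈ Icc (c.κ * (c.lam / (2 * Real.sqrt c.K)) * Real.exp (-((n : ℝ) + 1)))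
      (c.k * c.Λ * c.D * Real.exp (-(n : ℝ))) := by
  have hR := c.R_pos
  have hn0 : (0 : ℝ) ≤ n := n.cast_nonneg
  have h0 := h.mem_chartBall_of_mem_layer hx hn.radius (t := 0)
    (by rw [abs_zero]; linarith [hn.two_le])
  rw [h.flow.zero] at h0
  have hx' : x ∈ chartBall σ p (3 * c.R / 4) := chartBall_mono (by linarith [hn.radius]) h0
  constructor
  · refine le_trans ?_ (h.le_norm_apply hx')
    have h1 := h.field_ge_of_mem_layer hx (t := 0) (fun s hs => by
      rw [uIcc_self, mem_singleton_iff] at hs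
      rwa [hs, h.flow.zero])
    rw [h.flow.zero] at h1
    rw [mul_assoc]
    have := c.κ_pos
    gcongr
  · refine (h.norm_apply_le hx').trans ?_
    have h1 := h.saddle.norm_field_le (h.extChartAt_mem le_rfl hx')
    have h2 := hx.1.2
    have h3 := c.one_le_Λ
    have h4 := c.one_le_k
    calc c.k * ‖coordField Y σ (extChartAt (𝓡 d) σ x)‖
        ≤ c.k * (c.Λ * (c.D * Real.exp (-(n : ℝ)))) := by
          gcongr
          exact h1.trans (by gcongr)
      _ = _ := by ring

theorem edist_lt_of_mem_layer (h : FlowSaddle c Lg Cd δ σ Y φ B S U p) (hn : c.IsLarge Cd δ r n)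
    (hx : x ∈ layer c Lg σ p S U n) {t : ℝ} (ht : |t| ≤ 1 / (2 * c.Λ) * n) :
    edist (φ t x) ((extChartAt (𝓡 d) σ).symm p) < ENNReal.ofReal r := by
  have hR := c.R_pos
  have hD := c.D_pos
  have hCd := h.chart.Cd_pos
  have h1 := h.mem_chartBall_of_mem_layer hx hn.radius ht
  refine (h.edist_le (by linarith [hn.radius]) h1).trans_lt ?_
  have h2 : 0 ≤ Cd * (c.D * Real.exp (-(n : ℝ) / 2)) := by positivity
  exact (ENNReal.ofReal_lt_ofReal_iff (h2.trans_lt hn.dist)).2 hn.dist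

/-- Orbits that start in a layer stay in the ball for a time that is linear in the index. -/
theorem lt_of_forall_edist_le (h : FlowSaddle c Lg Cd δ σ Y φ B S U p)
    (hr : ∀ y, edist y ((extChartAt (𝓡 d) σ).symm p) ≤ ENNReal.ofReal r →
      y ∈ chartBall σ p (Real.exp (-c.Λ) * (c.R / 8)))
    (hn : c.IsLarge Cd δ r n) (hx : x ∈ layer c Lg σ p S U n) {t : ℝ} (ht : 0 ≤ t)
    (hst : ∀ s ∈ Icc 0 t, edist (φ s x) ((extChartAt (𝓡 d) σ).symm p) ≤ ENNReal.ofReal r) :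
    t < 5 / c.ρ * n := by
  have hR := c.R_pos
  have hρ := c.ρ_pos
  have h1 : Real.exp (-c.Λ) ≤ 1 := Real.exp_le_one_iff.2 (by linarith [c.one_le_Λ])
  -- Combined with 4K < e^{n/2 - 2} this gives ρt/2 - 2(n + 1) < n/2 - 2, that is ρt < 5n.
  have h2 := (h.exp_le_of_mem_layer hx ht fun s hs =>
    chartBall_mono (by nlinarith) (hr _ (hst s hs))).trans_lt hn.exit
  rw [Real.exp_lt_exp] at h2
  rw [div_mul_eq_mul_div, lt_div_iff₀ hρ]
  linarith

/-- The orbit stays in the open ball up to time n/(2Λ) and is outside the closed ball at some time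
before 5n/ρ; connectedness gives a boundary point in between. In particular the set of exit times is
nonempty, so its infimum is not the default value 0. -/
theorem exitTime_mem (h : FlowSaddle c Lg Cd δ σ Y φ B S U p)
    (hr : ∀ y, edist y ((extChartAt (𝓡 d) σ).symm p) ≤ ENNReal.ofReal r →
      y ∈ chartBall σ p (Real.exp (-c.Λ) * (c.R / 8)))
    (hn : c.IsLarge Cd δ r n) (hx : x ∈ layer c Lg σ p S U n) :
    exitTime φ ((extChartAt (𝓡 d) σ).symm p) r x ∈ Icc (1 / (2 * c.Λ) * n) (5 / c.ρ * n) := by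
  set q := (extChartAt (𝓡 d) σ).symm p with hq
  have hopen : IsOpen {z : M | edist z q < ENNReal.ofReal r} := Metric.isOpen_eball
  have hlow : ∀ τ ∈ {τ : ℝ | 0 < τ ∧ φ τ x ∈ frontier {z : M | edist z q < ENNReal.ofReal r}},
      1 / (2 * c.Λ) * n ≤ τ := by
    rintro τ ⟨hτ, hfr⟩
    by_contra hcon
    push Not at hcon
    have h1 := h.edist_lt_of_mem_layer hn hx (t := τ) (by rw [abs_of_pos hτ]; exact hcon.le)
    exact (hopen.frontier_eq ▸ hfr).2 h1
  have hT : 0 ≤ 5 / c.ρ * n := by have := c.ρ_pos; positivity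
  obtain ⟨t, ht, htr⟩ : ∃ t ∈ Icc 0 (5 / c.ρ * (n : ℝ)), ENNReal.ofReal r < edist (φ t x) q := by
    by_contra hcon
    push Not at hcon
    exact lt_irrefl _ (h.lt_of_forall_edist_le hr hn hx hT hcon)
  have h0 : φ 0 x ∈ {z : M | edist z q < ENNReal.ofReal r} :=
    h.edist_lt_of_mem_layer hn hx (by rw [abs_zero]; linarith [hn.two_le])
  have hpre : IsPreconnected ((fun s => φ s x) '' Icc 0 t) :=
    isPreconnected_Icc.image _ (h.flow.integral x).continuous.continuousOn
  obtain ⟨z, ⟨τ, hτ, rfl⟩, hz⟩ := hpre.exists_mem_frontier hopen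
    ⟨φ 0 x, mem_image_of_mem _ (left_mem_Icc.2 ht.1), h0⟩
    ⟨φ t x, mem_image_of_mem _ (right_mem_Icc.2 ht.1), fun h1 => lt_asymm htr h1⟩
  have hτ0 : 0 < τ := lt_of_le_of_ne hτ.1 fun h1 => by
    rw [← h1] at hz
    exact (hopen.frontier_eq ▸ hz).2 h0
  exact ⟨le_csInf ⟨τ, hτ0, hz⟩ hlow,
    (csInf_le ⟨_, hlow⟩ (show τ ∈ _ from ⟨hτ0, hz⟩)).trans (hτ.2.trans ht.2)⟩

end FlowSaddle

end ExitTime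


/-! ### The cells and the tubular neighbourhoods of their orbits. -/

section Cell

variable {d : ℕ} {M : Type*} [EMetricSpace M] [ChartedSpace (Model d) M]
  [IsManifold (𝓡 d) ∞ M] [RiemannianBundle (fun x : M => TangentSpace (𝓡 d) x)]

/-- The cell swept out by a layer in unit time. -/
def cell (c : SaddleConst) (Lg : Model d → Model d → Model d) (σ : M) (p : Model d)
    (S U : Model d →L[ℝ] Model d →L[ℝ] ℝ) (φ : ℝ → M → M) (n : ℕ) : Set M :=
  {z | ∃ x ∈ layer c Lg σ p S U n, ∃ s ∈ Ico (0 : ℝ) 1, φ s x = z}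

/-- The proportion between the admissible size of the pieces of a cell and the speed of the flow
there. -/
def SaddleConst.a (c : SaddleConst) : ℝ :=
  min (c.κ ^ 2 / (5000 * c.k ^ 2 * c.Λ) * (c.lam / (2 * Real.sqrt c.K))) (c.R / 8)

theorem SaddleConst.a_pos (c : SaddleConst) : 0 < c.a := by
  have := c.κ_pos
  have := c.one_le_k
  have := c.one_le_Λ
  have := c.lam_pos
  have := c.K_pos
  have := c.R_pos
  unfold a
  positivity

theorem ordConnected_stayTimes (φ : ℝ → M → M) (q : M) (r : ℝ) (x : M) :
    (stayTimes φ q r x).OrdConnected := by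
  refine ⟨fun t ht t' ht' s hs u hu => ?_⟩
  rcases mem_uIcc.1 hu with h | h
  · exact ht' u (mem_uIcc.2 (Or.inl ⟨h.1, h.2.trans hs.2⟩))
  · exact ht u (mem_uIcc.2 (Or.inr ⟨hs.1.trans h.1, h.2⟩))

theorem ordConnected_near {I : Set ℝ} (hI : I.OrdConnected) :
    {s : ℝ | ∃ t ∈ I, |s - t| ≤ 1}.OrdConnected := by
  refine ⟨fun s₁ hs₁ s₂ hs₂ s hs => ?_⟩
  obtain ⟨t₁, ht₁, h1⟩ := hs₁
  obtain ⟨t₂, ht₂, h2⟩ := hs₂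
  rw [abs_le] at h1 h2
  by_cases h3 : |s - t₁| ≤ 1
  · exact ⟨t₁, ht₁, h3⟩
  by_cases h4 : |s - t₂| ≤ 1
  · exact ⟨t₂, ht₂, h4⟩
  have h5 : t₁ ≤ s := by
    by_contra h
    exact h3 (abs_le.2 ⟨by linarith [hs.1], by linarith⟩)
  have h6 : s ≤ t₂ := by
    by_contra h
    exact h4 (abs_le.2 ⟨by linarith, by linarith [hs.2]⟩)
  exact ⟨s, hI.out ht₁ ht₂ ⟨h5, h6⟩, by simp⟩

variable {c : SaddleConst} {Lg : Model d → Model d → Model d} {Cd δ : ℝ} {σ : M}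
  {Y : ∀ x : M, TangentSpace (𝓡 d) x} {φ : ℝ → M → M} {B : Model d →L[ℝ] Model d}
  {S U : Model d →L[ℝ] Model d →L[ℝ] ℝ} {p : Model d} {n m : ℕ} {r : ℝ} {x y : M}

namespace FlowSaddle

theorem coarseCell_eq (h : FlowSaddle c Lg Cd δ σ Y φ B S U p) (hY : IsC1VectorField Y)
    (hB : B = fderiv ℝ (coordField Y σ) p) (hyp : HyperbolicForms B S U c.ρ c.m c.K)
    (hn : c.D * Real.exp (-(n : ℝ)) ≤ c.R / 4) (hnδ : c.D * Real.exp (-(n : ℝ)) ≤ δ) :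
    coarseCell Y φ ((extChartAt (𝓡 d) σ).symm p)
      (adaptedForm S U (tangentEquiv h.symm_mem_source (mem_extChartAt_source _))) n
      = cell c Lg σ p S U φ n := by
  rw [coarseCell, h.sectionLayer_eq hY hB hyp hn hnδ, cell]

/-- Orbits that start in a cell do not meet the cells again for a while. -/
theorem notMem_cell (h : FlowSaddle c Lg Cd δ σ Y φ B S U p) (hn : c.IsLarge Cd δ r n)
    (hx : x ∈ cell c Lg σ p S U φ n) {t : ℝ} (ht : 1 ≤ |t|)
    (htn : |t| + 1 ≤ 1 / (2 * c.Λ) * n) : φ t x ∉ cell c Lg σ p S U φ m := by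
  obtain ⟨x, hx, s, hs, rfl⟩ := hx
  rintro ⟨y, hy, s', hs', hyx⟩
  have h1 : y = φ (t + s - s') x := by
    rw [← h.flow.neg_apply s' y, hyx, ← h.flow.add, ← h.flow.add]
    ring_nf
  have h2 : |s - s'| < 1 := abs_lt.2 ⟨by linarith [hs.1, hs'.2], by linarith [hs.2, hs'.1]⟩
  have h3 := abs_add_le t (s - s')
  refine h.notMem_layer hx hn.radius (t := t + s - s') (fun h0 => ?_) ?_ (h1 ▸ hy)
  · rw [show t = -(s - s') by linarith, abs_neg] at ht
    linarith
  · rw [add_sub_assoc]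
    linarith

/-- A common point would place points of two layers on one orbit at a time distance less than 1. A
nonzero distance contradicts the absence of early returns, and distance zero the disjointness of the
layers. -/
theorem disjoint_cell (h : FlowSaddle c Lg Cd δ σ Y φ B S U p) (hn : c.IsLarge Cd δ r n)
    (hnm : n ≠ m) : Disjoint (cell c Lg σ p S U φ n) (cell c Lg σ p S U φ m) := by
  rw [Set.disjoint_left]
  rintro z ⟨x, hx, s, hs, rfl⟩ ⟨y, hy, s', hs', hyx⟩
  have h1 : y = φ (s - s') x := by
    rw [← h.flow.neg_apply s' y, hyx, ← h.flow.add]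
    ring_nf
  have h2 : |s - s'| < 1 := abs_lt.2 ⟨by linarith [hs.1, hs'.2], by linarith [hs.2, hs'.1]⟩
  by_cases h0 : s - s' = 0
  · rw [h0, h.flow.zero] at h1
    exact Set.disjoint_left.1 (disjoint_layer hnm) hx (h1 ▸ hy)
  · exact h.notMem_layer hx hn.radius h0 (by linarith [hn.two_le]) (h1 ▸ hy)

theorem mem_chartBall_of_mem_cell (h : FlowSaddle c Lg Cd δ σ Y φ B S U p)
    (hn : c.IsLarge Cd δ r n) (hx : x ∈ cell c Lg σ p S U φ n) : x ∈ chartBall σ p (c.R / 4) := by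
  obtain ⟨x, hx, s, hs, rfl⟩ := hx
  refine chartBall_mono hn.radius.le (h.mem_chartBall_of_mem_layer hx hn.radius ?_)
  rw [abs_of_nonneg hs.1]
  linarith [hs.2, hn.two_le]

theorem mem_stayTimes (h : FlowSaddle c Lg Cd δ σ Y φ B S U p) (hn : c.IsLarge Cd δ r n)
    (hx : x ∈ cell c Lg σ p S U φ n) {t : ℝ} (ht : |t| ≤ 1) :
    t ∈ stayTimes φ ((extChartAt (𝓡 d) σ).symm p) r x := by
  obtain ⟨x, hx, s, hs, rfl⟩ := hx
  intro u hu
  rw [← h.flow.add]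
  refine (h.edist_lt_of_mem_layer hn hx ?_).le
  rw [abs_le] at ht
  have h1 := hn.two_le
  rw [abs_le]
  rcases mem_uIcc.1 hu with h2 | h2 <;>
    exact ⟨by linarith [hs.1, h2.1], by linarith [hs.2, h2.2]⟩

/-- The time that an orbit stays in the ball is at most linear in the index of the cell. -/
theorem abs_le_of_mem_stayTimes (h : FlowSaddle c Lg Cd δ σ Y φ B S U p)
    (hr : ∀ y, edist y ((extChartAt (𝓡 d) σ).symm p) ≤ ENNReal.ofReal r →
      y ∈ chartBall σ p (Real.exp (-c.Λ) * (c.R / 8)))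
    (hn : c.IsLarge Cd δ r n) (hx : x ∈ cell c Lg σ p S U φ n) {t : ℝ}
    (ht : t ∈ stayTimes φ ((extChartAt (𝓡 d) σ).symm p) r x) : |t| ≤ 5 / c.ρ * n + 1 := by
  have hρ := c.ρ_pos
  have hx' := hx
  obtain ⟨x, hx, s, hs, rfl⟩ := hx
  have h0 : 0 ≤ 5 / c.ρ * (n : ℝ) := by positivity
  have hnear : ∀ u, |u| ≤ 2 →
      edist (φ u x) ((extChartAt (𝓡 d) σ).symm p) ≤ ENNReal.ofReal r := fun u hu =>
    (h.edist_lt_of_mem_layer hn hx (hu.trans hn.two_le)).le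
  have hφ : ∀ u, φ (u - s) (φ s x) = φ u x := fun u => by rw [← h.flow.add, sub_add_cancel]
  rcases le_total 0 t with h1 | h1
  · have := h.lt_of_forall_edist_le hr hn hx (t := s + t) (by linarith [hs.1]) fun u hu => by
      rcases le_total u s with h2 | h2
      · exact hnear u (abs_le.2 ⟨by linarith [hu.1], by linarith [hs.2]⟩)
      · rw [← hφ]
        exact ht _ (mem_uIcc.2 (Or.inl ⟨by linarith, by linarith [hu.2]⟩))
    rw [abs_of_nonneg h1]
    linarith [hs.1]
  · rw [abs_of_nonpos h1]
    by_cases h2 : 0 ≤ s + t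
    · linarith [hs.2]
    · have := h.neg.lt_of_forall_edist_le hr hn (layer_swap hx) (t := -(s + t)) (by linarith)
        fun u hu => by
          rw [← hφ]
          exact ht _ (mem_uIcc.2 (Or.inr ⟨by linarith [hu.2], by linarith [hs.1, hu.1]⟩))
      linarith [hs.2]

/-- Points of a small piece of a cell stay in the scaled tubular neighbourhoods of each other. -/
theorem inTubeUntilExit (h : FlowSaddle c Lg Cd δ σ Y φ B S U p)
    (hr : ∀ y, edist y ((extChartAt (𝓡 d) σ).symm p) ≤ ENNReal.ofReal r →
      y ∈ chartBall σ p (Real.exp (-c.Λ) * (c.R / 8)))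
    (hn : c.IsLarge Cd δ r n) (hx : x ∈ cell c Lg σ p S U φ n)
    (hy : y ∈ (extChartAt (𝓡 d) σ).source) {β : ℝ} (hβ0 : 0 < β) (hβ1 : β ≤ 1)
    (hxy : Real.exp (c.Λ * (6 / c.ρ * n)) * ‖extChartAt (𝓡 d) σ y - extChartAt (𝓡 d) σ x‖
      ≤ c.a * β * Real.exp (-((n : ℝ) + 1))) :
    InTubeUntilExit Y φ ((extChartAt (𝓡 d) σ).symm p) r β x y := by
  have hR := c.R_pos
  have hρ := c.ρ_pos
  have hΛ := c.one_le_Λ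
  have hk := c.one_le_k
  have hκ := c.κ_pos
  have hκ1 := c.κ_le
  have hK := c.K_pos
  have hlam := c.lam_pos
  set q := (extChartAt (𝓡 d) σ).symm p with hq
  set I := stayTimes φ q r x with hIdef
  -- The changed time may run ahead of or behind t, so both orbits have to be controlled one unit of
  -- time beyond the stay.
  set J := {s : ℝ | ∃ t ∈ I, |s - t| ≤ 1} with hJdef
  have hI : I.OrdConnected := ordConnected_stayTimes φ q r x
  have hJ : J.OrdConnected := ordConnected_near hI
  have hIJ : I ⊆ J := fun t ht => ⟨t, ht, by simp⟩
  have hunit : ∀ t, |t| ≤ 1 → t ∈ I := fun t ht => h.mem_stayTimes hn hx ht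
  have h0I : (0 : ℝ) ∈ I := hunit 0 (by simp)
  -- The factor e^{-Λ} in the hypothesis on `r` pays for the additional unit of time.
  have hxJ : ∀ s ∈ J, φ s x ∈ chartBall σ p (c.R / 8) := by
    rintro s ⟨t, ht, hst⟩
    have h1 := hr _ (ht t right_mem_uIcc)
    have h2 : Real.exp (c.Λ * |s - t|) * (Real.exp (-c.Λ) * (c.R / 8)) ≤ c.R / 8 := by
      rw [← mul_assoc, ← Real.exp_add]
      refine mul_le_of_le_one_left (by linarith) (Real.exp_le_one_iff.2 ?_)
      nlinarith
    have h3 := h.shadow_saddle h1 (t := s - t) (h2.trans_lt (by linarith))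
    rw [← h.flow.add, sub_add_cancel] at h3
    exact chartBall_mono h2 h3
  have hx34 : ∀ s ∈ J, φ s x ∈ chartBall σ p (3 * c.R / 4) := fun s hs =>
    chartBall_mono (by linarith) (hxJ s hs)
  -- 5n/ρ + 1 for the stay and 1 for the enlargement; the excess 2 is at most n/ρ.
  have habs : ∀ s ∈ J, |s| ≤ 6 / c.ρ * n := by
    rintro s ⟨t, ht, hst⟩
    have h1 := h.abs_le_of_mem_stayTimes hr hn hx ht
    have h2 := abs_add_le (s - t) t
    rw [sub_add_cancel] at h2
    have h3 : 2 ≤ n / c.ρ := (le_div_iff₀ hρ).2 hn.rate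
    rw [div_mul_eq_mul_div] at h1 ⊢
    have h4 : 6 * n / c.ρ = 5 * n / c.ρ + n / c.ρ := by ring
    linarith
  have hn1 : Real.exp (-((n : ℝ) + 1)) ≤ 1 := Real.exp_le_one_iff.2 (by
    have : (0 : ℝ) ≤ n := n.cast_nonneg
    linarith)
  have ha := c.a_pos
  have haR : c.a ≤ c.R / 8 := min_le_right _ _
  have hexp : ∀ s ∈ J, Real.exp (c.Λ * |s|) * ‖extChartAt (𝓡 d) σ y - extChartAt (𝓡 d) σ x‖
      ≤ c.a * β * Real.exp (-((n : ℝ) + 1)) := fun s hs => by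
    refine le_trans ?_ hxy
    have := habs s hs
    gcongr
  have hyJ : ∀ s ∈ J, φ s y ∈ chartBall σ p (c.R / 2) ∧
      ‖extChartAt (𝓡 d) σ (φ s y) - extChartAt (𝓡 d) σ (φ s x)‖
        ≤ c.a * β * Real.exp (-((n : ℝ) + 1)) := fun s hs => by
    have h1 : IsOrbitOn (coordField Y σ) (Metric.closedBall p (c.R / 4))
        (fun t => extChartAt (𝓡 d) σ (φ t x)) (uIcc 0 s) :=
      h.flow.isOrbitOn fun u hu => chartBall_mono (by linarith)
        (hxJ u (hJ.uIcc_subset (hIJ h0I) hs hu))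
    have h2 : c.a * β * Real.exp (-((n : ℝ) + 1)) < c.R / 4 := by
      calc c.a * β * Real.exp (-((n : ℝ) + 1)) ≤ c.R / 8 * 1 * 1 := by gcongr
        _ < c.R / 4 := by linarith
    obtain ⟨h3, h4⟩ := h.shadow h1 hy (by
      simp only [h.flow.zero]
      exact (hexp s hs).trans_lt h2)
    simp only [h.flow.zero] at h4
    exact ⟨h3, h4.trans (hexp s hs)⟩
  have hspeed : ∀ t ∈ I, c.lam / (2 * Real.sqrt c.K) * Real.exp (-((n : ℝ) + 1)) ≤
      ‖coordField Y σ (extChartAt (𝓡 d) σ (φ t x))‖ := fun t ht => by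
    obtain ⟨x₀, hx₀, s, hs, hsx⟩ := hx
    have h1 : ∀ u, φ u x₀ = φ (u - s) x := fun u => by rw [← hsx, ← h.flow.add, sub_add_cancel]
    have h2 := h.field_ge_of_mem_layer hx₀ (t := t + s) (fun u hu => by
      rw [h1]
      refine hx34 _ (hJ.uIcc_subset (x := -s) (y := t)
        ⟨0, h0I, by rw [sub_zero, abs_neg, abs_of_nonneg hs.1]; exact hs.2.le⟩ (hIJ ht) ?_)
      rw [mem_uIcc] at hu ⊢
      refine hu.imp (fun h => ⟨?_, ?_⟩) (fun h => ⟨?_, ?_⟩) <;> linarith [h.1, h.2])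
    rwa [h1, add_sub_cancel_right] at h2
  have hpos : ∀ t ∈ I, 0 < ‖coordField Y σ (extChartAt (𝓡 d) σ (φ t x))‖ := fun t ht =>
    lt_of_lt_of_le (by positivity) (hspeed t ht)
  -- The largest relative distance that the tube lemma admits, times β; the definition of `a` bounds
  -- the distance of the orbits by `α` times the minimal speed.
  set α := c.κ ^ 2 / (5000 * c.k ^ 2 * c.Λ) * β with hα
  have hα0 : 0 < α := by positivity
  have hαeq : 5000 * c.k ^ 2 * c.Λ * α = c.κ ^ 2 * β := by rw [hα]; field_simp
  have horb : ∀ {z : M} {K : Set ℝ}, (∀ t ∈ K, φ t z ∈ chartBall σ p (c.R / 2)) →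
      IsOrbitOn (coordField Y σ) (Metric.closedBall (extChartAt (𝓡 d) σ σ) c.R)
        (fun t => extChartAt (𝓡 d) σ (φ t z)) K := fun hK t ht =>
    ⟨(h.flow.isOrbitOn hK t ht).1, h.closedBall_subset (by linarith) (h.flow.isOrbitOn hK t ht).2⟩
  obtain ⟨τ, hτc, hτm, hτ⟩ := h.saddle.exists_tube hI
    (horb fun t ht => chartBall_mono (by linarith) (hxJ t (hIJ ht)))
    (horb fun t ht => (hyJ t ht).1)
    (fun t ht => norm_pos_iff.1 (hpos t ht)) hα0 (by
      rw [hαeq]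
      exact mul_le_of_le_one_right (by positivity) hβ1) (fun t ht => by
      refine (hyJ t (hIJ ht)).2.trans ?_
      have h1 : c.a ≤ c.κ ^ 2 / (5000 * c.k ^ 2 * c.Λ) * (c.lam / (2 * Real.sqrt c.K)) :=
        min_le_left _ _
      calc c.a * β * Real.exp (-((n : ℝ) + 1))
          ≤ c.κ ^ 2 / (5000 * c.k ^ 2 * c.Λ) * (c.lam / (2 * Real.sqrt c.K)) * β
              * Real.exp (-((n : ℝ) + 1)) := by gcongr
        _ = α * (c.lam / (2 * Real.sqrt c.K) * Real.exp (-((n : ℝ) + 1))) := by rw [hα]; ring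
        _ ≤ _ := by gcongr; exact hspeed t ht)
  refine ⟨τ, hτc, hτm, fun t ht => ?_, ?_⟩
  · obtain ⟨h1, h2, h3⟩ := hτ t ht
    have hτJ : τ t ∈ J := ⟨t, ht, by linarith⟩
    have hxt := hx34 t (hIJ ht)
    have hyt := (hyJ _ hτJ).1
    refine ⟨chartVector σ (φ t x)
      (Lg (extChartAt (𝓡 d) σ (φ t x)) (extChartAt (𝓡 d) σ (φ (τ t) y))), ?_, ?_, ?_⟩
    · rw [← chartVector_coordField (Y := Y) σ hxt.1, ← metricForm_extChartAt σ hxt.1]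
      exact h2
    · refine (h.norm_chartVector_le hxt _).trans_lt ?_
      have h4 := h.le_norm_apply hxt
      have h5 := hpos t ht
      set f := ‖coordField Y σ (extChartAt (𝓡 d) σ (φ t x))‖ with hf
      have h6 : c.k * (50 * c.k / c.κ * α * f) < β * (c.κ * f) := by
        have h7 : 50 * c.k ^ 2 * α < c.κ ^ 2 * β := by
          rw [← hαeq]
          have : 50 * c.k ^ 2 * α < 5000 * (c.k ^ 2 * α) := by
            have : 0 < c.k ^ 2 * α := by positivity
            linarith
          nlinarith [show 0 < c.k ^ 2 * α by positivity]
        calc c.k * (50 * c.k / c.κ * α * f) = 50 * c.k ^ 2 * α / c.κ * f := by ring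
          _ < c.κ ^ 2 * β / c.κ * f := by gcongr
          _ = β * (c.κ * f) := by field_simp
      calc c.k * ‖Lg (extChartAt (𝓡 d) σ (φ t x)) (extChartAt (𝓡 d) σ (φ (τ t) y))‖
          ≤ c.k * (50 * c.k / c.κ * α * f) := by gcongr
        _ < β * (c.κ * f) := h6
        _ ≤ β * ‖Y (φ t x)‖ := by gcongr
    · have h4 := h.chart.isExp_log _ (h.extChartAt_mem le_rfl hxt) _
        (h.extChartAt_mem (by linarith) hyt)
      rwa [(extChartAt (𝓡 d) σ).left_inv hxt.1, (extChartAt (𝓡 d) σ).left_inv hyt.1] at h4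
  · have hm1 : (-1 : ℝ) ∈ I := hunit _ (by simp)
    have h1 : (1 : ℝ) ∈ I := hunit _ (by simp)
    have h2 := (abs_lt.1 (hτ _ hm1).1).2
    have h3 := (abs_lt.1 (hτ _ h1).1).1
    -- The time change moves points by less than 1/2, so it is negative at -1 and positive at 1.
    obtain ⟨s, hs, hs0⟩ := intermediate_value_Icc (show (-1 : ℝ) ≤ 1 by norm_num)
      (hτc.mono (hI.out hm1 h1)) (show (0 : ℝ) ∈ Icc (τ (-1)) (τ 1) from
        ⟨by linarith, by linarith⟩)
    exact ⟨s, hI.out hm1 h1 hs, abs_le.2 hs, hs0⟩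

end FlowSaddle

end Cell


/-! ### Refined partitions, entropy, and measures of sets with disjoint preimages. -/

section Entropy

variable {M : Type*} [MeasurableSpace M]

/-- A countable family of disjoint sets, each of them cut by a map with values in a finite set,
together with the complement of the family. -/
theorem exists_refined_partition {ι : Type*} [Countable ι] {n₀ : ℕ} {C : ℕ → Set M}
    (hdisj : ∀ n > n₀, ∀ m > n₀, n ≠ m → Disjoint (C n) (C m)) (hC : ∀ n > n₀, MeasurableSet (C n))
    {g : ℕ → M → ι} (hg : ∀ n > n₀, ∀ i, MeasurableSet (C n ∩ g n ⁻¹' {i})) {T : ℕ → Finset ι}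
    (hT : ∀ n > n₀, ∀ x ∈ C n, g n x ∈ T n) :
    ∃ 𝒜 : Set (Set M), IsCountablePartition 𝒜 ∧
      (∀ A ∈ 𝒜, (∃ n > n₀, A ⊆ C n) ∨ A = (⋃ n > n₀, C n)ᶜ) ∧
      ∀ n > n₀, {A ∈ 𝒜 | A ⊆ C n}.Finite ∧ ⋃₀ {A ∈ 𝒜 | A ⊆ C n} = C n ∧
        {A ∈ 𝒜 | A ⊆ C n}.ncard ≤ (T n).card ∧
        ∀ A ∈ 𝒜, A ⊆ C n → ∃ i, A = C n ∩ g n ⁻¹' {i} := by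
  classical
  let N : M → Option ℕ := fun x => if h : ∃ n, n > n₀ ∧ x ∈ C n then some h.choose else none
  -- The partition consists of the nonempty fibres of this countably valued map; the value `none`
  -- labels the complement of all `C n`.
  let G : M → Option (ℕ × ι) := fun x => (N x).map fun n => (n, g n x)
  have hN : ∀ n > n₀, ∀ x ∈ C n, N x = some n := fun n hn x hx => by
    have h : ∃ n, n > n₀ ∧ x ∈ C n := ⟨n, hn, hx⟩
    have h1 : N x = some h.choose := dif_pos h
    rw [h1]
    by_contra hne
    exact Set.disjoint_left.1 (hdisj _ h.choose_spec.1 n hn fun h2 => hne (by rw [h2]))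
      h.choose_spec.2 hx
  have hNone : ∀ x, x ∉ (⋃ n > n₀, C n) → N x = none := fun x hx => by
    refine dif_neg fun ⟨n, hn, hxn⟩ => hx ?_
    simp only [mem_iUnion]
    exact ⟨n, hn, hxn⟩
  have hG : ∀ n > n₀, ∀ x ∈ C n, G x = some (n, g n x) := fun n hn x hx => by
    simp only [G, hN n hn x hx, Option.map_some]
  have hGnone : ∀ x, x ∉ (⋃ n > n₀, C n) → G x = none := fun x hx => by
    simp only [G, hNone x hx, Option.map_none]
  have hcases : ∀ x, (∃ n > n₀, x ∈ C n) ∨ x ∉ (⋃ n > n₀, C n) := fun x => by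
    by_cases h : x ∈ (⋃ n > n₀, C n)
    · simp only [mem_iUnion] at h
      obtain ⟨n, hn, hx⟩ := h
      exact Or.inl ⟨n, hn, hx⟩
    · exact Or.inr h
  have hsome : ∀ n > n₀, ∀ i, G ⁻¹' {some (n, i)} = C n ∩ g n ⁻¹' {i} := fun n hn i => by
    ext x
    constructor
    · intro hx
      have hx' : G x = some (n, i) := hx
      rcases hcases x with ⟨m, hm, hxm⟩ | h
      · rw [hG m hm x hxm, Option.some_inj, Prod.mk.injEq] at hx'
        obtain ⟨rfl, h2⟩ := hx'
        exact ⟨hxm, h2⟩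
      · rw [hGnone x h] at hx'
        cases hx'
    · rintro ⟨hx, hxi⟩
      rw [mem_preimage, hG n hn x hx, mem_singleton_iff, show g n x = i from hxi]
  have hnone : G ⁻¹' {none} = (⋃ n > n₀, C n)ᶜ := by
    ext x
    constructor
    · intro hx
      have hx' : G x = none := hx
      rcases hcases x with ⟨m, hm, hxm⟩ | h
      · rw [hG m hm x hxm] at hx'
        cases hx'
      · exact h
    · exact fun hx => hGnone x hx
  have hmem : ∀ n > n₀, ∀ x, G ⁻¹' {G x} ⊆ C n ↔ x ∈ C n := fun n hn x => by
    refine ⟨fun h => h rfl, fun hx => ?_⟩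
    rw [hG n hn x hx, hsome n hn]
    exact inter_subset_left
  have hset : ∀ n > n₀, {A ∈ range fun x => G ⁻¹' {G x} | A ⊆ C n}
      = (fun x => C n ∩ g n ⁻¹' {g n x}) '' C n := fun n hn => by
    ext A
    constructor
    · rintro ⟨⟨x, rfl⟩, hA⟩
      have hx := (hmem n hn x).1 hA
      refine ⟨x, hx, ?_⟩
      simp only [hG n hn x hx, hsome n hn]
    · rintro ⟨x, hx, rfl⟩
      refine ⟨⟨x, ?_⟩, inter_subset_left⟩
      simp only [hG n hn x hx, hsome n hn]
  have hsubT : ∀ n > n₀, {A ∈ range fun x => G ⁻¹' {G x} | A ⊆ C n}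
      ⊆ (fun i => C n ∩ g n ⁻¹' {i}) '' (T n : Set ι) := fun n hn => by
    rw [hset n hn]
    rintro - ⟨x, hx, rfl⟩
    exact ⟨g n x, hT n hn x hx, rfl⟩
  refine ⟨range fun x => G ⁻¹' {G x}, ⟨?_, ?_, ?_, ?_⟩, ?_, fun n hn => ⟨?_, ?_, ?_, ?_⟩⟩
  · rw [show (fun x => G ⁻¹' {G x}) = (fun i => G ⁻¹' {i}) ∘ G from rfl, range_comp]
    exact (Set.to_countable (range G)).image _
  · rintro - ⟨x, rfl⟩
    rcases hcases x with ⟨m, hm, hxm⟩ | h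
    · simp only [hG m hm x hxm, hsome m hm]
      exact hg m hm _
    · simp only [hGnone x h, hnone]
      exact (MeasurableSet.iUnion fun n => MeasurableSet.iUnion fun hn => hC n hn).compl
  · rintro ⟨x, hx⟩
    exact (Set.ext_iff.1 hx x).1 rfl
  · refine fun x => ⟨G ⁻¹' {G x}, ⟨⟨x, rfl⟩, rfl⟩, ?_⟩
    rintro - ⟨⟨y, rfl⟩, hy⟩
    rw [show G x = G y from hy]
  · rintro - ⟨x, rfl⟩
    rcases hcases x with ⟨m, hm, hxm⟩ | h
    · exact Or.inl ⟨m, hm, (hmem m hm x).2 hxm⟩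
    · refine Or.inr ?_
      simp only [hGnone x h, hnone]
  · exact ((T n).finite_toSet.image _).subset (hsubT n hn)
  · rw [hset n hn]
    ext x
    constructor
    · rintro ⟨-, ⟨y, -, rfl⟩, hx⟩
      exact hx.1
    · exact fun hx => ⟨_, ⟨x, hx, rfl⟩, hx, rfl⟩
  · refine (Set.ncard_le_ncard (hsubT n hn) ((T n).finite_toSet.image _)).trans ?_
    refine (Set.ncard_image_le (T n).finite_toSet).trans ?_
    rw [Set.ncard_coe_finset]
  · intro A hA hAn
    have : A ∈ {A ∈ range fun x => G ⁻¹' {G x} | A ⊆ C n} := ⟨hA, hAn⟩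
    rw [hset n hn] at this
    obtain ⟨x, -, rfl⟩ := this
    exact ⟨_, rfl⟩

/-- The concave function lies below its tangent line of slope `a`. Being affine, the bound sums over
a family of sets to `a` times the total mass plus e^{-a-1} times the number of sets, and `a` is free
for each family. -/
theorem negMulLog_le (a : ℝ) {t : ℝ} (ht : 0 ≤ t) :
    Real.negMulLog t ≤ a * t + Real.exp (-a - 1) := by
  rcases ht.eq_or_lt with rfl | ht
  · simpa using (Real.exp_pos _).le
  · have h1 := Real.log_le_sub_one_of_pos (show 0 < Real.exp (-a - 1) / t by positivity)
    rw [Real.log_div (Real.exp_pos _).ne' ht.ne', Real.log_exp] at h1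
    have h2 := mul_le_mul_of_nonneg_left h1 ht.le
    rw [mul_sub t (Real.exp (-a - 1) / t), mul_div_cancel₀ _ ht.ne'] at h2
    rw [Real.negMulLog]
    linarith

/-- The tangent line bound is used with slope `a n` on the n-th family and with slope 0 on the
exceptional set `Q`, whose contribution is at most 1. -/
theorem partitionEntropy_le {μ : Measure M} [IsProbabilityMeasure μ] {𝒜 : Set (Set M)}
    (h𝒜 : IsCountablePartition 𝒜) {Q : Set M} {ℬ : ℕ → Set (Set M)}
    (hsub : 𝒜 ⊆ {Q} ∪ ⋃ n, ℬ n) (hℬ : ∀ n, ℬ n ⊆ 𝒜) {a : ℕ → ℝ} (ha : ∀ n, 0 ≤ a n) :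
    partitionEntropy μ 𝒜 ≤ 1 + ∑' n, (ENNReal.ofReal (a n) * μ (⋃₀ ℬ n)
      + (ℬ n).encard * ENNReal.ofReal (Real.exp (-a n - 1))) := by
  set f : Set M → ℝ≥0∞ := fun A => ENNReal.ofReal (Real.negMulLog (μ.real A)) with hf
  have hQ : f Q ≤ 1 := by
    refine ENNReal.ofReal_le_one.2 ?_
    have h1 := negMulLog_le 0 (measureReal_nonneg (μ := μ) (s := Q))
    have h2 : Real.exp (-0 - 1) ≤ 1 := Real.exp_le_one_iff.2 (by norm_num)
    linarith
  have hn : ∀ n, ∑' A : ℬ n, f A ≤ ENNReal.ofReal (a n) * μ (⋃₀ ℬ n)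
      + (ℬ n).encard * ENNReal.ofReal (Real.exp (-a n - 1)) := fun n => by
    have hdisj : (ℬ n).Pairwise Disjoint :=
      (h𝒜.partition.pairwiseDisjoint).subset (hℬ n)
    rw [measure_sUnion (h𝒜.countable.mono (hℬ n)) hdisj
      (fun A hA => h𝒜.measurable A (hℬ n hA)), ← ENNReal.tsum_mul_left,
      ← ENNReal.tsum_set_const, ← ENNReal.tsum_add]
    refine ENNReal.tsum_le_tsum fun A => ?_
    refine (ENNReal.ofReal_le_ofReal (negMulLog_le (a n) measureReal_nonneg)).trans ?_
    refine ENNReal.ofReal_add_le.trans ?_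
    rw [ENNReal.ofReal_mul (ha n), ofReal_measureReal]
  calc partitionEntropy μ 𝒜 = ∑' A : 𝒜, f A := rfl
    _ ≤ ∑' A : ({Q} ∪ ⋃ n, ℬ n : Set (Set M)), f A := ENNReal.tsum_mono_subtype f hsub
    _ ≤ ∑' A : ({Q} : Set (Set M)), f A + ∑' A : (⋃ n, ℬ n : Set (Set M)), f A :=
        ENNReal.tsum_union_le f _ _
    _ ≤ f Q + ∑' n, ∑' A : ℬ n, f A := by
        gcongr
        · rw [tsum_singleton]
        · exact ENNReal.tsum_iUnion_le_tsum f ℬ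
    _ ≤ _ := by
        gcongr with n
        exact hn n

/-- Sets with many disjoint preimages under a measure preserving flow have small measure. -/
theorem tsum_mul_measure_le {φ : ℝ → M → M} {μ : Measure M} [IsProbabilityMeasure μ]
    (hφ : ∀ t, μ.map (φ t) = μ) {C : ℕ → Set M} (hC : ∀ n, MeasurableSet (C n)) {k : ℕ → ℕ}
    (hdisj : ∀ n m, ∀ j < k n, ∀ j' < k m, (j < j' ∨ j = j' ∧ n ≠ m) →
      Disjoint (φ j ⁻¹' C n) (φ j' ⁻¹' C m)) :
    ∑' n, (k n : ℝ≥0∞) * μ (C n) ≤ 1 := by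
  -- The image of a measure under a map that is not a.e. measurable is 0 by convention, so
  -- invariance of a probability measure already forces a.e. measurability.
  have hae : ∀ t, AEMeasurable (φ t) μ := fun t => by
    by_contra h
    have h1 := hφ t
    rw [Measure.map_of_not_aemeasurable h] at h1
    exact IsProbabilityMeasure.ne_zero μ h1.symm
  have hmeas : ∀ t n, μ (φ t ⁻¹' C n) = μ (C n) := fun t n => by
    rw [← Measure.map_apply_of_aemeasurable (hae t) (hC n), hφ t]
  have hpair : Pairwise (Function.onFun (AEDisjoint μ)
      fun i : (n : ℕ) × Fin (k n) => φ (i.2 : ℕ) ⁻¹' C i.1) := by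
    rintro ⟨n, j⟩ ⟨m, j'⟩ hne
    refine Disjoint.aedisjoint ?_
    rcases lt_trichotomy (j : ℕ) j' with h | h | h
    · exact hdisj n m j j.2 j' j'.2 (Or.inl h)
    · refine hdisj n m j j.2 j' j'.2 (Or.inr ⟨h, fun hnm => hne ?_⟩)
      subst hnm
      rw [Fin.ext h]
    · exact (hdisj m n j' j'.2 j j.2 (Or.inl h)).symm
  have h1 := measure_iUnion₀ hpair fun i => (hae (i.2 : ℕ)).nullMeasurableSet_preimage (hC i.1)
  calc ∑' n, (k n : ℝ≥0∞) * μ (C n)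
      = ∑' n, ∑' _ : Fin (k n), μ (C n) := by
        refine tsum_congr fun n => ?_
        rw [ENNReal.tsum_const, ENat.card_eq_coe_fintype_card, Fintype.card_fin]
        rfl
    _ = ∑' i : (n : ℕ) × Fin (k n), μ (φ (i.2 : ℕ) ⁻¹' C i.1) := by
        rw [ENNReal.tsum_sigma (fun n (j : Fin (k n)) => μ (φ (j : ℕ) ⁻¹' C n))]
        simp only [hmeas]
    _ = μ (⋃ i : (n : ℕ) × Fin (k n), φ (i.2 : ℕ) ⁻¹' C i.1) := h1.symm
    _ ≤ 1 := prob_le_one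

end Entropy

/-! ### Cubes in Euclidean space. -/

section Cubes

variable {d : ℕ}

/-- The index of the cube of side `η` that contains a point. -/
def cubeIndex (η : ℝ) (u : Model d) : Fin d → ℤ := fun i => ⌊u i / η⌋

theorem measurable_cubeIndex (η : ℝ) : Measurable (cubeIndex (d := d) η) := by
  refine measurable_pi_lambda _ fun i => Int.measurable_floor.comp ?_
  have : Continuous fun u : Model d => u i / η := by fun_prop
  exact this.measurable

theorem norm_sub_le_of_cubeIndex_eq {η : ℝ} (hη : 0 < η) {u v : Model d}
    (h : cubeIndex η u = cubeIndex η v) : ‖u - v‖ ≤ Real.sqrt d * η := by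
  have h1 : ∀ i, ‖(u - v) i‖ ^ 2 ≤ η ^ 2 := fun i => by
    have h2 := Int.abs_sub_lt_one_of_floor_eq_floor (congrFun h i)
    rw [← sub_div, abs_div, abs_of_pos hη, div_lt_one hη] at h2
    rw [PiLp.sub_apply, Real.norm_eq_abs]
    gcongr
  rw [EuclideanSpace.norm_eq]
  calc Real.sqrt (∑ i, ‖(u - v) i‖ ^ 2) ≤ Real.sqrt (∑ _i : Fin d, η ^ 2) :=
        Real.sqrt_le_sqrt (Finset.sum_le_sum fun i _ => h1 i)
    _ = Real.sqrt d * η := by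
        rw [Finset.sum_const, Finset.card_univ, Fintype.card_fin, nsmul_eq_mul,
          Real.sqrt_mul d.cast_nonneg, Real.sqrt_sq hη.le]

/-- The number of cubes that meet a ball of radius one. -/
theorem exists_finset_cubeIndex (p : Model d) {η : ℝ} (hη : 0 < η) :
    ∃ T : Finset (Fin d → ℤ), (∀ u, ‖u - p‖ ≤ 1 → cubeIndex η u ∈ T) ∧
      (T.card : ℝ) ≤ (2 / η + 2) ^ d := by
  refine ⟨Fintype.piFinset fun i => Finset.Icc ⌊(p i - 1) / η⌋ ⌊(p i + 1) / η⌋, fun u hu => ?_, ?_⟩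
  · rw [Fintype.mem_piFinset]
    intro i
    have h1 := (PiLp.norm_apply_le (u - p) i).trans hu
    rw [PiLp.sub_apply, Real.norm_eq_abs, abs_le] at h1
    rw [Finset.mem_Icc]
    constructor
    · refine Int.floor_le_floor ?_
      gcongr
      linarith
    · refine Int.floor_le_floor ?_
      gcongr
      linarith
  · rw [Fintype.card_piFinset, Nat.cast_prod]
    calc ∏ i, ((Finset.Icc ⌊(p i - 1) / η⌋ ⌊(p i + 1) / η⌋).card : ℝ)
        ≤ ∏ _i : Fin d, (2 / η + 2) := by
          refine Finset.prod_le_prod (fun _ _ => Nat.cast_nonneg _) fun i _ => ?_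
          have h0 : (p i - 1) / η ≤ (p i + 1) / η := by gcongr; linarith
          have h1 := Int.floor_le_floor h0
          rw [Int.card_Icc, ← Int.cast_natCast, Int.toNat_of_nonneg (by omega)]
          push_cast
          have h2 := Int.floor_le ((p i + 1) / η)
          have h3 := Int.lt_floor_add_one ((p i - 1) / η)
          have h4 : (p i + 1) / η - (p i - 1) / η = 2 / η := by ring
          linarith
      _ = _ := by simp

end Cubes


/-! ### Measurability of the cells. -/

section Measurability

variable {d : ℕ} {M : Type*} [EMetricSpace M] [ChartedSpace (Model d) M]
  [IsManifold (𝓡 d) ∞ M] [RiemannianBundle (fun x : M => TangentSpace (𝓡 d) x)]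
  [MeasurableSpace M] [BorelSpace M]

variable {c : SaddleConst} {Lg : Model d → Model d → Model d} {Cd δ : ℝ} {σ : M}
  {Y : ∀ x : M, TangentSpace (𝓡 d) x} {φ : ℝ → M → M} {B : Model d →L[ℝ] Model d}
  {S U : Model d →L[ℝ] Model d →L[ℝ] ℝ} {p : Model d} {n : ℕ} {r : ℝ}

namespace FlowSaddle

/-- Near the saddle the flow is continuous. -/
theorem continuousOn_flow (h : FlowSaddle c Lg Cd δ σ Y φ B S U p) (hn : c.IsLarge Cd δ r n) :
    ContinuousOn (fun q : Model d × ℝ => φ q.2 ((extChartAt (𝓡 d) σ).symm q.1))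
      (Metric.closedBall p (c.D * Real.exp (-(n : ℝ))) ×ˢ Icc 0 1) := by
  have hR := c.R_pos
  have hΛ := c.one_le_Λ
  have hsmall : c.D * Real.exp (-(n : ℝ)) ≤ c.R / 4 := by
    refine le_trans ?_ hn.radius.le
    have := c.D_pos
    gcongr
    linarith [(n.cast_nonneg : (0 : ℝ) ≤ n)]
  have hball := h.closedBall_subset_target (ρ := c.D * Real.exp (-(n : ℝ))) (by linarith)
  have hmem : ∀ u ∈ Metric.closedBall p (c.D * Real.exp (-(n : ℝ))), ∀ s ∈ Icc (0 : ℝ) 1,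
      φ s ((extChartAt (𝓡 d) σ).symm u) ∈ chartBall σ p (c.R / 4) := fun u hu s hs => by
    refine chartBall_mono hn.radius.le (h.mem_chartBall_of_mem ?_ hn.radius ?_)
    · rw [chartBall_eq_image hball]
      exact mem_image_of_mem _ hu
    · rw [abs_of_nonneg hs.1]
      linarith [hs.2, hn.two_le]
  have h1 : ContinuousOn
      (fun q : Model d × ℝ => extChartAt (𝓡 d) σ (φ q.2 ((extChartAt (𝓡 d) σ).symm q.1)))
      (Metric.closedBall p (c.D * Real.exp (-(n : ℝ))) ×ˢ Icc 0 1) := by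
    -- Joint continuity from continuity in time and a Lipschitz bound in the point that is uniform
    -- for times in [0, 1].
    refine continuousOn_prod_of_continuousOn_lipschitzOnWith _ (Real.toNNReal (Real.exp c.Λ))
      (fun u hu => ?_) (fun s hs => ?_)
    · have h2 := (h.flow.integral ((extChartAt (𝓡 d) σ).symm u)).continuous.continuousOn (s := Icc 0 1)
      exact (continuousOn_extChartAt σ).comp h2 fun s hs => (hmem u hu s hs).1
    · refine LipschitzOnWith.of_dist_le_mul fun u hu v hv => ?_
      have hW := h.closedBall_subset (ρ := c.R / 4) (by linarith)
      have horb : ∀ u ∈ Metric.closedBall p (c.D * Real.exp (-(n : ℝ))),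
          IsOrbitOn (coordField Y σ) (Metric.closedBall p (c.R / 4))
          (fun t => extChartAt (𝓡 d) σ (φ t ((extChartAt (𝓡 d) σ).symm u))) (uIcc 0 s) :=
        fun u hu => h.flow.isOrbitOn fun t ht => hmem u hu t (by
          rw [uIcc_of_le hs.1] at ht
          exact ⟨ht.1, ht.2.trans hs.2⟩)
      have h2 := IsOrbitOn.norm_sub_le (by linarith)
        (fun x hx y hy => h.saddle.lipschitz x (hW hx) y (hW hy)) (horb u hu) (horb v hv)
      simp only [h.flow.zero, (extChartAt (𝓡 d) σ).right_inv (hball hu),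
        (extChartAt (𝓡 d) σ).right_inv (hball hv)] at h2
      rw [dist_eq_norm, dist_eq_norm, Real.coe_toNNReal _ (Real.exp_pos _).le]
      refine h2.trans ?_
      gcongr
      rw [sub_zero, abs_of_nonneg hs.1]
      exact mul_le_of_le_one_right (by linarith) hs.2
  have h2 := (continuousOn_extChartAt_symm σ).comp h1 fun q hq =>
    (extChartAt (𝓡 d) σ).map_source (hmem q.1 hq.1 q.2 hq.2).1
  refine h2.congr fun q hq => ?_
  exact ((extChartAt (𝓡 d) σ).left_inv (hmem q.1 hq.1 q.2 hq.2).1).symm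

/-- The two strict inequalities, for the radius of the layer and for the time s < 1, are exhausted
by closed ones with margin 1/(j + 1). So the cell is a countable union of continuous images of
compact sets. -/
theorem measurableSet_cell (h : FlowSaddle c Lg Cd δ σ Y φ B S U p) (hn : c.IsLarge Cd δ r n) :
    MeasurableSet (cell c Lg σ p S U φ n) := by
  have hR := c.R_pos
  set V := Metric.closedBall p (c.D * Real.exp (-(n : ℝ))) with hV
  have hsmall : c.D * Real.exp (-(n : ℝ)) ≤ c.R / 4 := by
    refine le_trans ?_ hn.radius.le
    have := c.D_pos
    gcongr
    linarith [(n.cast_nonneg : (0 : ℝ) ≤ n)]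
  have hball := h.closedBall_subset_target (ρ := c.D * Real.exp (-(n : ℝ))) (by linarith)
  have hlog : ContinuousOn (fun u => Lg p u) V := by
    refine h.saddle.continuousOn_log.comp (f := fun u : Model d => (p, u)) (by fun_prop)
      fun u hu => ⟨h.saddle.p_mem, h.closedBall_subset (by linarith) hu⟩
  have hq : ContinuousOn (fun u => (S (Lg p u) (Lg p u), U (Lg p u) (Lg p u))) V := by
    have h1 : Continuous fun v : Model d => (S v v, U v v) :=
      (S.continuous.clm_apply continuous_id).prodMk (U.continuous.clm_apply continuous_id)
    exact h1.comp_continuousOn hlog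
  let F : ℕ → Set (ℝ × ℝ) := fun j => {q | q.1 = q.2 ∧ Real.exp (-((n : ℝ) + 1)) ≤ Real.sqrt q.1 ∧
    Real.sqrt q.1 ≤ Real.exp (-(n : ℝ)) - 1 / ((j : ℝ) + 1)}
  have hF : ∀ j, IsClosed (F j) := fun j =>
    (isClosed_eq continuous_fst continuous_snd).inter
      ((isClosed_le continuous_const (Real.continuous_sqrt.comp continuous_fst)).inter
        (isClosed_le (Real.continuous_sqrt.comp continuous_fst) continuous_const))
  let K : ℕ → Set (Model d × ℝ) := fun j =>
    (V ∩ (fun u => (S (Lg p u) (Lg p u), U (Lg p u) (Lg p u))) ⁻¹' F j) ×ˢ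
      Icc 0 (1 - 1 / ((j : ℝ) + 1))
  have hK : ∀ j, IsCompact (K j) := fun j =>
    ((isCompact_closedBall _ _).of_isClosed_subset
      (hq.preimage_isClosed_of_isClosed Metric.isClosed_closedBall (hF j)) inter_subset_left).prod
      isCompact_Icc
  have hKV : ∀ j, K j ⊆ V ×ˢ Icc 0 1 := fun j q hq => by
    refine ⟨hq.1.1, hq.2.1, hq.2.2.trans ?_⟩
    linarith [show (0 : ℝ) < 1 / ((j : ℝ) + 1) by positivity]
  have heq : cell c Lg σ p S U φ n
      = ⋃ j, (fun q : Model d × ℝ => φ q.2 ((extChartAt (𝓡 d) σ).symm q.1)) '' K j := by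
    ext z
    rw [mem_iUnion]
    constructor
    · rintro ⟨x, ⟨hx1, hx2, hx3, hx4⟩, s, hs, rfl⟩
      obtain ⟨j, hj⟩ := exists_nat_one_div_lt (K := ℝ)
        (show 0 < min (Real.exp (-(n : ℝ)) - Real.sqrt (quadAt Lg σ p S x)) (1 - s) from
          lt_min (by linarith) (by linarith [hs.2]))
      rw [lt_min_iff] at hj
      refine ⟨j, (extChartAt (𝓡 d) σ x, s), ⟨⟨mem_closedBall_iff_norm.2 hx1.2, hx2, hx3, ?_⟩,
        hs.1, ?_⟩, ?_⟩
      · have : Real.sqrt (quadAt Lg σ p S x) ≤ Real.exp (-(n : ℝ)) - 1 / ((j : ℝ) + 1) := by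
          linarith [hj.1]
        exact this
      · linarith [hj.2]
      · simp only [(extChartAt (𝓡 d) σ).left_inv hx1.1]
    · rintro ⟨j, ⟨u, s⟩, ⟨⟨hu, h1, h2, h3⟩, hs0, hs1⟩, rfl⟩
      have hj : (0 : ℝ) < 1 / ((j : ℝ) + 1) := by positivity
      have hr := (extChartAt (𝓡 d) σ).right_inv (hball hu)
      refine ⟨(extChartAt (𝓡 d) σ).symm u, ⟨?_, ?_, ?_, ?_⟩, s, ⟨hs0, ?_⟩, rfl⟩
      · rw [chartBall_eq_image hball]
        exact mem_image_of_mem _ hu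
      · rw [quadAt, quadAt, hr]; exact h1
      · rw [quadAt, hr]; exact h2
      · rw [quadAt, hr]; exact lt_of_le_of_lt h3 (by linarith)
      · exact lt_of_le_of_lt hs1 (by linarith)
  rw [heq]
  exact MeasurableSet.iUnion fun j =>
    ((hK j).image_of_continuousOn ((h.continuousOn_flow hn).mono (hKV j))).measurableSet

end FlowSaddle

theorem measurableSet_inter_preimage_extChartAt {A : Set M} (hA : MeasurableSet A) (σ : M)
    (hsub : A ⊆ (extChartAt (𝓡 d) σ).source) {D : Set (Model d)} (hD : MeasurableSet D) :
    MeasurableSet (A ∩ extChartAt (𝓡 d) σ ⁻¹' D) := by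
  classical
  have h1 : Measurable ((extChartAt (𝓡 d) σ).source.piecewise (extChartAt (𝓡 d) σ) fun _ => 0) :=
    (continuousOn_extChartAt σ).measurable_piecewise continuousOn_const
      (isOpen_extChartAt_source σ).measurableSet
  have h2 : A ∩ extChartAt (𝓡 d) σ ⁻¹' D
      = A ∩ (extChartAt (𝓡 d) σ).source.piecewise (extChartAt (𝓡 d) σ) (fun _ => 0) ⁻¹' D := by
    ext x
    refine and_congr_right fun hx => ?_
    rw [mem_preimage, mem_preimage, piecewise_eq_of_mem _ _ _ (hsub hx)]
  rw [h2]
  exact hA.inter (h1 hD)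

end Measurability

/-! ### The partition and its entropy. -/

section Partition

variable {d : ℕ} {M : Type*} [EMetricSpace M] [ChartedSpace (Model d) M]
  [IsManifold (𝓡 d) ∞ M] [RiemannianBundle (fun x : M => TangentSpace (𝓡 d) x)]
  [MeasurableSpace M] [BorelSpace M]

variable {c : SaddleConst} {Lg : Model d → Model d → Model d} {Cd δ : ℝ} {σ : M}
  {Y : ∀ x : M, TangentSpace (𝓡 d) x} {φ : ℝ → M → M} {B : Model d →L[ℝ] Model d}
  {S U : Model d →L[ℝ] Model d →L[ℝ] ℝ} {p : Model d} {n₀ : ℕ} {r : ℝ}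

/-- The constant in the bound for the number of pieces of a cell. -/
def SaddleConst.cardConst (c : SaddleConst) (d : ℕ) (β : ℝ) : ℝ :=
  (2 * (Real.sqrt d + 1) * Real.exp 1 / (c.a * |β|) + 2) ^ d

theorem SaddleConst.cardConst_pos (c : SaddleConst) (d : ℕ) (β : ℝ) : 0 < c.cardConst d β := by
  have := c.a_pos
  unfold cardConst
  positivity

/-- The bound for the entropy of the partition into pieces of cells. -/
def SaddleConst.entropyBound (c : SaddleConst) (d : ℕ) (L' β : ℝ) : ℝ :=
  2 + 4 * c.Λ * (|Real.log (L' ^ d)| + 1) + 2 * c.cardConst d β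

theorem SaddleConst.entropyBound_pos (c : SaddleConst) (d : ℕ) (L' β : ℝ) :
    0 < c.entropyBound d L' β := by
  have := c.cardConst_pos d β
  have := c.one_le_Λ
  unfold entropyBound
  positivity

namespace FlowSaddle

/-- The n-th cell has ⌊n/(2Λ)⌋ preimages at integer times, all disjoint from each other and from
those of other cells. As n/(2Λ) ≥ 2, n is at most 4Λ times this number. -/
theorem tsum_mul_measure_cell_le (h : FlowSaddle c Lg Cd δ σ Y φ B S U p)
    (hn : ∀ n > n₀, c.IsLarge Cd δ r n) {μ : Measure M} [IsProbabilityMeasure μ]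
    (hμ : ∀ t, μ.map (φ t) = μ) :
    ∑' n : ℕ, (n : ℝ≥0∞) * μ (if n₀ < n then cell c Lg σ p S U φ n else ∅)
      ≤ ENNReal.ofReal (4 * c.Λ) := by
  have hΛ := c.one_le_Λ
  set C : ℕ → Set M := fun n => if n₀ < n then cell c Lg σ p S U φ n else ∅ with hC
  set k : ℕ → ℕ := fun n => ⌊1 / (2 * c.Λ) * (n : ℝ)⌋₊ with hk
  have hCn : ∀ n, n₀ < n → C n = cell c Lg σ p S U φ n := fun n hn => if_pos hn
  have hC0 : ∀ n, ¬ n₀ < n → C n = ∅ := fun n hn => if_neg hn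
  have hkn : ∀ n, (k n : ℝ) ≤ 1 / (2 * c.Λ) * n := fun n => Nat.floor_le (by positivity)
  have h1 := tsum_mul_measure_le hμ (C := C) (k := k) (fun n => by
      by_cases h1 : n₀ < n
      · rw [hCn n h1]; exact h.measurableSet_cell (hn n h1)
      · rw [hC0 n h1]; exact MeasurableSet.empty) (fun n m j hj j' hj' hjj' => by
      by_cases h1 : n₀ < n
      swap
      · rw [hC0 n h1]; exact disjoint_bot_left
      by_cases h2 : n₀ < m
      swap
      · rw [hC0 m h2]; exact disjoint_bot_right
      rw [hCn n h1, hCn m h2]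
      rcases hjj' with hlt | ⟨rfl, hnm⟩
      · rw [Set.disjoint_left]
        intro z hz hz'
        have h3 : (j : ℝ) + 1 ≤ j' := by exact_mod_cast hlt
        have h4 : (j' : ℝ) + 1 ≤ k m := by exact_mod_cast hj'
        have h5 : |(j : ℝ) - j'| = j' - j := by
          rw [abs_sub_comm, abs_of_nonneg (by linarith)]
        have h6 : (0 : ℝ) ≤ j := j.cast_nonneg
        -- Run backwards from the later visit: the index of that cell bounds its time j', hence the
        -- length of the arc.
        refine h.notMem_cell (hn m h2) hz' (t := (j : ℝ) - j') (m := n) (by linarith)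
          (by linarith [hkn m]) ?_
        rw [← h.flow.add, sub_add_cancel]
        exact hz
      · exact (h.disjoint_cell (hn n h1) hnm).preimage _)
  calc ∑' n : ℕ, (n : ℝ≥0∞) * μ (C n)
      ≤ ∑' n, ENNReal.ofReal (4 * c.Λ) * ((k n : ℝ≥0∞) * μ (C n)) := by
        refine ENNReal.tsum_le_tsum fun n => ?_
        by_cases h2 : n₀ < n
        · rw [← mul_assoc]
          gcongr
          rw [← ENNReal.ofReal_natCast n, ← ENNReal.ofReal_natCast (k n),
            ← ENNReal.ofReal_mul (by positivity)]
          refine ENNReal.ofReal_le_ofReal ?_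
          have h3 := (hn n h2).two_le
          have h4 : 1 / (2 * c.Λ) * (n : ℝ) < k n + 1 := Nat.lt_floor_add_one _
          have h5 : (n : ℝ) = 2 * c.Λ * (1 / (2 * c.Λ) * n) := by field_simp
          nlinarith
        · rw [hC0 n h2, measure_empty, mul_zero]
          exact zero_le
    _ = ENNReal.ofReal (4 * c.Λ) * ∑' n, (k n : ℝ≥0∞) * μ (C n) := ENNReal.tsum_mul_left
    _ ≤ ENNReal.ofReal (4 * c.Λ) * 1 := by gcongr
    _ = _ := mul_one _

/-- The partition of the cells into pieces of exponentially small diameter. -/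
theorem exists_partition (h : FlowSaddle c Lg Cd δ σ Y φ B S U p)
    (hr : ∀ y, edist y ((extChartAt (𝓡 d) σ).symm p) ≤ ENNReal.ofReal r →
      y ∈ chartBall σ p (Real.exp (-c.Λ) * (c.R / 8)))
    (hn : ∀ n > n₀, c.IsLarge Cd δ r n) {L' β : ℝ} (hβ0 : 0 < β) (hβ1 : β ≤ 1)
    (hL' : Real.exp (c.Λ * (6 / c.ρ) + 1) ≤ L') :
    ∃ 𝒜 : Set (Set M), IsCountablePartition 𝒜 ∧
      (∀ A ∈ 𝒜, (∃ n > n₀, A ⊆ cell c Lg σ p S U φ n) ∨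
        A = (⋃ n > n₀, cell c Lg σ p S U φ n)ᶜ) ∧
      (∀ n > n₀, {A ∈ 𝒜 | A ⊆ cell c Lg σ p S U φ n}.Finite ∧
        ⋃₀ {A ∈ 𝒜 | A ⊆ cell c Lg σ p S U φ n} = cell c Lg σ p S U φ n ∧
        ({A ∈ 𝒜 | A ⊆ cell c Lg σ p S U φ n}.ncard : ℝ) ≤ c.cardConst d β * (L' ^ d) ^ n ∧
        ∀ A ∈ 𝒜, A ⊆ cell c Lg σ p S U φ n →
          Metric.ediam A ≤ ENNReal.ofReal (Cd * (c.a * Real.exp (-1)) * β * (L' ^ n)⁻¹) ∧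
          ∀ x ∈ A, ∀ y ∈ A, InTubeUntilExit Y φ ((extChartAt (𝓡 d) σ).symm p) r β x y) ∧
      ∀ μ : Measure M, IsProbabilityMeasure μ → (∀ t : ℝ, μ.map (φ t) = μ) →
        partitionEntropy μ 𝒜 < ENNReal.ofReal (c.entropyBound d L' β) := by
  have hR := c.R_pos
  have hρ := c.ρ_pos
  have hΛ := c.one_le_Λ
  have ha := c.a_pos
  have hCd := h.chart.Cd_pos
  have hL1 : 1 ≤ L' := (Real.one_le_exp (by positivity)).trans hL'
  have hL0 : 0 < L' := by linarith
  -- `q` bounds the chart diameter of the pieces; the factor e^{-1} matches the exponent -(n + 1) of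
  -- the minimal speed.
  set q : ℕ → ℝ := fun n => c.a * Real.exp (-1) * β * (L' ^ n)⁻¹ with hq
  have hq0 : ∀ n, 0 < q n := fun n => by positivity
  set η : ℕ → ℝ := fun n => q n / (Real.sqrt d + 1) with hη
  have hη0 : ∀ n, 0 < η n := fun n => by have := hq0 n; positivity
  have hηq : ∀ n, Real.sqrt d * η n ≤ q n := fun n => by
    rw [hη, mul_div_assoc', div_le_iff₀ (by positivity)]
    have := (hq0 n).le
    linarith
  have hcell : ∀ n > n₀, cell c Lg σ p S U φ n ⊆ chartBall σ p (c.R / 4) := fun n hn' x hx =>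
    h.mem_chartBall_of_mem_cell (hn n hn') hx
  choose T hT hTcard using fun n => exists_finset_cubeIndex p (hη0 n)
  obtain ⟨𝒜, h𝒜, hrefine, hfine⟩ := exists_refined_partition (n₀ := n₀)
    (C := cell c Lg σ p S U φ) (g := fun n x => cubeIndex (η n) (extChartAt (𝓡 d) σ x)) (T := T)
    (fun n hn' m _ hnm => h.disjoint_cell (hn n hn') hnm)
    (fun n hn' => h.measurableSet_cell (hn n hn'))
    (fun n hn' i => measurableSet_inter_preimage_extChartAt (h.measurableSet_cell (hn n hn')) σ
      (fun x hx => (hcell n hn' hx).1)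
      (measurable_cubeIndex (η n) (measurableSet_singleton i)))
    (fun n hn' x hx => hT n _ ((hcell n hn' hx).2.trans (by linarith [c.R_le])))
  have hcard : ∀ n > n₀, ({A ∈ 𝒜 | A ⊆ cell c Lg σ p S U φ n}.ncard : ℝ)
      ≤ c.cardConst d β * (L' ^ d) ^ n := fun n hn' => by
    have h1 : ({A ∈ 𝒜 | A ⊆ cell c Lg σ p S U φ n}.ncard : ℝ) ≤ (T n).card := by
      exact_mod_cast (hfine n hn').2.2.1
    refine (h1.trans (hTcard n)).trans ?_
    rw [SaddleConst.cardConst, ← pow_mul, mul_comm d n, pow_mul, ← mul_pow]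
    have h2 : 1 ≤ L' ^ n := one_le_pow₀ hL1
    have h3 := hη0 n
    refine pow_le_pow_left₀ (by positivity) ?_ d
    have h4 : 2 / η n = 2 * (Real.sqrt d + 1) * Real.exp 1 / (c.a * |β|) * L' ^ n := by
      simp only [hη, hq]
      rw [abs_of_pos hβ0, Real.exp_neg]
      field_simp
    rw [h4]
    linarith
  have hdist : ∀ n > n₀, ∀ A ∈ 𝒜, A ⊆ cell c Lg σ p S U φ n → ∀ x ∈ A, ∀ y ∈ A,
      ‖extChartAt (𝓡 d) σ x - extChartAt (𝓡 d) σ y‖ ≤ q n := fun n hn' A hA hAn x hx y hy => by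
    obtain ⟨i, rfl⟩ := (hfine n hn').2.2.2 A hA hAn
    exact (norm_sub_le_of_cubeIndex_eq (hη0 n) (hx.2.trans hy.2.symm)).trans (hηq n)
  refine ⟨𝒜, h𝒜, hrefine, fun n hn' => ⟨(hfine n hn').1, (hfine n hn').2.1, hcard n hn',
    fun A hA hAn => ⟨?_, fun x hx y hy => ?_⟩⟩, fun μ hμ hinv => ?_⟩
  · refine Metric.ediam_le fun x hx y hy => ?_
    have hx' := hcell n hn' (hAn hx)
    have hy' := hcell n hn' (hAn hy)
    have h1 := h.chart.edist_le _ (h.extChartAt_mem (by linarith) hx') _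
      (h.extChartAt_mem (by linarith) hy')
    rw [(extChartAt (𝓡 d) σ).left_inv hx'.1, (extChartAt (𝓡 d) σ).left_inv hy'.1] at h1
    refine h1.trans (ENNReal.ofReal_le_ofReal ?_)
    calc Cd * ‖extChartAt (𝓡 d) σ x - extChartAt (𝓡 d) σ y‖ ≤ Cd * q n := by
          have := hdist n hn' A hA hAn x hx y hy
          gcongr
      _ = _ := by rw [hq]; ring
  · refine h.inTubeUntilExit hr (hn n hn') (hAn hx) (hcell n hn' (hAn hy)).1 hβ0 hβ1 ?_
    have h1 := hdist n hn' A hA hAn y hy x hx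
    -- (L')^n absorbs both the separation of orbits during the stay and the decay e^{-n} of the
    -- speed.
    have h2 : Real.exp (c.Λ * (6 / c.ρ * n)) * Real.exp n ≤ L' ^ n := by
      rw [← Real.exp_add]
      calc Real.exp (c.Λ * (6 / c.ρ * n) + n) = Real.exp (c.Λ * (6 / c.ρ) + 1) ^ n := by
            rw [← Real.exp_nat_mul]; ring_nf
        _ ≤ L' ^ n := pow_le_pow_left₀ (Real.exp_pos _).le hL' n
    calc Real.exp (c.Λ * (6 / c.ρ * n)) * ‖extChartAt (𝓡 d) σ y - extChartAt (𝓡 d) σ x‖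
        ≤ Real.exp (c.Λ * (6 / c.ρ * n)) * q n := by gcongr
      _ = c.a * β * Real.exp (-1) * (Real.exp (c.Λ * (6 / c.ρ * n)) * Real.exp n / L' ^ n)
            * Real.exp (-n) := by
          rw [hq, Real.exp_neg (n : ℝ)]
          field_simp
      _ ≤ c.a * β * Real.exp (-1) * 1 * Real.exp (-n) := by
          gcongr
          exact div_le_one_of_le₀ h2 (by positivity)
      _ = c.a * β * Real.exp (-((n : ℝ) + 1)) := by
          rw [mul_one, mul_assoc, ← Real.exp_add]; ring_nf
  -- With slope bn on the n-th cell the masses sum to b ∑ n μ(C_n), and the number of pieces times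
  -- e^{-bn} is at most a constant times 2^{-n}, because L'^d e^{-b} ≤ e^{-1} ≤ 1/2.
  · set b := |Real.log (L' ^ d)| + 1 with hb
    have hb0 : 0 < b := by positivity
    set ℬ : ℕ → Set (Set M) := fun n =>
      if n₀ < n then {A ∈ 𝒜 | A ⊆ cell c Lg σ p S U φ n} else ∅ with hℬ
    have hc0 := c.cardConst_pos d β
    have hsub : 𝒜 ⊆ {(⋃ n > n₀, cell c Lg σ p S U φ n)ᶜ} ∪ ⋃ n, ℬ n := fun A hA => by
      rcases hrefine A hA with ⟨n, hn', hAn⟩ | h1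
      · refine Or.inr (mem_iUnion.2 ⟨n, ?_⟩)
        rw [hℬ]
        simp only [if_pos hn']
        exact ⟨hA, hAn⟩
      · exact Or.inl h1
    have h1 := partitionEntropy_le (μ := μ) h𝒜 hsub (fun n => by
      by_cases hn' : n₀ < n
      · simp only [hℬ, if_pos hn']; exact sep_subset _ _
      · simp only [hℬ, if_neg hn']; exact empty_subset _) (a := fun n => b * n)
      (fun n => by positivity)
    refine h1.trans_lt ?_
    have h2 : ∑' n : ℕ, ENNReal.ofReal (b * n) * μ (⋃₀ ℬ n) ≤ ENNReal.ofReal (b * (4 * c.Λ)) := by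
      calc ∑' n : ℕ, ENNReal.ofReal (b * n) * μ (⋃₀ ℬ n)
          = ENNReal.ofReal b *
            ∑' n : ℕ, (n : ℝ≥0∞) * μ (if n₀ < n then cell c Lg σ p S U φ n else ∅) := by
            rw [← ENNReal.tsum_mul_left]
            refine tsum_congr fun n => ?_
            rw [ENNReal.ofReal_mul hb0.le, ENNReal.ofReal_natCast, mul_assoc]
            congr 3
            by_cases hn' : n₀ < n
            · simp only [hℬ, if_pos hn']; exact (hfine n hn').2.1
            · simp only [hℬ, if_neg hn', sUnion_empty]
        _ ≤ ENNReal.ofReal b * ENNReal.ofReal (4 * c.Λ) := by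
            gcongr
            exact h.tsum_mul_measure_cell_le hn hinv
        _ = _ := (ENNReal.ofReal_mul hb0.le).symm
    have h3 : ∑' n : ℕ, ((ℬ n).encard : ℝ≥0∞) * ENNReal.ofReal (Real.exp (-(b * n) - 1))
        ≤ ENNReal.ofReal (2 * c.cardConst d β) := by
      have hgeo : ENNReal.ofReal (2 * c.cardConst d β)
          = ∑' n : ℕ, ENNReal.ofReal (c.cardConst d β * (1 / 2) ^ n) := by
        rw [← ENNReal.ofReal_tsum_of_nonneg (fun n => by positivity)
          (summable_geometric_two.mul_left _), tsum_mul_left, tsum_geometric_two, mul_comm]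
      rw [hgeo]
      refine ENNReal.tsum_le_tsum fun n => ?_
      by_cases hn' : n₀ < n
      · simp only [hℬ, if_pos hn']
        rw [← (hfine n hn').1.cast_ncard_eq, ENat.toENNReal_coe, ← ENNReal.ofReal_natCast,
          ← ENNReal.ofReal_mul (by positivity)]
        refine ENNReal.ofReal_le_ofReal ?_
        have h4 : L' ^ d * Real.exp (-b) ≤ 1 / 2 := by
          have h5 : L' ^ d ≤ Real.exp |Real.log (L' ^ d)| := by
            conv_lhs => rw [← Real.exp_log (show 0 < L' ^ d by positivity)]
            exact Real.exp_le_exp.2 (le_abs_self _)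
          have h6 := Real.add_one_le_exp (1 : ℝ)
          calc L' ^ d * Real.exp (-b) ≤ Real.exp |Real.log (L' ^ d)| * Real.exp (-b) := by gcongr
            _ = (Real.exp 1)⁻¹ := by rw [← Real.exp_add, ← Real.exp_neg, hb]; ring_nf
            _ ≤ 1 / 2 := by
              rw [one_div]
              exact inv_anti₀ (by norm_num) (by linarith)
        calc ({A ∈ 𝒜 | A ⊆ cell c Lg σ p S U φ n}.ncard : ℝ) * Real.exp (-(b * n) - 1)
            ≤ c.cardConst d β * (L' ^ d) ^ n * Real.exp (-(b * n)) := by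
              gcongr
              · exact hcard n hn'
              · linarith
          _ = c.cardConst d β * (L' ^ d * Real.exp (-b)) ^ n := by
              rw [mul_pow, ← Real.exp_nat_mul, mul_assoc]; ring_nf
          _ ≤ c.cardConst d β * (1 / 2) ^ n := by gcongr
      · simp only [hℬ, if_neg hn', encard_empty, ENat.toENNReal_zero, zero_mul, zero_le]
    rw [ENNReal.tsum_add]
    calc 1 + (∑' n : ℕ, ENNReal.ofReal (b * n) * μ (⋃₀ ℬ n)
          + ∑' n : ℕ, ((ℬ n).encard : ℝ≥0∞) * ENNReal.ofReal (Real.exp (-(b * n) - 1)))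
        ≤ ENNReal.ofReal 1 + (ENNReal.ofReal (b * (4 * c.Λ))
          + ENNReal.ofReal (2 * c.cardConst d β)) := by
          rw [ENNReal.ofReal_one]
          gcongr
      _ = ENNReal.ofReal (1 + (b * (4 * c.Λ) + 2 * c.cardConst d β)) := by
          rw [← ENNReal.ofReal_add (by positivity) (by positivity),
            ← ENNReal.ofReal_add zero_le_one (by positivity)]
      _ < ENNReal.ofReal (c.entropyBound d L' β) := by
          refine (ENNReal.ofReal_lt_ofReal_iff (c.entropyBound_pos d L' β)).2 ?_
          rw [SaddleConst.entropyBound]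
          linarith

end FlowSaddle

end Partition

end SingFlow

end

/-! ### Choice of the constants and conclusion. -/

theorem theoremB {d : ℕ} {M : Type*} [EMetricSpace M]
    [ChartedSpace (EuclideanSpace ℝ (Fin d)) M] [IsManifold (𝓡 d) ∞ M]
    [RiemannianBundle (fun x : M => TangentSpace (𝓡 d) x)]
    [IsContMDiffRiemannianBundle (𝓡 d) ∞ (EuclideanSpace ℝ (Fin d))
      (fun x : M => TangentSpace (𝓡 d) x)]
    [IsRiemannianManifold (𝓡 d) M] [MeasurableSpace M] [BorelSpace M]
    (X : ∀ x : M, TangentSpace (𝓡 d) x) (hX : SingFlow.IsC1VectorField X)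
    (σ : M) (hσ : SingFlow.IsHyperbolicSingularity X σ) :
    -- constants that depend only on `X` and `σ`
    ∃ L₀ L₁ K₀ K₁ c₀ β₀ r₀ : ℝ, 0 < L₀ ∧ L₀ < L₁ ∧ 0 < K₀ ∧ K₀ < K₁ ∧ 0 < c₀ ∧ 0 < β₀ ∧ 0 < r₀ ∧
    ∀ r : ℝ, 0 < r → r < r₀ →
    -- constants that depend also on `r`; `c₁` depends on `β`, and `H₂` on `L` and `β`
    ∃ (n₀ : ℕ) (N₀ : ℝ) (c₁ : ℝ → ℝ) (H₂ : ℝ → ℝ → ℝ), 0 < N₀ ∧ (∀ β, 0 < c₁ β) ∧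
      (∀ L β, 0 < H₂ L β) ∧
    ∃ 𝒰 : Set (∀ x : M, TangentSpace (𝓡 d) x), SingFlow.IsC1Neighborhood X 𝒰 ∧
    ∀ Y ∈ 𝒰, SingFlow.IsC1VectorField Y →
    -- the continuation `σY` of `σ` is the only singularity of `Y` in `B_r(σ)`
    ∃ σY : M, edist σY σ < ENNReal.ofReal r ∧ SingFlow.IsHyperbolicSingularity Y σY ∧
      (∀ z : M, edist z σ < ENNReal.ofReal r → Y z = 0 → z = σY) ∧
    ∃ g : LinearMap.BilinForm ℝ (EuclideanSpace ℝ (Fin d)),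
      SingFlow.IsAdapted (SingFlow.linearization Y σY) g ∧
    ∀ φ : ℝ → M → M, SingFlow.IsFlowOf Y φ →
      -- the layers of the cross section, with their flow speed and exit times
      (∀ n > n₀, ∀ x ∈ SingFlow.sectionLayer Y σY g n,
        edist x σY < ENNReal.ofReal r ∧
        ‖Y x‖ ∈ Icc (L₀ * Real.exp (-((n : ℝ) + 1))) (L₁ * Real.exp (-(n : ℝ))) ∧
        SingFlow.exitTime φ σY r x / n ∈ Icc K₀ K₁ ∧
        SingFlow.exitTime (fun t => φ (-t)) σY r x / n ∈ Icc K₀ K₁) ∧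
      -- the coarse partition
      (∀ n > n₀, MeasurableSet (SingFlow.coarseCell Y φ σY g n)) ∧
      (∀ n > n₀, ∀ m > n₀, n ≠ m →
        Disjoint (SingFlow.coarseCell Y φ σY g n) (SingFlow.coarseCell Y φ σY g m)) ∧
      -- the refined partition
      ∀ L : ℝ, N₀ ≤ L → ∀ β : ℝ, 0 < β → β < β₀ →
      ∃ 𝒜 : Set (Set M), SingFlow.IsCountablePartition 𝒜 ∧
        SingFlow.Refines 𝒜 (SingFlow.coarsePartition Y φ σY g n₀) ∧
        (∀ n > n₀,
          {A ∈ 𝒜 | A ⊆ SingFlow.coarseCell Y φ σY g n}.Finite ∧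
          ⋃₀ {A ∈ 𝒜 | A ⊆ SingFlow.coarseCell Y φ σY g n} = SingFlow.coarseCell Y φ σY g n ∧
          ({A ∈ 𝒜 | A ⊆ SingFlow.coarseCell Y φ σY g n}.ncard : ℝ)
            ≤ c₁ β * ((L ^ K₁ * Real.exp 1) ^ d) ^ n ∧
          ∀ A ∈ 𝒜, A ⊆ SingFlow.coarseCell Y φ σY g n →
            Metric.ediam A ≤ ENNReal.ofReal (c₀ * β * ((L ^ K₁ * Real.exp 1) ^ n)⁻¹) ∧
            ∀ x ∈ A, ∀ y ∈ A, SingFlow.InTubeUntilExit Y φ σY r β x y) ∧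
        ∀ μ : Measure M, IsProbabilityMeasure μ → (∀ t : ℝ, μ.map (φ t) = μ) →
          SingFlow.partitionEntropy μ 𝒜 < ENNReal.ofReal (H₂ L β) := by
  obtain ⟨c, Lg, Cd, δ, hchart, hpert⟩ := SingFlow.exists_saddleChart hX hσ
  have hR := c.R_pos
  have hρ := c.ρ_pos
  have hΛ := c.one_le_Λ
  have hκ := c.κ_pos
  have hk := c.one_le_k
  have hlam := c.lam_pos
  have hK := c.K_pos
  have hD := c.D_pos
  have ha := c.a_pos
  have hCd := hchart.Cd_pos
  have hball : SingFlow.chartBall σ (extChartAt (𝓡 d) σ σ) (Real.exp (-c.Λ) * (c.R / 16)) ∈ 𝓝 σ :=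
    SingFlow.chartBall_mem_nhds (mem_extChartAt_source σ) (by
      rw [sub_self, norm_zero]; positivity)
  obtain ⟨ε₀, hε₀, hε₀s⟩ := EMetric.mem_nhds_iff.1 hball
  obtain ⟨r₁, hr₁, hr₁ε⟩ : ∃ r₁ : ℝ, 0 < r₁ ∧ ENNReal.ofReal (2 * r₁) ≤ ε₀ := by
    obtain ⟨s, hs0, hs⟩ := ENNReal.lt_iff_exists_real_btwn.1 hε₀
    have hs' : 0 < s := ENNReal.ofReal_pos.1 hs.1
    exact ⟨s / 2, by positivity, by rw [mul_div_cancel₀ s two_ne_zero]; exact hs.2.le⟩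
  -- K₁ is 6/ρ although exit times are below 5n/ρ: it also serves as the exponent in L^{K₁}, which
  -- has to cover the enlarged stay. The extra summand in L₁ and the minimum with 1/ρ in K₀ only
  -- secure strict inequalities, and β₀ = 1 is what the tube needs.
  refine ⟨c.κ * (c.lam / (2 * Real.sqrt c.K)),
    c.k * c.Λ * c.D + c.κ * (c.lam / (2 * Real.sqrt c.K)), min (1 / (2 * c.Λ)) (1 / c.ρ), 6 / c.ρ,
    Cd * (c.a * Real.exp (-1)), 1, r₁, by positivity, ?_, by positivity, ?_, by positivity,
    one_pos, hr₁, fun r hr hrr₁ => ?_⟩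
  · have : 0 < c.k * c.Λ * c.D := by positivity
    linarith
  · refine (min_le_right _ _).trans_lt ?_
    gcongr
    norm_num
  obtain ⟨n₀, hn₀⟩ := c.exists_isLarge Cd hchart.δ_pos hr
  -- The first bound keeps the ball around the continued singularity deep in the chart; the second
  -- places that singularity within r/2 of `σ`.
  obtain ⟨ε, hε, hY'⟩ := hpert (min (Real.exp (-c.Λ) * (c.R / 16)) (r / (2 * Cd))) (by positivity)
  refine ⟨n₀, Real.exp c.Λ, c.cardConst d,
    fun L β => c.entropyBound d (L ^ (6 / c.ρ) * Real.exp 1) β, Real.exp_pos _,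
    c.cardConst_pos d, fun L β => c.entropyBound_pos d _ β,
    {Y | ∀ u ∈ Metric.closedBall (extChartAt (𝓡 d) σ σ) c.R,
      ‖SingFlow.coordField Y σ u - SingFlow.coordField X σ u‖ < ε ∧
      ‖fderiv ℝ (SingFlow.coordField Y σ) u - fderiv ℝ (SingFlow.coordField X σ) u‖ < ε},
    ⟨{(σ, Metric.closedBall (extChartAt (𝓡 d) σ σ) c.R)}, finite_singleton _, ?_, ε, hε,
      fun Y _ hYF => hYF _ rfl⟩, fun Y hYX hY => ?_⟩
  · rintro q rfl
    exact ⟨isCompact_closedBall _ _, hchart.subset⟩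
  obtain ⟨p, B, S, U, hp, hB, hBh, hforms, hsaddle⟩ := hY' Y hY hYX
  have hexp : Real.exp (-c.Λ) ≤ 1 := Real.exp_le_one_iff.2 (by linarith)
  have hp1 : ‖p - extChartAt (𝓡 d) σ σ‖ ≤ Real.exp (-c.Λ) * (c.R / 16) :=
    hp.trans (min_le_left _ _)
  have hp2 : Cd * ‖p - extChartAt (𝓡 d) σ σ‖ < r := by
    have h1 := mul_le_mul_of_nonneg_left (hp.trans (min_le_right _ _)) hCd.le
    rw [show Cd * (r / (2 * Cd)) = r / 2 by field_simp] at h1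
    linarith
  have hfield : SingFlow.FieldSaddle c Lg Cd δ σ Y B S U p :=
    ⟨hchart, hsaddle, hp1.trans (by nlinarith)⟩
  have hσY : edist ((extChartAt (𝓡 d) σ).symm p) σ < ENNReal.ofReal r := by
    have h1 := hchart.edist_le p hsaddle.p_mem _ (Metric.mem_closedBall_self hR.le)
    rw [extChartAt_to_inv] at h1
    exact h1.trans_lt ((ENNReal.ofReal_lt_ofReal_iff hr).2 hp2)
  have hnear : ∀ z : M, edist z σ < ENNReal.ofReal (2 * r) →
      z ∈ SingFlow.chartBall σ (extChartAt (𝓡 d) σ σ) (Real.exp (-c.Λ) * (c.R / 16)) :=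
    fun z hz => hε₀s (hz.trans_le ((ENNReal.ofReal_le_ofReal (by linarith)).trans hr₁ε))
  -- The closed r-ball around the continued singularity lies in the 2r-ball around `σ`, which the
  -- choice of r₁ places in the small chart ball.
  have hstay : ∀ y, edist y ((extChartAt (𝓡 d) σ).symm p) ≤ ENNReal.ofReal r →
      y ∈ SingFlow.chartBall σ p (Real.exp (-c.Λ) * (c.R / 8)) := fun y hy => by
    have h1 : edist y σ < ENNReal.ofReal (2 * r) := by
      refine (edist_triangle y ((extChartAt (𝓡 d) σ).symm p) σ).trans_lt ?_
      rw [two_mul, ENNReal.ofReal_add hr.le hr.le]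
      exact ENNReal.add_lt_add_of_le_of_lt (hy.trans_lt ENNReal.ofReal_lt_top).ne hy hσY
    obtain ⟨h2, h3⟩ := hnear y h1
    refine ⟨h2, ?_⟩
    have h4 := norm_sub_le_norm_sub_add_norm_sub (extChartAt (𝓡 d) σ y) (extChartAt (𝓡 d) σ σ) p
    rw [norm_sub_rev (extChartAt (𝓡 d) σ σ) p] at h4
    linarith
  have hconj := hfield.linearization_conj hY hB
  refine ⟨(extChartAt (𝓡 d) σ).symm p, hσY,
    ⟨hfield.apply_symm_eq_zero, SingFlow.IsHyperbolicLinear.conj hconj hBh⟩, fun z hz hz0 => ?_,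
    SingFlow.adaptedForm S U
      (SingFlow.tangentEquiv hfield.symm_mem_source (mem_extChartAt_source _)),
    hforms.isAdapted hρ c.m_pos hconj, fun φ hφ => ?_⟩
  · obtain ⟨h1, h2⟩ := hnear z (hz.trans_le (ENNReal.ofReal_le_ofReal (by linarith)))
    have h3 := hsaddle.le_norm_field (mem_closedBall_iff_norm.2 (h2.trans (by nlinarith)))
    rw [(SingFlow.coordField_eq_zero_iff σ h1).2 hz0, norm_zero] at h3
    have h4 : ‖extChartAt (𝓡 d) σ z - p‖ ≤ 0 := by
      by_contra h5
      push Not at h5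
      have := mul_pos hlam h5
      linarith
    rw [← sub_eq_zero.1 (norm_le_zero_iff.1 h4), (extChartAt (𝓡 d) σ).left_inv h1]
  have h : SingFlow.FlowSaddle c Lg Cd δ σ Y φ B S U p := ⟨hfield, hφ⟩
  have hsmall : ∀ n > n₀, c.D * Real.exp (-(n : ℝ)) ≤ c.R / 4 := fun n hn => by
    refine le_trans ?_ (hn₀ n hn).radius.le
    gcongr
    linarith [(n.cast_nonneg : (0 : ℝ) ≤ n)]
  have hlayer : ∀ n > n₀, _ := fun n hn =>
    h.sectionLayer_eq hY hB hforms (hsmall n hn) (hn₀ n hn).log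
  have hcell : ∀ n > n₀, _ := fun n hn =>
    h.coarseCell_eq hY hB hforms (hsmall n hn) (hn₀ n hn).log
  set g := SingFlow.adaptedForm S U
    (SingFlow.tangentEquiv hfield.symm_mem_source (mem_extChartAt_source _)) with hg
  set q := (extChartAt (𝓡 d) σ).symm p with hq
  have hexit : ∀ n > n₀, ∀ t ∈ Icc (1 / (2 * c.Λ) * (n : ℝ)) (5 / c.ρ * n),
      t / n ∈ Icc (min (1 / (2 * c.Λ)) (1 / c.ρ)) (6 / c.ρ) := fun n hn t ht => by
    have hn0 : (0 : ℝ) < n := by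
      have : 0 < n := by omega
      exact_mod_cast this
    refine ⟨(min_le_left _ _).trans ((le_div_iff₀ hn0).2 ht.1), (div_le_iff₀ hn0).2
      (ht.2.trans ?_)⟩
    gcongr
    norm_num
  refine ⟨fun n hn x hx => ?_, fun n hn => ?_, fun n hn m hm hnm => ?_, fun L hL β hβ0 hβ1 => ?_⟩
  · rw [hlayer n hn] at hx
    have h1 := h.edist_lt_of_mem_layer (hn₀ n hn) hx (t := 0)
      (by rw [abs_zero]; linarith [(hn₀ n hn).two_le])
    rw [hφ.zero] at h1
    have h2 := h.norm_mem_Icc (hn₀ n hn) hx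
    refine ⟨h1, ⟨h2.1, h2.2.trans ?_⟩, hexit n hn _ (h.exitTime_mem hstay (hn₀ n hn) hx),
      hexit n hn _ (h.neg.exitTime_mem hstay (hn₀ n hn) (SingFlow.layer_swap hx))⟩
    gcongr
    linarith [show 0 < c.κ * (c.lam / (2 * Real.sqrt c.K)) by positivity]
  · rw [hcell n hn]
    exact h.measurableSet_cell (hn₀ n hn)
  · rw [hcell n hn, hcell m hm]
    exact h.disjoint_cell (hn₀ n hn) hnm
  -- This is where N₀ = e^Λ comes from.
  · have hL' : Real.exp (c.Λ * (6 / c.ρ) + 1) ≤ L ^ (6 / c.ρ) * Real.exp 1 := by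
      rw [Real.exp_add, Real.exp_mul]
      gcongr
    obtain ⟨𝒜, h1, h2, h3, h4⟩ := h.exists_partition hstay hn₀ hβ0 hβ1.le hL'
    have hUnion : (⋃ n > n₀, SingFlow.cell c Lg σ p S U φ n)
        = ⋃ n > n₀, SingFlow.coarseCell Y φ q g n :=
      iUnion₂_congr fun n hn => (hcell n hn).symm
    refine ⟨𝒜, h1, fun A hA => ?_, fun n hn => ?_, h4⟩
    · rcases h2 A hA with ⟨n, hn, hAn⟩ | rfl
      · exact ⟨_, Or.inl ⟨n, hn, rfl⟩, by rw [hcell n hn]; exact hAn⟩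
      · exact ⟨_, Or.inr rfl, by rw [hUnion]⟩
    · rw [hcell n hn]
      exact h3 n hn
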